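/- **Setting.** Let $V:\mathbb R^d\to\mathbb R$ be bounded below and have an analytic continuation (again denoted $V$) to $D=\{z\in\mathbb C^d:\ |\mathrm{Im}\,z_j|<\delta,\ j=1,\dots,d\}$, where $\delta>0$, and suppose that for some $M,\tau>0$ one has $|V(z)|\le M\exp(\tau|z|)$ for all $z\in D$, where $|z|^2=\sum_j|z_j|^2$. Let $a(t),\eta(t)\in\mathbb R^d$, $A(t),B(t)\in\mathbb C^{d\times d}$, $S(t)\in\mathbb R$ solve, for all $t\in\mathbb R$, $$\dot a=\eta,\quad \dot\eta=-\nabla V(a),\quad \dot A=iB,\quad \dot B=iV^{(2)}(a)A,\quad \dot S=\tfrac12|\eta|^2-V(a),$$ where $V^{(2)}$ is the Hessian of $V$, with $S(0)=0$, $A(0)^tB(0)-B(0)^tA(0)=0$ and $A(0)^*B(0)+B(0)^*A(0)=2I$. Assume that there are $N,\lambda>0$ with $\|A(t)\|\le N e^{\lambda|t|}$ for all $t$ (operator norm). *Wave packets.* For $\hbar>0$ and multi-indices $j\in\mathbb N^d$, $|j|=\sum_k j_k$, put $$\varphi_0(A,B,\hbar,a,\eta,x)=(\pi\hbar)^{-d/4}(\det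 A)^{-1/2}\exp\Big\{-\tfrac{\langle x-a,\,BA^{-1}(x-a)\rangle}{2\hbar}+\tfrac{i\langle\eta,x-a\rangle}{\hbar}\Big\},$$ $$\varphi_j=(j!)^{-1/2}(\mathcal A_1^*)^{j_1}\cdots(\mathcal A_d^*)^{j_d}\varphi_0,\qquad \mathcal A_m^*=\tfrac1{\sqrt{2\hbar}}\Big[\sum_n\overline{B_{nm}}(x_n-a_n)-i\sum_n\overline{A_{nm}}\big(-i\hbar\tfrac{\partial}{\partial x_n}-\eta_n\big)\Big].$$ Along the trajectory, $(\det A(t))^{1/2}$ is continuous in $t$, after an arbitrary initial choice of sign. Write $\varphi_j(t)=\varphi_j(A(t),B(t),\hbar,a(t),\eta(t),\cdot)$. *Semiclassical approximation.* Fix $J\in\mathbb N$ and $(c_j)_{|j|\le J}$ with $\sum_{|j|\le J}|c_j|^2=1$. For $l\ge1$ let $\widetilde J(l)=J+3l-3$, and let $$Z_a^{[l]}(x)=\sum_{3\le|m|\le l+1}\frac{(D^mV)(a)}{m!}(x-a)^m .$$ Let $c_k(l,t,\hbar)$, $|k|\le\widetilde J(l)$, solve $$i\hbar\,\dot c_k=\sum_{|j|\le\widetilde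 J(l)}\big\langle\varphi_k(t),Z^{[l]}_{a(t)}\varphi_j(t)\big\rangle c_j,\qquad c_k(l,0,\hbar)=c_k\ (|k|\le J),\quad c_k(l,0,\hbar)=0\ (|k|>J),$$ and put $\psi_l(x,t,\hbar)=e^{iS(t)/\hbar}\sum_{|j|\le\widetilde J(l)}c_j(l,t,\hbar)\,\varphi_j(t)(x)$. For $l=0$ put $\psi_0=\psi_1$. *Exact solution.* Let $H(\hbar)$ be the self-adjoint operator in $L^2(\mathbb R^d)$ that is the closure of $-\frac{\hbar^2}2\Delta+V$ on $C_c^\infty(\mathbb R^d)$, and let $\Psi(\cdot,t,\hbar)=e^{-itH(\hbar)/\hbar}\Psi(\cdot,0,\hbar)$ be the exact solution of $i\hbar\,\partial_t\Psi=H(\hbar)\Psi$ with $\Psi(\cdot,0,\hbar)=\sum_{|j|\le J}c_j\,\varphi_j(0)$. **Theorem 1.2.** There exist $g_0>0$, $\nu>0$ and $T_0>0$ such that for every $T'\in(0,T_0]$ there exist $C'>0$, $\gamma'>0$ and $\sigma>0$ with the following property. For each $\hbar>0$ let $\psi=\psi_{l(\hbar)}$ with the order of truncation $$l(\hbar)=\big\lfloor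 g(T)/\hbar\big\rfloor,\qquad g(T)=g_0e^{-\nu T},\qquad T=T'|\log\hbar| .$$ Then $$\|\psi(\cdot,t,\hbar)-\Psi(\cdot,t,\hbar)\|_{L^2(\mathbb R^d)}\le C'\exp\{-\gamma'/\hbar^{\sigma}\}\qquad\text{whenever } |t|\le T'|\log\hbar| .$$ -/

import Mathlib

open Complex MeasureTheory Filter Topology
open scoped ContDiff Matrix

namespace Semiclassical

/-- The configuration space `ℝ^d` with its Euclidean norm. -/
abbrev RSpace (d : ℕ) : Type := EuclideanSpace ℝ (Fin d)

/-- `ℂ^d` with the norm `|z|² = ∑ |z_j|²`. -/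
abbrev CSpace (d : ℕ) : Type := EuclideanSpace ℂ (Fin d)

/-- The Hilbert space `L²(ℝ^d)`. -/
abbrev L2Space (d : ℕ) : Type := Lp ℂ 2 (volume : Measure (RSpace d))

/-- The inclusion `ℝ^d ⊆ ℂ^d`. -/
def complexify {d : ℕ} (x : RSpace d) : CSpace d :=
  WithLp.toLp 2 (fun i => ((x i : ℝ) : ℂ))

/-- The domain `D = {z ∈ ℂ^d : |Im z_j| < δ for all j}`. -/
def strip (d : ℕ) (δ : ℝ) : Set (CSpace d) := {z | ∀ i, |(z i).im| < δ}

/-- The partial derivative `∂f/∂x_i`. -/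
noncomputable def partialD {d : ℕ} {F : Type} [NormedAddCommGroup F] [NormedSpace ℝ F]
    (i : Fin d) (f : RSpace d → F) : RSpace d → F :=
  fun x => fderiv ℝ f x (EuclideanSpace.single i 1)

/-! ### Multi-indices -/

/-- The order `|j| = j_1 + ⋯ + j_d` of a multi-index. -/
def order {d : ℕ} (j : Fin d → ℕ) : ℕ := ∑ i, j i

/-- The factorial `j! = j_1! ⋯ j_d!` of a multi-index. -/
def multiFactorial {d : ℕ} (j : Fin d → ℕ) : ℕ := ∏ i, (j i).factorial

/-- The finite set of all multi-indices `j` with `|j| ≤ n`. -/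
def indicesUpTo (d n : ℕ) : Finset (Fin d → ℕ) :=
  (Fintype.piFinset fun _ : Fin d => Finset.range (n + 1)).filter fun j => order j ≤ n

theorem mem_indicesUpTo {d n : ℕ} (j : Fin d → ℕ) : j ∈ indicesUpTo d n ↔ order j ≤ n := by
  simp only [indicesUpTo, Finset.mem_filter, Fintype.mem_piFinset, Finset.mem_range,
    and_iff_right_iff_imp]
  intro h i
  have := Finset.single_le_sum (f := j) (fun _ _ => Nat.zero_le _) (Finset.mem_univ i)
  unfold order at h
  omega

/-- `D^m f = ∂_1^{m_1} ⋯ ∂_d^{m_d} f`. -/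
noncomputable def multiD {d : ℕ} (m : Fin d → ℕ) (f : RSpace d → ℝ) : RSpace d → ℝ :=
  (List.finRange d).foldr (fun i g => (partialD i)^[m i] g) f

/-- The anharmonic part of the Taylor polynomial of order `l + 1` of `V` at `a`,
`∑_{3 ≤ |m| ≤ l+1} (D^m V)(a) / m! * (x - a)^m`. -/
noncomputable def taylorZ {d : ℕ} (V : RSpace d → ℝ) (l : ℕ) (a x : RSpace d) : ℝ :=
  ∑ m ∈ (indicesUpTo d (l + 1)).filter (fun m => 3 ≤ order m),
    multiD m V a / (multiFactorial m : ℝ) * ∏ i, (x i - a i) ^ m i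

/-- The Hessian matrix `V^{(2)}`. -/
noncomputable def hessian {d : ℕ} (V : RSpace d → ℝ) (x : RSpace d) : Matrix (Fin d) (Fin d) ℝ :=
  Matrix.of fun i j => partialD i (partialD j V) x

/-- The operator norm of a complex matrix acting on `ℂ^d` with its Euclidean norm. -/
noncomputable def opNorm {d : ℕ} (A : Matrix (Fin d) (Fin d) ℂ) : ℝ :=
  ‖Matrix.toEuclideanCLM (𝕜 := ℂ) A‖

/-! ### Semiclassical wave packets -/

/-- The raising operator
`(2ℏ)^{-1/2} [∑_n conj(B_{nm}) (x_n - a_n) - i ∑_n conj(A_{nm}) (-iℏ ∂/∂x_n - η_n)]`. -/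
noncomputable def raising {d : ℕ} (A B : Matrix (Fin d) (Fin d) ℂ) (h : ℝ) (a η : RSpace d)
    (m : Fin d) (f : RSpace d → ℂ) : RSpace d → ℂ := fun x =>
  ((1 / Real.sqrt (2 * h) : ℝ) : ℂ) *
    ((∑ n, starRingEnd ℂ (B n m) * ((x n - a n : ℝ) : ℂ) * f x) -
      I * ∑ n, starRingEnd ℂ (A n m) * (-I * (h : ℂ) * partialD n f x - ((η n : ℝ) : ℂ) * f x))

/-- The Gaussian wave packet `φ_0(A, B, ℏ, a, η, ·)`. The number `r` is the chosen square root
of `det A`. -/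
noncomputable def gaussianPacket {d : ℕ} (A B : Matrix (Fin d) (Fin d) ℂ) (r : ℂ) (h : ℝ)
    (a η : RSpace d) : RSpace d → ℂ := fun x =>
  ((Real.pi ^ (-(d : ℝ) / 4) * h ^ (-(d : ℝ) / 4) : ℝ) : ℂ) * r⁻¹ *
    cexp (-(∑ n, ∑ p, ((x n - a n : ℝ) : ℂ) * (B * A⁻¹) n p * ((x p - a p : ℝ) : ℂ)) /
        (2 * (h : ℂ)) +
      I * (∑ n, ((η n * (x n - a n) : ℝ) : ℂ)) / (h : ℂ))

/-- The wave packet `φ_j = (j!)^{-1/2} (𝒜_1^*)^{j_1} ⋯ (𝒜_d^*)^{j_d} φ_0`. -/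
noncomputable def packet {d : ℕ} (A B : Matrix (Fin d) (Fin d) ℂ) (r : ℂ) (h : ℝ)
    (a η : RSpace d) (j : Fin d → ℕ) : RSpace d → ℂ := fun x =>
  ((1 / Real.sqrt (multiFactorial j : ℝ) : ℝ) : ℂ) *
    ((List.finRange d).foldr (fun m f => (raising A B h a η m)^[j m] f)
      (gaussianPacket A B r h a η)) x

/-! ### Classical dynamics -/

/-- A classical trajectory `(a, η, A, B, S)` for the potential `V`, together with a continuous
branch `r` of the square root of `det A`. -/
structure Trajectory (d : ℕ) where
  a : ℝ → RSpace d
  η : ℝ → RSpace d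
  A : ℝ → Matrix (Fin d) (Fin d) ℂ
  B : ℝ → Matrix (Fin d) (Fin d) ℂ
  S : ℝ → ℝ
  r : ℝ → ℂ

/-- The classical equations of motion for all times, the conditions on the initial data, and the
choice of the branch of `(det A)^{1/2}` by continuity in `t` after an arbitrary initial choice. -/
structure Trajectory.IsClassical {d : ℕ} (V : RSpace d → ℝ) (γ : Trajectory d) : Prop where
  deriv_a : ∀ t, HasDerivAt γ.a (γ.η t) t
  deriv_η : ∀ t, HasDerivAt γ.η (-gradient V (γ.a t)) t
  deriv_A : ∀ t i j, HasDerivAt (fun s => γ.A s i j) (I * γ.B t i j) t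
  deriv_B : ∀ t i j, HasDerivAt (fun s => γ.B s i j)
    (I * ((hessian V (γ.a t)).map (fun y : ℝ => (y : ℂ)) * γ.A t) i j) t
  deriv_S : ∀ t, HasDerivAt γ.S (‖γ.η t‖ ^ 2 / 2 - V (γ.a t)) t
  S_zero : γ.S 0 = 0
  symm_zero : (γ.A 0)ᵀ * γ.B 0 - (γ.B 0)ᵀ * γ.A 0 = 0
  herm_zero : (γ.A 0)ᴴ * γ.B 0 + (γ.B 0)ᴴ * γ.A 0 = (2 : ℂ) • (1 : Matrix (Fin d) (Fin d) ℂ)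
  continuous_r : Continuous γ.r
  r_sq : ∀ t, γ.r t ^ 2 = (γ.A t).det

/-- `φ_j(A(t), B(t), ℏ, a(t), η(t), ·)`. -/
noncomputable def Trajectory.packet {d : ℕ} (γ : Trajectory d) (h t : ℝ) (j : Fin d → ℕ) :
    RSpace d → ℂ :=
  Semiclassical.packet (γ.A t) (γ.B t) (γ.r t) h (γ.a t) (γ.η t) j

/-! ### The semiclassical approximation -/

/-- The cutoff `J + 3l - 3`, for `l ≥ 1`. (For `l = 0` it is `J`, so that the approximations
for `l = 0` and `l = 1` coincide.) -/
def cutoff (J l : ℕ) : ℕ := J + 3 * (l - 1)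

/-- `K_{kj}(l, t, ℏ) = ⟨φ_k(t), Z^{[l]}_{a(t)} φ_j(t)⟩`. -/
noncomputable def kernelK {d : ℕ} (V : RSpace d → ℝ) (γ : Trajectory d) (l : ℕ) (h t : ℝ)
    (k j : Fin d → ℕ) : ℂ :=
  ∫ x, starRingEnd ℂ (γ.packet h t k x) * ((taylorZ V l (γ.a t) x : ℝ) : ℂ) * γ.packet h t j x

/-- The functions `c_k(l, t, ℏ)`, `|k| ≤ J + 3l - 3`, solve the linear system
`iℏ ċ_k = ∑_j K_{kj} c_j` with the initial values `c0_k` for `|k| ≤ J` and `0` for `|k| > J`. -/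
structure IsCoefficients {d : ℕ} (V : RSpace d → ℝ) (γ : Trajectory d) (J : ℕ)
    (c0 : (Fin d → ℕ) → ℂ) (l : ℕ) (h : ℝ) (c : ℝ → (Fin d → ℕ) → ℂ) : Prop where
  deriv : ∀ t, ∀ k ∈ indicesUpTo d (cutoff J l), HasDerivAt (fun s => c s k)
    ((I * (h : ℂ))⁻¹ * ∑ j ∈ indicesUpTo d (cutoff J l), kernelK V γ l h t k j * c t j) t
  initial : ∀ k ∈ indicesUpTo d (cutoff J l), c 0 k = if order k ≤ J then c0 k else 0

/-- `ψ_l(x, t, ℏ) = e^{iS(t)/ℏ} ∑_{|j| ≤ J+3l-3} c_j(l, t, ℏ) φ_j(A(t), B(t), ℏ, a(t), η(t), x)`. -/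
noncomputable def approx {d : ℕ} (γ : Trajectory d) (J l : ℕ) (h : ℝ)
    (c : ℝ → (Fin d → ℕ) → ℂ) (t : ℝ) : RSpace d → ℂ := fun x =>
  cexp (I * (γ.S t : ℂ) / (h : ℂ)) *
    ∑ j ∈ indicesUpTo d (cutoff J l), c t j * γ.packet h t j x

/-- The order of truncation `l(ℏ) = ⌊g(T) / ℏ⌋` for the time scale `T = T' |log ℏ|`, where
`g(T) = g₀ e^{-νT}`. -/
noncomputable def truncation (g₀ ν T' h : ℝ) : ℕ :=
  ⌊g₀ * Real.exp (-ν * (T' * |Real.log h|)) / h⌋₊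

/-! ### The Schrödinger equation -/

/-- The graph of `-(ℏ²/2) Δ + V` on `C_c^∞(ℝ^d)`, as a subset of `L² × L²`. -/
def hamiltonianCore {d : ℕ} (V : RSpace d → ℝ) (h : ℝ) : Set (L2Space d × L2Space d) :=
  {p | ∃ φ : RSpace d → ℂ, ContDiff ℝ ∞ φ ∧ HasCompactSupport φ ∧
    (p.1 : RSpace d → ℂ) =ᵐ[volume] φ ∧
    (p.2 : RSpace d → ℂ) =ᵐ[volume]
      fun x => -((h : ℂ) ^ 2 / 2) * Laplacian.laplacian φ x + ((V x : ℝ) : ℂ) * φ x}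

/-- The graph of the Hamiltonian `H(ℏ)`, the closure of `-(ℏ²/2) Δ + V` on `C_c^∞(ℝ^d)` in
`L²(ℝ^d)`. For the potentials considered (smooth and bounded below) the latter operator is
essentially self-adjoint, and `H(ℏ)` is its unique self-adjoint extension. -/
def hamiltonianGraph {d : ℕ} (V : RSpace d → ℝ) (h : ℝ) : Set (L2Space d × L2Space d) :=
  closure (hamiltonianCore V h)

/-- `Ψ` is the exact solution `e^{-itH(ℏ)/ℏ} Ψ(0)` of the Schrödinger equation, with `Ψ(0)` in the
domain of `H(ℏ)`: at all times `Ψ(t)` lies in the domain of `H(ℏ)`, is differentiable in `L²`, and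
`iℏ ∂Ψ/∂t = H(ℏ) Ψ`. -/
def IsExactSolution {d : ℕ} (V : RSpace d → ℝ) (h : ℝ) (Ψ : ℝ → L2Space d) : Prop :=
  ∀ t, ∃ Ψ' : L2Space d, HasDerivAt Ψ Ψ' t ∧ (Ψ t, (I * (h : ℂ)) • Ψ') ∈ hamiltonianGraph V h

end Semiclassical

/-!
The theorem combines an algebraic description of the wave packets, Cauchy estimates for the
potential, and an energy argument for the difference of the two solutions.

*Wave packets.* In the rescaled coordinate `ζ = (2/ℏ)^{1/2} A⁻¹ (x - a)` the packet `φ_j` is a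
Hermite polynomial, built from the symmetric matrix `S = A⁻¹ Ā`, times the Gaussian `φ_0`
(`packet_eq_polyPacket`). Integration by parts moves a raising operator to a derivative of the other
factor, so the packets are orthonormal (`integral_packet`). Along a classical trajectory
`e^{iS/ℏ} φ_j` solves the Schrödinger equation whose potential is the quadratic Taylor polynomial of
`V` at `a(t)` exactly (`hasDerivAt_packet`): the Gaussian by the Riccati equation for `B A⁻¹`, the
polynomial factor because the motion of `ζ` and `S` reproduces the remaining terms of the Laplacian.
Multiplication by `(x - a)_i` raises or lowers the order by one with coefficients of size
`(ℏ |j|)^{1/2} ‖A‖`; hence the moments of degree `p` of a combination of order at most `n` have norm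
at most `(κ (n + p))^{p/2}` with `κ` a multiple of `ℏ ‖A‖²` (`integral_moment_le`).

*The potential.* Cauchy estimates in the strip bound the homogeneous Taylor part of degree `p` by
`M' (‖v‖ / (δ/2))^p` with `M' = M e^{τ (‖a‖ + δ/2)}` (`abs_taylorTerm_le`), so on packets of order
at most `n` it has norm at most `M' q^p` as soon as `κ (n + p)` is at most `(δ q / 2)²`. Energy
conservation and the lower bound of `V` keep `‖a(t)‖` of linear growth in time
(`exists_norm_position_le`), which makes `M'` at most exponential in `|t|`.

*The coefficients.* Their system is Hermitian, so the `ℓ²` norm is conserved, and the Taylor part of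
degree `p` couples only orders that differ by at most `p`. Such a banded matrix remains bounded with
the weight `e^{2|k|}`, at the cost of a factor `(2p + 1) e^p`; the weighted norm therefore grows at
the rate `O(q³/ℏ)` only (`weighted_norm_coefficients_le`), and the mass near the cutoff
`J + 3l - 3` is exponentially small in `l`. The residual of the approximation consists of the part
of the Taylor polynomial that leaves the span of the packets, controlled by this mass, and of the
Taylor remainder, of size `q^{l+2}` up to a factor `C^l` (`norm_residual_le`).

*Comparison.* By Green's identity on the core and passage to the closure, `⟨HΨ, u⟩ = ⟨Ψ, Hu⟩` for
`Ψ` in the domain and smooth `u` with `u`, `Hu` square integrable. Hence the norm of `Ψ` is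
conserved and the derivative of `⟨Ψ, ψ⟩` is the pairing with the residual `ξ`, divided by `iℏ`. As
both solutions have norm one, `‖ψ - Ψ‖² = 2 (1 - Re ⟨Ψ, ψ⟩) ≤ 2 |t| sup ‖ξ‖ / ℏ`
(`norm_sub_sq_le_of_residual`).

*The order of truncation.* With `l = ⌊g/ℏ⌋`, the number `q²` can be taken as a multiple of
`e^{2λT} g`; for `g = g₀ e^{-νT}` with small `g₀` and large `ν` the residual is at most
`e^{-2g/ℏ}` up to factors exponential in `T`. For `T = T' |log ℏ|` one has `g/ℏ = g₀ ℏ^{-(1 - νT')}`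
when `ℏ < 1`, and this dominates every power of `1/ℏ` provided that `νT' ≤ 1/2`. If `g < ℏ` the
trivial bound `‖ψ - Ψ‖ ≤ 2` suffices.
-/

namespace Semiclassical

/-! ### Multi-index induction and Hermite polynomials -/

theorem order_add {d : ℕ} (j k : Fin d → ℕ) : order (j + k) = order j + order k := by
  simp [order, Finset.sum_add_distrib]

@[simp] theorem order_single {d : ℕ} (m : Fin d) (n : ℕ) : order (Pi.single m n) = n := by
  simp [order]

theorem order_eq_zero {d : ℕ} {j : Fin d → ℕ} : order j = 0 ↔ j = 0 := by
  simp [order, funext_iff]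

theorem sub_single_add {d : ℕ} {j : Fin d → ℕ} {m : Fin d} (h : j m ≠ 0) :
    j - Pi.single m 1 + Pi.single m 1 = j := by
  ext i
  by_cases hi : i = m
  · subst hi
    simp
    omega
  · simp [hi]

theorem order_sub_single {d : ℕ} {j : Fin d → ℕ} {m : Fin d} (h : j m ≠ 0) :
    order (j - Pi.single m 1) + 1 = order j := by
  conv_rhs => rw [← sub_single_add h, order_add, order_single]

theorem multiIndex_induction {d : ℕ} {p : (Fin d → ℕ) → Prop} (zero : p 0)
    (add : ∀ j m, p j → p (j + Pi.single m 1)) (j : Fin d → ℕ) : p j := by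
  induction hn : order j generalizing j with
  | zero => rwa [order_eq_zero.1 hn]
  | succ n ih =>
    obtain ⟨m, hm⟩ : ∃ m, j m ≠ 0 := by
      by_contra! hc
      have : j = 0 := funext hc
      rw [order_eq_zero.2 this] at hn
      omega
    have := add (j - Pi.single m 1) m (ih _ (by have := order_sub_single hm; omega))
    rwa [sub_single_add hm] at this

theorem multiFactorial_add_single {d : ℕ} (j : Fin d → ℕ) (m : Fin d) :
    multiFactorial (j + Pi.single m 1) = (j m + 1) * multiFactorial j := by
  unfold multiFactorial
  rw [← Finset.mul_prod_erase _ _ (Finset.mem_univ m),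
    ← Finset.mul_prod_erase _ (fun i => (j i).factorial) (Finset.mem_univ m)]
  rw [← mul_assoc]
  congr 1
  · simp [Nat.factorial_succ]
  · refine Finset.prod_congr rfl fun i hi => ?_
    simp [Finset.ne_of_mem_erase hi]

theorem multiFactorial_pos {d : ℕ} (j : Fin d → ℕ) : 0 < multiFactorial j :=
  Finset.prod_pos fun _ _ => Nat.factorial_pos _

/-- For a commuting family of maps, the ordered product of their iterates absorbs one more factor
at any place. -/
theorem foldr_iterate_add_single {d : ℕ} {α : Type*} (g : Fin d → α → α)
    (hg : ∀ m n f, g m (g n f) = g n (g m f)) (j : Fin d → ℕ) (k : Fin d) (x : α) :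
    (List.finRange d).foldr (fun m f => (g m)^[(j + Pi.single k 1 : Fin d → ℕ) m] f) x =
      g k ((List.finRange d).foldr (fun m f => (g m)^[j m] f) x) := by
  have hit : ∀ m n i f, g m ((g n)^[i] f) = (g n)^[i] (g m f) := fun m n i f =>
    (Function.Commute.iterate_right (f := g m) (g := g n) (hg m n) i) f
  have key : ∀ l : List (Fin d), l.Nodup →
      l.foldr (fun m f => (g m)^[(j + Pi.single k 1 : Fin d → ℕ) m] f) x =
        if k ∈ l then g k (l.foldr (fun m f => (g m)^[j m] f) x)
        else l.foldr (fun m f => (g m)^[j m] f) x := by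
    intro l hl
    induction l with
    | nil => simp
    | cons a l ih =>
      have hl' := List.nodup_cons.1 hl
      simp only [List.foldr_cons, ih hl'.2]
      by_cases hak : a = k
      · subst hak
        simp [hl'.1, Function.iterate_succ_apply']
      · have : k ≠ a := fun h => hak h.symm
        by_cases hkl : k ∈ l
        · simp [hkl, hak, hit]
        · simp [hkl, hak, this]
  rw [key _ (List.nodup_finRange d), if_pos (List.mem_finRange k)]

section Hermite

open MvPolynomial

variable {d : ℕ}

/-- The raising operator `X_m - ∑_n S_{mn} ∂_n` on polynomials, whose iterates applied to `1` are
the Hermite polynomials attached to the symmetric matrix `S`. -/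
noncomputable def raisePoly (S : Matrix (Fin d) (Fin d) ℂ) (m : Fin d)
    (f : MvPolynomial (Fin d) ℂ) : MvPolynomial (Fin d) ℂ :=
  X m * f - ∑ n, C (S m n) * pderiv n f

/-- The multivariate Hermite polynomial of multi-index `j` attached to `S`. -/
noncomputable def hermitePoly (S : Matrix (Fin d) (Fin d) ℂ) (j : Fin d → ℕ) :
    MvPolynomial (Fin d) ℂ :=
  (List.finRange d).foldr (fun m f => (raisePoly S m)^[j m] f) 1

theorem pderiv_comm (m n : Fin d) (f : MvPolynomial (Fin d) ℂ) :
    pderiv m (pderiv n f) = pderiv n (pderiv m f) := by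
  have : ⁅pderiv (R := ℂ) m, pderiv n⁆ = (0 : Derivation ℂ (MvPolynomial (Fin d) ℂ) _) := by
    apply MvPolynomial.derivation_ext
    intro i
    simp [Derivation.commutator_apply, pderiv_X, Pi.single_apply]
    split_ifs <;> simp
  have h := congrArg (fun D => D f) this
  simpa [Derivation.commutator_apply, sub_eq_zero] using h

theorem pderiv_raisePoly (S : Matrix (Fin d) (Fin d) ℂ) (k m : Fin d)
    (f : MvPolynomial (Fin d) ℂ) :
    pderiv k (raisePoly S m f) = raisePoly S m (pderiv k f) + if k = m then f else 0 := by
  unfold raisePoly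
  simp only [map_sub, map_sum, Derivation.leibniz, smul_eq_mul, pderiv_C, mul_zero, add_zero,
    pderiv_X, Pi.single_apply]
  simp only [fun n => pderiv_comm k n f]
  by_cases h : k = m
  · subst h; simp; ring
  · have : m ≠ k := fun h' => h h'.symm
    simp [h, this]

/-- The raising operators commute because `S` is symmetric; hence the order in which `hermitePoly`
iterates them is irrelevant. -/
theorem raisePoly_comm {S : Matrix (Fin d) (Fin d) ℂ} (hS : ∀ m n, S m n = S n m) (m k : Fin d)
    (f : MvPolynomial (Fin d) ℂ) :
    raisePoly S m (raisePoly S k f) = raisePoly S k (raisePoly S m f) := by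
  have h : ∀ m k, raisePoly S m (raisePoly S k f) =
      X m * X k * f - ∑ n, C (S k n) * (X m * pderiv n f) -
        ∑ n, C (S m n) * (X k * pderiv n f) +
        ∑ n, ∑ p, C (S m n) * C (S k p) * pderiv n (pderiv p f) - C (S m k) * f := by
    intro m k
    change X m * raisePoly S k f - ∑ n, C (S m n) * pderiv n (raisePoly S k f) = _
    simp only [pderiv_raisePoly]
    unfold raisePoly
    simp only [mul_sub, mul_add, Finset.sum_add_distrib, Finset.sum_sub_distrib, Finset.mul_sum,
      mul_ite, mul_zero, Finset.sum_ite_eq', Finset.mem_univ, if_true]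
    have e1 : ∀ n, X m * (C (S k n) * pderiv n f) = C (S k n) * (X m * pderiv n f) :=
      fun n => by ring
    have e2 : ∀ n p, C (S m n) * (C (S k p) * pderiv p (pderiv n f)) =
        C (S m n) * C (S k p) * pderiv n (pderiv p f) := fun n p => by
      rw [pderiv_comm p n]; ring
    simp only [e1, e2]
    ring
  rw [h m k, h k m, hS m k]
  rw [Finset.sum_comm]
  have e3 : ∀ n p, C (S m p) * C (S k n) * pderiv p (pderiv n f) =
      C (S k n) * C (S m p) * pderiv n (pderiv p f) := fun n p => by
    rw [pderiv_comm p n]; ring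
  simp only [e3]
  ring

@[simp] theorem hermitePoly_zero (S : Matrix (Fin d) (Fin d) ℂ) : hermitePoly S 0 = 1 := by
  unfold hermitePoly
  induction (List.finRange d) with
  | nil => rfl
  | cons a l ih => simp

theorem hermitePoly_add_single {S : Matrix (Fin d) (Fin d) ℂ} (hS : ∀ m n, S m n = S n m)
    (j : Fin d → ℕ) (m : Fin d) :
    hermitePoly S (j + Pi.single m 1) = raisePoly S m (hermitePoly S j) :=
  foldr_iterate_add_single _ (fun m n f => raisePoly_comm hS m n f) j m 1

/-- Partial derivatives lower Hermite polynomials. -/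
theorem pderiv_hermitePoly {S : Matrix (Fin d) (Fin d) ℂ} (hS : ∀ m n, S m n = S n m)
    (m : Fin d) (j : Fin d → ℕ) :
    pderiv m (hermitePoly S j) = C (j m : ℂ) * hermitePoly S (j - Pi.single m 1) := by
  have hsc : ∀ k (c : ℂ) f, raisePoly S k (C c * f) = C c * raisePoly S k f := by
    intro k c f
    unfold raisePoly
    simp only [Derivation.leibniz, smul_eq_mul, pderiv_C, mul_zero, add_zero, mul_sub,
      Finset.mul_sum]
    congr 1
    · ring
    · exact Finset.sum_congr rfl fun n _ => by ring
  induction j using multiIndex_induction with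
  | zero => simp
  | add j k ih =>
    rw [hermitePoly_add_single hS, pderiv_raisePoly, ih, hsc]
    by_cases h : m = k
    · subst h
      rw [if_pos rfl, add_tsub_cancel_right]
      by_cases hj : j m = 0
      · simp [hj]
      · rw [← hermitePoly_add_single hS, sub_single_add hj]
        simp; ring
    · rw [if_neg h, ← hermitePoly_add_single hS]
      have : j - Pi.single m 1 + Pi.single k 1 = j + Pi.single k 1 - Pi.single m 1 := by
        ext i
        by_cases hi : i = m
        · subst hi; simp [h]
        · simp [hi]
      rw [this]
      simp [h]

/-- The three-term recursion of the Hermite polynomials. -/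
theorem hermitePoly_recursion {S : Matrix (Fin d) (Fin d) ℂ} (hS : ∀ m n, S m n = S n m)
    (j : Fin d → ℕ) (m : Fin d) :
    hermitePoly S (j + Pi.single m 1) = X m * hermitePoly S j -
      ∑ n, C (S m n) * (C (j n : ℂ) * hermitePoly S (j - Pi.single n 1)) := by
  rw [hermitePoly_add_single hS, raisePoly]
  simp only [pderiv_hermitePoly hS]

end Hermite


/-! ### Symplectic pairs of matrices -/

/-- The algebraic relations between the matrices `A` and `B` of a Gaussian wave packet. They say
that the `2d × 2d` matrix built from the real and imaginary parts of `A` and `B` is symplectic. -/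
structure IsSymplecticPair {d : ℕ} (A B : Matrix (Fin d) (Fin d) ℂ) : Prop where
  symm : Aᵀ * B = Bᵀ * A
  herm : Aᴴ * B + Bᴴ * A = (2 : ℂ) • (1 : Matrix (Fin d) (Fin d) ℂ)

namespace IsSymplecticPair

variable {d : ℕ} {A B : Matrix (Fin d) (Fin d) ℂ}

/-- The defining relations say that a block matrix built from `A`, `B` has an explicit left inverse;
reading that inverse from the right gives the companion relations. -/
theorem conj_relations (h : IsSymplecticPair A B) :
    A * Aᴴ = Aᴴᵀ * Aᵀ ∧ A * Bᴴ + Aᴴᵀ * Bᵀ = (2 : ℂ) • 1 := by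
  have h1 : Bᴴ * Aᴴᵀ - Aᴴ * Bᴴᵀ = 0 := by
    have := congrArg (fun M : Matrix (Fin d) (Fin d) ℂ => Mᴴᵀ) h.symm
    simp only [Matrix.conjTranspose_mul, Matrix.transpose_mul] at this
    have e : ∀ M : Matrix (Fin d) (Fin d) ℂ, Mᵀᴴᵀ = Mᴴ := fun M => by ext i k; simp
    rw [e, e] at this
    rw [sub_eq_zero]
    exact this.symm
  have h2 : Bᵀ * Aᴴᵀ + Aᵀ * Bᴴᵀ = (2 : ℂ) • 1 := by
    have := congrArg (fun M : Matrix (Fin d) (Fin d) ℂ => Mᵀ) h.herm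
    simp only [Matrix.transpose_add, Matrix.transpose_mul, Matrix.transpose_smul,
      Matrix.transpose_one] at this
    exact this
  have hX : Matrix.fromBlocks Bᴴ Aᴴ Bᵀ (-Aᵀ) *
      ((2 : ℂ)⁻¹ • Matrix.fromBlocks A Aᴴᵀ B (-Bᴴᵀ)) = 1 := by
    rw [Matrix.mul_smul, Matrix.fromBlocks_multiply, Matrix.fromBlocks_smul,
      ← Matrix.fromBlocks_one]
    congr 1
    · rw [add_comm, h.herm, smul_smul]; norm_num
    · rw [Matrix.mul_neg, ← sub_eq_add_neg, h1, smul_zero]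
    · rw [Matrix.neg_mul, ← sub_eq_add_neg, ← h.symm, sub_self, smul_zero]
    · rw [Matrix.neg_mul, Matrix.mul_neg, neg_neg, h2, smul_smul]; norm_num
  have hY := mul_eq_one_comm.1 hX
  rw [Matrix.smul_mul, Matrix.fromBlocks_multiply, Matrix.fromBlocks_smul,
      ← Matrix.fromBlocks_one, Matrix.fromBlocks_inj] at hY
  obtain ⟨e1, e2, -, -⟩ := hY
  constructor
  · rw [Matrix.mul_neg, ← sub_eq_add_neg] at e2
    have := (smul_eq_zero.1 e2).resolve_left (by norm_num)
    exact sub_eq_zero.1 this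
  · rw [← e1, smul_smul]; norm_num

open scoped ComplexOrder in
theorem det_ne_zero (h : IsSymplecticPair A B) : A.det ≠ 0 := by
  intro h0
  obtain ⟨v, hv, hAv⟩ := Matrix.exists_mulVec_eq_zero_iff.2 h0
  have h1 := congrArg (fun M => star v ⬝ᵥ (M *ᵥ v)) h.herm
  simp only [Matrix.add_mulVec, ← Matrix.mulVec_mulVec, hAv, Matrix.mulVec_zero, add_zero,
    Matrix.smul_mulVec, Matrix.one_mulVec, dotProduct_smul] at h1
  rw [Matrix.dotProduct_mulVec, Matrix.vecMul_conjTranspose, star_star, hAv, star_zero,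
    zero_dotProduct] at h1
  have h2 : star v ⬝ᵥ v = 0 := by
    have := h1.symm
    simpa using this
  exact hv (dotProduct_star_self_eq_zero.1 h2)

theorem isUnit_det (h : IsSymplecticPair A B) : IsUnit A.det := h.det_ne_zero.isUnit

theorem mul_inv (h : IsSymplecticPair A B) : A * A⁻¹ = 1 := Matrix.mul_nonsing_inv _ h.isUnit_det

theorem inv_mul (h : IsSymplecticPair A B) : A⁻¹ * A = 1 := Matrix.nonsing_inv_mul _ h.isUnit_det

theorem transpose_mul_inv (h : IsSymplecticPair A B) : Aᵀ * A⁻¹ᵀ = 1 := by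
  rw [← Matrix.transpose_mul, h.inv_mul, Matrix.transpose_one]

theorem transpose_inv_mul (h : IsSymplecticPair A B) : A⁻¹ᵀ * Aᵀ = 1 := by
  rw [← Matrix.transpose_mul, h.mul_inv, Matrix.transpose_one]

/-- The matrix `A⁻¹ conj(A)` of a symplectic pair is symmetric. -/
theorem symmS (h : IsSymplecticPair A B) : Aᴴ * A⁻¹ᵀ = A⁻¹ * Aᴴᵀ := by
  calc Aᴴ * A⁻¹ᵀ = A⁻¹ * (A * Aᴴ) * A⁻¹ᵀ := by
        rw [← Matrix.mul_assoc A⁻¹, h.inv_mul, Matrix.one_mul]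
    _ = A⁻¹ * Aᴴᵀ * (Aᵀ * A⁻¹ᵀ) := by rw [h.conj_relations.1]; simp only [Matrix.mul_assoc]
    _ = _ := by rw [h.transpose_mul_inv, Matrix.mul_one]

/-- The matrix `B A⁻¹` of a symplectic pair is symmetric. -/
theorem symmC (h : IsSymplecticPair A B) : (B * A⁻¹)ᵀ = B * A⁻¹ := by
  rw [Matrix.transpose_mul]
  calc A⁻¹ᵀ * Bᵀ = A⁻¹ᵀ * (Bᵀ * A) * A⁻¹ := by
        rw [Matrix.mul_assoc, Matrix.mul_assoc, h.mul_inv, Matrix.mul_one]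
    _ = (A⁻¹ᵀ * Aᵀ) * B * A⁻¹ := by rw [← h.symm]; simp only [Matrix.mul_assoc]
    _ = _ := by rw [h.transpose_inv_mul, Matrix.one_mul]

/-- The real part of `B A⁻¹` is `(A A*)⁻¹`. -/
theorem reC (h : IsSymplecticPair A B) : B * A⁻¹ + (B * A⁻¹)ᴴ = (2 : ℂ) • (A⁻¹ᴴ * A⁻¹) := by
  have hA : A⁻¹ᴴ * Aᴴ = 1 := by rw [← Matrix.conjTranspose_mul, h.mul_inv]; simp
  calc B * A⁻¹ + (B * A⁻¹)ᴴ = A⁻¹ᴴ * (Aᴴ * B + Bᴴ * A) * A⁻¹ := by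
        rw [Matrix.mul_add, Matrix.add_mul, ← Matrix.mul_assoc A⁻¹ᴴ, hA, Matrix.one_mul,
          ← Matrix.mul_assoc A⁻¹ᴴ, Matrix.mul_assoc (A⁻¹ᴴ * Bᴴ), h.mul_inv, Matrix.mul_one,
          Matrix.conjTranspose_mul]
    _ = _ := by rw [h.herm]; simp

end IsSymplecticPair

/-! ### Polynomials times the Gaussian -/

section Packets

open MvPolynomial

variable {d : ℕ}

/-- The chain rule for a polynomial along a curve. -/
theorem hasDerivAt_eval {z : ℝ → Fin d → ℂ} {z' : Fin d → ℂ} {t : ℝ}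
    (hz : ∀ m, HasDerivAt (fun s => z s m) (z' m) t) (P : MvPolynomial (Fin d) ℂ) :
    HasDerivAt (fun s => eval (z s) P) (∑ m, z' m * eval (z t) (pderiv m P)) t := by
  induction P using MvPolynomial.induction_on with
  | C a => simpa using hasDerivAt_const t a
  | add p q hp hq => simpa [mul_add, Finset.sum_add_distrib] using hp.fun_add hq
  | mul_X p i hp =>
    have := hp.fun_mul (hz i)
    have e : (fun s => eval (z s) (p * X i)) = fun s => eval (z s) p * z s i := by ext s; simp
    rw [e]
    refine this.congr_deriv (Eq.symm ?_)
    simp only [Derivation.leibniz, smul_eq_mul, pderiv_X, map_add, map_mul, eval_X, mul_add,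
      Finset.sum_add_distrib, Pi.single_apply]
    rw [add_comm]
    congr 1
    · rw [Finset.sum_mul]
      exact Finset.sum_congr rfl fun m _ => by ring
    · rw [Finset.sum_eq_single i]
      · simp; ring
      · intro b _ hb; simp [hb.symm]
      · simp

/-- The complex coordinate `ζ = (2/ℏ)^{1/2} A⁻¹ (x - a)` in which the wave packets are Hermite
polynomials times a Gaussian. -/
noncomputable def zeta (A : Matrix (Fin d) (Fin d) ℂ) (h : ℝ) (a x : RSpace d) (m : Fin d) : ℂ :=
  (Real.sqrt (2 / h) : ℂ) * ∑ k, A⁻¹ m k * ((x k - a k : ℝ) : ℂ)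

/-- The product of the polynomial `P` in `ζ` with the Gaussian wave packet `φ_0`. -/
noncomputable def polyPacket (A B : Matrix (Fin d) (Fin d) ℂ) (r : ℂ) (h : ℝ) (a η : RSpace d)
    (P : MvPolynomial (Fin d) ℂ) (x : RSpace d) : ℂ :=
  eval (zeta A h a x) P * gaussianPacket A B r h a η x

theorem contDiff_eval {E : Type*} [NormedAddCommGroup E] [NormedSpace ℝ E] {n : WithTop ℕ∞}
    {z : E → Fin d → ℂ}
    (hz : ∀ m, ContDiff ℝ n fun x => z x m) (P : MvPolynomial (Fin d) ℂ) :
    ContDiff ℝ n fun x => eval (z x) P := by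
  induction P using MvPolynomial.induction_on with
  | C a => simpa using contDiff_const
  | add p q hp hq => simpa using hp.add hq
  | mul_X p i hp => simpa using hp.mul (hz i)

theorem contDiff_coord {n : WithTop ℕ∞} (k : Fin d) :
    ContDiff ℝ n fun x : RSpace d => x k := by fun_prop

theorem contDiff_coordC {n : WithTop ℕ∞} (a : RSpace d) (k : Fin d) :
    ContDiff ℝ n fun x : RSpace d => ((x k - a k : ℝ) : ℂ) :=
  ofRealCLM.contDiff.comp ((contDiff_coord k).sub contDiff_const)

theorem contDiff_gaussianPacket {n : WithTop ℕ∞} (A B : Matrix (Fin d) (Fin d) ℂ) (r : ℂ) (h : ℝ)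
    (a η : RSpace d) : ContDiff ℝ n (gaussianPacket A B r h a η) := by
  unfold gaussianPacket
  have hc := fun k => contDiff_coordC (n := n) a k
  refine contDiff_const.mul (ContDiff.cexp ?_)
  refine ContDiff.add (ContDiff.div_const (ContDiff.neg (ContDiff.sum fun i _ =>
    ContDiff.sum fun j _ => ((hc i).mul contDiff_const).mul (hc j))) _)
    (ContDiff.div_const (contDiff_const.mul (ContDiff.sum fun i _ => ?_)) _)
  have : (fun x : RSpace d => ((η i * (x i - a i) : ℝ) : ℂ)) =
      fun x => (η i : ℂ) * ((x i - a i : ℝ) : ℂ) := by ext; push_cast; ring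
  rw [this]
  exact contDiff_const.mul (hc i)

theorem contDiff_polyPacket {n : WithTop ℕ∞} (A B : Matrix (Fin d) (Fin d) ℂ) (r : ℂ) (h : ℝ)
    (a η : RSpace d) (P : MvPolynomial (Fin d) ℂ) :
    ContDiff ℝ n (polyPacket A B r h a η P) :=
  (contDiff_eval (fun _ => contDiff_const.mul (ContDiff.sum fun k _ =>
    contDiff_const.mul (contDiff_coordC a k))) P).mul (contDiff_gaussianPacket A B r h a η)

/-- A partial derivative is computed along the coordinate line. -/
theorem partialD_eq_of_hasDerivAt {F : Type} [NormedAddCommGroup F] [NormedSpace ℝ F]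
    {f : RSpace d → F} {k : Fin d} {x : RSpace d} {f' : F} (hf : DifferentiableAt ℝ f x)
    (h : HasDerivAt (fun s : ℝ => f (x + s • EuclideanSpace.single k 1)) f' 0) :
    partialD k f x = f' := by
  unfold partialD
  rw [← hf.lineDeriv_eq_fderiv]
  exact HasLineDerivAt.lineDeriv h

theorem hasDerivAt_line_coord (x a : RSpace d) (k n : Fin d) (s : ℝ) :
    HasDerivAt (fun s : ℝ => (((x + s • EuclideanSpace.single k (1 : ℝ)) n - a n : ℝ) : ℂ))
      (if n = k then 1 else 0) s := by
  have h1 : HasDerivAt (fun s : ℝ => (x + s • EuclideanSpace.single k (1 : ℝ)) n - a n)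
      (if n = k then 1 else 0) s := by
    simp only [PiLp.add_apply, PiLp.smul_apply, PiLp.single_apply, smul_eq_mul]
    have := (((hasDerivAt_id s).mul_const (if n = k then (1:ℝ) else 0)).const_add (x n)).sub_const
      (a n)
    simpa [Pi.single_apply] using this
  convert h1.ofReal_comp using 1
  split_ifs <;> simp

/-- The polynomial describing the `k`-th partial derivative of a polynomial times `φ_0`. -/
noncomputable def gradPoly (A B : Matrix (Fin d) (Fin d) ℂ) (h : ℝ) (η : RSpace d) (k : Fin d)
    (P : MvPolynomial (Fin d) ℂ) : MvPolynomial (Fin d) ℂ :=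
  (∑ m, C ((Real.sqrt (2 / h) : ℂ) * A⁻¹ m k) * pderiv m P) -
    (∑ m, C ((Real.sqrt (2 / h) : ℂ) / 2 * B k m) * (X m * P)) + C (I * η k / h) * P

theorem sqrt_two_div_mul_sqrt {h : ℝ} (hh : 0 < h) :
    (Real.sqrt (2 / h) : ℂ) * (Real.sqrt (h / 2) : ℂ) = 1 := by
  rw [← ofReal_mul, ← Real.sqrt_mul (by positivity)]
  have : 2 / h * (h / 2) = 1 := by field_simp
  rw [this]; simp

/-- The position in terms of `ζ`: `x - a = (ℏ/2)^{1/2} A ζ`. -/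
theorem coord_eq_zeta {A : Matrix (Fin d) (Fin d) ℂ} (hA : A * A⁻¹ = 1) {h : ℝ} (hh : 0 < h)
    (a x : RSpace d) (i : Fin d) :
    ((x i - a i : ℝ) : ℂ) = (Real.sqrt (h / 2) : ℂ) * ∑ m, A i m * zeta A h a x m := by
  set y : Fin d → ℂ := fun k => ((x k - a k : ℝ) : ℂ) with hy
  have hz : zeta A h a x = (Real.sqrt (2 / h) : ℂ) • (A⁻¹ *ᵥ y) := by
    ext m; simp [zeta, Matrix.mulVec, dotProduct, hy]
  have h1 : ∑ m, A i m * zeta A h a x m = (A *ᵥ zeta A h a x) i := rfl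
  rw [h1, hz, Matrix.mulVec_smul, Matrix.mulVec_mulVec, hA, Matrix.one_mulVec, Pi.smul_apply,
    smul_eq_mul, ← mul_assoc, mul_comm (Real.sqrt (h / 2) : ℂ), sqrt_two_div_mul_sqrt hh, one_mul]

theorem mul_inv_coord_eq_zeta (A B : Matrix (Fin d) (Fin d) ℂ) {h : ℝ} (hh : 0 < h)
    (a x : RSpace d) (k : Fin d) :
    ∑ p, (B * A⁻¹) k p * ((x p - a p : ℝ) : ℂ) =
      (Real.sqrt (h / 2) : ℂ) * ∑ m, B k m * zeta A h a x m := by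
  set y : Fin d → ℂ := fun k => ((x k - a k : ℝ) : ℂ) with hy
  have hz : zeta A h a x = (Real.sqrt (2 / h) : ℂ) • (A⁻¹ *ᵥ y) := by
    ext m; simp [zeta, Matrix.mulVec, dotProduct, hy]
  have h1 : ∑ m, B k m * zeta A h a x m = (B *ᵥ zeta A h a x) k := rfl
  have h2 : ∑ p, (B * A⁻¹) k p * ((x p - a p : ℝ) : ℂ) = ((B * A⁻¹) *ᵥ y) k := rfl
  rw [h1, h2, hz, Matrix.mulVec_smul, Matrix.mulVec_mulVec, Pi.smul_apply,
    smul_eq_mul, ← mul_assoc, mul_comm (Real.sqrt (h / 2) : ℂ), sqrt_two_div_mul_sqrt hh, one_mul]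

theorem sqrt_half_div {h : ℝ} (hh : 0 < h) :
    (Real.sqrt (h / 2) : ℂ) / h = (Real.sqrt (2 / h) : ℂ) / 2 := by
  have h1 := sqrt_two_div_mul_sqrt hh
  have h2 : (Real.sqrt (2 / h) : ℂ) * (Real.sqrt (2 / h) : ℂ) = 2 / h := by
    rw [← ofReal_mul, Real.mul_self_sqrt (by positivity)]; push_cast; ring
  have hne : (Real.sqrt (2 / h) : ℂ) ≠ 0 := left_ne_zero_of_mul_eq_one h1
  have hhne : (h : ℂ) ≠ 0 := by exact_mod_cast hh.ne'
  apply mul_left_cancel₀ hne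
  rw [mul_div_assoc', h1, mul_div_assoc', h2]
  field_simp

/-- Partial derivatives act on polynomials times `φ_0` through `gradPoly`. -/
theorem partialD_polyPacket {A B : Matrix (Fin d) (Fin d) ℂ} (hAB : IsSymplecticPair A B) (r : ℂ)
    {h : ℝ} (hh : 0 < h) (a η : RSpace d) (k : Fin d) (P : MvPolynomial (Fin d) ℂ) :
    partialD k (polyPacket A B r h a η P) = polyPacket A B r h a η (gradPoly A B h η k P) := by
  ext x
  refine partialD_eq_of_hasDerivAt
    ((contDiff_polyPacket (n := 1) A B r h a η P).differentiable one_ne_zero x) ?_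
  have hc := fun n => hasDerivAt_line_coord x a k n 0
  have hx0 : x + (0 : ℝ) • EuclideanSpace.single k (1 : ℝ) = x := by simp
  have hz : ∀ m, HasDerivAt
      (fun s : ℝ => zeta A h a (x + s • EuclideanSpace.single k (1 : ℝ)) m)
      ((Real.sqrt (2 / h) : ℂ) * A⁻¹ m k) 0 := by
    intro m
    have := (HasDerivAt.fun_sum (u := Finset.univ) fun p _ =>
      (hc p).const_mul (A⁻¹ m p)).const_mul (Real.sqrt (2 / h) : ℂ)
    simpa [zeta] using this
  have hP := hasDerivAt_eval hz P
  have hη : ∀ n, HasDerivAt (fun s : ℝ =>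
      ((η n * ((x + s • EuclideanSpace.single k (1 : ℝ)) n - a n) : ℝ) : ℂ))
      ((η n : ℂ) * if n = k then 1 else 0) 0 := by
    intro n
    have := (hc n).const_mul (η n : ℂ)
    refine this.congr_of_eventuallyEq (Eventually.of_forall fun s => ?_)
    simp only [ofReal_mul]
  have hq := ((HasDerivAt.fun_sum (u := Finset.univ) fun n _ => HasDerivAt.fun_sum
    (u := Finset.univ) fun p _ =>
      ((hc n).mul_const ((B * A⁻¹) n p)).fun_mul (hc p)).fun_neg.div_const (2 * (h : ℂ))).fun_add
    (((HasDerivAt.fun_sum (u := Finset.univ) fun n _ => hη n).const_mul I).div_const (h : ℂ))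
  have hG := hq.cexp.const_mul
    (((Real.pi ^ (-(d : ℝ) / 4) * h ^ (-(d : ℝ) / 4) : ℝ) : ℂ) * r⁻¹)
  have hfin := hP.fun_mul hG
  unfold polyPacket gaussianPacket
  refine hfin.congr_deriv ?_
  simp only [hx0]
  have e1 : ∑ n, ∑ p, ((if n = k then (1 : ℂ) else 0) * (B * A⁻¹) n p * ((x p - a p : ℝ) : ℂ) +
      ((x n - a n : ℝ) : ℂ) * (B * A⁻¹) n p * if p = k then (1 : ℂ) else 0) =
      2 * ((Real.sqrt (h / 2) : ℂ) * ∑ m, B k m * zeta A h a x m) := by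
    rw [← mul_inv_coord_eq_zeta A B hh]
    have hsy : ∀ p, (B * A⁻¹) p k = (B * A⁻¹) k p := fun p => by
      conv_lhs => rw [← hAB.symmC]
      rfl
    simp only [Finset.sum_add_distrib, ite_mul, one_mul, zero_mul, mul_ite, mul_one, mul_zero,
      Finset.sum_ite_eq', Finset.mem_univ, if_true, two_mul]
    congr 1
    · rw [Finset.sum_comm]; simp
    · exact Finset.sum_congr rfl fun p _ => by rw [hsy]; ring
  rw [e1]
  have hhne : (h : ℂ) ≠ 0 := by exact_mod_cast hh.ne'
  have e2 : -(2 * ((Real.sqrt (h / 2) : ℂ) * ∑ m, B k m * zeta A h a x m)) / (2 * (h : ℂ)) =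
      -((Real.sqrt (2 / h) : ℂ) / 2 * ∑ m, B k m * zeta A h a x m) := by
    rw [← sqrt_half_div hh]; field_simp
  rw [e2]
  simp only [mul_ite, mul_one, mul_zero, Finset.sum_ite_eq', Finset.mem_univ, if_true]
  simp only [gradPoly, map_add, map_sub, map_sum, map_mul, eval_C, eval_X]
  have e3 : ∑ m, (Real.sqrt (2 / h) : ℂ) / 2 * B k m *
      (zeta A h a x m * eval (zeta A h a x) P) =
      (Real.sqrt (2 / h) : ℂ) / 2 * (∑ m, B k m * zeta A h a x m) * eval (zeta A h a x) P := by
    rw [Finset.mul_sum, Finset.sum_mul]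
    exact Finset.sum_congr rfl fun m _ => by ring
  rw [e3]
  ring

/-- Multiplication by a coordinate acts on polynomials times `φ_0` through multiplication by a
linear polynomial. -/
theorem coord_mul_polyPacket {A B : Matrix (Fin d) (Fin d) ℂ} (hAB : IsSymplecticPair A B) (r : ℂ)
    {h : ℝ} (hh : 0 < h) (a η : RSpace d) (i : Fin d) (P : MvPolynomial (Fin d) ℂ)
    (x : RSpace d) :
    ((x i - a i : ℝ) : ℂ) * polyPacket A B r h a η P x =
      polyPacket A B r h a η (∑ m, C ((Real.sqrt (h / 2) : ℂ) * A i m) * (X m * P)) x := by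
  rw [coord_eq_zeta hAB.mul_inv hh]
  simp only [polyPacket, map_sum, map_mul, eval_C, eval_X, Finset.mul_sum, Finset.sum_mul]
  exact Finset.sum_congr rfl fun m _ => by ring

theorem polyPacket_add (A B : Matrix (Fin d) (Fin d) ℂ) (r : ℂ) (h : ℝ) (a η : RSpace d)
    (P Q : MvPolynomial (Fin d) ℂ) (x : RSpace d) :
    polyPacket A B r h a η (P + Q) x =
      polyPacket A B r h a η P x + polyPacket A B r h a η Q x := by
  simp [polyPacket, add_mul]

theorem polyPacket_C_mul (A B : Matrix (Fin d) (Fin d) ℂ) (r : ℂ) (h : ℝ) (a η : RSpace d)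
    (c : ℂ) (P : MvPolynomial (Fin d) ℂ) (x : RSpace d) :
    polyPacket A B r h a η (C c * P) x = c * polyPacket A B r h a η P x := by
  simp [polyPacket, mul_assoc]

theorem polyPacket_sum {ι : Type*} (A B : Matrix (Fin d) (Fin d) ℂ) (r : ℂ) (h : ℝ)
    (a η : RSpace d) (s : Finset ι) (P : ι → MvPolynomial (Fin d) ℂ) (x : RSpace d) :
    polyPacket A B r h a η (∑ i ∈ s, P i) x = ∑ i ∈ s, polyPacket A B r h a η (P i) x := by
  simp [polyPacket, Finset.sum_mul]

/-- The matrix `S = A⁻¹ conj(A)` governing the Hermite polynomials of the wave packets. -/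
noncomputable def matS (A : Matrix (Fin d) (Fin d) ℂ) : Matrix (Fin d) (Fin d) ℂ := A⁻¹ * Aᴴᵀ

theorem matS_symm {A B : Matrix (Fin d) (Fin d) ℂ} (hAB : IsSymplecticPair A B) (m n : Fin d) :
    matS A m n = matS A n m := by
  have h : (matS A)ᵀ = matS A := by
    rw [matS, ← hAB.symmS, Matrix.transpose_mul, Matrix.transpose_transpose, hAB.symmS]
  conv_lhs => rw [← h]
  rfl

theorem one_div_sqrt_two_mul {h : ℝ} (hh : 0 < h) :
    ((1 / Real.sqrt (2 * h) : ℝ) : ℂ) = (Real.sqrt (2 / h) : ℂ) / 2 := by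
  have : 1 / Real.sqrt (2 * h) = Real.sqrt (2 / h) / 2 := by
    have h1 : Real.sqrt (2 * h) * Real.sqrt (2 / h) = 2 := by
      rw [← Real.sqrt_mul (by positivity)]
      have : 2 * h * (2 / h) = 2 ^ 2 := by field_simp
      rw [this, Real.sqrt_sq (by norm_num)]
    have h2 : Real.sqrt (2 * h) ≠ 0 := left_ne_zero_of_mul (by rw [h1]; norm_num)
    field_simp
    linarith
  rw [this]; push_cast; ring

/-- The raising operator acts on polynomials times `φ_0` through `raisePoly`. -/
theorem raising_polyPacket {A B : Matrix (Fin d) (Fin d) ℂ} (hAB : IsSymplecticPair A B) (r : ℂ)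
    {h : ℝ} (hh : 0 < h) (a η : RSpace d) (m : Fin d) (P : MvPolynomial (Fin d) ℂ) :
    raising A B h a η m (polyPacket A B r h a η P) =
      polyPacket A B r h a η (raisePoly (matS A) m P) := by
  ext x
  unfold raising
  simp only [partialD_polyPacket hAB r hh]
  have hhne : (h : ℂ) ≠ 0 := by exact_mod_cast hh.ne'
  have e0 : ∀ n, -I * (h : ℂ) * polyPacket A B r h a η (gradPoly A B h η n P) x -
      ((η n : ℝ) : ℂ) * polyPacket A B r h a η P x =
      -I * (h : ℂ) * ((∑ k, (Real.sqrt (2 / h) : ℂ) * A⁻¹ k n *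
        polyPacket A B r h a η (pderiv k P) x) -
        ∑ k, (Real.sqrt (2 / h) : ℂ) / 2 * B n k * polyPacket A B r h a η (X k * P) x) := by
    intro n
    have : polyPacket A B r h a η (gradPoly A B h η n P) x =
      (∑ k, (Real.sqrt (2 / h) : ℂ) * A⁻¹ k n * polyPacket A B r h a η (pderiv k P) x) -
        (∑ k, (Real.sqrt (2 / h) : ℂ) / 2 * B n k * polyPacket A B r h a η (X k * P) x) +
        I * η n / h * polyPacket A B r h a η P x := by
      unfold gradPoly polyPacket
      simp only [map_add, map_sub, map_sum, map_mul, eval_C, eval_X, add_mul, sub_mul,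
        Finset.sum_mul, mul_assoc]
    rw [this]
    have h3 : -I * (h : ℂ) * (I * η n / h) = η n := by
      field_simp
      rw [I_sq]; ring
    rw [mul_add, ← mul_assoc _ (I * η n / h : ℂ), h3]
    ring
  simp only [e0]
  have e1 : ∀ n, starRingEnd ℂ (B n m) * ((x n - a n : ℝ) : ℂ) * polyPacket A B r h a η P x =
      ∑ k, (Real.sqrt (h / 2) : ℂ) * (starRingEnd ℂ (B n m) * A n k) *
        polyPacket A B r h a η (X k * P) x := by
    intro n
    rw [mul_assoc, coord_mul_polyPacket hAB r hh, polyPacket_sum, Finset.mul_sum]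
    refine Finset.sum_congr rfl fun k _ => ?_
    rw [polyPacket_C_mul]; ring
  simp only [e1]
  set u : Fin d → ℂ := fun k => polyPacket A B r h a η (X k * P) x with hu
  set w : Fin d → ℂ := fun k => polyPacket A B r h a η (pderiv k P) x with hw
  set s : ℂ := (Real.sqrt (2 / h) : ℂ) with hs
  have hs2 : s * s = 2 / h := by
    rw [hs, ← ofReal_mul, Real.mul_self_sqrt (by positivity)]; push_cast; ring
  have hs' : (Real.sqrt (h / 2) : ℂ) = h * s / 2 := by
    have := sqrt_half_div hh
    field_simp at this
    rw [hs, ← this]; ring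
  have f1 : ∑ n, ∑ k, (Real.sqrt (h / 2) : ℂ) * (starRingEnd ℂ (B n m) * A n k) * u k =
      h * s / 2 * ((Bᴴ * A) *ᵥ u) m := by
    simp only [hs', Matrix.mulVec, dotProduct, Matrix.mul_apply, Finset.mul_sum,
      Finset.sum_mul, Matrix.conjTranspose_apply]
    rw [Finset.sum_comm]
    exact Finset.sum_congr rfl fun n _ => Finset.sum_congr rfl fun k _ => by
      simp only [starRingEnd_apply]; ring
  have f2 : I * ∑ n, starRingEnd ℂ (A n m) * (-I * (h : ℂ) * ((∑ k, s * A⁻¹ k n * w k) -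
      ∑ k, s / 2 * B n k * u k)) =
      h * s * ((Aᴴ * A⁻¹ᵀ) *ᵥ w) m - h * s / 2 * ((Aᴴ * B) *ᵥ u) m := by
    simp only [Matrix.mulVec, dotProduct, Matrix.mul_apply, Finset.mul_sum, mul_sub,
      Finset.sum_mul, Matrix.conjTranspose_apply, Finset.sum_sub_distrib, Matrix.transpose_apply]
    have hI : ∀ z : ℂ, I * (I * z) = -z := fun z => by rw [← mul_assoc, I_mul_I]; ring
    congr 1
    · rw [Finset.sum_comm]
      refine Finset.sum_congr rfl fun n _ => Finset.sum_congr rfl fun k _ => ?_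
      simp only [starRingEnd_apply]
      linear_combination (-(star (A k m)) * h * s * A⁻¹ n k * w n) * I_mul_I
    · rw [Finset.sum_comm]
      refine Finset.sum_congr rfl fun n _ => Finset.sum_congr rfl fun k _ => ?_
      simp only [starRingEnd_apply]
      linear_combination (-(star (A k m)) * h * s / 2 * B k n * u n) * I_mul_I
  rw [f1, f2, one_div_sqrt_two_mul hh, ← hs]
  -- Here `A* B + B* A = 2` enters: multiplication by `ζ` survives with coefficient one.
  have f3 : ((Bᴴ * A) *ᵥ u) m + ((Aᴴ * B) *ᵥ u) m = 2 * u m := by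
    have := congrArg (fun M => (M *ᵥ u) m) hAB.herm
    simp only [Matrix.add_mulVec, Matrix.smul_mulVec, Matrix.one_mulVec, Pi.add_apply,
      Pi.smul_apply, smul_eq_mul] at this
    rw [add_comm]; exact this
  have f4 : polyPacket A B r h a η (raisePoly (matS A) m P) x = u m - ((Aᴴ * A⁻¹ᵀ) *ᵥ w) m := by
    rw [hAB.symmS]
    simp [polyPacket, raisePoly, hu, hw, Matrix.mulVec, dotProduct, matS, sub_mul, Finset.sum_mul,
      mul_assoc]
  rw [f4]
  have hs3 : s / 2 * (h * s) = 1 := by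
    rw [div_mul_eq_mul_div, mul_comm (h : ℂ), ← mul_assoc, hs2]; field_simp
  linear_combination (s / 2 * (h * s) / 2) * f3 + (u m - ((Aᴴ * A⁻¹ᵀ) *ᵥ w) m) * hs3

/-- The wave packets are normalized Hermite polynomials in `ζ` times `φ_0`. -/
theorem packet_eq_polyPacket {A B : Matrix (Fin d) (Fin d) ℂ} (hAB : IsSymplecticPair A B) (r : ℂ)
    {h : ℝ} (hh : 0 < h) (a η : RSpace d) (j : Fin d → ℕ) (x : RSpace d) :
    packet A B r h a η j x = ((1 / Real.sqrt (multiFactorial j : ℝ) : ℝ) : ℂ) *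
      polyPacket A B r h a η (hermitePoly (matS A) j) x := by
  unfold packet
  congr 1
  have hit : ∀ m i P, (raising A B h a η m)^[i] (polyPacket A B r h a η P) =
      polyPacket A B r h a η ((raisePoly (matS A) m)^[i] P) := by
    intro m i P
    induction i with
    | zero => rfl
    | succ i ih => rw [Function.iterate_succ_apply', Function.iterate_succ_apply', ih,
        raising_polyPacket hAB r hh]
  have key : ∀ l : List (Fin d), l.foldr (fun m f => (raising A B h a η m)^[j m] f)
      (gaussianPacket A B r h a η) = polyPacket A B r h a η
        (l.foldr (fun m f => (raisePoly (matS A) m)^[j m] f) 1) := by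
    intro l
    induction l with
    | nil => ext x; simp [polyPacket]
    | cons m l ih => simp only [List.foldr_cons, ih, hit]
  rw [key]
  rfl

end Packets


/-! ### Families of functions with Gaussian decay -/

/-- The family `F` of functions on `ℝ^d` is dominated, eventually along the filter `l`, by one
Gaussian. -/
def GaussDecay {d : ℕ} {ι : Type*} (l : Filter ι) (F : ι → RSpace d → ℂ) : Prop :=
  ∃ C c : ℝ, 0 < c ∧ ∀ᶠ t in l, ∀ x, ‖F t x‖ ≤ C * Real.exp (-c * ‖x‖ ^ 2)

namespace GaussDecay

variable {d : ℕ} {ι : Type*} {l : Filter ι} {F G : ι → RSpace d → ℂ}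

theorem exists_nonneg (hF : GaussDecay l F) : ∃ C c : ℝ, 0 ≤ C ∧ 0 < c ∧
    ∀ᶠ t in l, ∀ x, ‖F t x‖ ≤ C * Real.exp (-c * ‖x‖ ^ 2) := by
  obtain ⟨C, c, hc, h⟩ := hF
  refine ⟨max C 0, c, le_max_right _ _, hc, h.mono fun t ht x => (ht x).trans ?_⟩
  gcongr
  exact le_max_left _ _

theorem congr' (hF : GaussDecay l F) (h : ∀ᶠ t in l, ∀ x, F t x = G t x) : GaussDecay l G := by
  obtain ⟨C, c, hc, h'⟩ := hF
  exact ⟨C, c, hc, by filter_upwards [h, h'] with t h1 h2 x; rw [← h1]; exact h2 x⟩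

theorem add (hF : GaussDecay l F) (hG : GaussDecay l G) :
    GaussDecay l (fun t x => F t x + G t x) := by
  obtain ⟨C, c, hC, hc, h1⟩ := hF.exists_nonneg
  obtain ⟨C', c', hC', hc', h2⟩ := hG.exists_nonneg
  refine ⟨C + C', min c c', lt_min hc hc', ?_⟩
  filter_upwards [h1, h2] with t h1 h2 x
  refine (norm_add_le _ _).trans ?_
  rw [add_mul]
  refine add_le_add ((h1 x).trans ?_) ((h2 x).trans ?_)
  · gcongr
    exact min_le_left _ _
  · gcongr
    exact min_le_right _ _

/-- Multiplication by functions of uniformly at most exponential growth preserves Gaussian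
decay. -/
theorem growth_mul (hF : GaussDecay l F) {g : ι → RSpace d → ℂ} {M τ : ℝ}
    (hg : ∀ᶠ t in l, ∀ x, ‖g t x‖ ≤ M * Real.exp (τ * ‖x‖)) :
    GaussDecay l (fun t x => g t x * F t x) := by
  obtain ⟨C, c, hC, hc, h1⟩ := hF.exists_nonneg
  refine ⟨|M| * C * Real.exp (τ ^ 2 / (2 * c)), c / 2, by positivity, ?_⟩
  filter_upwards [h1, hg] with t h1 hg x
  rw [norm_mul]
  have hM : ‖g t x‖ ≤ |M| * Real.exp (τ * ‖x‖) :=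
    (hg x).trans (mul_le_mul_of_nonneg_right (le_abs_self M) (Real.exp_nonneg _))
  calc ‖g t x‖ * ‖F t x‖
      ≤ (|M| * Real.exp (τ * ‖x‖)) * (C * Real.exp (-c * ‖x‖ ^ 2)) := by
        gcongr
        exact h1 x
    _ = |M| * C * Real.exp (τ * ‖x‖ + -c * ‖x‖ ^ 2) := by rw [Real.exp_add]; ring
    _ ≤ |M| * C * Real.exp (τ ^ 2 / (2 * c) + -(c / 2) * ‖x‖ ^ 2) := by
        gcongr |M| * C * Real.exp ?_
        have : 0 ≤ (τ - c * ‖x‖) ^ 2 / (2 * c) := by positivity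
        have e : (τ - c * ‖x‖) ^ 2 / (2 * c) =
            τ ^ 2 / (2 * c) - τ * ‖x‖ + c / 2 * ‖x‖ ^ 2 := by field_simp; ring
        linarith
    _ = _ := by rw [Real.exp_add]; ring

theorem bdd_mul (hF : GaussDecay l F) {α : ι → ℂ} {K : ℝ} (hα : ∀ᶠ t in l, ‖α t‖ ≤ K) :
    GaussDecay l (fun t x => α t * F t x) :=
  hF.growth_mul (g := fun t _ => α t) (M := K) (τ := 0)
    (hα.mono fun t ht x => by simpa using ht)

theorem const_mul (hF : GaussDecay l F) (c : ℂ) : GaussDecay l (fun t x => c * F t x) :=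
  hF.bdd_mul (α := fun _ => c) (K := ‖c‖) (Eventually.of_forall fun _ => le_rfl)

theorem neg (hF : GaussDecay l F) : GaussDecay l (fun t x => -F t x) := by
  simpa using hF.const_mul (-1)

theorem sub (hF : GaussDecay l F) (hG : GaussDecay l G) :
    GaussDecay l (fun t x => F t x - G t x) := by
  simpa [sub_eq_add_neg] using hF.add hG.neg

theorem zero : GaussDecay l (fun _ (_ : RSpace d) => (0 : ℂ)) := ⟨0, 1, one_pos, by simp⟩

theorem sum {κ : Type*} (s : Finset κ) {F : κ → ι → RSpace d → ℂ}
    (hF : ∀ k ∈ s, GaussDecay l (F k)) : GaussDecay l (fun t x => ∑ k ∈ s, F k t x) := by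
  classical
  induction s using Finset.induction_on with
  | empty => simpa using zero
  | insert a s ha ih =>
    simp only [Finset.sum_insert ha]
    exact (hF a (Finset.mem_insert_self _ _)).add
      (ih fun k hk => hF k (Finset.mem_insert_of_mem hk))

theorem coord_sub_mul (hF : GaussDecay l F) {a : ι → RSpace d} {K : ℝ}
    (ha : ∀ᶠ t in l, ‖a t‖ ≤ K) (i : Fin d) :
    GaussDecay l (fun t x => ((x i - a t i : ℝ) : ℂ) * F t x) := by
  refine hF.growth_mul (g := fun t x => ((x i - a t i : ℝ) : ℂ)) (M := |K| + 1) (τ := 1) ?_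
  filter_upwards [ha] with t ht x
  rw [norm_real]
  have h1 : ‖x i‖ ≤ ‖x‖ := PiLp.norm_apply_le x i
  have h2 : ‖a t i‖ ≤ ‖a t‖ := PiLp.norm_apply_le (a t) i
  have h3 : ‖x i - a t i‖ ≤ ‖x‖ + |K| :=
    (norm_sub_le _ _).trans (add_le_add h1 (h2.trans (ht.trans (le_abs_self K))))
  have h4 : ‖x‖ + 1 ≤ Real.exp ‖x‖ := Real.add_one_le_exp _
  have h5 := norm_nonneg x
  have h6 := abs_nonneg K
  rw [one_mul]
  nlinarith

end GaussDecay

section Static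

variable {d : ℕ}

theorem integrable_gaussian {c : ℝ} (hc : 0 < c) :
    Integrable (fun x : RSpace d => Real.exp (-c * ‖x‖ ^ 2)) := by
  have := (GaussianFourier.integrable_cexp_neg_mul_sq_norm_add (V := RSpace d) (b := (c : ℂ))
    (by simpa using hc) 0 0).norm
  refine this.congr (Eventually.of_forall fun x => ?_)
  simp only [norm_exp]
  congr 1
  simp [← ofReal_pow]

theorem GaussDecay.self {ι : Type*} [TopologicalSpace ι] {t : ι} {F : ι → RSpace d → ℂ}
    (hF : GaussDecay (𝓝 t) F) :
    ∃ C c : ℝ, 0 < c ∧ ∀ x, ‖F t x‖ ≤ C * Real.exp (-c * ‖x‖ ^ 2) := by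
  obtain ⟨C, c, hc, h⟩ := hF
  exact ⟨C, c, hc, h.self_of_nhds⟩

theorem memLp_of_gaussDecay {f : RSpace d → ℂ} (hf : AEStronglyMeasurable f volume)
    {C c : ℝ} (hc : 0 < c) (h : ∀ x, ‖f x‖ ≤ C * Real.exp (-c * ‖x‖ ^ 2)) : MemLp f 2 volume := by
  rw [memLp_two_iff_integrable_sq_norm hf]
  have hc2 : 0 < 2 * c := by positivity
  refine ((integrable_gaussian hc2).const_mul (C ^ 2)).mono' (hf.norm.pow 2)
    (Eventually.of_forall fun x => ?_)
  have h1 := pow_le_pow_left₀ (norm_nonneg _) (h x) 2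
  rw [mul_pow, ← Real.exp_nat_mul] at h1
  rw [Real.norm_of_nonneg (by positivity)]
  refine h1.trans (le_of_eq ?_)
  congr 2
  push_cast; ring

theorem gaussDecay_mul_integrable {f g : RSpace d → ℂ} (hf : AEStronglyMeasurable f volume)
    (hg : AEStronglyMeasurable g volume)
    (h1 : ∃ C c : ℝ, 0 < c ∧ ∀ x, ‖f x‖ ≤ C * Real.exp (-c * ‖x‖ ^ 2))
    (h2 : ∃ C c : ℝ, 0 < c ∧ ∀ x, ‖g x‖ ≤ C * Real.exp (-c * ‖x‖ ^ 2)) :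
    Integrable (fun x => f x * g x) := by
  obtain ⟨C, c, hc, h1⟩ := h1
  obtain ⟨C', c', hc', h2⟩ := h2
  exact MemLp.integrable_mul (memLp_of_gaussDecay hf hc h1) (memLp_of_gaussDecay hg hc' h2)

end Static

/-! ### Bounded families of polynomials -/

/-- The families of polynomials whose coefficients are eventually bounded along the filter `l`,
with a uniform bound on the degree: the smallest class that contains the bounded families of
constants and is closed under sums and under multiplication by the variables. -/
inductive BddPoly {d : ℕ} {ι : Type*} (l : Filter ι) : (ι → MvPolynomial (Fin d) ℂ) → Prop
  | const {α : ι → ℂ} {K : ℝ} (hα : ∀ᶠ t in l, ‖α t‖ ≤ K) :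
      BddPoly l (fun t => MvPolynomial.C (α t))
  | add {P Q : ι → MvPolynomial (Fin d) ℂ} (hP : BddPoly l P) (hQ : BddPoly l Q) :
      BddPoly l (fun t => P t + Q t)
  | X_mul (m : Fin d) {P : ι → MvPolynomial (Fin d) ℂ} (hP : BddPoly l P) :
      BddPoly l (fun t => MvPolynomial.X m * P t)
  | congr {P Q : ι → MvPolynomial (Fin d) ℂ} (h : ∀ᶠ t in l, P t = Q t) (hP : BddPoly l P) :
      BddPoly l Q

namespace BddPoly

open MvPolynomial

variable {d : ℕ} {ι : Type*} {l : Filter ι} {P Q : ι → MvPolynomial (Fin d) ℂ}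

theorem one : BddPoly l (fun _ => (1 : MvPolynomial (Fin d) ℂ)) := by
  simpa using const (d := d) (l := l) (α := fun _ => 1) (K := 1) (by simp)

theorem zero : BddPoly l (fun _ => (0 : MvPolynomial (Fin d) ℂ)) := by
  simpa using const (d := d) (l := l) (α := fun _ => 0) (K := 0) (by simp)

theorem C_mul (hP : BddPoly l P) {α : ι → ℂ} {K : ℝ} (hα : ∀ᶠ t in l, ‖α t‖ ≤ K) :
    BddPoly l (fun t => C (α t) * P t) := by
  induction hP with
  | @const β K' hβ =>
    refine .congr (Eventually.of_forall fun t => map_mul C (α t) (β t)) (.const (K := |K| * |K'|) ?_)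
    filter_upwards [hα, hβ] with t h1 h2
    rw [norm_mul]
    gcongr
    · exact h1.trans (le_abs_self _)
    · exact h2.trans (le_abs_self _)
  | add _ _ hp hq => exact .congr (Eventually.of_forall fun t => (mul_add _ _ _).symm) (hp.add hq)
  | X_mul m _ hp =>
    exact .congr (Eventually.of_forall fun t => mul_left_comm _ _ _) (hp.X_mul m)
  | congr h _ hp => exact .congr (h.mono fun t ht => by rw [ht]) hp

theorem sub (hP : BddPoly l P) (hQ : BddPoly l Q) : BddPoly l (fun t => P t - Q t) :=
  .congr (Eventually.of_forall fun t => by simp [sub_eq_add_neg])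
    (hP.add (hQ.C_mul (α := fun _ => -1) (K := 1) (by simp)))

theorem sum {κ : Type*} (s : Finset κ) {P : κ → ι → MvPolynomial (Fin d) ℂ}
    (hP : ∀ k ∈ s, BddPoly l (P k)) : BddPoly l (fun t => ∑ k ∈ s, P k t) := by
  classical
  induction s using Finset.induction_on with
  | empty => simpa using zero
  | insert a s ha ih =>
    simp only [Finset.sum_insert ha]
    exact (hP a (Finset.mem_insert_self _ _)).add
      (ih fun k hk => hP k (Finset.mem_insert_of_mem hk))

theorem pderiv (hP : BddPoly l P) (k : Fin d) :
    BddPoly l (fun t => MvPolynomial.pderiv k (P t)) := by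
  induction hP with
  | const hα => exact .congr (Eventually.of_forall fun t => pderiv_C.symm) zero
  | add _ _ hp hq => exact .congr (Eventually.of_forall fun t => (map_add _ _ _).symm) (hp.add hq)
  | @X_mul m P hP hp =>
    refine .congr (Eventually.of_forall fun t => ?_) ((hp.X_mul m).add
      (hP.C_mul (α := fun _ => Pi.single (M := fun _ => ℂ) k 1 m) (K := 1)
        (Eventually.of_forall fun t => ?_)))
    · rw [Derivation.leibniz, smul_eq_mul, smul_eq_mul, pderiv_X]
      by_cases hkm : k = m
      · subst hkm; simp
      · simp [Ne.symm hkm]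
    · rw [Pi.single_apply]; split_ifs <;> simp
  | congr h _ hp => exact .congr (h.mono fun t ht => by rw [ht]) hp

theorem of_const (P : MvPolynomial (Fin d) ℂ) : BddPoly l (fun _ => P) := by
  induction P using MvPolynomial.induction_on with
  | C c => exact .const (K := ‖c‖) (by simp)
  | add p q hp hq => exact hp.add hq
  | mul_X p i hp => exact .congr (Eventually.of_forall fun t => mul_comm _ _) (hp.X_mul i)

end BddPoly

/-! ### Decay of the wave packets -/

section Decay

variable {d : ℕ}

/-- The modulus of the Gaussian is `exp (-|ζ|² / 4)` up to a constant. -/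
theorem norm_gaussianPacket {A B : Matrix (Fin d) (Fin d) ℂ} (hAB : IsSymplecticPair A B) (r : ℂ)
    {h : ℝ} (hh : 0 < h) (a η : RSpace d) (x : RSpace d) :
    ‖gaussianPacket A B r h a η x‖ = Real.pi ^ (-(d : ℝ) / 4) * h ^ (-(d : ℝ) / 4) * ‖r‖⁻¹ *
      Real.exp (-(∑ m, ‖zeta A h a x m‖ ^ 2) / 4) := by
  unfold gaussianPacket
  have hp : 0 ≤ Real.pi ^ (-(d : ℝ) / 4) * h ^ (-(d : ℝ) / 4) := by positivity
  rw [norm_mul, norm_mul, norm_inv, norm_real, Real.norm_of_nonneg hp, norm_exp]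
  congr 2
  set y : Fin d → ℂ := fun k => ((x k - a k : ℝ) : ℂ) with hy
  have hstar : star y = y := by ext k; simp [hy]
  have hq : ∑ n, ∑ p, ((x n - a n : ℝ) : ℂ) * (B * A⁻¹) n p * ((x p - a p : ℝ) : ℂ) =
      y ⬝ᵥ ((B * A⁻¹) *ᵥ y) := by
    simp only [dotProduct, Matrix.mulVec, Finset.mul_sum, hy, mul_assoc]
  have hη : ∑ n, ((η n * (x n - a n) : ℝ) : ℂ) = ((∑ n, η n * (x n - a n) : ℝ) : ℂ) := by
    push_cast; rfl
  rw [hq, hη]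
  have hre2 : 2 * (y ⬝ᵥ ((B * A⁻¹) *ᵥ y)).re = 2 * ∑ m, ‖(A⁻¹ *ᵥ y) m‖ ^ 2 := by
    have h1 := congrArg (fun M => y ⬝ᵥ (M *ᵥ y)) hAB.reC
    simp only [Matrix.add_mulVec, Matrix.smul_mulVec, dotProduct_add, dotProduct_smul] at h1
    have h2 : y ⬝ᵥ ((B * A⁻¹)ᴴ *ᵥ y) = star (y ⬝ᵥ ((B * A⁻¹) *ᵥ y)) := by
      conv_rhs => rw [← Matrix.star_dotProduct_star, hstar, Matrix.star_mulVec, hstar,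
        ← Matrix.dotProduct_mulVec]
    have h3 : y ⬝ᵥ ((A⁻¹ᴴ * A⁻¹) *ᵥ y) = ((∑ m, ‖(A⁻¹ *ᵥ y) m‖ ^ 2 : ℝ) : ℂ) := by
      rw [← Matrix.mulVec_mulVec, Matrix.dotProduct_mulVec, Matrix.vecMul_conjTranspose, hstar]
      simp only [dotProduct, Pi.star_apply]
      push_cast
      exact Finset.sum_congr rfl fun m _ => by
        rw [← Complex.conj_mul']; rfl
    rw [h2, h3] at h1
    have h4 := congrArg Complex.re h1
    simp only [add_re, smul_eq_mul, star_def, conj_re, mul_re, ofReal_re, ofReal_im, re_ofNat,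
      im_ofNat, mul_zero, sub_zero] at h4
    linarith
  have hre : (y ⬝ᵥ ((B * A⁻¹) *ᵥ y)).re = ∑ m, ‖(A⁻¹ *ᵥ y) m‖ ^ 2 := by linarith
  have hz : ∑ m, ‖zeta A h a x m‖ ^ 2 = 2 / h * ∑ m, ‖(A⁻¹ *ᵥ y) m‖ ^ 2 := by
    rw [Finset.mul_sum]
    refine Finset.sum_congr rfl fun m _ => ?_
    have : zeta A h a x m = (Real.sqrt (2 / h) : ℂ) * (A⁻¹ *ᵥ y) m := by
      simp [zeta, Matrix.mulVec, dotProduct, hy]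
    rw [this, norm_mul, mul_pow, norm_real, Real.norm_of_nonneg (Real.sqrt_nonneg _),
      Real.sq_sqrt (by positivity)]
  have h2h : (2 * (h : ℂ)) = ((2 * h : ℝ) : ℂ) := by push_cast; ring
  rw [add_re, h2h, div_ofReal_re, div_ofReal_re, neg_re, hre, hz, re_mul_ofReal]
  simp
  field_simp
  ring

/-- The norm of the complex coordinate `ζ` controls the distance to the centre of the packet. -/
theorem norm_sub_sq_le {A B : Matrix (Fin d) (Fin d) ℂ} (hAB : IsSymplecticPair A B)
    {h : ℝ} (hh : 0 < h) (a x : RSpace d) :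
    ‖x - a‖ ^ 2 ≤ h / 2 * opNorm A ^ 2 * ∑ m, ‖zeta A h a x m‖ ^ 2 := by
  set z : CSpace d := WithLp.toLp 2 (zeta A h a x) with hz
  have h1 := (Matrix.toEuclideanCLM (𝕜 := ℂ) A).le_opNorm z
  have h2 : ∀ i, Matrix.toEuclideanCLM (𝕜 := ℂ) A z i = ∑ m, A i m * zeta A h a x m := fun i => rfl
  have h3 : ‖x - a‖ ^ 2 = h / 2 * ‖Matrix.toEuclideanCLM (𝕜 := ℂ) A z‖ ^ 2 := by
    rw [EuclideanSpace.norm_sq_eq, EuclideanSpace.norm_sq_eq, Finset.mul_sum]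
    refine Finset.sum_congr rfl fun i _ => ?_
    have := coord_eq_zeta hAB.mul_inv hh a x i
    rw [h2, PiLp.sub_apply, ← norm_real, this, norm_mul, mul_pow, norm_real,
      Real.norm_of_nonneg (Real.sqrt_nonneg _), Real.sq_sqrt (by positivity)]
  have h4 : ‖z‖ ^ 2 = ∑ m, ‖zeta A h a x m‖ ^ 2 := by rw [EuclideanSpace.norm_sq_eq]
  rw [h3, ← h4]
  have h5 := pow_le_pow_left₀ (norm_nonneg _) h1 2
  rw [mul_pow] at h5
  unfold opNorm
  have : 0 ≤ h / 2 := by positivity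
  nlinarith

variable {ι : Type*} {l : Filter ι} {A B : ι → Matrix (Fin d) (Fin d) ℂ} {r : ι → ℂ}
  {a η : ι → RSpace d} {h K : ℝ}

/-- Data of wave packets that are eventually bounded along a filter. -/
structure BoundedData (l : Filter ι) (A B : ι → Matrix (Fin d) (Fin d) ℂ) (r : ι → ℂ)
    (a η : ι → RSpace d) (K : ℝ) : Prop where
  pair : ∀ᶠ t in l, IsSymplecticPair (A t) (B t)
  norm_a : ∀ᶠ t in l, ‖a t‖ ≤ K
  norm_η : ∀ᶠ t in l, ‖η t‖ ≤ K
  opNorm_A : ∀ᶠ t in l, opNorm (A t) ≤ K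
  norm_A : ∀ᶠ t in l, ∀ m n, ‖A t m n‖ ≤ K
  norm_B : ∀ᶠ t in l, ∀ m n, ‖B t m n‖ ≤ K
  norm_inv : ∀ᶠ t in l, ∀ m n, ‖(A t)⁻¹ m n‖ ≤ K
  norm_r : ∀ᶠ t in l, ‖r t‖⁻¹ ≤ K

namespace BoundedData

theorem gaussDecay (hb : BoundedData l A B r a η K) (hh : 0 < h) :
    GaussDecay l (fun t => gaussianPacket (A t) (B t) (r t) h (a t) (η t)) := by
  set c : ℝ := 1 / (4 * h * (K ^ 2 + 1)) with hc
  have hcpos : 0 < c := by positivity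
  refine ⟨Real.pi ^ (-(d : ℝ) / 4) * h ^ (-(d : ℝ) / 4) * |K| * Real.exp (2 * c * K ^ 2), c,
    hcpos, ?_⟩
  filter_upwards [hb.pair, hb.norm_a, hb.opNorm_A, hb.norm_r] with t hp ha hA hr x
  rw [norm_gaussianPacket hp _ hh, mul_assoc _ (Real.exp _) (Real.exp _), ← Real.exp_add]
  gcongr ?_ * ?_ * ?_ * Real.exp ?_
  · exact hr.trans (le_abs_self K)
  have h1 := norm_sub_sq_le hp hh (a t) x
  have hA0 : 0 ≤ opNorm (A t) := norm_nonneg _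
  have hs : 0 ≤ ∑ m, ‖zeta (A t) h (a t) x m‖ ^ 2 := Finset.sum_nonneg fun _ _ => by positivity
  have h2 : ‖x - a t‖ ^ 2 ≤ h / 2 * (K ^ 2 + 1) * ∑ m, ‖zeta (A t) h (a t) x m‖ ^ 2 := by
    refine h1.trans ?_
    gcongr
    have := pow_le_pow_left₀ hA0 hA 2
    linarith
  have h3 : 2 * c * ‖x - a t‖ ^ 2 ≤ (∑ m, ‖zeta (A t) h (a t) x m‖ ^ 2) / 4 := by
    have h2c := mul_le_mul_of_nonneg_left h2 (by positivity : 0 ≤ 2 * c)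
    refine h2c.trans (le_of_eq ?_)
    rw [hc]; field_simp
  have h4 : ‖x‖ ^ 2 ≤ 2 * ‖x - a t‖ ^ 2 + 2 * K ^ 2 := by
    have h5 : ‖x‖ ≤ ‖x - a t‖ + ‖a t‖ := by
      calc ‖x‖ = ‖x - a t + a t‖ := by simp
        _ ≤ _ := norm_add_le _ _
    have h6 := norm_nonneg (a t)
    have h7 := norm_nonneg (x - a t)
    have h8 := pow_le_pow_left₀ h6 ha 2
    have h9 := pow_le_pow_left₀ (norm_nonneg x) h5 2
    nlinarith [sq_nonneg (‖x - a t‖ - ‖a t‖)]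
  have := mul_le_mul_of_nonneg_left h4 hcpos.le
  linarith

theorem zeta_mul (hb : BoundedData l A B r a η K) {F : ι → RSpace d → ℂ} (hF : GaussDecay l F)
    (m : Fin d) : GaussDecay l (fun t x => zeta (A t) h (a t) x m * F t x) := by
  have : GaussDecay l (fun t x => ∑ k, (Real.sqrt (2 / h) : ℂ) *
      ((A t)⁻¹ m k * (((x k - a t k : ℝ) : ℂ) * F t x))) :=
    GaussDecay.sum _ fun k _ => ((hF.coord_sub_mul hb.norm_a k).bdd_mul
      (hb.norm_inv.mono fun t ht => ht m k)).const_mul _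
  refine this.congr' (Eventually.of_forall fun t x => ?_)
  simp only [zeta, Finset.mul_sum, Finset.sum_mul]
  exact Finset.sum_congr rfl fun k _ => by ring

theorem norm_matS (hb : BoundedData l A B r a η K) :
    ∃ K', ∀ᶠ t in l, ∀ m n, ‖matS (A t) m n‖ ≤ K' := by
  refine ⟨∑ _k : Fin d, |K| * |K|, ?_⟩
  filter_upwards [hb.norm_inv, hb.norm_A] with t h1 h2 m n
  rw [matS, Matrix.mul_apply]
  refine (norm_sum_le _ _).trans (Finset.sum_le_sum fun k _ => ?_)
  rw [norm_mul]
  gcongr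
  · exact (h1 m k).trans (le_abs_self K)
  · simpa using (h2 k n).trans (le_abs_self K)

/-- A bounded family of polynomials times the moving Gaussian decays like a Gaussian. -/
theorem polyPacket (hb : BoundedData l A B r a η K) (hh : 0 < h)
    {P : ι → MvPolynomial (Fin d) ℂ} (hP : BddPoly l P) :
    GaussDecay l (fun t => polyPacket (A t) (B t) (r t) h (a t) (η t) (P t)) := by
  induction hP with
  | const hα =>
    exact ((hb.gaussDecay hh).bdd_mul hα).congr'
      (Eventually.of_forall fun t x => by simp [Semiclassical.polyPacket])
  | add _ _ hp hq =>
    exact (hp.add hq).congr' (Eventually.of_forall fun t x => (polyPacket_add ..).symm)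
  | X_mul i _ hp =>
    refine (hb.zeta_mul (h := h) hp i).congr' (Eventually.of_forall fun t x => ?_)
    simp only [Semiclassical.polyPacket, map_mul, MvPolynomial.eval_X]
    ring
  | congr h _ hp =>
    exact hp.congr' (h.mono fun t ht x => by rw [ht])

theorem hermite (hb : BoundedData l A B r a η K) (j : Fin d → ℕ) :
    BddPoly l (fun t => hermitePoly (matS (A t)) j) := by
  obtain ⟨K', hK'⟩ := hb.norm_matS
  induction j using multiIndex_induction with
  | zero => simpa using BddPoly.one
  | add j m ih =>
    refine .congr (hb.pair.mono fun t ht => (hermitePoly_add_single (matS_symm ht) j m).symm) ?_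
    exact (ih.X_mul m).sub (BddPoly.sum _ fun n _ =>
      (ih.pderiv n).C_mul (hK'.mono fun t ht => ht m n))

theorem gradPoly (hb : BoundedData l A B r a η K) (k : Fin d)
    {P : ι → MvPolynomial (Fin d) ℂ} (hP : BddPoly l P) :
    BddPoly l (fun t => gradPoly (A t) (B t) h (η t) k (P t)) := by
  refine ((BddPoly.sum _ fun m _ => (hP.pderiv m).C_mul (K := ‖(Real.sqrt (2 / h) : ℂ)‖ * K)
    (hb.norm_inv.mono fun t ht => ?_)).sub (BddPoly.sum _ fun m _ => (hP.X_mul m).C_mul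
    (K := ‖(Real.sqrt (2 / h) : ℂ) / 2‖ * K) (hb.norm_B.mono fun t ht => ?_))).add
    (hP.C_mul (K := K / ‖(h : ℂ)‖) (hb.norm_η.mono fun t ht => ?_))
  · rw [norm_mul]
    exact mul_le_mul_of_nonneg_left (ht m k) (norm_nonneg _)
  · rw [norm_mul]
    exact mul_le_mul_of_nonneg_left (ht k m) (norm_nonneg _)
  · rw [norm_div, norm_mul, norm_I, one_mul, norm_real]
    gcongr
    exact (PiLp.norm_apply_le (η t) k).trans ht

theorem packet (hb : BoundedData l A B r a η K) (hh : 0 < h) (j : Fin d → ℕ) :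
    GaussDecay l (fun t => packet (A t) (B t) (r t) h (a t) (η t) j) := by
  refine ((hb.polyPacket hh (hb.hermite j)).const_mul
    ((1 / Real.sqrt (multiFactorial j : ℝ) : ℝ) : ℂ)).congr' ?_
  filter_upwards [hb.pair] with t ht x
  exact (packet_eq_polyPacket ht _ hh _ _ j x).symm

end BoundedData

/-- Constant data are bounded. -/
theorem boundedData_const {A B : Matrix (Fin d) (Fin d) ℂ} (hAB : IsSymplecticPair A B) (r : ℂ)
    (a η : RSpace d) : ∃ K, BoundedData (𝓝 ()) (fun _ => A) (fun _ => B) (fun _ => r)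
      (fun _ => a) (fun _ => η) K := by
  have hle : ∀ M : Matrix (Fin d) (Fin d) ℂ, ∀ m n, ‖M m n‖ ≤ ∑ p, ∑ q, ‖M p q‖ := fun M m n =>
    (Finset.single_le_sum (f := fun q => ‖M m q‖) (fun _ _ => norm_nonneg _)
      (Finset.mem_univ n)).trans (Finset.single_le_sum (f := fun p => ∑ q, ‖M p q‖)
        (fun _ _ => Finset.sum_nonneg fun _ _ => norm_nonneg _) (Finset.mem_univ m))
  have h1 := norm_nonneg a
  have h2 := norm_nonneg η
  have h3 : 0 ≤ opNorm A := norm_nonneg _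
  have h4 : 0 ≤ ‖r‖⁻¹ := by positivity
  have h5 : ∀ M : Matrix (Fin d) (Fin d) ℂ, 0 ≤ ∑ p, ∑ q, ‖M p q‖ := fun M =>
    Finset.sum_nonneg fun _ _ => Finset.sum_nonneg fun _ _ => norm_nonneg _
  have h6 := h5 A
  have h7 := h5 B
  have h8 := h5 A⁻¹
  refine ⟨‖a‖ + ‖η‖ + opNorm A + ‖r‖⁻¹ + ∑ p, ∑ q, ‖A p q‖ + ∑ p, ∑ q, ‖B p q‖ +
    ∑ p, ∑ q, ‖A⁻¹ p q‖, Eventually.of_forall fun _ => hAB, ?_, ?_, ?_, ?_, ?_, ?_, ?_⟩ <;>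
    refine Eventually.of_forall fun _ => ?_
  · linarith
  · linarith
  · linarith
  · exact fun m n => by linarith [hle A m n]
  · exact fun m n => by linarith [hle B m n]
  · exact fun m n => by linarith [hle A⁻¹ m n]
  · linarith

theorem gaussDecay_polyPacket {A B : Matrix (Fin d) (Fin d) ℂ} (hAB : IsSymplecticPair A B)
    (r : ℂ) {h : ℝ} (hh : 0 < h) (a η : RSpace d) (P : MvPolynomial (Fin d) ℂ) :
    ∃ C c : ℝ, 0 < c ∧ ∀ x, ‖polyPacket A B r h a η P x‖ ≤ C * Real.exp (-c * ‖x‖ ^ 2) := by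
  obtain ⟨K, hK⟩ := boundedData_const hAB r a η
  exact (hK.polyPacket hh (.of_const P)).self

end Decay


/-! ### Orthonormality of the wave packets -/

section Orthonormal

open MvPolynomial

variable {d : ℕ} {A B : Matrix (Fin d) (Fin d) ℂ}

/-- The lowering operator annihilating `φ_0` differentiates the polynomial. -/
theorem lowering_polyPacket (hAB : IsSymplecticPair A B) (r : ℂ)
    {h : ℝ} (hh : 0 < h) (a η : RSpace d) (m : Fin d) (P : MvPolynomial (Fin d) ℂ) (x : RSpace d) :
    ((1 / Real.sqrt (2 * h) : ℝ) : ℂ) *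
      ((∑ n, B n m * ((x n - a n : ℝ) : ℂ) * polyPacket A B r h a η P x) +
        I * ∑ n, A n m * (-I * (h : ℂ) * partialD n (polyPacket A B r h a η P) x -
          ((η n : ℝ) : ℂ) * polyPacket A B r h a η P x)) =
      polyPacket A B r h a η (pderiv m P) x := by
  simp only [partialD_polyPacket hAB r hh]
  have hhne : (h : ℂ) ≠ 0 := by exact_mod_cast hh.ne'
  have e0 : ∀ n, -I * (h : ℂ) * polyPacket A B r h a η (gradPoly A B h η n P) x -
      ((η n : ℝ) : ℂ) * polyPacket A B r h a η P x =
      -I * (h : ℂ) * ((∑ k, (Real.sqrt (2 / h) : ℂ) * A⁻¹ k n *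
        polyPacket A B r h a η (pderiv k P) x) -
        ∑ k, (Real.sqrt (2 / h) : ℂ) / 2 * B n k * polyPacket A B r h a η (X k * P) x) := by
    intro n
    have : polyPacket A B r h a η (gradPoly A B h η n P) x =
      (∑ k, (Real.sqrt (2 / h) : ℂ) * A⁻¹ k n * polyPacket A B r h a η (pderiv k P) x) -
        (∑ k, (Real.sqrt (2 / h) : ℂ) / 2 * B n k * polyPacket A B r h a η (X k * P) x) +
        I * η n / h * polyPacket A B r h a η P x := by
      unfold gradPoly polyPacket
      simp only [map_add, map_sub, map_sum, map_mul, eval_C, eval_X, add_mul, sub_mul,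
        Finset.sum_mul, mul_assoc]
    rw [this]
    have h3 : -I * (h : ℂ) * (I * η n / h) = η n := by
      field_simp
      rw [I_sq]; ring
    rw [mul_add, ← mul_assoc _ (I * η n / h : ℂ), h3]
    ring
  simp only [e0]
  have e1 : ∀ n, B n m * ((x n - a n : ℝ) : ℂ) * polyPacket A B r h a η P x =
      ∑ k, (Real.sqrt (h / 2) : ℂ) * (B n m * A n k) *
        polyPacket A B r h a η (X k * P) x := by
    intro n
    rw [mul_assoc, coord_mul_polyPacket hAB r hh, polyPacket_sum, Finset.mul_sum]
    refine Finset.sum_congr rfl fun k _ => ?_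
    rw [polyPacket_C_mul]; ring
  simp only [e1]
  set u : Fin d → ℂ := fun k => polyPacket A B r h a η (X k * P) x with hu
  set w : Fin d → ℂ := fun k => polyPacket A B r h a η (pderiv k P) x with hw
  set s : ℂ := (Real.sqrt (2 / h) : ℂ) with hs
  have hs2 : s * s = 2 / h := by
    rw [hs, ← ofReal_mul, Real.mul_self_sqrt (by positivity)]; push_cast; ring
  have hs' : (Real.sqrt (h / 2) : ℂ) = h * s / 2 := by
    have := sqrt_half_div hh
    field_simp at this
    rw [hs, ← this]; ring
  have f1 : ∑ n, ∑ k, (Real.sqrt (h / 2) : ℂ) * (B n m * A n k) * u k =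
      h * s / 2 * ((Bᵀ * A) *ᵥ u) m := by
    simp only [hs', Matrix.mulVec, dotProduct, Matrix.mul_apply, Finset.mul_sum,
      Finset.sum_mul, Matrix.transpose_apply]
    rw [Finset.sum_comm]
    exact Finset.sum_congr rfl fun n _ => Finset.sum_congr rfl fun k _ => by ring
  have f2 : I * ∑ n, A n m * (-I * (h : ℂ) * ((∑ k, s * A⁻¹ k n * w k) -
      ∑ k, s / 2 * B n k * u k)) =
      h * s * ((Aᵀ * A⁻¹ᵀ) *ᵥ w) m - h * s / 2 * ((Aᵀ * B) *ᵥ u) m := by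
    simp only [Matrix.mulVec, dotProduct, Matrix.mul_apply, Finset.mul_sum, mul_sub,
      Finset.sum_mul, Finset.sum_sub_distrib, Matrix.transpose_apply]
    congr 1
    · rw [Finset.sum_comm]
      refine Finset.sum_congr rfl fun n _ => Finset.sum_congr rfl fun k _ => ?_
      linear_combination (-(A k m) * h * s * A⁻¹ n k * w n) * I_mul_I
    · rw [Finset.sum_comm]
      refine Finset.sum_congr rfl fun n _ => Finset.sum_congr rfl fun k _ => ?_
      linear_combination (-(A k m) * h * s / 2 * B k n * u n) * I_mul_I
  rw [f1, f2, one_div_sqrt_two_mul hh, ← hs, hAB.symm, hAB.transpose_mul_inv, Matrix.one_mulVec]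
  have hs3 : s / 2 * (h * s) = 1 := by
    rw [div_mul_eq_mul_div, mul_comm (h : ℂ), ← mul_assoc, hs2]; field_simp
  change _ = w m
  linear_combination w m * hs3

variable (hAB : IsSymplecticPair A B) (r : ℂ) {h : ℝ} (hh : 0 < h) (a η : RSpace d)

theorem continuous_polyPacket (A B : Matrix (Fin d) (Fin d) ℂ) (r : ℂ) (h : ℝ) (a η : RSpace d)
    (P : MvPolynomial (Fin d) ℂ) : Continuous (polyPacket A B r h a η P) :=
  (contDiff_polyPacket (n := 0) A B r h a η P).continuous

include hAB hh in
theorem integrable_polyPacket_mul (P Q : MvPolynomial (Fin d) ℂ) :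
    Integrable (fun x => starRingEnd ℂ (polyPacket A B r h a η P x) *
      polyPacket A B r h a η Q x) := by
  refine gaussDecay_mul_integrable
    (continuous_conj.comp (continuous_polyPacket A B r h a η P)).aestronglyMeasurable
    (continuous_polyPacket A B r h a η Q).aestronglyMeasurable ?_
    (gaussDecay_polyPacket hAB r hh a η Q)
  simpa using gaussDecay_polyPacket hAB r hh a η P

theorem partialD_star {f : RSpace d → ℂ} (hf : Differentiable ℝ f) (k : Fin d) (x : RSpace d) :
    partialD k (fun x => starRingEnd ℂ (f x)) x = starRingEnd ℂ (partialD k f x) := by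
  have := (conjCLE.toContinuousLinearMap.hasFDerivAt.comp x (hf x).hasFDerivAt).fderiv
  unfold partialD
  change fderiv ℝ (conjCLE ∘ f) x _ = _
  erw [this]
  rfl

include hAB hh in
/-- Integration by parts for polynomials times `φ_0`. -/
theorem integral_polyPacket_partialD (P Q : MvPolynomial (Fin d) ℂ) (k : Fin d) :
    ∫ x, starRingEnd ℂ (polyPacket A B r h a η P x) * partialD k (polyPacket A B r h a η Q) x =
      -∫ x, starRingEnd ℂ (partialD k (polyPacket A B r h a η P) x) *
        polyPacket A B r h a η Q x := by
  have hd := fun P => (contDiff_polyPacket (n := 1) A B r h a η P).differentiable one_ne_zero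
  have hst : ∀ x, fderiv ℝ (fun x => starRingEnd ℂ (polyPacket A B r h a η P x)) x
      (EuclideanSpace.single k 1) = starRingEnd ℂ (partialD k (polyPacket A B r h a η P) x) :=
    fun x => partialD_star (hd P) k x
  have := integral_mul_fderiv_eq_neg_fderiv_mul_of_integrable (μ := volume)
    (f := fun x => starRingEnd ℂ (polyPacket A B r h a η P x))
    (g := polyPacket A B r h a η Q) (v := EuclideanSpace.single k 1)
    (by
      simp only [hst, partialD_polyPacket hAB r hh]
      exact integrable_polyPacket_mul hAB r hh a η _ _)
    (by
      change Integrable (fun x => _ * partialD k (polyPacket A B r h a η Q) x) volume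
      simp only [partialD_polyPacket hAB r hh]
      exact integrable_polyPacket_mul hAB r hh a η _ _)
    (integrable_polyPacket_mul hAB r hh a η _ _)
    (fun x _ => conjCLE.differentiable.comp (hd P) x) (fun x _ => hd Q x)
  simp only [hst] at this
  exact this

theorem integral_linear_comb {F G H : RSpace d → ℂ} (hF : Integrable F) (hG : Integrable G)
    (hH : Integrable H) (c₁ c₂ c₃ : ℂ) :
    ∫ x, (c₁ * F x + (c₂ * G x + c₃ * H x)) =
      c₁ * (∫ x, F x) + (c₂ * (∫ x, G x) + c₃ * ∫ x, H x) := by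
  rw [← integral_const_mul, ← integral_const_mul, ← integral_const_mul,
    ← integral_add (hG.const_mul _) (hH.const_mul _)]
  exact integral_add (hF.const_mul _) ((hG.const_mul _).add (hH.const_mul _))

include hAB hh in
/-- Raising and lowering operators are adjoint to each other. -/
theorem integral_polyPacket_raisePoly (P Q : MvPolynomial (Fin d) ℂ) (m : Fin d) :
    ∫ x, starRingEnd ℂ (polyPacket A B r h a η P x) *
        polyPacket A B r h a η (raisePoly (matS A) m Q) x =
      ∫ x, starRingEnd ℂ (polyPacket A B r h a η (pderiv m P) x) * polyPacket A B r h a η Q x := by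
  set f := polyPacket A B r h a η P with hf
  set g := polyPacket A B r h a η Q with hg
  set s : ℂ := ((1 / Real.sqrt (2 * h) : ℝ) : ℂ) with hs
  have hI0 : Integrable (fun x => starRingEnd ℂ (f x) * g x) :=
    integrable_polyPacket_mul hAB r hh a η P Q
  have hIx : ∀ n, Integrable (fun x => ((x n - a n : ℝ) : ℂ) * (starRingEnd ℂ (f x) * g x)) := by
    intro n
    refine (integrable_polyPacket_mul hAB r hh a η P
      (∑ m, C ((Real.sqrt (h / 2) : ℂ) * A n m) * (X m * Q))).congr
      (Eventually.of_forall fun x => ?_)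
    simp only [← coord_mul_polyPacket hAB r hh]
    ring
  have hI1 : ∀ n, Integrable (fun x => starRingEnd ℂ (f x) * partialD n g x) := by
    intro n
    rw [hg, partialD_polyPacket hAB r hh]
    exact integrable_polyPacket_mul hAB r hh a η _ _
  have hI2 : ∀ n, Integrable (fun x => starRingEnd ℂ (partialD n f x) * g x) := by
    intro n
    rw [hf, partialD_polyPacket hAB r hh]
    exact integrable_polyPacket_mul hAB r hh a η _ _
  have hL : ∀ x, starRingEnd ℂ (f x) * polyPacket A B r h a η (raisePoly (matS A) m Q) x =
      ∑ n, (s * starRingEnd ℂ (B n m) * (((x n - a n : ℝ) : ℂ) * (starRingEnd ℂ (f x) * g x)) +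
        (-(s * starRingEnd ℂ (A n m) * h) * (starRingEnd ℂ (f x) * partialD n g x) +
          (I * s * starRingEnd ℂ (A n m) * η n) * (starRingEnd ℂ (f x) * g x))) := by
    intro x
    rw [← raising_polyPacket hAB r hh, raising, ← hs, ← hg, Finset.mul_sum, mul_sub, mul_sub,
      Finset.mul_sum, Finset.mul_sum, Finset.mul_sum, Finset.mul_sum,
      ← Finset.sum_sub_distrib]
    refine Finset.sum_congr rfl fun n _ => ?_
    linear_combination (s * starRingEnd ℂ (f x) * starRingEnd ℂ (A n m) * h * partialD n g x) *
      I_mul_I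
  have hR : ∀ x, starRingEnd ℂ (polyPacket A B r h a η (pderiv m P) x) * g x =
      ∑ n, (s * starRingEnd ℂ (B n m) * (((x n - a n : ℝ) : ℂ) * (starRingEnd ℂ (f x) * g x)) +
        ((s * starRingEnd ℂ (A n m) * h) * (starRingEnd ℂ (partialD n f x) * g x) +
          (I * s * starRingEnd ℂ (A n m) * η n) * (starRingEnd ℂ (f x) * g x))) := by
    intro x
    rw [← lowering_polyPacket hAB r hh, ← hs, ← hf]
    simp only [map_mul, map_add, map_sub, map_sum, map_neg, conj_I, conj_ofReal]
    rw [show starRingEnd ℂ s = s from conj_ofReal _, Finset.mul_sum, ← Finset.sum_add_distrib,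
      Finset.mul_sum, Finset.sum_mul]
    refine Finset.sum_congr rfl fun n _ => ?_
    linear_combination (-(s * starRingEnd ℂ (partialD n f x) * g x * starRingEnd ℂ (A n m) * h)) *
      I_mul_I
  simp only [hL, hR]
  have hJ1 : ∀ n, Integrable (fun x => s * starRingEnd ℂ (B n m) *
      (((x n - a n : ℝ) : ℂ) * (starRingEnd ℂ (f x) * g x)) +
        (-(s * starRingEnd ℂ (A n m) * h) * (starRingEnd ℂ (f x) * partialD n g x) +
          (I * s * starRingEnd ℂ (A n m) * η n) * (starRingEnd ℂ (f x) * g x))) := fun n =>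
    ((hIx n).const_mul _).add (((hI1 n).const_mul _).add (hI0.const_mul _))
  have hJ2 : ∀ n, Integrable (fun x => s * starRingEnd ℂ (B n m) *
      (((x n - a n : ℝ) : ℂ) * (starRingEnd ℂ (f x) * g x)) +
        ((s * starRingEnd ℂ (A n m) * h) * (starRingEnd ℂ (partialD n f x) * g x) +
          (I * s * starRingEnd ℂ (A n m) * η n) * (starRingEnd ℂ (f x) * g x))) := fun n =>
    ((hIx n).const_mul _).add (((hI2 n).const_mul _).add (hI0.const_mul _))
  rw [integral_finsetSum _ fun n _ => hJ1 n, integral_finsetSum _ fun n _ => hJ2 n]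
  refine Finset.sum_congr rfl fun n _ => ?_
  rw [integral_linear_comb (hIx n) (hI1 n) hI0, integral_linear_comb (hIx n) (hI2 n) hI0, hf, hg,
    integral_polyPacket_partialD hAB r hh a η P Q n]
  ring

/-- The Gaussian integral of a positive definite quadratic form. -/
theorem integral_exp_neg_posDef {G : Matrix (Fin d) (Fin d) ℝ} (hG : G.PosDef) {b : ℝ}
    (hb : 0 < b) :
    ∫ x : RSpace d, Real.exp (-b * ∑ i, ∑ j, x i * G i j * x j) =
      (Real.sqrt G.det)⁻¹ * (Real.pi / b) ^ ((d : ℝ) / 2) := by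
  open scoped MatrixOrder in
  -- Write `G = Rᵀ R` and substitute `y = R x`.
  obtain ⟨R, hR⟩ := CStarAlgebra.nonneg_iff_eq_star_mul_self.mp hG.posSemidef.nonneg
  rw [Matrix.star_eq_conjTranspose, Matrix.conjTranspose_eq_transpose_of_trivial] at hR
  have hdet : G.det = R.det ^ 2 := by rw [hR, Matrix.det_mul, Matrix.det_transpose, sq]
  have hR0 : R.det ≠ 0 := by
    intro h0
    have := hG.det_pos
    rw [hdet, h0] at this
    simp at this
  set f : RSpace d →ₗ[ℝ] RSpace d := Matrix.toEuclideanLin R with hf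
  have hfd : LinearMap.det f = R.det := by
    rw [hf, Matrix.toEuclideanLin_eq_toLin_orthonormal, LinearMap.det_toLin]
  have hq : ∀ x : RSpace d, ∑ i, ∑ j, x i * G i j * x j = ‖f x‖ ^ 2 := by
    intro x
    have e1 : ∀ i, f x i = ∑ j, R i j * x j := fun i => rfl
    have e2 : ∀ i j, G i j = ∑ k, R k i * R k j := fun i j => by
      rw [hR, Matrix.mul_apply]; rfl
    rw [EuclideanSpace.norm_sq_eq]
    simp only [e1, e2, Real.norm_eq_abs, sq_abs]
    simp only [sq, Finset.mul_sum, Finset.sum_mul]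
    rw [Finset.sum_congr rfl fun i _ => Finset.sum_comm, Finset.sum_comm]
    exact Finset.sum_congr rfl fun k _ => Finset.sum_congr rfl fun i _ =>
      Finset.sum_congr rfl fun j _ => by ring
  simp only [hq]
  have hmap := Measure.map_linearMap_addHaar_eq_smul_addHaar (volume : Measure (RSpace d))
    (f := f) (by rw [hfd]; exact hR0)
  have hfc : Continuous f := LinearMap.continuous_of_finiteDimensional f
  have h1 : ∫ x, Real.exp (-b * ‖f x‖ ^ 2) =
      ∫ y, Real.exp (-b * ‖y‖ ^ 2) ∂(Measure.map f volume) :=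
    (integral_map (f := fun y => Real.exp (-b * ‖y‖ ^ 2)) hfc.aemeasurable
      (Continuous.aestronglyMeasurable (by fun_prop))).symm
  rw [h1, hmap, integral_smul_measure, GaussianFourier.integral_rexp_neg_mul_sq_norm hb, hfd, hdet,
    Real.sqrt_sq_eq_abs, ENNReal.toReal_ofReal (abs_nonneg _), abs_inv, smul_eq_mul]
  simp

include hAB in
/-- The modulus of the Gaussian is governed by a real quadratic form: `(A A*)⁻¹ = Re (B A⁻¹)` is a
real positive definite matrix, and `|A⁻¹ y|²` is its quadratic form. -/
theorem posDef_re (hr : r ^ 2 = A.det) :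
    ∃ G : Matrix (Fin d) (Fin d) ℝ, G.PosDef ∧ Real.sqrt G.det = (‖r‖ ^ 2)⁻¹ ∧
      ∀ y : Fin d → ℝ, ∑ m, ‖∑ k, A⁻¹ m k * (y k : ℂ)‖ ^ 2 = ∑ i, ∑ j, y i * G i j * y j := by
  set H := A⁻¹ᴴ * A⁻¹ with hH
  have hreal : ∀ i j, H i j = ((H i j).re : ℂ) := by
    have hconj : Hᴴᵀ = H := by
      have h1 : A⁻¹ᴴᵀ = (Aᴴᵀ)⁻¹ := by
        rw [Matrix.conjTranspose_nonsing_inv, Matrix.transpose_nonsing_inv]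
      have h2 : H = (A * Aᴴ)⁻¹ := by
        rw [Matrix.mul_inv_rev, hH, Matrix.conjTranspose_nonsing_inv]
      rw [h2, Matrix.conjTranspose_nonsing_inv, Matrix.transpose_nonsing_inv,
        Matrix.conjTranspose_mul, Matrix.conjTranspose_conjTranspose, hAB.conj_relations.1,
        Matrix.transpose_mul, ← hAB.conj_relations.1]
      rw [Matrix.transpose_transpose, Matrix.transpose_transpose]
    intro i j
    have := congrFun (congrFun hconj i) j
    rw [Matrix.transpose_apply, Matrix.conjTranspose_apply] at this
    exact (conj_eq_iff_re.1 this).symm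
  set G : Matrix (Fin d) (Fin d) ℝ := Matrix.of fun i j => (H i j).re with hG
  have hGH : G.map (fun y : ℝ => (y : ℂ)) = H := by ext i j; simp [hG, ← hreal]
  have hquad : ∀ y : Fin d → ℝ,
      ∑ m, ‖∑ k, A⁻¹ m k * (y k : ℂ)‖ ^ 2 = ∑ i, ∑ j, y i * G i j * y j := by
    intro y
    set yc : Fin d → ℂ := fun k => (y k : ℂ) with hyc
    have hstar : star yc = yc := by ext k; simp [hyc]
    have h1 : star (A⁻¹ *ᵥ yc) ⬝ᵥ (A⁻¹ *ᵥ yc) = yc ⬝ᵥ (H *ᵥ yc) := by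
      rw [Matrix.star_mulVec, ← Matrix.dotProduct_mulVec, hstar, Matrix.mulVec_mulVec]
    rw [← ofReal_inj]
    calc ((∑ m, ‖∑ k, A⁻¹ m k * (y k : ℂ)‖ ^ 2 : ℝ) : ℂ)
        = star (A⁻¹ *ᵥ yc) ⬝ᵥ (A⁻¹ *ᵥ yc) := by
          simp only [dotProduct, Pi.star_apply]
          push_cast
          exact Finset.sum_congr rfl fun m _ => (Complex.conj_mul' _).symm
      _ = yc ⬝ᵥ (H *ᵥ yc) := h1
      _ = _ := by
          rw [← hGH]
          push_cast
          simp only [dotProduct, Matrix.mulVec, Matrix.map_apply, Finset.mul_sum, hyc, mul_assoc]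
  refine ⟨G, ?_, ?_, hquad⟩
  · refine Matrix.PosDef.of_dotProduct_mulVec_pos ?_ ?_
    · ext i j
      have h1 : Hᴴ = H := by rw [hH]; simp
      have h2 := congrArg re (congrFun (congrFun h1 i) j)
      simpa [hG] using h2
    · intro y hy
      have h1 : star y ⬝ᵥ (G *ᵥ y) = ∑ m, ‖∑ k, A⁻¹ m k * (y k : ℂ)‖ ^ 2 := by
        rw [hquad]
        simp [dotProduct, Matrix.mulVec, Finset.mul_sum, mul_assoc]
      rw [h1]
      refine lt_of_le_of_ne (Finset.sum_nonneg fun _ _ => by positivity) fun h0 => hy ?_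
      have h2 : A⁻¹ *ᵥ (fun k => (y k : ℂ)) = 0 := by
        ext m
        have := (Finset.sum_eq_zero_iff_of_nonneg (fun _ _ => by positivity)).1 h0.symm m
          (Finset.mem_univ m)
        change ∑ k, A⁻¹ m k * (y k : ℂ) = 0
        simpa using this
      have h3 : (fun k => (y k : ℂ)) = 0 := by
        rw [← Matrix.one_mulVec (fun k => (y k : ℂ)), ← hAB.mul_inv, ← Matrix.mulVec_mulVec, h2,
          Matrix.mulVec_zero]
      ext k
      simpa using congrFun h3 k
  · have h1 : ((G.det : ℝ) : ℂ) = (((‖r‖ ^ 2)⁻¹ ^ 2 : ℝ) : ℂ) := by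
      have h2 : ((G.det : ℝ) : ℂ) = H.det := by
        rw [← hGH]
        exact RingHom.map_det ofRealHom G
      rw [h2, hH, Matrix.det_mul, Matrix.det_conjTranspose, Matrix.det_nonsing_inv,
        Ring.inverse_eq_inv', ← hr]
      rw [star_def, Complex.conj_mul', norm_inv, norm_pow]
      push_cast; ring
    rw [ofReal_inj.1 h1, Real.sqrt_sq (by positivity)]

include hAB hh in
/-- The Gaussian wave packet is normalized. -/
theorem integral_gaussianPacket (hr : r ^ 2 = A.det) :
    ∫ x, starRingEnd ℂ (gaussianPacket A B r h a η x) * gaussianPacket A B r h a η x = 1 := by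
  obtain ⟨G, hG, hdet, hquad⟩ := posDef_re hAB r hr
  have hr0 : 0 < ‖r‖ := norm_pos_iff.2 fun h0 => hAB.det_ne_zero (by rw [← hr, h0]; simp)
  set κ : ℝ := (Real.pi ^ (-(d : ℝ) / 4) * h ^ (-(d : ℝ) / 4) * ‖r‖⁻¹) ^ 2 with hκ
  have h1 : ∀ x, starRingEnd ℂ (gaussianPacket A B r h a η x) * gaussianPacket A B r h a η x =
      ((κ * Real.exp (-(1 / h) * ∑ i, ∑ j, (x - a) i * G i j * (x - a) j) : ℝ) : ℂ) := by
    intro x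
    rw [Complex.conj_mul', norm_gaussianPacket hAB r hh, ← ofReal_pow, mul_pow, ← hκ,
      ← Real.exp_nat_mul]
    congr 3
    have h2 : ∑ m, ‖zeta A h a x m‖ ^ 2 = 2 / h * ∑ i, ∑ j, (x - a) i * G i j * (x - a) j := by
      rw [← hquad, Finset.mul_sum]
      refine Finset.sum_congr rfl fun m _ => ?_
      rw [zeta, norm_mul, mul_pow, norm_real, Real.norm_of_nonneg (Real.sqrt_nonneg _),
        Real.sq_sqrt (by positivity)]
      simp
    rw [h2]
    field_simp
    norm_num
    ring
  simp only [h1]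
  have h2 : ∫ x : RSpace d,
      ((κ * Real.exp (-(1 / h) * ∑ i, ∑ j, (x - a) i * G i j * (x - a) j) : ℝ) : ℂ) =
      ((∫ x : RSpace d, κ * Real.exp (-(1 / h) * ∑ i, ∑ j, (x - a) i * G i j * (x - a) j) : ℝ) :
        ℂ) := integral_ofReal
  rw [h2]
  rw [integral_const_mul,
    integral_sub_right_eq_self (fun y : RSpace d =>
      Real.exp (-(1 / h) * ∑ i, ∑ j, y i * G i j * y j)) a,
    integral_exp_neg_posDef hG (by positivity), hdet, hκ, ← ofReal_one, ofReal_inj]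
  have hp : 0 < Real.pi := Real.pi_pos
  rw [div_div_eq_mul_div, div_one, Real.mul_rpow hp.le hh.le, inv_inv, mul_pow, mul_pow]
  have e : ∀ y : ℝ, 0 < y → (y ^ (-(d : ℝ) / 4)) ^ 2 * y ^ ((d : ℝ) / 2) = 1 := by
    intro y hy
    rw [← Real.rpow_natCast, ← Real.rpow_mul hy.le, ← Real.rpow_add hy]
    have : -(d : ℝ) / 4 * ((2 : ℕ) : ℝ) + (d : ℝ) / 2 = 0 := by push_cast; ring
    rw [this, Real.rpow_zero]
  have e1 := e _ hp
  have e2 := e _ hh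
  have e3 : ‖r‖⁻¹ ^ 2 * ‖r‖ ^ 2 = 1 := by
    rw [← mul_pow, inv_mul_cancel₀ hr0.ne', one_pow]
  calc _ = ((Real.pi ^ (-(d : ℝ) / 4)) ^ 2 * Real.pi ^ ((d : ℝ) / 2)) *
        ((h ^ (-(d : ℝ) / 4)) ^ 2 * h ^ ((d : ℝ) / 2)) * (‖r‖⁻¹ ^ 2 * ‖r‖ ^ 2) := by ring
    _ = 1 := by rw [e1, e2, e3]; norm_num

include hAB hh in
/-- By induction on one index: a raising operator moved to the other factor becomes a derivative,
which lowers the other Hermite polynomial. -/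
theorem integral_hermite (hr : r ^ 2 = A.det) (j k : Fin d → ℕ) :
    ∫ x, starRingEnd ℂ (polyPacket A B r h a η (hermitePoly (matS A) j) x) *
      polyPacket A B r h a η (hermitePoly (matS A) k) x =
      if j = k then (multiFactorial j : ℂ) else 0 := by
  have hS := matS_symm hAB
  have hone : ∀ x, polyPacket A B r h a η 1 x = gaussianPacket A B r h a η x := fun x => by
    simp [polyPacket]
  have hzero : ∀ (k : Fin d → ℕ) (m : Fin d),
      ∫ x, starRingEnd ℂ (polyPacket A B r h a η (hermitePoly (matS A) 0) x) *
      polyPacket A B r h a η (hermitePoly (matS A) (k + Pi.single m 1)) x = 0 := by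
    intro k m
    rw [hermitePoly_add_single hS, integral_polyPacket_raisePoly hAB r hh]
    simp [polyPacket]
  induction k using multiIndex_induction generalizing j with
  | zero =>
    induction j using multiIndex_induction with
    | zero =>
      simp only [hermitePoly_zero, hone, if_true]
      rw [integral_gaussianPacket hAB r hh a η hr]
      simp [multiFactorial]
    | add j m _ =>
      rw [if_neg (fun h0 => by simpa using congrFun h0 m)]
      have := congrArg (starRingEnd ℂ) (hzero j m)
      rw [← integral_conj] at this
      simpa [mul_comm] using this
  | add k m ih =>
    rw [hermitePoly_add_single hS, integral_polyPacket_raisePoly hAB r hh, pderiv_hermitePoly hS]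
    have h1 : ∀ x, starRingEnd ℂ (polyPacket A B r h a η (C (j m : ℂ) *
        hermitePoly (matS A) (j - Pi.single m 1)) x) *
        polyPacket A B r h a η (hermitePoly (matS A) k) x =
        (j m : ℂ) * (starRingEnd ℂ (polyPacket A B r h a η
        (hermitePoly (matS A) (j - Pi.single m 1)) x) *
        polyPacket A B r h a η (hermitePoly (matS A) k) x) := by
      intro x
      rw [polyPacket_C_mul, map_mul, Complex.conj_natCast]; ring
    simp only [h1]
    rw [integral_const_mul, ih]
    by_cases hj : j m = 0
    · rw [if_neg (fun h0 : j = _ => by rw [h0] at hj; simp at hj)]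
      simp [hj]
    · by_cases hjk : j = k + Pi.single m 1
      · have : j - Pi.single m 1 = k := by rw [hjk, add_tsub_cancel_right]
        rw [if_pos this, if_pos hjk, this, hjk, multiFactorial_add_single]
        simp
      · rw [if_neg hjk, if_neg fun h0 => hjk (by rw [← h0, sub_single_add hj])]
        simp

include hAB hh in
/-- The wave packets are orthonormal. -/
theorem integral_packet (hr : r ^ 2 = A.det) (j k : Fin d → ℕ) :
    ∫ x, starRingEnd ℂ (packet A B r h a η j x) * packet A B r h a η k x =
      if j = k then 1 else 0 := by
  have h1 : ∀ x, starRingEnd ℂ (packet A B r h a η j x) * packet A B r h a η k x =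
      ((1 / Real.sqrt (multiFactorial j : ℝ) * (1 / Real.sqrt (multiFactorial k : ℝ)) : ℝ) : ℂ) *
      (starRingEnd ℂ (polyPacket A B r h a η (hermitePoly (matS A) j) x) *
      polyPacket A B r h a η (hermitePoly (matS A) k) x) := by
    intro x
    rw [packet_eq_polyPacket hAB r hh, packet_eq_polyPacket hAB r hh, map_mul, conj_ofReal]
    push_cast; ring
  simp only [h1]
  rw [integral_const_mul, integral_hermite hAB r hh a η hr]
  by_cases hjk : j = k
  · subst hjk
    have hp : (0 : ℝ) < multiFactorial j := by exact_mod_cast multiFactorial_pos j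
    have hs := Real.mul_self_sqrt hp.le
    have hs0 := (Real.sqrt_pos.2 hp).ne'
    rw [if_pos rfl, if_pos rfl, ← ofReal_natCast, ← ofReal_mul, ← ofReal_one, ofReal_inj]
    field_simp
    rw [sq, hs]
  · simp [hjk]

end Orthonormal


/-! ### Derivatives of matrix-valued curves -/

section MatrixCalculus

variable {d : ℕ}

/-- Entrywise differentiability of a matrix-valued curve. -/
def HasMatDerivAt (M : ℝ → Matrix (Fin d) (Fin d) ℂ) (M' : Matrix (Fin d) (Fin d) ℂ) (t : ℝ) :
    Prop := ∀ i j, HasDerivAt (fun s => M s i j) (M' i j) t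

variable {M N : ℝ → Matrix (Fin d) (Fin d) ℂ} {M' N' : Matrix (Fin d) (Fin d) ℂ} {t : ℝ}

theorem HasMatDerivAt.mul (hM : HasMatDerivAt M M' t) (hN : HasMatDerivAt N N' t) :
    HasMatDerivAt (fun s => M s * N s) (M' * N t + M t * N') t := by
  intro i j
  have := HasDerivAt.fun_sum (u := Finset.univ) fun k _ => (hM i k).fun_mul (hN k j)
  simp only [Matrix.mul_apply, Matrix.add_apply]
  rwa [Finset.sum_add_distrib] at this

theorem HasMatDerivAt.add (hM : HasMatDerivAt M M' t) (hN : HasMatDerivAt N N' t) :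
    HasMatDerivAt (fun s => M s + N s) (M' + N') t := fun i j => (hM i j).fun_add (hN i j)

theorem HasMatDerivAt.sub (hM : HasMatDerivAt M M' t) (hN : HasMatDerivAt N N' t) :
    HasMatDerivAt (fun s => M s - N s) (M' - N') t := fun i j => (hM i j).fun_sub (hN i j)

theorem HasMatDerivAt.transpose (hM : HasMatDerivAt M M' t) :
    HasMatDerivAt (fun s => (M s)ᵀ) M'ᵀ t := fun i j => hM j i

theorem HasMatDerivAt.conjTranspose (hM : HasMatDerivAt M M' t) :
    HasMatDerivAt (fun s => (M s)ᴴ) M'ᴴ t := fun i j => (hM j i).star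

theorem HasMatDerivAt.unique (hM : HasMatDerivAt M M' t) (hM' : HasMatDerivAt M N' t) :
    M' = N' := by ext i j; exact (hM i j).unique (hM' i j)

/-- Jacobi's formula for the derivative of a determinant. -/
theorem HasMatDerivAt.det (hM : HasMatDerivAt M M' t) :
    HasDerivAt (fun s => (M s).det) ((M t).adjugate * M').trace t := by
  have h1 := HasDerivAt.fun_sum (u := (Finset.univ : Finset (Equiv.Perm (Fin d)))) fun σ _ =>
    (HasDerivAt.fun_finsetProd (u := (Finset.univ : Finset (Fin d)))
      (fun i _ => hM (σ i) i)).const_mul ((Equiv.Perm.sign σ : ℤ) : ℂ)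
  simp only [Matrix.det_apply']
  refine h1.congr_deriv ?_
  have h2 : ∀ i, ((M t).adjugate * M') i i = ((M t).updateCol i (fun k => M' k i)).det := by
    intro i
    rw [← Matrix.cramer_apply, Matrix.cramer_eq_adjugate_mulVec]
    rfl
  rw [Matrix.trace]
  simp only [Matrix.diag_apply, h2, Matrix.det_apply', Finset.mul_sum]
  rw [Finset.sum_comm]
  refine Finset.sum_congr rfl fun i _ => Finset.sum_congr rfl fun σ _ => ?_
  congr 1
  rw [← Finset.mul_prod_erase _ _ (Finset.mem_univ i), smul_eq_mul, mul_comm]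
  congr 1
  · simp
  · exact Finset.prod_congr rfl fun k hk => by
      rw [Matrix.updateCol_ne (Finset.ne_of_mem_erase hk)]

theorem HasMatDerivAt.inv (hM : HasMatDerivAt M M' t) (h0 : ∀ s, (M s).det ≠ 0) :
    HasMatDerivAt (fun s => (M s)⁻¹) (-((M t)⁻¹ * M' * (M t)⁻¹)) t := by
  -- Entries of the inverse are differentiable, as quotients of cofactors by the determinant; the
  -- value of the derivative then follows from `M * M⁻¹ = 1`.
  have hadj : ∀ i j, ∃ c, HasDerivAt (fun s => (M s).adjugate i j) c t := by
    intro i j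
    have : HasMatDerivAt (fun s => (M s).updateRow j (Pi.single i 1)) (M'.updateRow j 0) t := by
      intro p q
      by_cases hp : p = j
      · subst hp
        simpa using hasDerivAt_const t _
      · simpa [Matrix.updateRow_ne hp] using hM p q
    exact ⟨_, by simpa only [Matrix.adjugate_apply] using this.det⟩
  choose c hc using hadj
  have h1 : ∃ N', HasMatDerivAt (fun s => (M s)⁻¹) N' t := by
    refine ⟨Matrix.of fun i j => _, fun i j => ((hM.det.inv (h0 t)).fun_mul
      (hc i j)).congr_of_eventuallyEq (Eventually.of_forall fun s => ?_)⟩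
    simp only [Matrix.inv_def, Ring.inverse_eq_inv']
    rfl
  obtain ⟨N', hN'⟩ := h1
  have h2 := hM.mul hN'
  have h3 : HasMatDerivAt (fun s => M s * (M s)⁻¹) 0 t := by
    have : (fun s => M s * (M s)⁻¹) = fun _ => 1 :=
      funext fun s => Matrix.mul_nonsing_inv _ (h0 s).isUnit
    rw [this]
    exact fun i j => hasDerivAt_const t _
  have h4 := h2.unique h3
  have h5 : N' = -((M t)⁻¹ * M' * (M t)⁻¹) := by
    have h6 := congrArg (fun X => (M t)⁻¹ * X) h4
    simp only [Matrix.mul_add, Matrix.mul_zero, ← Matrix.mul_assoc,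
      Matrix.nonsing_inv_mul _ (h0 t).isUnit, Matrix.one_mul] at h6
    exact eq_neg_of_add_eq_zero_right h6
  rwa [h5] at hN'

/-- A continuous square root of a differentiable nonvanishing function is differentiable. -/
theorem hasDerivAt_of_sq {r D : ℝ → ℂ} {D' : ℂ} {t : ℝ} (hr : Continuous r)
    (hrD : ∀ s, r s ^ 2 = D s) (hD : HasDerivAt D D' t) (h0 : D t ≠ 0) :
    HasDerivAt r (D' / (2 * r t)) t := by
  have hrt : r t ≠ 0 := fun h => h0 (by rw [← hrD, h]; simp)
  rw [hasDerivAt_iff_tendsto_slope] at hD ⊢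
  have h1 : Tendsto (fun s => r s + r t) (𝓝[≠] t) (𝓝 (2 * r t)) := by
    have := (hr.tendsto t).add_const (r t)
    rw [two_mul]
    exact this.mono_left nhdsWithin_le_nhds
  have h2 := hD.div h1 (by simpa using hrt)
  refine h2.congr' ?_
  filter_upwards [h1.eventually_ne (by simpa using hrt : 2 * r t ≠ 0)] with s hs
  simp only [slope, vsub_eq_sub, ← hrD, Pi.div_apply]
  rw [div_eq_iff hs, smul_mul_assoc]
  congr 1
  ring

end MatrixCalculus

/-! ### The classical trajectory -/

section Trajectory

variable {d : ℕ} {V : RSpace d → ℝ} {γ : Trajectory d}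

theorem partialD_contDiff {F : Type} [NormedAddCommGroup F] [NormedSpace ℝ F]
    {f : RSpace d → F} (hf : ContDiff ℝ ∞ f) (i : Fin d) : ContDiff ℝ ∞ (partialD i f) := by
  unfold partialD
  exact (hf.fderiv_right (m := ∞) (by simp)).clm_apply contDiff_const

theorem partialD_comm {F : Type} [NormedAddCommGroup F] [NormedSpace ℝ F]
    {f : RSpace d → F} (hf : ContDiff ℝ ∞ f) (i j : Fin d) :
    partialD i (partialD j f) = partialD j (partialD i f) := by
  have h2 : ContDiff ℝ 2 f := contDiff_infty.1 hf 2
  have hd : Differentiable ℝ (fderiv ℝ f) :=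
    (h2.fderiv_right (m := 1) (by norm_num)).differentiable one_ne_zero
  have key : ∀ i j x, partialD i (partialD j f) x =
      fderiv ℝ (fderiv ℝ f) x (EuclideanSpace.single i 1) (EuclideanSpace.single j 1) := by
    intro i j x
    unfold partialD
    have := ((hd x).hasFDerivAt.clm_apply
      (hasFDerivAt_const (EuclideanSpace.single j (1 : ℝ)) x)).fderiv
    rw [this]
    simp
  ext x
  rw [key, key]
  exact (h2.contDiffAt.isSymmSndFDerivAt (by simp)) _ _

theorem hessian_symm (hV : ContDiff ℝ ∞ V) (x : RSpace d) : (hessian V x)ᵀ = hessian V x := by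
  ext i j
  exact congrFun (partialD_comm hV j i) x

theorem gradient_apply (hV : ContDiff ℝ ∞ V) (x : RSpace d) (k : Fin d) :
    gradient V x k = partialD k V x := by
  have hd : DifferentiableAt ℝ V x := hV.differentiable (by simp) x
  unfold partialD
  have h1 := (hasGradientAt_iff_hasFDerivAt.1 hd.hasGradientAt).fderiv
  rw [h1, InnerProductSpace.toDual_apply_apply, EuclideanSpace.inner_single_right, one_mul,
    conj_trivial]

theorem Trajectory.IsClassical.matA (hγ : γ.IsClassical V) (t : ℝ) :
    HasMatDerivAt γ.A (I • γ.B t) t := fun i j => hγ.deriv_A t i j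

theorem Trajectory.IsClassical.matB (hγ : γ.IsClassical V) (t : ℝ) :
    HasMatDerivAt γ.B (I • ((hessian V (γ.a t)).map (fun y : ℝ => (y : ℂ)) * γ.A t)) t :=
  fun i j => hγ.deriv_B t i j

theorem eq_zero_of_hasMatDerivAt_zero {M : ℝ → Matrix (Fin d) (Fin d) ℂ}
    (hM : ∀ t, HasMatDerivAt M 0 t) (t : ℝ) : M t = M 0 := by
  ext i j
  exact is_const_of_deriv_eq_zero (fun s => (hM s i j).differentiableAt)
    (fun s => (hM s i j).deriv) t 0

/-- The flow linearized along a classical trajectory is symplectic. -/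
theorem Trajectory.IsClassical.pair (hγ : γ.IsClassical V) (hV : ContDiff ℝ ∞ V) (t : ℝ) :
    IsSymplecticPair (γ.A t) (γ.B t) := by
  have hHt : ∀ t, ((hessian V (γ.a t)).map (fun y : ℝ => (y : ℂ)))ᵀ =
      (hessian V (γ.a t)).map (fun y : ℝ => (y : ℂ)) := fun t => by
    rw [← Matrix.transpose_map, hessian_symm hV]
  have hHh : ∀ t, ((hessian V (γ.a t)).map (fun y : ℝ => (y : ℂ)))ᴴ =
      (hessian V (γ.a t)).map (fun y : ℝ => (y : ℂ)) := fun t => by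
    conv_rhs => rw [← hHt]
    ext i j
    simp
  constructor
  · have h1 : ∀ t, HasMatDerivAt (fun s => (γ.A s)ᵀ * γ.B s - (γ.B s)ᵀ * γ.A s) 0 t := by
      intro t
      have := ((hγ.matA t).transpose.mul (hγ.matB t)).sub ((hγ.matB t).transpose.mul (hγ.matA t))
      convert this using 1
      simp only [Matrix.transpose_smul, Matrix.transpose_mul, hHt, Matrix.smul_mul,
        Matrix.mul_smul, Matrix.mul_assoc]
      abel
    have := eq_zero_of_hasMatDerivAt_zero h1 t
    rw [hγ.symm_zero] at this
    exact sub_eq_zero.1 this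
  · have h1 : ∀ t, HasMatDerivAt (fun s => (γ.A s)ᴴ * γ.B s + (γ.B s)ᴴ * γ.A s) 0 t := by
      intro t
      have := ((hγ.matA t).conjTranspose.mul (hγ.matB t)).add
        ((hγ.matB t).conjTranspose.mul (hγ.matA t))
      convert this using 1
      simp only [Matrix.conjTranspose_smul, Matrix.conjTranspose_mul, hHh, Matrix.smul_mul,
        Matrix.mul_smul, Matrix.mul_assoc, star_def, conj_I, neg_smul, Matrix.neg_mul]
      abel
    have := eq_zero_of_hasMatDerivAt_zero h1 t
    rw [hγ.herm_zero] at this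
    exact this

theorem continuous_matrix_entry {M : ℝ → Matrix (Fin d) (Fin d) ℂ}
    {M' : ℝ → Matrix (Fin d) (Fin d) ℂ}
    (hM : ∀ t, HasMatDerivAt M (M' t) t) (i j : Fin d) : Continuous fun t => M t i j :=
  continuous_iff_continuousAt.2 fun t => (hM t i j).continuousAt

theorem eventually_bdd_of_continuous {E : Type*} [SeminormedAddCommGroup E] {f : ℝ → E}
    (hf : Continuous f) (t : ℝ) : ∃ K, 0 ≤ K ∧ ∀ᶠ s in 𝓝 t, ‖f s‖ ≤ K := by
  refine ⟨‖f t‖ + 1, by positivity, ?_⟩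
  have h1 := hf.norm.tendsto t
  exact (h1.eventually (gt_mem_nhds (lt_add_one _))).mono fun s hs => hs.le

theorem eventually_bdd_matrix {M : ℝ → Matrix (Fin d) (Fin d) ℂ}
    {M' : ℝ → Matrix (Fin d) (Fin d) ℂ}
    (hM : ∀ t, HasMatDerivAt M (M' t) t) (t : ℝ) :
    ∃ K, 0 ≤ K ∧ ∀ᶠ s in 𝓝 t, ∀ i j, ‖M s i j‖ ≤ K := by
  choose K hK0 hK using fun p : Fin d × Fin d =>
    eventually_bdd_of_continuous (continuous_matrix_entry hM p.1 p.2) t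
  refine ⟨∑ p, K p, Finset.sum_nonneg fun p _ => hK0 p, ?_⟩
  have := eventually_all.2 hK
  filter_upwards [this] with s hs i j
  exact (hs (i, j)).trans (Finset.single_le_sum (f := K) (fun p _ => hK0 p)
    (Finset.mem_univ (i, j)))

/-- Along a classical trajectory the data of the wave packets are locally bounded. -/
theorem Trajectory.IsClassical.boundedData (hγ : γ.IsClassical V) (hV : ContDiff ℝ ∞ V) {N lam : ℝ}
    (hA : ∀ t, opNorm (γ.A t) ≤ N * Real.exp (lam * |t|)) (t : ℝ) :
    ∃ K, BoundedData (𝓝 t) γ.A γ.B γ.r γ.a γ.η K := by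
  have ca : Continuous γ.a := continuous_iff_continuousAt.2 fun t => (hγ.deriv_a t).continuousAt
  have cη : Continuous γ.η := continuous_iff_continuousAt.2 fun t => (hγ.deriv_η t).continuousAt
  have hdet := fun t => (hγ.pair hV t).det_ne_zero
  have hr0 : ∀ t, γ.r t ≠ 0 := fun t h0 => hdet t (by rw [← hγ.r_sq, h0]; simp)
  have cr : Continuous fun t => (γ.r t)⁻¹ := hγ.continuous_r.inv₀ hr0
  obtain ⟨K1, h1, k1⟩ := eventually_bdd_of_continuous ca t
  obtain ⟨K2, h2, k2⟩ := eventually_bdd_of_continuous cη t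
  obtain ⟨K3, h3, k3⟩ := eventually_bdd_of_continuous cr t
  obtain ⟨K4, h4, k4⟩ := eventually_bdd_matrix hγ.matA t
  obtain ⟨K5, h5, k5⟩ := eventually_bdd_matrix hγ.matB t
  obtain ⟨K6, h6, k6⟩ := eventually_bdd_matrix (fun t => (hγ.matA t).inv hdet) t
  obtain ⟨K7, h7, k7⟩ := eventually_bdd_of_continuous
    (f := fun t => N * Real.exp (lam * |t|)) (by fun_prop) t
  have hK := fun (f : ℝ → ℝ) (k : ℝ) (hk : k ≤ K1 + K2 + K3 + K4 + K5 + K6 + K7)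
    (s : ℝ) (h : f s ≤ k) => h.trans hk
  refine ⟨K1 + K2 + K3 + K4 + K5 + K6 + K7, Eventually.of_forall (hγ.pair hV), ?_, ?_, ?_, ?_, ?_,
    ?_, ?_⟩
  · exact k1.mono fun s hs => by linarith
  · exact k2.mono fun s hs => by linarith
  · refine k7.mono fun s hs => ?_
    have := (hA s).trans ((le_abs_self _).trans hs)
    linarith
  · exact k4.mono fun s hs i j => by linarith [hs i j]
  · exact k5.mono fun s hs i j => by linarith [hs i j]
  · exact k6.mono fun s hs i j => by linarith [hs i j]
  · exact k3.mono fun s hs => by rw [norm_inv] at hs; linarith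

end Trajectory


/-! ### Time evolution of the wave packets -/

section TimeEvolution

open MvPolynomial

variable {d : ℕ}

/-- The infinitesimal generator of the motion of Hermite polynomials when the evaluation point
moves with velocity `v` and the matrix `S` with velocity `S'`. -/
noncomputable def movePoly (v : Fin d → ℂ) (S' : Matrix (Fin d) (Fin d) ℂ)
    (f : MvPolynomial (Fin d) ℂ) : MvPolynomial (Fin d) ℂ :=
  ∑ m, C (v m) * pderiv m f - ∑ m, ∑ n, C (S' m n / 2) * pderiv m (pderiv n f)

/-- The commutator of the generator of the motion with multiplication by a coordinate. -/
theorem movePoly_X_mul {v : Fin d → ℂ} {S' : Matrix (Fin d) (Fin d) ℂ}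
    (hS' : ∀ m n, S' m n = S' n m) (k : Fin d) (f : MvPolynomial (Fin d) ℂ) :
    movePoly v S' (X k * f) = X k * movePoly v S' f + C (v k) * f -
      ∑ n, C (S' k n) * pderiv n f := by
  have h1 : ∀ m, pderiv m (X k * f) = X k * pderiv m f + if k = m then f else 0 := by
    intro m
    simp only [Derivation.leibniz, smul_eq_mul, pderiv_X, Pi.single_apply]
    by_cases h : k = m <;> simp [h]
  have h2 : ∀ m n, pderiv m (pderiv n (X k * f)) = X k * pderiv m (pderiv n f) +
      (if k = m then pderiv n f else 0) + (if k = n then pderiv m f else 0) := by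
    intro m n
    rw [h1 n, map_add]
    have : pderiv m (X k * pderiv n f) =
        X k * pderiv m (pderiv n f) + if k = m then pderiv n f else 0 := by
      simp only [Derivation.leibniz, smul_eq_mul, pderiv_X, Pi.single_apply]
      by_cases h : k = m <;> simp [h]
    rw [this]
    by_cases h : k = n <;> simp [h]
  unfold movePoly
  simp only [h2]
  simp only [h1, mul_add, Finset.sum_add_distrib, mul_ite, mul_zero, Finset.sum_ite_eq,
    Finset.mem_univ, if_true, mul_sub, Finset.mul_sum]
  have e1 : ∑ m, ∑ n, (if k = m then C (S' m n / 2) * pderiv n f else 0) =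
      ∑ n, C (S' k n / 2) * pderiv n f := by
    rw [Finset.sum_comm]
    simp
  have e2 : ∑ n, C (S' k n) * pderiv n f = ∑ n, C (S' k n / 2) * pderiv n f +
      ∑ n, C (S' n k / 2) * pderiv n f := by
    rw [← Finset.sum_add_distrib]
    refine Finset.sum_congr rfl fun n _ => ?_
    rw [hS' n k, ← add_mul, ← C_add, add_halves]
  rw [e1, e2]
  have e3 : ∀ m, C (v m) * (X k * pderiv m f) = X k * (C (v m) * pderiv m f) := fun m => by ring
  have e4 : ∀ m n, C (S' m n / 2) * (X k * pderiv m (pderiv n f)) =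
      X k * (C (S' m n / 2) * pderiv m (pderiv n f)) := fun m n => by ring
  simp only [e3, e4]
  ring

theorem movePoly_sub (v : Fin d → ℂ) (S' : Matrix (Fin d) (Fin d) ℂ)
    (f g : MvPolynomial (Fin d) ℂ) : movePoly v S' (f - g) = movePoly v S' f - movePoly v S' g := by
  simp only [movePoly, map_sub, mul_sub, Finset.sum_sub_distrib]
  ring

theorem movePoly_C_mul (v : Fin d → ℂ) (S' : Matrix (Fin d) (Fin d) ℂ) (c : ℂ)
    (f : MvPolynomial (Fin d) ℂ) : movePoly v S' (C c * f) = C c * movePoly v S' f := by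
  have e1 : ∀ m, C (v m) * (C c * pderiv m f) = C c * (C (v m) * pderiv m f) := fun m =>
    mul_left_comm _ _ _
  have e2 : ∀ m n, C (S' m n / 2) * (C c * pderiv m (pderiv n f)) =
      C c * (C (S' m n / 2) * pderiv m (pderiv n f)) := fun m n => mul_left_comm _ _ _
  simp only [movePoly, pderiv_C_mul, e1, e2, mul_sub, Finset.mul_sum]

theorem movePoly_sum {ι : Type*} (v : Fin d → ℂ) (S' : Matrix (Fin d) (Fin d) ℂ)
    (s : Finset ι) (f : ι → MvPolynomial (Fin d) ℂ) :
    movePoly v S' (∑ i ∈ s, f i) = ∑ i ∈ s, movePoly v S' (f i) := by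
  classical
  induction s using Finset.induction_on with
  | empty => simp [movePoly]
  | insert a s ha ih =>
    have := movePoly_sub v S' (f a) (-∑ i ∈ s, f i)
    have h2 := movePoly_C_mul v S' (-1) (∑ i ∈ s, f i)
    simp only [map_neg, map_one, neg_mul, one_mul] at h2
    rw [sub_neg_eq_add, h2, sub_neg_eq_add, ih] at this
    rw [Finset.sum_insert ha, Finset.sum_insert ha, this]

/-- The derivative in time of Hermite polynomials at a moving point. It is obtained from the
three-term recursion, so that no mixed derivatives occur. -/
theorem hasDerivAt_hermitePoly {S : ℝ → Matrix (Fin d) (Fin d) ℂ} {S' : Matrix (Fin d) (Fin d) ℂ}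
    {z : ℝ → Fin d → ℂ} {v : Fin d → ℂ} {t : ℝ} (hsymm : ∀ s m n, S s m n = S s n m)
    (hS : HasMatDerivAt S S' t) (hz : ∀ m, HasDerivAt (fun s => z s m) (v m) t)
    (j : Fin d → ℕ) :
    HasDerivAt (fun s => eval (z s) (hermitePoly (S s) j))
      (eval (z t) (movePoly v S' (hermitePoly (S t) j))) t := by
  have hS' : ∀ m n, S' m n = S' n m := by
    intro m n
    have h1 := hS n m
    simp only [hsymm _ n m] at h1
    exact (hS m n).unique h1
  induction hn : order j using Nat.strong_induction_on generalizing j with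
  | _ n ih =>
    by_cases hj : j = 0
    · subst hj
      simpa [movePoly] using hasDerivAt_const t (1 : ℂ)
    obtain ⟨m, hm⟩ : ∃ m, j m ≠ 0 := by
      by_contra! hc
      exact hj (funext hc)
    set j' := j - Pi.single m 1 with hj'
    have ho : order j' + 1 = order j := order_sub_single hm
    have hjj : j = j' + Pi.single m 1 := (sub_single_add hm).symm
    have h1 := (hz m).fun_mul (ih (order j') (by omega) j' rfl)
    have h2 : ∀ n, HasDerivAt (fun s => (j' n : ℂ) *
        eval (z s) (hermitePoly (S s) (j' - Pi.single n 1)))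
        ((j' n : ℂ) * eval (z t) (movePoly v S' (hermitePoly (S t) (j' - Pi.single n 1)))) t := by
      intro n
      by_cases hn' : j' n = 0
      · simpa [hn'] using hasDerivAt_const t (0 : ℂ)
      · have := order_sub_single hn'
        exact (ih _ (by omega) (j' - Pi.single n 1) rfl).const_mul _
    have h3 := h1.fun_sub (HasDerivAt.fun_sum (u := Finset.univ) fun n _ => (hS m n).fun_mul (h2 n))
    rw [hjj]
    simp only [fun s => hermitePoly_recursion (hsymm s) j' m, map_sub, map_mul, map_sum, eval_C,
      eval_X]
    refine h3.congr_deriv ?_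
    rw [movePoly_sub, movePoly_X_mul hS', movePoly_sum]
    simp only [movePoly_C_mul, map_sub, map_add, map_mul, map_sum, eval_C, eval_X,
      pderiv_hermitePoly (hsymm t), Finset.sum_add_distrib]
    ring

/-- The second derivative of a polynomial times `φ_0`. -/
theorem gradPoly_gradPoly (A B : Matrix (Fin d) (Fin d) ℂ) (h : ℝ) (η : RSpace d) (k : Fin d)
    (P : MvPolynomial (Fin d) ℂ) (w : MvPolynomial (Fin d) ℂ)
    (hw : w = C (I * η k / h) - ∑ m, C ((Real.sqrt (2 / h) : ℂ) / 2 * B k m) * X m) :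
    gradPoly A B h η k (gradPoly A B h η k P) =
      (∑ m, ∑ n, C ((Real.sqrt (2 / h) : ℂ) ^ 2 * (A⁻¹ m k * A⁻¹ n k)) * pderiv m (pderiv n P)) +
        2 * w * (∑ m, C ((Real.sqrt (2 / h) : ℂ) * A⁻¹ m k) * pderiv m P) +
        (w ^ 2 - C ((Real.sqrt (2 / h) : ℂ) ^ 2 / 2 * (B * A⁻¹) k k)) * P := by
  set s : ℂ := (Real.sqrt (2 / h) : ℂ)
  have hg : ∀ P, gradPoly A B h η k P = (∑ m, C (s * A⁻¹ m k) * pderiv m P) + w * P := by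
    intro P
    rw [gradPoly, hw, sub_mul, Finset.sum_mul]
    simp only [mul_assoc]
    ring
  have hdw : ∀ m, pderiv m w = -C (s / 2 * B k m) := by
    intro m
    rw [hw, map_sub, map_sum, pderiv_C]
    simp [Derivation.leibniz, pderiv_X, Pi.single_apply, mul_ite]
  rw [hg, hg]
  simp only [map_add, map_sum, Derivation.leibniz, smul_eq_mul, pderiv_C, mul_zero, add_zero, hdw,
    mul_add, Finset.sum_add_distrib, Finset.mul_sum]
  have e1 : ∑ m, ∑ n, C (s * A⁻¹ m k) * (C (s * A⁻¹ n k) * pderiv m (pderiv n P)) =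
      ∑ m, ∑ n, C (s ^ 2 * (A⁻¹ m k * A⁻¹ n k)) * pderiv m (pderiv n P) :=
    Finset.sum_congr rfl fun m _ => Finset.sum_congr rfl fun n _ => by
      simp only [C_mul, map_pow]; ring
  have e2 : ∑ m, C (s * A⁻¹ m k) * (P * -C (s / 2 * B k m)) =
      -(C (s ^ 2 / 2 * (B * A⁻¹) k k) * P) := by
    rw [Matrix.mul_apply, Finset.mul_sum, map_sum, Finset.sum_mul, ← Finset.sum_neg_distrib]
    refine Finset.sum_congr rfl fun m _ => ?_
    have : s ^ 2 / 2 * (B k m * A⁻¹ m k) = (s * A⁻¹ m k) * (s / 2 * B k m) := by ring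
    rw [this, map_mul C (s * A⁻¹ m k) (s / 2 * B k m)]; ring
  have e3 : ∑ m, C (s * A⁻¹ m k) * (w * pderiv m P) = ∑ m, w * (C (s * A⁻¹ m k) * pderiv m P) :=
    Finset.sum_congr rfl fun m _ => by ring
  have e4 : ∑ m, 2 * w * (C (s * A⁻¹ m k) * pderiv m P) =
      2 * ∑ m, w * (C (s * A⁻¹ m k) * pderiv m P) := by
    rw [Finset.mul_sum]; exact Finset.sum_congr rfl fun m _ => by ring
  rw [e1, e2, e3, e4]
  ring

/-- The quadratic Taylor polynomial of `V` at `a`. -/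
noncomputable def quadTaylor (V : RSpace d → ℝ) (a x : RSpace d) : ℝ :=
  V a + ∑ k, partialD k V a * (x k - a k) +
    (∑ i, ∑ j, (x i - a i) * hessian V a i j * (x j - a j)) / 2

variable {V : RSpace d → ℝ} {γ : Trajectory d}

theorem hasDerivAt_coord (hγ : γ.IsClassical V) (t : ℝ) (x : RSpace d) (k : Fin d) :
    HasDerivAt (fun s => ((x k - γ.a s k : ℝ) : ℂ)) (-(γ.η t k : ℂ)) t := by
  have h1 : HasDerivAt (fun s => γ.a s k) (γ.η t k) t :=
    (EuclideanSpace.proj (𝕜 := ℝ) k).hasFDerivAt.comp_hasDerivAt t (hγ.deriv_a t)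
  have := (h1.const_sub (x k)).ofReal_comp
  simpa using this

theorem hasDerivAt_momentum (hγ : γ.IsClassical V) (hV : ContDiff ℝ ∞ V) (t : ℝ) (k : Fin d) :
    HasDerivAt (fun s => (γ.η s k : ℂ)) (-((partialD k V (γ.a t) : ℝ) : ℂ)) t := by
  have h1 : HasDerivAt (fun s => γ.η s k) ((-gradient V (γ.a t)) k) t :=
    (EuclideanSpace.proj (𝕜 := ℝ) k).hasFDerivAt.comp_hasDerivAt t (hγ.deriv_η t)
  have := h1.ofReal_comp
  simpa [gradient_apply hV] using this

theorem hasMatDerivAt_C (hγ : γ.IsClassical V) (hV : ContDiff ℝ ∞ V) (t : ℝ) :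
    HasMatDerivAt (fun s => γ.B s * (γ.A s)⁻¹)
      (I • ((hessian V (γ.a t)).map (fun y : ℝ => (y : ℂ)) -
        (γ.B t * (γ.A t)⁻¹) * (γ.B t * (γ.A t)⁻¹))) t := by
  have := (hγ.matB t).mul ((hγ.matA t).inv fun s => (hγ.pair hV s).det_ne_zero)
  convert this using 1
  rw [Matrix.smul_mul, Matrix.mul_assoc _ (γ.A t), (hγ.pair hV t).mul_inv, Matrix.mul_one,
    Matrix.mul_neg, Matrix.mul_smul, Matrix.smul_mul, Matrix.mul_smul, smul_sub, sub_eq_add_neg]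
  simp only [Matrix.mul_assoc]

/-- The symmetric matrix `S = A⁻¹ Ā` of the Hermite polynomials moves along a classical trajectory
with velocity `-2i A⁻¹ A⁻ᵀ`; the potential drops out. -/
theorem hasMatDerivAt_S (hγ : γ.IsClassical V) (hV : ContDiff ℝ ∞ V) (t : ℝ) :
    HasMatDerivAt (fun s => matS (γ.A s)) ((-2 * I) • ((γ.A t)⁻¹ * (γ.A t)⁻¹ᵀ)) t := by
  have hp := hγ.pair hV t
  have := ((hγ.matA t).inv fun s => (hγ.pair hV s).det_ne_zero).mul
    (hγ.matA t).conjTranspose.transpose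
  unfold matS
  convert this using 1
  set A := γ.A t
  set B := γ.B t
  have h1 : (I • B)ᴴᵀ = -(I • Bᴴᵀ) := by
    ext i j; simp
  rw [h1, Matrix.mul_smul, Matrix.smul_mul, Matrix.neg_mul, Matrix.smul_mul, Matrix.mul_neg,
    Matrix.mul_smul]
  have h2 : A⁻¹ * (A * Bᴴ + Aᴴᵀ * Bᵀ) = A⁻¹ * ((2 : ℂ) • 1) := by rw [hp.conj_relations.2]
  have h3 : Bᴴᵀ * Aᵀ + B * Aᴴ = (2 : ℂ) • 1 := by
    have := congrArg Matrix.transpose hp.conj_relations.2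
    simp only [Matrix.transpose_add, Matrix.transpose_mul, Matrix.transpose_transpose,
      Matrix.transpose_smul, Matrix.transpose_one] at this
    exact this
  have h4 : A⁻¹ * B * A⁻¹ * Aᴴᵀ + A⁻¹ * Bᴴᵀ = (2 : ℂ) • (A⁻¹ * A⁻¹ᵀ) := by
    calc A⁻¹ * B * A⁻¹ * Aᴴᵀ + A⁻¹ * Bᴴᵀ
        = A⁻¹ * B * (Aᴴ * A⁻¹ᵀ) + A⁻¹ * (Bᴴᵀ * (Aᵀ * A⁻¹ᵀ)) := by
          rw [hp.symmS, hp.transpose_mul_inv, Matrix.mul_one]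
          simp only [Matrix.mul_assoc]
      _ = A⁻¹ * ((Bᴴᵀ * Aᵀ + B * Aᴴ) * A⁻¹ᵀ) := by
          rw [Matrix.add_mul, Matrix.mul_add, add_comm]
          simp only [Matrix.mul_assoc]
      _ = _ := by rw [h3]; simp
  rw [← neg_add, ← smul_add, h4, smul_smul, ← neg_smul]
  congr 1
  ring

/-- The velocity of the rescaled coordinate `ζ = (2/ℏ)^{1/2} A⁻¹ (x - a)` at a fixed point `x`. -/
theorem hasDerivAt_zeta (hγ : γ.IsClassical V) (hV : ContDiff ℝ ∞ V) (h t : ℝ)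
    (x : RSpace d) (m : Fin d) :
    HasDerivAt (fun s => zeta (γ.A s) h (γ.a s) x m)
      (-I * ∑ k, ((γ.A t)⁻¹ * γ.B t) m k * zeta (γ.A t) h (γ.a t) x k -
        (Real.sqrt (2 / h) : ℂ) * ∑ k, (γ.A t)⁻¹ m k * (γ.η t k : ℂ)) t := by
  have h1 := (HasDerivAt.fun_sum (u := Finset.univ) fun k _ =>
    ((hγ.matA t).inv (fun s => (hγ.pair hV s).det_ne_zero) m k).fun_mul
      (hasDerivAt_coord hγ t x k)).const_mul (Real.sqrt (2 / h) : ℂ)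
  refine h1.congr_deriv ?_
  set y : Fin d → ℂ := fun k => ((x k - γ.a t k : ℝ) : ℂ) with hy
  have hz : zeta (γ.A t) h (γ.a t) x = (Real.sqrt (2 / h) : ℂ) • ((γ.A t)⁻¹ *ᵥ y) := by
    ext m; simp [zeta, Matrix.mulVec, dotProduct, hy]
  have e1 : ∑ k, ((γ.A t)⁻¹ * γ.B t) m k * zeta (γ.A t) h (γ.a t) x k =
      (Real.sqrt (2 / h) : ℂ) * (((γ.A t)⁻¹ * γ.B t * (γ.A t)⁻¹) *ᵥ y) m := by
    have : ∑ k, ((γ.A t)⁻¹ * γ.B t) m k * zeta (γ.A t) h (γ.a t) x k =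
      (((γ.A t)⁻¹ * γ.B t) *ᵥ zeta (γ.A t) h (γ.a t) x) m := rfl
    rw [this, hz, Matrix.mulVec_smul, Matrix.mulVec_mulVec]; rfl
  rw [e1]
  simp only [Finset.sum_add_distrib, Matrix.mul_smul, Matrix.smul_mul, Matrix.neg_apply,
    Matrix.smul_apply, smul_eq_mul, mul_neg, Finset.sum_neg_distrib, Matrix.mulVec, dotProduct]
  have e2 : ∑ k, -(I * ((γ.A t)⁻¹ * γ.B t * (γ.A t)⁻¹) m k) * y k =
      -I * ∑ k, ((γ.A t)⁻¹ * γ.B t * (γ.A t)⁻¹) m k * y k := by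
    rw [Finset.mul_sum]; exact Finset.sum_congr rfl fun k _ => by ring
  change (Real.sqrt (2 / h) : ℂ) * (∑ k, -(I * ((γ.A t)⁻¹ * γ.B t * (γ.A t)⁻¹) m k) * y k +
    -∑ k, (γ.A t)⁻¹ m k * (γ.η t k : ℂ)) = _
  rw [e2]
  ring

end TimeEvolution


section TimeEvolution

open MvPolynomial

variable {d : ℕ} {V : RSpace d → ℝ} {γ : Trajectory d}

/-- The Gaussian `e^{iS/ℏ} φ_0` solves the Schrödinger equation with the quadratic Taylor
approximation of the potential: its logarithmic derivative in time, with
`w_k = ∂_k φ_0 / φ_0 = (i η_k - (B A⁻¹ (x - a))_k) / ℏ`. -/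
theorem hasDerivAt_gaussianPacket (hγ : γ.IsClassical V) (hV : ContDiff ℝ ∞ V) {h : ℝ}
    (hh : 0 < h) (t : ℝ) (x : RSpace d) {w : Fin d → ℂ}
    (hw : ∀ k, w k = (I * γ.η t k -
      ∑ p, (γ.B t * (γ.A t)⁻¹) k p * ((x p - γ.a t p : ℝ) : ℂ)) / h) :
    HasDerivAt (fun s => cexp (I * (γ.S s : ℂ) / h) *
        gaussianPacket (γ.A s) (γ.B s) (γ.r s) h (γ.a s) (γ.η s) x)
      (cexp (I * (γ.S t : ℂ) / h) *
        gaussianPacket (γ.A t) (γ.B t) (γ.r t) h (γ.a t) (γ.η t) x *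
        (I * h / 2 * ∑ k, (w k ^ 2 - (γ.B t * (γ.A t)⁻¹) k k / h) -
          I / h * (quadTaylor V (γ.a t) x : ℂ))) t := by
  have hp := hγ.pair hV t
  have hhne : (h : ℂ) ≠ 0 := by exact_mod_cast hh.ne'
  have hr0 : γ.r t ≠ 0 := fun h0 => hp.det_ne_zero (by rw [← hγ.r_sq, h0]; simp)
  have hr := (hasDerivAt_of_sq hγ.continuous_r hγ.r_sq (hγ.matA t).det hp.det_ne_zero).inv hr0
  have hS := (((hγ.deriv_S t).ofReal_comp.const_mul I).div_const (h : ℂ)).cexp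
  have hy := hasDerivAt_coord hγ t x
  -- Riccati equation: `C = B A⁻¹` has derivative `i (H - C²)`.
  have hC := hasMatDerivAt_C hγ hV t
  have hη : ∀ n, HasDerivAt (fun s => ((γ.η s n * (x n - γ.a s n) : ℝ) : ℂ))
      (-((partialD n V (γ.a t) : ℝ) : ℂ) * ((x n - γ.a t n : ℝ) : ℂ) +
        (γ.η t n : ℂ) * -(γ.η t n : ℂ)) t := by
    intro n
    refine ((hasDerivAt_momentum hγ hV t n).fun_mul (hy n)).congr_of_eventuallyEq
      (Eventually.of_forall fun s => ?_)
    simp only [ofReal_mul]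
  have hE := (((HasDerivAt.fun_sum (u := Finset.univ) fun n _ => HasDerivAt.fun_sum
    (u := Finset.univ) fun p _ =>
      ((hy n).fun_mul (hC n p)).fun_mul (hy p)).fun_neg.div_const (2 * (h : ℂ))).fun_add
    (((HasDerivAt.fun_sum (u := Finset.univ) fun n _ => hη n).const_mul I).div_const
      (h : ℂ))).cexp
  have hfin := hS.fun_mul ((hr.const_mul
    ((Real.pi ^ (-(d : ℝ) / 4) * h ^ (-(d : ℝ) / 4) : ℝ) : ℂ)).fun_mul hE)
  unfold gaussianPacket
  refine hfin.congr_deriv ?_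
  set y : Fin d → ℂ := fun k => ((x k - γ.a t k : ℝ) : ℂ) with hydef
  set Cm := γ.B t * (γ.A t)⁻¹ with hCm
  set H := (hessian V (γ.a t)).map (fun y : ℝ => (y : ℂ)) with hH
  set E := cexp (-(∑ n, ∑ p, ((x n - γ.a t n : ℝ) : ℂ) * Cm n p * ((x p - γ.a t p : ℝ) : ℂ)) /
        (2 * (h : ℂ)) + I * (∑ n, ((γ.η t n * (x n - γ.a t n) : ℝ) : ℂ)) / (h : ℂ)) with hEdef
  set u : Fin d → ℂ := fun k => ∑ p, Cm k p * y p with hu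
  -- Jacobi's formula: the logarithmic derivative of `(det A)^{-1/2}` is `-(i/2) tr (B A⁻¹)`.
  have hdr : -((γ.A t).adjugate * I • γ.B t).trace / (2 * γ.r t) / γ.r t ^ 2 =
      (γ.r t)⁻¹ * (-(I / 2) * Cm.trace) := by
    have h1 : (γ.A t).adjugate = (γ.A t).det • (γ.A t)⁻¹ := by
      rw [Matrix.inv_def, Ring.inverse_eq_inv', smul_smul, mul_inv_cancel₀ hp.det_ne_zero, one_smul]
    rw [h1, Matrix.smul_mul, Matrix.mul_smul, Matrix.trace_smul, Matrix.trace_smul,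
      Matrix.trace_mul_comm, ← hCm, ← hγ.r_sq, smul_eq_mul, smul_eq_mul]
    field_simp
  have hdr' : -(((γ.A t).adjugate * I • γ.B t).trace / (2 * γ.r t)) / γ.r t ^ 2 =
      (γ.r t)⁻¹ * (-(I / 2) * Cm.trace) := by rw [← hdr]; ring
  have hsumE : ∑ n, ∑ p, ((-(γ.η t n : ℂ) * Cm n p + y n * (I • (H - Cm * Cm)) n p) * y p +
      y n * Cm n p * -(γ.η t p : ℂ)) =
      -2 * ∑ k, (γ.η t k : ℂ) * u k + I * (∑ n, ∑ p, y n * H n p * y p - ∑ k, u k ^ 2) := by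
    have hCsy : Cmᵀ = Cm := hp.symmC
    have hsy : ∀ p k, Cm p k = Cm k p := fun p k => congrFun (congrFun hCsy k) p
    have e1 : ∑ n, ∑ p, -(γ.η t n : ℂ) * Cm n p * y p = -∑ k, (γ.η t k : ℂ) * u k := by
      simp only [hu, Finset.mul_sum, ← Finset.sum_neg_distrib]
      exact Finset.sum_congr rfl fun n _ => Finset.sum_congr rfl fun p _ => by ring
    have e2 : ∑ n, ∑ p, y n * Cm n p * -(γ.η t p : ℂ) = -∑ k, (γ.η t k : ℂ) * u k := by
      rw [Finset.sum_comm]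
      simp only [hu, Finset.mul_sum, ← Finset.sum_neg_distrib]
      exact Finset.sum_congr rfl fun n _ => Finset.sum_congr rfl fun p _ => by rw [hsy p n]; ring
    have e3 : ∑ n, ∑ p, y n * (Cm * Cm) n p * y p = ∑ k, u k ^ 2 := by
      simp only [Matrix.mul_apply, Finset.mul_sum, Finset.sum_mul, hu, sq]
      rw [Finset.sum_congr rfl fun n _ => Finset.sum_comm, Finset.sum_comm]
      refine Finset.sum_congr rfl fun k _ => ?_
      rw [Finset.sum_comm]
      exact Finset.sum_congr rfl fun n _ => Finset.sum_congr rfl fun p _ => by rw [hsy p k]; ring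
    have e4 : ∀ n p, (-(γ.η t n : ℂ) * Cm n p + y n * (I • (H - Cm * Cm)) n p) * y p +
        y n * Cm n p * -(γ.η t p : ℂ) = -(γ.η t n : ℂ) * Cm n p * y p +
        I * (y n * H n p * y p) - I * (y n * (Cm * Cm) n p * y p) +
        y n * Cm n p * -(γ.η t p : ℂ) := by
      intro n p
      rw [Matrix.smul_apply, Matrix.sub_apply, smul_eq_mul]; ring
    simp only [e4, Finset.sum_add_distrib, Finset.sum_sub_distrib, ← Finset.mul_sum, e1, e2, e3]
    ring
  have hsumη : ∑ n, (-((partialD n V (γ.a t) : ℝ) : ℂ) * y n + (γ.η t n : ℂ) * -(γ.η t n : ℂ)) =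
      -∑ n, ((partialD n V (γ.a t) : ℝ) : ℂ) * y n - ∑ k, (γ.η t k : ℂ) ^ 2 := by
    rw [Finset.sum_add_distrib, ← Finset.sum_neg_distrib, sub_eq_add_neg, ← Finset.sum_neg_distrib]
    congr 1
    · exact Finset.sum_congr rfl fun n _ => by ring
    · exact Finset.sum_congr rfl fun n _ => by ring
  have hnorm : ((‖γ.η t‖ ^ 2 / 2 - V (γ.a t) : ℝ) : ℂ) =
      (∑ k, (γ.η t k : ℂ) ^ 2) / 2 - (V (γ.a t) : ℂ) := by
    rw [EuclideanSpace.norm_sq_eq]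
    push_cast
    simp only [Real.norm_eq_abs, ← ofReal_pow, sq_abs]
  have hW : (quadTaylor V (γ.a t) x : ℂ) = (V (γ.a t) : ℂ) +
      ∑ n, ((partialD n V (γ.a t) : ℝ) : ℂ) * y n + (∑ n, ∑ p, y n * H n p * y p) / 2 := by
    unfold quadTaylor
    push_cast
    simp only [hydef, hH, Matrix.map_apply]
    push_cast
    rfl
  have hww : ∑ k, (w k ^ 2 - Cm k k / h) =
      (-(∑ k, (γ.η t k : ℂ) ^ 2) - 2 * I * ∑ k, (γ.η t k : ℂ) * u k + ∑ k, u k ^ 2) / h ^ 2 -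
        Cm.trace / h := by
    have e1 : ∀ k, w k ^ 2 - Cm k k / h = (-(γ.η t k : ℂ) ^ 2 - 2 * I * ((γ.η t k : ℂ) * u k) +
        u k ^ 2) / h ^ 2 - Cm k k / h := by
      intro k
      have : w k = (I * γ.η t k - u k) / h := hw k
      rw [this]
      congr 1
      rw [div_pow]
      congr 1
      linear_combination ((γ.η t k : ℂ) ^ 2) * I_sq
    simp only [e1, Finset.sum_sub_distrib, ← Finset.sum_div, Finset.sum_add_distrib,
      ← Finset.mul_sum, Finset.sum_neg_distrib]
    rfl
  rw [hdr', hsumE, hsumη, hnorm, hW, hww]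
  set X1 := ∑ k, (γ.η t k : ℂ) * u k
  set X2 := ∑ n, ∑ p, y n * H n p * y p
  set X3 := ∑ k, u k ^ 2
  set X4 := ∑ k, (γ.η t k : ℂ) ^ 2
  set X5 := ∑ n, ((partialD n V (γ.a t) : ℝ) : ℂ) * y n
  set K := ((Real.pi ^ (-(d : ℝ) / 4) * h ^ (-(d : ℝ) / 4) : ℝ) : ℂ)
  set ES := cexp (I * (γ.S t : ℂ) / h)
  have hI : I * I = -1 := I_mul_I
  have hkey : I * (X4 / 2 - (V (γ.a t) : ℂ)) / h + (-(I / 2) * Cm.trace) +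
      (-(-2 * X1 + I * (X2 - X3)) / (2 * h) + I * (-X5 - X4) / h) =
      I * h / 2 * ((-X4 - 2 * I * X1 + X3) / h ^ 2 - Cm.trace / h) -
        I / h * ((V (γ.a t) : ℂ) + X5 + X2 / 2) := by
    field_simp
    linear_combination (2 * X1) * hI
  rw [← hkey]
  simp only [Pi.inv_apply]
  ring

/-- The wave packets `e^{iS/ℏ} φ_j` solve the Schrödinger equation with the quadratic Taylor
approximation of the potential at the moving centre. -/
theorem hasDerivAt_packet (hγ : γ.IsClassical V) (hV : ContDiff ℝ ∞ V) {h : ℝ}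
    (hh : 0 < h) (t : ℝ) (x : RSpace d) (j : Fin d → ℕ) :
    HasDerivAt (fun s => cexp (I * (γ.S s : ℂ) / h) * γ.packet h s j x)
      (cexp (I * (γ.S t : ℂ) / h) *
        (I * h / 2 * ∑ k, partialD k (partialD k (γ.packet h t j)) x -
          I / h * (quadTaylor V (γ.a t) x : ℂ) * γ.packet h t j x)) t := by
  have hp := hγ.pair hV t
  have hhne : (h : ℂ) ≠ 0 := by exact_mod_cast hh.ne'
  set cj : ℂ := ((1 / Real.sqrt (multiFactorial j : ℝ) : ℝ) : ℂ) with hcj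
  have hpk : ∀ s, γ.packet h s j = fun x => cj * polyPacket (γ.A s) (γ.B s) (γ.r s) h (γ.a s)
      (γ.η s) (hermitePoly (matS (γ.A s)) j) x := fun s => by
    ext x
    exact packet_eq_polyPacket (hγ.pair hV s) _ hh _ _ j x
  have hpartial : ∀ k, partialD k (partialD k (γ.packet h t j)) x = cj *
      polyPacket (γ.A t) (γ.B t) (γ.r t) h (γ.a t) (γ.η t) (gradPoly (γ.A t) (γ.B t) h (γ.η t) k
        (gradPoly (γ.A t) (γ.B t) h (γ.η t) k (hermitePoly (matS (γ.A t)) j))) x := by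
    intro k
    have e : ∀ P, (fun x => cj * polyPacket (γ.A t) (γ.B t) (γ.r t) h (γ.a t) (γ.η t) P x) =
        polyPacket (γ.A t) (γ.B t) (γ.r t) h (γ.a t) (γ.η t) (C cj * P) := fun P => by
      ext x; rw [polyPacket_C_mul]
    have e2 : ∀ P, gradPoly (γ.A t) (γ.B t) h (γ.η t) k (C cj * P) =
        C cj * gradPoly (γ.A t) (γ.B t) h (γ.η t) k P := by
      intro P
      unfold gradPoly
      have f1 : ∀ m, C ((Real.sqrt (2 / h) : ℂ) * (γ.A t)⁻¹ m k) * (C cj * pderiv m P) =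
          C cj * (C ((Real.sqrt (2 / h) : ℂ) * (γ.A t)⁻¹ m k) * pderiv m P) := fun m =>
        mul_left_comm _ _ _
      have f2 : ∀ m, C ((Real.sqrt (2 / h) : ℂ) / 2 * γ.B t k m) * (X m * (C cj * P)) =
          C cj * (C ((Real.sqrt (2 / h) : ℂ) / 2 * γ.B t k m) * (X m * P)) := fun m => by
        rw [mul_left_comm (X m), mul_left_comm]
      simp only [pderiv_C_mul, f1, f2, ← Finset.mul_sum]
      rw [mul_left_comm _ (C cj) P, ← mul_sub, ← mul_add]
    rw [hpk, e, partialD_polyPacket hp _ hh, partialD_polyPacket hp _ hh, e2, e2, polyPacket_C_mul]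
  simp only [hpartial]
  simp only [hpk]
  set z := zeta (γ.A t) h (γ.a t) x with hz
  set s : ℂ := (Real.sqrt (2 / h) : ℂ) with hs
  have hs2 : s ^ 2 = 2 / h := by
    rw [hs, ← ofReal_pow, Real.sq_sqrt (by positivity)]; push_cast; ring
  set w : Fin d → ℂ := fun k => (I * γ.η t k -
      ∑ p, (γ.B t * (γ.A t)⁻¹) k p * ((x p - γ.a t p : ℝ) : ℂ)) / h with hw
  have hG := hasDerivAt_gaussianPacket hγ hV hh t x (w := w) (fun k => rfl)
  set v : Fin d → ℂ := fun m => -I * ∑ k, ((γ.A t)⁻¹ * γ.B t) m k * z k -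
        s * ∑ k, (γ.A t)⁻¹ m k * (γ.η t k : ℂ) with hv
  have hH := hasDerivAt_hermitePoly (fun s => matS_symm (hγ.pair hV s)) (hasMatDerivAt_S hγ hV t)
    (v := v) (fun m => hasDerivAt_zeta hγ hV h t x m) j
  have hfin := ((hH.fun_mul hG).const_mul cj)
  have e0 : (fun s => cexp (I * (γ.S s : ℂ) / h) * (cj * polyPacket (γ.A s) (γ.B s) (γ.r s) h
      (γ.a s) (γ.η s) (hermitePoly (matS (γ.A s)) j) x)) = fun s => cj *
      (eval (zeta (γ.A s) h (γ.a s) x) (hermitePoly (matS (γ.A s)) j) *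
        (cexp (I * (γ.S s : ℂ) / h) *
          gaussianPacket (γ.A s) (γ.B s) (γ.r s) h (γ.a s) (γ.η s) x)) := by
    ext s; unfold polyPacket; ring
  rw [e0]
  refine hfin.congr_deriv ?_
  set P := hermitePoly (matS (γ.A t)) j with hP
  set p0 := eval z P with hp0
  set p1 : Fin d → ℂ := fun m => eval z (pderiv m P) with hp1
  set p2 : Fin d → Fin d → ℂ := fun m n => eval z (pderiv m (pderiv n P)) with hp2
  have hwpoly : ∀ k, eval z (C (I * γ.η t k / h) - ∑ m, C (s / 2 * γ.B t k m) * X m) = w k := by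
    intro k
    simp only [map_sub, map_sum, map_mul, eval_C, eval_X, hw]
    rw [mul_inv_coord_eq_zeta (γ.A t) (γ.B t) hh, sub_div]
    congr 1
    rw [mul_div_right_comm, sqrt_half_div hh, Finset.mul_sum]
    exact Finset.sum_congr rfl fun m _ => by ring
  have hgrad : ∀ k, eval z (gradPoly (γ.A t) (γ.B t) h (γ.η t) k
      (gradPoly (γ.A t) (γ.B t) h (γ.η t) k P)) =
      (∑ m, ∑ n, s ^ 2 * ((γ.A t)⁻¹ m k * (γ.A t)⁻¹ n k) * p2 m n) +
        2 * w k * (∑ m, s * (γ.A t)⁻¹ m k * p1 m) +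
        (w k ^ 2 - (γ.B t * (γ.A t)⁻¹) k k / h) * p0 := by
    intro k
    obtain ⟨wp, hwp⟩ : ∃ wp, wp = C (I * γ.η t k / h) - ∑ m, C (s / 2 * γ.B t k m) * X m :=
      ⟨_, rfl⟩
    have hwk : eval z wp = w k := by rw [hwp, hwpoly k]
    rw [gradPoly_gradPoly (γ.A t) (γ.B t) h (γ.η t) k P wp hwp]
    simp only [map_add, map_sub, map_mul, map_pow, map_sum, eval_C, map_ofNat, hwk]
    have hsb : s ^ 2 / 2 * (γ.B t * (γ.A t)⁻¹) k k = (γ.B t * (γ.A t)⁻¹) k k / h := by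
      rw [hs2]; ring
    rw [← hs, hsb]
  -- The velocity of `ζ` produces exactly the first-order terms of the Laplacian, and the velocity of
  -- `S` (in `hmove`) the second-order terms.
  have hF1 : ∀ m, v m = I * h * ∑ k, w k * (s * (γ.A t)⁻¹ m k) := by
    intro m
    have f1 : ∀ k, w k = (I * γ.η t k - (Real.sqrt (h / 2) : ℂ) * ∑ q, γ.B t k q * z q) / h :=
      fun k => by rw [hw, ← mul_inv_coord_eq_zeta (γ.A t) (γ.B t) hh]
    have f2 : ∑ k, w k * (s * (γ.A t)⁻¹ m k) = (I * s * ∑ k, (γ.A t)⁻¹ m k * (γ.η t k : ℂ) -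
        ∑ k, (γ.A t)⁻¹ m k * ∑ q, γ.B t k q * z q) / h := by
      rw [Finset.mul_sum, ← Finset.sum_sub_distrib, Finset.sum_div]
      refine Finset.sum_congr rfl fun k _ => ?_
      rw [f1]
      have := sqrt_two_div_mul_sqrt hh
      rw [← hs] at this
      rw [div_mul_eq_mul_div]
      congr 1
      linear_combination (-(γ.A t)⁻¹ m k * ∑ q, γ.B t k q * z q) * this
    have f3 : ∑ k, (γ.A t)⁻¹ m k * ∑ q, γ.B t k q * z q =
        ∑ k, ((γ.A t)⁻¹ * γ.B t) m k * z k := by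
      simp only [Matrix.mul_apply, Finset.mul_sum, Finset.sum_mul]
      rw [Finset.sum_comm]
      exact Finset.sum_congr rfl fun k _ => Finset.sum_congr rfl fun q _ => by ring
    rw [f2, f3, hv]
    field_simp
    linear_combination (-s * ∑ k, (γ.A t)⁻¹ m k * (γ.η t k : ℂ)) * I_sq
  have hmove : eval z (movePoly v ((-2 * I) • ((γ.A t)⁻¹ * (γ.A t)⁻¹ᵀ)) P) =
      I * h / 2 * ∑ k, ((∑ m, ∑ n, s ^ 2 * ((γ.A t)⁻¹ m k * (γ.A t)⁻¹ n k) * p2 m n) +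
        2 * w k * (∑ m, s * (γ.A t)⁻¹ m k * p1 m)) := by
    unfold movePoly
    simp only [map_sub, map_sum, map_mul, eval_C]
    rw [Finset.sum_add_distrib, mul_add, add_comm, sub_eq_add_neg]
    have g1 : ∑ m, v m * eval z (pderiv m P) =
        I * h / 2 * ∑ k, 2 * w k * ∑ m, s * (γ.A t)⁻¹ m k * p1 m := by
      simp only [hF1, Finset.mul_sum, Finset.sum_mul]
      rw [Finset.sum_comm]
      exact Finset.sum_congr rfl fun k _ => Finset.sum_congr rfl fun m _ => by ring
    have g2 : -∑ m, ∑ n, ((-2 * I) • ((γ.A t)⁻¹ * (γ.A t)⁻¹ᵀ)) m n / 2 *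
        eval z (pderiv m (pderiv n P)) = I * h / 2 * ∑ k, ∑ m, ∑ n,
          s ^ 2 * ((γ.A t)⁻¹ m k * (γ.A t)⁻¹ n k) * p2 m n := by
      symm
      rw [hs2, Finset.mul_sum, Finset.sum_congr rfl fun k _ => Finset.mul_sum _ _ _,
        Finset.sum_comm, ← Finset.sum_neg_distrib]
      refine Finset.sum_congr rfl fun m _ => ?_
      rw [Finset.sum_congr rfl fun k _ => Finset.mul_sum _ _ _, Finset.sum_comm,
        ← Finset.sum_neg_distrib]
      refine Finset.sum_congr rfl fun n _ => ?_
      rw [Matrix.smul_apply, Matrix.mul_apply, smul_eq_mul, Finset.mul_sum, Finset.sum_div,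
        Finset.sum_mul, ← Finset.sum_neg_distrib]
      refine Finset.sum_congr rfl fun k _ => ?_
      rw [Matrix.transpose_apply]
      field_simp
      rfl
    rw [g1, g2]
  set G := gaussianPacket (γ.A t) (γ.B t) (γ.r t) h (γ.a t) (γ.η t) x
  set ES := cexp (I * (γ.S t : ℂ) / h)
  have hq0 : polyPacket (γ.A t) (γ.B t) (γ.r t) h (γ.a t) (γ.η t) P x = p0 * G := rfl
  have hq : ∀ k, polyPacket (γ.A t) (γ.B t) (γ.r t) h (γ.a t) (γ.η t)
      (gradPoly (γ.A t) (γ.B t) h (γ.η t) k (gradPoly (γ.A t) (γ.B t) h (γ.η t) k P)) x =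
      ((∑ m, ∑ n, s ^ 2 * ((γ.A t)⁻¹ m k * (γ.A t)⁻¹ n k) * p2 m n) +
        2 * w k * (∑ m, s * (γ.A t)⁻¹ m k * p1 m) +
        (w k ^ 2 - (γ.B t * (γ.A t)⁻¹) k k / h) * p0) * G := fun k =>
    congrArg (· * G) (hgrad k)
  simp only [hq, hq0]
  rw [hmove]
  have e1 : ∀ (f g : Fin d → ℂ), ∑ k, cj * ((f k + g k * p0) * G) =
      cj * G * (∑ k, f k + (∑ k, g k) * p0) := by
    intro f g
    rw [Finset.sum_mul, ← Finset.sum_add_distrib, Finset.mul_sum]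
    exact Finset.sum_congr rfl fun k _ => by ring
  rw [e1]
  ring

end TimeEvolution


/-! ### Functions as elements of `L²` -/

section L2

variable {d : ℕ} {f g : RSpace d → ℂ}

open Classical in
/-- The class of a function in `L²(ℝ^d)`, with the value `0` for functions that are not square
integrable. -/
noncomputable def toL2 (f : RSpace d → ℂ) : L2Space d :=
  if hf : MemLp f 2 volume then hf.toLp f else 0

theorem toL2_of_memLp (hf : MemLp f 2 volume) : toL2 f = hf.toLp f := dif_pos hf

theorem coeFn_toL2 (hf : MemLp f 2 volume) : (toL2 f : RSpace d → ℂ) =ᵐ[volume] f := by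
  rw [toL2_of_memLp hf]; exact hf.coeFn_toLp

theorem inner_toL2 (hf : MemLp f 2 volume) (hg : MemLp g 2 volume) :
    inner ℂ (toL2 f) (toL2 g) = ∫ x, starRingEnd ℂ (f x) * g x := by
  rw [L2.inner_def]
  refine integral_congr_ae ?_
  filter_upwards [coeFn_toL2 hf, coeFn_toL2 hg] with x h1 h2
  rw [h1, h2, RCLike.inner_apply, mul_comm]

theorem inner_toL2_right (u : L2Space d) (hg : MemLp g 2 volume) :
    inner ℂ u (toL2 g) = ∫ x, starRingEnd ℂ (u x) * g x := by
  rw [L2.inner_def]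
  refine integral_congr_ae ?_
  filter_upwards [coeFn_toL2 hg] with x h2
  rw [h2, RCLike.inner_apply, mul_comm]

theorem norm_toL2_sq (hf : MemLp f 2 volume) : ‖toL2 f‖ ^ 2 = ∫ x, ‖f x‖ ^ 2 := by
  have h := inner_toL2 hf hf
  rw [inner_self_eq_norm_sq_to_K] at h
  have h2 : ∫ x, starRingEnd ℂ (f x) * f x = ((∫ x, ‖f x‖ ^ 2 : ℝ) : ℂ) := by
    rw [← integral_complex_ofReal]
    refine integral_congr_ae (Eventually.of_forall fun x => ?_)
    simp only [conj_mul']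
    push_cast; rfl
  rw [h2] at h
  apply ofReal_injective
  push_cast
  exact h

theorem toL2_add (hf : MemLp f 2 volume) (hg : MemLp g 2 volume) :
    toL2 (fun x => f x + g x) = toL2 f + toL2 g := by
  rw [toL2_of_memLp hf, toL2_of_memLp hg, ← MemLp.toLp_add hf hg]
  exact toL2_of_memLp (hf.add hg)

theorem toL2_sub (hf : MemLp f 2 volume) (hg : MemLp g 2 volume) :
    toL2 (fun x => f x - g x) = toL2 f - toL2 g := by
  rw [toL2_of_memLp hf, toL2_of_memLp hg, ← MemLp.toLp_sub hf hg]
  exact toL2_of_memLp (hf.sub hg)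

theorem toL2_const_mul (c : ℂ) (hf : MemLp f 2 volume) :
    toL2 (fun x => c * f x) = c • toL2 f := by
  rw [toL2_of_memLp hf, ← MemLp.toLp_const_smul c hf]
  exact toL2_of_memLp (hf.const_mul c)

theorem memLp_sum {κ : Type*} (s : Finset κ) {F : κ → RSpace d → ℂ}
    (hF : ∀ k ∈ s, MemLp (F k) 2 volume) : MemLp (fun x => ∑ k ∈ s, F k x) 2 volume :=
  memLp_finsetSum s hF

theorem toL2_sum {κ : Type*} (s : Finset κ) {F : κ → RSpace d → ℂ}
    (hF : ∀ k ∈ s, MemLp (F k) 2 volume) :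
    toL2 (fun x => ∑ k ∈ s, F k x) = ∑ k ∈ s, toL2 (F k) := by
  classical
  induction s using Finset.induction_on with
  | empty =>
    have : MemLp (fun _ : RSpace d => (0 : ℂ)) 2 volume := MemLp.zero'
    simp only [Finset.sum_empty]
    rw [toL2_of_memLp this]
    exact MemLp.toLp_zero this
  | insert a s ha ih =>
    have h2 : ∀ k ∈ s, MemLp (F k) 2 volume := fun k hk => hF k (Finset.mem_insert_of_mem hk)
    simp only [Finset.sum_insert ha]
    rw [toL2_add (hF a (Finset.mem_insert_self _ _)) (memLp_sum s h2), ih h2]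

/-- Differentiation in `L²` of a family of functions whose pointwise derivatives are locally
dominated by a Gaussian. -/
theorem hasDerivAt_toL2 {F F' : ℝ → RSpace d → ℂ} {t : ℝ}
    (hF : ∀ s, MemLp (F s) 2 volume) (hF' : AEStronglyMeasurable (F' t) volume)
    (hder : ∀ s x, HasDerivAt (fun s => F s x) (F' s x) s) (hdec : GaussDecay (𝓝 t) F') :
    HasDerivAt (fun s => toL2 (F s)) (toL2 (F' t)) t := by
  obtain ⟨C, c, hC, hc, hb⟩ := hdec.exists_nonneg
  have hF't : MemLp (F' t) 2 volume := memLp_of_gaussDecay hF' hc hb.self_of_nhds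
  obtain ⟨ε, hε, hball⟩ := Metric.eventually_nhds_iff_ball.1 hb
  set G : ℝ → RSpace d → ℂ := fun s x => F s x - F t x - ((s - t : ℝ) : ℂ) * F' t x with hG
  have hGm : ∀ s, MemLp (G s) 2 volume := fun s =>
    ((hF s).sub (hF t)).sub (hF't.const_mul _)
  have hGeq : ∀ s, toL2 (F s) - toL2 (F t) - (s - t) • toL2 (F' t) = toL2 (G s) := by
    intro s
    have e1 : toL2 (G s) = toL2 (fun x => F s x - F t x) -
        toL2 (fun x => ((s - t : ℝ) : ℂ) * F' t x) :=
      toL2_sub ((hF s).sub (hF t)) (hF't.const_mul _)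
    rw [e1, toL2_const_mul _ hF't, toL2_sub (hF s) (hF t)]
    rfl
  have hGb : ∀ s ∈ Metric.ball t ε, ∀ x,
      ‖G s x‖ ≤ 2 * (C * Real.exp (-c * ‖x‖ ^ 2)) * |s - t| := by
    intro s hs x
    have h1 := (convex_ball t ε).norm_image_sub_le_of_norm_hasDerivWithin_le
      (f := fun s => F s x) (f' := fun s => F' s x) (C := C * Real.exp (-c * ‖x‖ ^ 2))
      (fun y _ => (hder y x).hasDerivWithinAt) (fun y hy => hball y hy x)
      (Metric.mem_ball_self hε) hs
    have h2 : ‖((s - t : ℝ) : ℂ) * F' t x‖ ≤ |s - t| * (C * Real.exp (-c * ‖x‖ ^ 2)) := by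
      rw [norm_mul, norm_real, Real.norm_eq_abs]
      gcongr
      exact hball t (Metric.mem_ball_self hε) x
    rw [Real.norm_eq_abs] at h1
    calc ‖G s x‖ ≤ ‖F s x - F t x‖ + ‖((s - t : ℝ) : ℂ) * F' t x‖ := norm_sub_le _ _
      _ ≤ _ := by linarith
  rw [hasDerivAt_iff_tendsto]
  -- Dominated convergence for the squared difference quotients.
  have hsq : Tendsto (fun s => ∫ x, (‖s - t‖⁻¹ * ‖G s x‖) ^ 2) (𝓝 t) (𝓝 0) := by
    have h0 : ∫ _x : RSpace d, (0 : ℝ) = 0 := by simp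
    rw [← h0]
    refine tendsto_integral_filter_of_dominated_convergence
      (fun x => (2 * C) ^ 2 * Real.exp (-(2 * c) * ‖x‖ ^ 2)) ?_ ?_ ?_ ?_
    · exact Eventually.of_forall fun s => ((hGm s).1.norm.const_mul _).pow 2
    · filter_upwards [Metric.ball_mem_nhds t hε] with s hs
      refine Eventually.of_forall fun x => ?_
      rw [Real.norm_eq_abs, abs_of_nonneg (by positivity)]
      have h1 : ‖s - t‖⁻¹ * ‖G s x‖ ≤ 2 * (C * Real.exp (-c * ‖x‖ ^ 2)) := by
        by_cases h : s = t
        · rw [h]; simp; positivity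
        · have hp : 0 < |s - t| := abs_pos.2 (sub_ne_zero.2 h)
          rw [Real.norm_eq_abs, inv_mul_le_iff₀ hp, mul_comm]
          exact hGb s hs x
      refine (pow_le_pow_left₀ (by positivity) h1 2).trans (le_of_eq ?_)
      rw [mul_pow, mul_pow, ← Real.exp_nat_mul, mul_pow]
      push_cast
      ring_nf
    · exact (integrable_gaussian (by positivity)).const_mul _
    · refine Eventually.of_forall fun x => ?_
      have := ((hasDerivAt_iff_tendsto.1 (hder t x))).pow 2
      simpa [G] using this
  have hsqrt := hsq.sqrt
  rw [Real.sqrt_zero] at hsqrt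
  refine hsqrt.congr fun s => ?_
  rw [hGeq, ← Real.sqrt_sq (by positivity : 0 ≤ ‖s - t‖⁻¹ * ‖toL2 (G s)‖), mul_pow,
    norm_toL2_sq (hGm s), ← integral_const_mul]
  simp only [mul_pow]

end L2

/-! ### Regularity of the moving wave packets in `L²` -/

section Regularity

variable {d : ℕ} {V : RSpace d → ℝ} {γ : Trajectory d} {h : ℝ}

theorem packet_eq (hγ : γ.IsClassical V) (hV : ContDiff ℝ ∞ V) (hh : 0 < h) (t : ℝ)
    (j : Fin d → ℕ) : ∃ P : MvPolynomial (Fin d) ℂ, γ.packet h t j =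
      polyPacket (γ.A t) (γ.B t) (γ.r t) h (γ.a t) (γ.η t) P :=
  ⟨MvPolynomial.C ((1 / Real.sqrt (multiFactorial j : ℝ) : ℝ) : ℂ) * hermitePoly (matS (γ.A t)) j, by
    ext x
    rw [polyPacket_C_mul]
    exact packet_eq_polyPacket (hγ.pair hV t) _ hh _ _ j x⟩

theorem contDiff_packet (hγ : γ.IsClassical V) (hV : ContDiff ℝ ∞ V) (hh : 0 < h) (t : ℝ)
    (j : Fin d → ℕ) {n : WithTop ℕ∞} : ContDiff ℝ n (γ.packet h t j) := by
  obtain ⟨P, hP⟩ := packet_eq hγ hV hh t j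
  rw [hP]
  exact contDiff_polyPacket _ _ _ _ _ _ P

section Decay

variable {N lam : ℝ} (hγ : γ.IsClassical V) (hV : ContDiff ℝ ∞ V)
  (hA : ∀ t, opNorm (γ.A t) ≤ N * Real.exp (lam * |t|)) (hh : 0 < h)
include hγ hV hA hh

theorem gaussDecay_packet (t : ℝ) (j : Fin d → ℕ) :
    GaussDecay (𝓝 t) (fun s => γ.packet h s j) := by
  obtain ⟨K, hK⟩ := hγ.boundedData hV hA t
  exact hK.packet hh j

theorem gaussDecay_partialD_partialD_packet (t : ℝ) (j : Fin d → ℕ) (k : Fin d) :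
    GaussDecay (𝓝 t) (fun s => partialD k (partialD k (γ.packet h s j))) := by
  obtain ⟨K, hK⟩ := hγ.boundedData hV hA t
  have hP : BddPoly (𝓝 t) (fun s => MvPolynomial.C ((1 / Real.sqrt (multiFactorial j : ℝ) : ℝ) : ℂ) *
      hermitePoly (matS (γ.A s)) j) := (hK.hermite j).C_mul (Eventually.of_forall fun _ => le_rfl)
  refine (hK.polyPacket hh (hK.gradPoly (h := h) k (hK.gradPoly (h := h) k hP))).congr'
    (Eventually.of_forall fun s x => ?_)
  have e : γ.packet h s j = polyPacket (γ.A s) (γ.B s) (γ.r s) h (γ.a s) (γ.η s)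
      (MvPolynomial.C ((1 / Real.sqrt (multiFactorial j : ℝ) : ℝ) : ℂ) *
        hermitePoly (matS (γ.A s)) j) := by
    ext x
    rw [polyPacket_C_mul]
    exact packet_eq_polyPacket (hγ.pair hV s) _ hh _ _ j x
  rw [e, partialD_polyPacket (hγ.pair hV s) _ hh, partialD_polyPacket (hγ.pair hV s) _ hh]

theorem memLp_packet (t : ℝ) (j : Fin d → ℕ) : MemLp (γ.packet h t j) 2 volume := by
  obtain ⟨C, c, hc, hb⟩ := (gaussDecay_packet hγ hV hA hh t j).self
  exact memLp_of_gaussDecay (contDiff_packet hγ hV hh t j (n := 0)).continuous.aestronglyMeasurable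
    hc hb

omit hA hh in
theorem gaussDecay_quadTaylor_mul {F : ℝ → RSpace d → ℂ} {t : ℝ} (hF : GaussDecay (𝓝 t) F) :
    GaussDecay (𝓝 t) (fun s x => (quadTaylor V (γ.a s) x : ℂ) * F s x) := by
  have ca : Continuous γ.a := continuous_iff_continuousAt.2 fun t => (hγ.deriv_a t).continuousAt
  have hb : ∀ f : RSpace d → ℝ, Continuous f → ∃ K, ∀ᶠ s in 𝓝 t, ‖((f (γ.a s) : ℝ) : ℂ)‖ ≤ K := by
    intro f hf
    obtain ⟨K, -, hK⟩ := eventually_bdd_of_continuous (hf.comp ca) t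
    exact ⟨K, hK.mono fun s hs => by simpa using hs⟩
  obtain ⟨Ka, -, hKa⟩ := eventually_bdd_of_continuous ca t
  obtain ⟨K0, hK0⟩ := hb V hV.continuous
  choose K1 hK1 using fun k => hb (partialD k V) (partialD_contDiff hV k).continuous
  choose K2 hK2 using fun i j => hb (partialD i (partialD j V))
    (partialD_contDiff (partialD_contDiff hV j) i).continuous
  refine (((hF.bdd_mul hK0).add (GaussDecay.sum Finset.univ fun k _ =>
    (hF.coord_sub_mul hKa k).bdd_mul (hK1 k))).add ((GaussDecay.sum Finset.univ fun i _ =>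
      GaussDecay.sum Finset.univ fun j _ => (((hF.coord_sub_mul hKa j).coord_sub_mul hKa i).bdd_mul
        (hK2 i j))).const_mul (1 / 2))).congr' (Eventually.of_forall fun s x => ?_)
  unfold quadTaylor
  push_cast
  rw [add_mul, add_mul, Finset.sum_mul, div_mul_eq_mul_div, one_mul, div_mul_eq_mul_div]
  congr 1
  · congr 1
    exact Finset.sum_congr rfl fun k _ => by ring
  · congr 1
    rw [Finset.sum_mul]
    simp only [Finset.sum_mul]
    refine Finset.sum_congr rfl fun i _ => Finset.sum_congr rfl fun j _ => ?_
    simp only [hessian, Matrix.of_apply]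
    ring

/-- The time derivative of `e^{iS/ℏ} φ_j` as an element of `L²`. -/
theorem hasDerivAt_toL2_packet (t : ℝ) (j : Fin d → ℕ) :
    HasDerivAt (fun s => toL2 (fun x => cexp (I * (γ.S s : ℂ) / h) * γ.packet h s j x))
      (toL2 (fun x => cexp (I * (γ.S t : ℂ) / h) *
        (I * h / 2 * ∑ k, partialD k (partialD k (γ.packet h t j)) x -
          I / h * (quadTaylor V (γ.a t) x : ℂ) * γ.packet h t j x))) t := by
  have hE : ∀ᶠ s in 𝓝 t, ‖cexp (I * (γ.S s : ℂ) / h)‖ ≤ 1 := Eventually.of_forall fun s => by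
    rw [show I * (γ.S s : ℂ) / h = ((γ.S s / h : ℝ) : ℂ) * I by push_cast; ring,
      norm_exp_ofReal_mul_I]
  have hcd : ∀ k, ContDiff ℝ ∞ (partialD k (partialD k (γ.packet h t j))) := fun k =>
    partialD_contDiff (partialD_contDiff (contDiff_packet hγ hV hh t j) k) k
  refine hasDerivAt_toL2 (F := fun s x => cexp (I * (γ.S s : ℂ) / h) * γ.packet h s j x)
    (F' := fun s x => cexp (I * (γ.S s : ℂ) / h) *
        (I * h / 2 * ∑ k, partialD k (partialD k (γ.packet h s j)) x -
          I / h * (quadTaylor V (γ.a s) x : ℂ) * γ.packet h s j x))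
    (fun s => (memLp_packet hγ hV hA hh s j).const_mul _) ?_
    (fun s x => hasDerivAt_packet hγ hV hh s x j) ?_
  · refine Continuous.aestronglyMeasurable ?_
    have h1 : Continuous fun x => (quadTaylor V (γ.a t) x : ℂ) := by
      unfold quadTaylor
      fun_prop
    have h2 : Continuous (γ.packet h t j) := (contDiff_packet hγ hV hh t j (n := 0)).continuous
    have h3 : ∀ k, Continuous (partialD k (partialD k (γ.packet h t j))) := fun k =>
      (hcd k).continuous
    fun_prop
  · refine (((GaussDecay.sum Finset.univ fun k _ =>
      gaussDecay_partialD_partialD_packet hγ hV hA hh t j k).const_mul (I * h / 2)).sub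
      ((gaussDecay_quadTaylor_mul hγ hV (gaussDecay_packet hγ hV hA hh t j)).const_mul
        (I / h))).bdd_mul hE |>.congr' (Eventually.of_forall fun s x => ?_)
    ring

end Decay

end Regularity


/-! ### Multiplication by coordinates in the basis of wave packets -/

section Indices

variable {d : ℕ}

theorem sum_indicesUpTo_of_le {E : Type*} [AddCommMonoid E] {n n' : ℕ} (hn : n ≤ n')
    {F : (Fin d → ℕ) → E} (hF : ∀ j, n < order j → F j = 0) :
    ∑ j ∈ indicesUpTo d n, F j = ∑ j ∈ indicesUpTo d n', F j := by
  refine Finset.sum_subset (fun j hj => ?_) fun j _ hj => hF j ?_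
  · rw [mem_indicesUpTo] at hj ⊢; omega
  · rw [mem_indicesUpTo] at hj; omega

theorem sum_indicesUpTo_succ {E : Type*} [AddCommMonoid E] (m : Fin d) (n : ℕ)
    {F : (Fin d → ℕ) → E} (hF : ∀ j, j m = 0 → F j = 0) :
    ∑ j ∈ indicesUpTo d (n + 1), F j = ∑ k ∈ indicesUpTo d n, F (k + Pi.single m 1) := by
  symm
  refine Finset.sum_of_injOn (fun k => k + Pi.single m 1) (fun j _ k _ hjk => ?_)
    (fun k hk => ?_) (fun j hj hj' => hF j ?_) fun _ _ => rfl
  · exact add_right_cancel hjk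
  · simp only [Finset.mem_coe, mem_indicesUpTo, order_add, order_single] at hk ⊢
    omega
  · by_contra h0
    refine hj' ⟨j - Pi.single m 1, ?_, sub_single_add h0⟩
    have := order_sub_single h0
    simp only [Finset.mem_coe, mem_indicesUpTo] at hj ⊢
    omega

end Indices

section Ladder

variable {d : ℕ} {A B : Matrix (Fin d) (Fin d) ℂ} (hAB : IsSymplecticPair A B) (r : ℂ) {h : ℝ}
  (hh : 0 < h) (a η : RSpace d)

/-- A finite linear combination of the wave packets `φ_j`, `|j| ≤ n`. -/
noncomputable def packetSum (A B : Matrix (Fin d) (Fin d) ℂ) (r : ℂ) (h : ℝ) (a η : RSpace d)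
    (n : ℕ) (c : (Fin d → ℕ) → ℂ) (x : RSpace d) : ℂ :=
  ∑ j ∈ indicesUpTo d n, c j * packet A B r h a η j x

include hAB hh in
/-- Multiplication by a coordinate is a combination of raising and lowering operators. -/
theorem coord_mul_packet (i : Fin d) (j : Fin d → ℕ) (x : RSpace d) :
    ((x i - a i : ℝ) : ℂ) * packet A B r h a η j x = (Real.sqrt (h / 2) : ℂ) *
      ∑ m, (starRingEnd ℂ (A i m) * (Real.sqrt (j m) : ℂ) *
          packet A B r h a η (j - Pi.single m 1) x +
        A i m * (Real.sqrt ((j m : ℝ) + 1) : ℂ) * packet A B r h a η (j + Pi.single m 1) x) := by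
  have hS := matS_symm hAB
  have hAS : ∀ n, ∑ m, A i m * matS A m n = starRingEnd ℂ (A i n) := by
    intro n
    have : A * matS A = Aᴴᵀ := by rw [matS, ← Matrix.mul_assoc, hAB.mul_inv, Matrix.one_mul]
    have h2 := congrFun (congrFun this i) n
    rwa [Matrix.mul_apply] at h2
  set gp := polyPacket A B r h a η with hgp
  set H := hermitePoly (matS A) with hH
  have hX : ∀ m, MvPolynomial.X m * H j = H (j + Pi.single m 1) +
      ∑ n, MvPolynomial.C (matS A m n) * (MvPolynomial.C (j n : ℂ) * H (j - Pi.single n 1)) :=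
    fun m => by
      have e := hermitePoly_recursion hS j m
      rw [← hH] at e
      rw [e]
      ring
  have hf : ∀ j : Fin d → ℕ, (0 : ℝ) < multiFactorial j := fun j => by
    exact_mod_cast multiFactorial_pos j
  have hup : ∀ m, ((1 / Real.sqrt (multiFactorial j : ℝ) : ℝ) : ℂ) * gp (H (j + Pi.single m 1)) x =
      (Real.sqrt ((j m : ℝ) + 1) : ℂ) * packet A B r h a η (j + Pi.single m 1) x := by
    intro m
    rw [packet_eq_polyPacket hAB r hh, multiFactorial_add_single, ← mul_assoc, ← ofReal_mul]
    congr 2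
    push_cast
    rw [Real.sqrt_mul (by positivity)]
    have h1 : Real.sqrt ((j m : ℝ) + 1) ≠ 0 := by positivity
    have h2 : Real.sqrt (multiFactorial j) ≠ 0 := (Real.sqrt_pos.2 (hf j)).ne'
    field_simp
  have hdown : ∀ n, ((1 / Real.sqrt (multiFactorial j : ℝ) : ℝ) : ℂ) *
      ((j n : ℂ) * gp (H (j - Pi.single n 1)) x) =
      (Real.sqrt (j n) : ℂ) * packet A B r h a η (j - Pi.single n 1) x := by
    intro n
    by_cases h0 : j n = 0
    · simp [h0]
    rw [packet_eq_polyPacket hAB r hh]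
    have e1 : multiFactorial j = (j n) * multiFactorial (j - Pi.single n 1) := by
      conv_lhs => rw [← sub_single_add h0, multiFactorial_add_single]
      congr 1
      simp
      omega
    have e2 : (j n : ℝ) = Real.sqrt (j n) * Real.sqrt (j n) :=
      (Real.mul_self_sqrt (Nat.cast_nonneg _)).symm
    have h1 : Real.sqrt (j n : ℝ) ≠ 0 := by
      have : 0 < j n := Nat.pos_of_ne_zero h0
      positivity
    have h2 := (Real.sqrt_pos.2 (hf (j - Pi.single n 1))).ne'
    rw [e1, ← mul_assoc, ← mul_assoc, ← ofReal_natCast, ← ofReal_mul, ← ofReal_mul]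
    congr 2
    push_cast
    rw [Real.sqrt_mul (by positivity)]
    field_simp
    rw [sq, ← e2]
  rw [packet_eq_polyPacket hAB r hh, mul_left_comm, coord_mul_polyPacket hAB r hh]
  simp only [← hH, hX, polyPacket_sum, polyPacket_C_mul, polyPacket_add, ← hgp]
  have key : ((1 / Real.sqrt (multiFactorial j : ℝ) : ℝ) : ℂ) *
      ∑ m, (Real.sqrt (h / 2) : ℂ) * A i m * (gp (H (j + Pi.single m 1)) x +
        ∑ n, matS A m n * ((j n : ℂ) * gp (H (j - Pi.single n 1)) x)) =
      (Real.sqrt (h / 2) : ℂ) * (∑ m, A i m *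
        (((1 / Real.sqrt (multiFactorial j : ℝ) : ℝ) : ℂ) * gp (H (j + Pi.single m 1)) x) +
        ∑ n, (∑ m, A i m * matS A m n) * (((1 / Real.sqrt (multiFactorial j : ℝ) : ℝ) : ℂ) *
          ((j n : ℂ) * gp (H (j - Pi.single n 1)) x))) := by
    simp only [mul_add, Finset.sum_add_distrib, Finset.mul_sum, Finset.sum_mul]
    congr 1
    · exact Finset.sum_congr rfl fun m _ => by ring
    · rw [Finset.sum_comm]
      exact Finset.sum_congr rfl fun m _ => Finset.sum_congr rfl fun n _ => by ring
  rw [key]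
  simp only [hup, hdown, hAS]
  rw [← Finset.sum_add_distrib]
  congr 1
  exact Finset.sum_congr rfl fun m _ => by ring

/-- The coefficients of `(x_i - a_i) ψ` in the basis of wave packets, if `c` are those of `ψ`. -/
noncomputable def coordCoef (A : Matrix (Fin d) (Fin d) ℂ) (h : ℝ) (i : Fin d)
    (c : (Fin d → ℕ) → ℂ) (k : Fin d → ℕ) : ℂ :=
  (Real.sqrt (h / 2) : ℂ) *
    ∑ m, (starRingEnd ℂ (A i m) * ((Real.sqrt ((k m : ℝ) + 1) : ℂ) * c (k + Pi.single m 1)) +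
      A i m * ((Real.sqrt (k m) : ℂ) * c (k - Pi.single m 1)))

theorem coordCoef_eq_zero (A : Matrix (Fin d) (Fin d) ℂ) (h : ℝ) (i : Fin d) {n : ℕ}
    {c : (Fin d → ℕ) → ℂ} (hc : ∀ j, n < order j → c j = 0) (k : Fin d → ℕ)
    (hk : n + 1 < order k) : coordCoef A h i c k = 0 := by
  unfold coordCoef
  rw [Finset.sum_eq_zero fun m _ => ?_, mul_zero]
  rw [hc (k + Pi.single m 1) (by rw [order_add, order_single]; omega)]
  by_cases h0 : k m = 0
  · simp [h0]
  · rw [hc (k - Pi.single m 1) (by have := order_sub_single h0; omega)]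
    simp

include hAB hh in
/-- The three-term relation for a coordinate, on the level of coefficients: the order grows by one. -/
theorem coord_mul_packetSum (i : Fin d) {n : ℕ} {c : (Fin d → ℕ) → ℂ}
    (hc : ∀ j, n < order j → c j = 0) (x : RSpace d) :
    ((x i - a i : ℝ) : ℂ) * packetSum A B r h a η n c x =
      packetSum A B r h a η (n + 1) (coordCoef A h i c) x := by
  set φ := fun j => packet A B r h a η j x
  have e1 : ∀ m, ∑ k ∈ indicesUpTo d (n + 1),
      (Real.sqrt ((k m : ℝ) + 1) : ℂ) * c (k + Pi.single m 1) * φ k =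
      ∑ j ∈ indicesUpTo d n, c j * ((Real.sqrt (j m) : ℂ) * φ (j - Pi.single m 1)) := by
    intro m
    symm
    rw [sum_indicesUpTo_of_le (n' := n + 2) (by omega) fun j hj => by rw [hc j hj, zero_mul],
      sum_indicesUpTo_succ m (n + 1) fun j hj => by simp [hj]]
    refine Finset.sum_congr rfl fun k _ => ?_
    have : k + Pi.single m 1 - Pi.single m 1 = k := add_tsub_cancel_right _ _
    rw [this]
    simp only [Pi.add_apply, Pi.single_eq_same]
    push_cast
    ring
  have e2 : ∀ m, ∑ k ∈ indicesUpTo d (n + 1), (Real.sqrt (k m) : ℂ) * c (k - Pi.single m 1) * φ k =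
      ∑ j ∈ indicesUpTo d n, c j * ((Real.sqrt ((j m : ℝ) + 1) : ℂ) * φ (j + Pi.single m 1)) := by
    intro m
    rw [sum_indicesUpTo_succ m n fun j hj => by simp [hj]]
    refine Finset.sum_congr rfl fun k _ => ?_
    have : k + Pi.single m 1 - Pi.single m 1 = k := add_tsub_cancel_right _ _
    rw [this]
    simp only [Pi.add_apply, Pi.single_eq_same]
    push_cast
    ring
  have hL : ((x i - a i : ℝ) : ℂ) * packetSum A B r h a η n c x = (Real.sqrt (h / 2) : ℂ) *
      ∑ m, (starRingEnd ℂ (A i m) * ∑ j ∈ indicesUpTo d n, c j * ((Real.sqrt (j m) : ℂ) *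
          φ (j - Pi.single m 1)) + A i m * ∑ j ∈ indicesUpTo d n, c j *
            ((Real.sqrt ((j m : ℝ) + 1) : ℂ) * φ (j + Pi.single m 1))) := by
    unfold packetSum
    simp only [Finset.mul_sum, mul_left_comm _ (c _), coord_mul_packet hAB r hh,
      ← Finset.sum_add_distrib]
    rw [Finset.sum_comm]
    exact Finset.sum_congr rfl fun m _ => Finset.sum_congr rfl fun j _ => by ring
  rw [hL]
  simp only [← e1, ← e2]
  unfold packetSum coordCoef
  simp only [Finset.mul_sum, Finset.sum_mul, ← Finset.sum_add_distrib]
  rw [Finset.sum_comm]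
  exact Finset.sum_congr rfl fun m _ => Finset.sum_congr rfl fun j _ => by ring

/-- The Hilbert–Schmidt norm is bounded by the operator norm, column by column. -/
theorem sum_norm_sq_le_opNorm (A : Matrix (Fin d) (Fin d) ℂ) :
    ∑ i, ∑ m, ‖A i m‖ ^ 2 ≤ d * opNorm A ^ 2 := by
  rw [Finset.sum_comm]
  have : ∀ m, ∑ i, ‖A i m‖ ^ 2 ≤ opNorm A ^ 2 := by
    intro m
    have h1 := (Matrix.toEuclideanCLM (𝕜 := ℂ) A).le_opNorm (EuclideanSpace.single m 1)
    rw [PiLp.norm_single, norm_one, mul_one] at h1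
    have h2 := pow_le_pow_left₀ (norm_nonneg _) h1 2
    rw [EuclideanSpace.norm_sq_eq] at h2
    refine (le_of_eq ?_).trans h2
    refine Finset.sum_congr rfl fun i _ => ?_
    congr 2
    simp [Matrix.ofLp_toEuclideanCLM]
  calc _ ≤ ∑ _m : Fin d, opNorm A ^ 2 := Finset.sum_le_sum fun m _ => this m
    _ = _ := by simp

/-- The `k`-th coefficient only sees the neighbours `k ± e_m`, with the weights of the harmonic
oscillator ladder. -/
theorem norm_coordCoef_sq_le (A : Matrix (Fin d) (Fin d) ℂ) (hh : 0 < h) (i : Fin d)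
    (c : (Fin d → ℕ) → ℂ) (k : Fin d → ℕ) :
    ‖coordCoef A h i c k‖ ^ 2 ≤ h * (∑ m, ‖A i m‖ ^ 2) *
      ∑ m, (((k m : ℝ) + 1) * ‖c (k + Pi.single m 1)‖ ^ 2 +
        (k m : ℝ) * ‖c (k - Pi.single m 1)‖ ^ 2) := by
  set u : Fin d → ℝ := fun m => Real.sqrt ((k m : ℝ) + 1) * ‖c (k + Pi.single m 1)‖
  set w : Fin d → ℝ := fun m => Real.sqrt (k m) * ‖c (k - Pi.single m 1)‖
  have h1 : ‖∑ m, (starRingEnd ℂ (A i m) * ((Real.sqrt ((k m : ℝ) + 1) : ℂ) *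
      c (k + Pi.single m 1)) + A i m * ((Real.sqrt (k m) : ℂ) * c (k - Pi.single m 1)))‖ ≤
      ∑ m, ‖A i m‖ * (u m + w m) := by
    refine (norm_sum_le _ _).trans (Finset.sum_le_sum fun m _ => (norm_add_le _ _).trans ?_)
    rw [norm_mul, norm_mul, norm_mul, norm_mul, RCLike.norm_conj, norm_real, norm_real,
      Real.norm_of_nonneg (Real.sqrt_nonneg _), Real.norm_of_nonneg (Real.sqrt_nonneg _), mul_add]
  have h2 := Finset.sum_mul_sq_le_sq_mul_sq Finset.univ (fun m => ‖A i m‖) (fun m => u m + w m)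
  have h3 : ∑ m, (u m + w m) ^ 2 ≤ 2 * ∑ m, (((k m : ℝ) + 1) * ‖c (k + Pi.single m 1)‖ ^ 2 +
        (k m : ℝ) * ‖c (k - Pi.single m 1)‖ ^ 2) := by
    rw [Finset.mul_sum]
    refine Finset.sum_le_sum fun m _ => ?_
    have e1 : u m ^ 2 = ((k m : ℝ) + 1) * ‖c (k + Pi.single m 1)‖ ^ 2 := by
      rw [mul_pow, Real.sq_sqrt (by positivity)]
    have e2 : w m ^ 2 = (k m : ℝ) * ‖c (k - Pi.single m 1)‖ ^ 2 := by
      rw [mul_pow, Real.sq_sqrt (by positivity)]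
    rw [← e1, ← e2]
    nlinarith [sq_nonneg (u m - w m)]
  unfold coordCoef
  rw [norm_mul, mul_pow, norm_real, Real.norm_of_nonneg (Real.sqrt_nonneg _),
    Real.sq_sqrt (by positivity)]
  have h4 := pow_le_pow_left₀ (norm_nonneg _) h1 2
  have h5 : 0 ≤ ∑ m, ‖A i m‖ ^ 2 := Finset.sum_nonneg fun _ _ => by positivity
  calc _ ≤ h / 2 * ((∑ m, ‖A i m‖ ^ 2) * (2 * _)) := by
        gcongr
        exact h4.trans (h2.trans (mul_le_mul_of_nonneg_left h3 h5))
    _ = _ := by ring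

/-- Multiplication by the coordinates increases the norm at most by a factor of the order of
`ℏ ‖A‖² (n + 1)` on the span of the wave packets of order at most `n`. -/
theorem sum_norm_coordCoef_sq_le (A : Matrix (Fin d) (Fin d) ℂ) (hh : 0 < h) {n : ℕ}
    {c : (Fin d → ℕ) → ℂ} (hc : ∀ j, n < order j → c j = 0) :
    ∑ i, ∑ k ∈ indicesUpTo d (n + 1), ‖coordCoef A h i c k‖ ^ 2 ≤
      (d * (d + 2) * h * opNorm A ^ 2) * (n + 1) * ∑ j ∈ indicesUpTo d n, ‖c j‖ ^ 2 := by
  have e1 : ∀ m, ∑ k ∈ indicesUpTo d (n + 1), ((k m : ℝ) + 1) * ‖c (k + Pi.single m 1)‖ ^ 2 =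
      ∑ j ∈ indicesUpTo d n, (j m : ℝ) * ‖c j‖ ^ 2 := by
    intro m
    symm
    rw [sum_indicesUpTo_of_le (n' := n + 2) (by omega) fun j hj => by rw [hc j hj]; simp,
      sum_indicesUpTo_succ m (n + 1) fun j hj => by simp [hj]]
    refine Finset.sum_congr rfl fun k _ => ?_
    simp only [Pi.add_apply, Pi.single_eq_same]
    push_cast
    ring
  have e2 : ∀ m, ∑ k ∈ indicesUpTo d (n + 1), (k m : ℝ) * ‖c (k - Pi.single m 1)‖ ^ 2 =
      ∑ j ∈ indicesUpTo d n, ((j m : ℝ) + 1) * ‖c j‖ ^ 2 := by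
    intro m
    rw [sum_indicesUpTo_succ m n fun j hj => by simp [hj]]
    refine Finset.sum_congr rfl fun k _ => ?_
    have : k + Pi.single m 1 - Pi.single m 1 = k := add_tsub_cancel_right _ _
    rw [this]
    simp only [Pi.add_apply, Pi.single_eq_same]
    push_cast
    ring
  set T := ∑ k ∈ indicesUpTo d (n + 1), ∑ m, (((k m : ℝ) + 1) * ‖c (k + Pi.single m 1)‖ ^ 2 +
        (k m : ℝ) * ‖c (k - Pi.single m 1)‖ ^ 2) with hT
  have hT0 : 0 ≤ T := Finset.sum_nonneg fun _ _ => Finset.sum_nonneg fun _ _ => by positivity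
  have hTle : T ≤ (d + 2) * (n + 1) * ∑ j ∈ indicesUpTo d n, ‖c j‖ ^ 2 := by
    rw [hT, Finset.sum_comm]
    simp only [Finset.sum_add_distrib, e1, e2]
    rw [← Finset.sum_add_distrib]
    simp only [← Finset.sum_add_distrib, ← add_mul]
    rw [Finset.sum_comm, Finset.mul_sum]
    refine Finset.sum_le_sum fun j hj => ?_
    rw [← Finset.sum_mul]
    refine mul_le_mul_of_nonneg_right ?_ (by positivity)
    rw [mem_indicesUpTo] at hj
    have h1 : ∑ m, ((j m : ℝ) + ((j m : ℝ) + 1)) = 2 * (order j : ℝ) + d := by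
      unfold order
      push_cast
      simp only [Finset.sum_add_distrib, Finset.sum_const, Finset.card_univ, Fintype.card_fin]
      simp; ring
    have h2 : (order j : ℝ) ≤ n := by exact_mod_cast hj
    rw [h1]
    have h3 : (0 : ℝ) ≤ d := Nat.cast_nonneg d
    have h4 : (0 : ℝ) ≤ n := Nat.cast_nonneg n
    nlinarith [mul_nonneg h3 h4]
  have hrow : ∀ i, ∑ k ∈ indicesUpTo d (n + 1), ‖coordCoef A h i c k‖ ^ 2 ≤
      h * (∑ m, ‖A i m‖ ^ 2) * T := by
    intro i
    rw [hT, Finset.mul_sum]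
    exact Finset.sum_le_sum fun k _ => norm_coordCoef_sq_le A hh i c k
  calc _ ≤ ∑ i, h * (∑ m, ‖A i m‖ ^ 2) * T := Finset.sum_le_sum fun i _ => hrow i
    _ = h * (∑ i, ∑ m, ‖A i m‖ ^ 2) * T := by rw [← Finset.sum_mul, ← Finset.mul_sum]
    _ ≤ h * (d * opNorm A ^ 2) * ((d + 2) * (n + 1) * ∑ j ∈ indicesUpTo d n, ‖c j‖ ^ 2) := by
        gcongr
        exact sum_norm_sq_le_opNorm A
    _ = _ := by ring

end Ladder


/-! ### Moments of finite sums of wave packets -/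

section Moments

variable {d : ℕ}

/-- A function of Gaussian decay multiplied by one of exponential growth is square integrable. -/
theorem memLp_growth_mul {f : RSpace d → ℂ} {g : RSpace d → ℝ} (hf : Continuous f)
    (hg : Continuous g) (hdec : ∃ C c : ℝ, 0 < c ∧ ∀ x, ‖f x‖ ≤ C * Real.exp (-c * ‖x‖ ^ 2))
    (hgrow : ∃ M τ : ℝ, ∀ x, |g x| ≤ M * Real.exp (τ * ‖x‖)) :
    MemLp (fun x => (g x : ℂ) * f x) 2 volume := by
  obtain ⟨C, c, hc, hb⟩ := hdec
  obtain ⟨M, τ, hM⟩ := hgrow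
  have h1 : GaussDecay (𝓝 ()) (fun _ : Unit => f) := ⟨C, c, hc, Eventually.of_forall fun _ => hb⟩
  have h2 : GaussDecay (𝓝 ()) (fun (_ : Unit) x => (g x : ℂ) * f x) :=
    h1.growth_mul (M := M) (τ := τ) (Eventually.of_forall fun _ x => by
      rw [norm_real]; exact hM x)
  obtain ⟨C', c', hc', hb'⟩ := h2.self (t := ())
  exact memLp_of_gaussDecay (by fun_prop) hc' hb'

theorem norm_sq_sum_of_orthonormal {ι E : Type*} [NormedAddCommGroup E] [InnerProductSpace ℂ E]
    {v : ι → E} (hv : Orthonormal ℂ v) (s : Finset ι) (c : ι → ℂ) :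
    ‖∑ i ∈ s, c i • v i‖ ^ 2 = ∑ i ∈ s, ‖c i‖ ^ 2 := by
  have h1 := hv.inner_sum c c s
  rw [inner_self_eq_norm_sq_to_K] at h1
  apply ofReal_injective
  push_cast
  refine h1.trans (Finset.sum_congr rfl fun i _ => ?_)
  rw [conj_mul']

theorem norm_sub_pow_le (a : RSpace d) (p : ℕ) (x : RSpace d) :
    ‖x - a‖ ^ p ≤ p.factorial * Real.exp ‖a‖ * Real.exp (1 * ‖x‖) := by
  have h1 := Real.pow_div_factorial_le_exp ‖x - a‖ (norm_nonneg _) p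
  rw [div_le_iff₀ (by positivity)] at h1
  refine h1.trans ?_
  rw [mul_assoc, ← Real.exp_add, mul_comm]
  gcongr
  rw [one_mul, add_comm]
  exact norm_sub_le _ _

theorem integrable_exp_moment {f : RSpace d → ℂ} (hf : Continuous f)
    (hdec : ∃ C c : ℝ, 0 < c ∧ ∀ x, ‖f x‖ ≤ C * Real.exp (-c * ‖x‖ ^ 2)) (a : RSpace d) (τ : ℝ)
    (p : ℕ) : Integrable
      (fun x => Real.exp (2 * τ * ‖x - a‖) * (‖x - a‖ ^ (2 * p) * ‖f x‖ ^ 2)) := by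
  have hm := memLp_growth_mul hf (g := fun x => Real.exp (τ * ‖x - a‖) * ‖x - a‖ ^ p)
    (by fun_prop) hdec ⟨Real.exp (|τ| * ‖a‖) * (p.factorial * Real.exp ‖a‖), |τ| + 1, fun x => by
      rw [abs_of_nonneg (by positivity)]
      calc _ ≤ Real.exp (|τ| * (‖x‖ + ‖a‖)) * (p.factorial * Real.exp ‖a‖ * Real.exp (1 * ‖x‖)) := by
            gcongr
            · exact le_abs_self τ
            · exact norm_sub_le _ _
            · exact norm_sub_pow_le a p x
        _ = _ := by rw [mul_add, Real.exp_add, add_mul, Real.exp_add]; ring⟩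
  refine ((memLp_two_iff_integrable_sq_norm hm.1).1 hm).congr (Eventually.of_forall fun x => ?_)
  simp only [norm_mul, norm_real, mul_pow, norm_pow, norm_norm]
  rw [← pow_mul, mul_comm p 2, Real.norm_of_nonneg (Real.exp_nonneg _), ← Real.exp_nat_mul]
  push_cast
  ring_nf

theorem integrable_moment {f : RSpace d → ℂ} (hf : Continuous f)
    (hdec : ∃ C c : ℝ, 0 < c ∧ ∀ x, ‖f x‖ ≤ C * Real.exp (-c * ‖x‖ ^ 2)) (a : RSpace d) (p : ℕ) :
    Integrable (fun x => ‖x - a‖ ^ (2 * p) * ‖f x‖ ^ 2) := by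
  simpa using integrable_exp_moment hf hdec a 0 p

theorem ascFactorial_bound (n p q : ℕ) : ((n + 1).ascFactorial (p + q) : ℝ) ≤
    (n + p) ^ p * (2 ^ (n + p) * 2 ^ q * q.factorial) := by
  have h1 : (n + 1).ascFactorial (p + q) ≤ (n + p) ^ p * (2 ^ (n + p) * 2 ^ q * q.factorial) := by
    rw [← Nat.ascFactorial_mul_ascFactorial]
    refine Nat.mul_le_mul (Nat.ascFactorial_le_pow_add n p) ?_
    rw [show n + 1 + p = n + p + 1 by ring, Nat.ascFactorial_eq_factorial_mul_choose, ← pow_add,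
      mul_comm]
    exact Nat.mul_le_mul_right _ (Nat.choose_le_two_pow _ _)
  exact_mod_cast h1

section

variable {A B : Matrix (Fin d) (Fin d) ℂ} (hAB : IsSymplecticPair A B) (r : ℂ) {h : ℝ}
  (hh : 0 < h) (a η : RSpace d)
include hAB hh

theorem packet_eq_polyPacket_C_mul (j : Fin d → ℕ) : packet A B r h a η j =
    polyPacket A B r h a η (MvPolynomial.C ((1 / Real.sqrt (multiFactorial j : ℝ) : ℝ) : ℂ) *
      hermitePoly (matS A) j) := by
  ext x
  rw [polyPacket_C_mul]
  exact packet_eq_polyPacket hAB r hh a η j x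

theorem packetSum_eq_polyPacket (n : ℕ) (c : (Fin d → ℕ) → ℂ) :
    ∃ P, packetSum A B r h a η n c = polyPacket A B r h a η P := by
  refine ⟨∑ j ∈ indicesUpTo d n, MvPolynomial.C (c j) *
    (MvPolynomial.C ((1 / Real.sqrt (multiFactorial j : ℝ) : ℝ) : ℂ) *
      hermitePoly (matS A) j), ?_⟩
  ext x
  rw [polyPacket_sum]
  refine Finset.sum_congr rfl fun j _ => ?_
  rw [polyPacket_C_mul, packet_eq_polyPacket_C_mul hAB r hh]

theorem contDiff_packetSum (n : ℕ) (c : (Fin d → ℕ) → ℂ) {m : WithTop ℕ∞} :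
    ContDiff ℝ m (packetSum A B r h a η n c) := by
  obtain ⟨P, hP⟩ := packetSum_eq_polyPacket hAB r hh a η n c
  rw [hP]
  exact contDiff_polyPacket _ _ _ _ _ _ P

theorem continuous_packetSum (n : ℕ) (c : (Fin d → ℕ) → ℂ) :
    Continuous (packetSum A B r h a η n c) :=
  (contDiff_packetSum hAB r hh a η n c (m := 0)).continuous

theorem gaussDecay_packetSum (n : ℕ) (c : (Fin d → ℕ) → ℂ) :
    ∃ C c' : ℝ, 0 < c' ∧ ∀ x, ‖packetSum A B r h a η n c x‖ ≤ C * Real.exp (-c' * ‖x‖ ^ 2) := by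
  obtain ⟨P, hP⟩ := packetSum_eq_polyPacket hAB r hh a η n c
  rw [hP]
  exact gaussDecay_polyPacket hAB r hh a η P

theorem memLp_packetSum (n : ℕ) (c : (Fin d → ℕ) → ℂ) :
    MemLp (packetSum A B r h a η n c) 2 volume := by
  obtain ⟨C, c', hc, hb⟩ := gaussDecay_packetSum hAB r hh a η n c
  exact memLp_of_gaussDecay (continuous_packetSum hAB r hh a η n c).aestronglyMeasurable hc hb

theorem memLp_packet_static (j : Fin d → ℕ) : MemLp (packet A B r h a η j) 2 volume := by
  rw [packet_eq_polyPacket_C_mul hAB r hh]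
  obtain ⟨C, c', hc, hb⟩ := gaussDecay_polyPacket hAB r hh a η
    (MvPolynomial.C ((1 / Real.sqrt (multiFactorial j : ℝ) : ℝ) : ℂ) * hermitePoly (matS A) j)
  exact memLp_of_gaussDecay (continuous_polyPacket _ _ _ _ _ _ _).aestronglyMeasurable hc hb

theorem orthonormal_packet (hr : r ^ 2 = A.det) :
    Orthonormal ℂ (fun j => toL2 (packet A B r h a η j)) := by
  rw [orthonormal_iff_ite]
  intro j k
  rw [inner_toL2 (memLp_packet_static hAB r hh a η j) (memLp_packet_static hAB r hh a η k)]
  exact integral_packet hAB r hh a η hr j k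

theorem toL2_packetSum (n : ℕ) (c : (Fin d → ℕ) → ℂ) : toL2 (packetSum A B r h a η n c) =
    ∑ j ∈ indicesUpTo d n, c j • toL2 (packet A B r h a η j) := by
  have := toL2_sum (indicesUpTo d n) (F := fun j x => c j * packet A B r h a η j x)
    fun j _ => (memLp_packet_static hAB r hh a η j).const_mul _
  refine this.trans (Finset.sum_congr rfl fun j _ => ?_)
  exact toL2_const_mul _ (memLp_packet_static hAB r hh a η j)

theorem norm_toL2_packetSum_sq (hr : r ^ 2 = A.det) (n : ℕ) (c : (Fin d → ℕ) → ℂ) :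
    ‖toL2 (packetSum A B r h a η n c)‖ ^ 2 = ∑ j ∈ indicesUpTo d n, ‖c j‖ ^ 2 := by
  rw [toL2_packetSum hAB r hh, norm_sq_sum_of_orthonormal (orthonormal_packet hAB r hh a η hr)]

/-- Polynomial moments of a sum of wave packets of order at most `n`. -/
theorem integral_moment_le (hr : r ^ 2 = A.det) (p : ℕ) : ∀ (n : ℕ) {c : (Fin d → ℕ) → ℂ},
    (∀ j, n < order j → c j = 0) →
    ∫ x, ‖x - a‖ ^ (2 * p) * ‖packetSum A B r h a η n c x‖ ^ 2 ≤
      (d * (d + 2) * h * opNorm A ^ 2) ^ p * (n + 1).ascFactorial p *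
        ∑ j ∈ indicesUpTo d n, ‖c j‖ ^ 2 := by
  set κ := d * (d + 2) * h * opNorm A ^ 2
  have hκ : 0 ≤ κ := by positivity
  induction p with
  | zero =>
    intro n c hc
    simp only [mul_zero, pow_zero, one_mul, Nat.ascFactorial_zero, Nat.cast_one]
    rw [← norm_toL2_packetSum_sq hAB r hh a η hr n c,
      norm_toL2_sq (memLp_packetSum hAB r hh a η n c)]
  | succ p ih =>
    intro n c hc
    -- Distribute one factor `‖x - a‖²` over the coordinates, each raising the order by one.
    have e1 : ∀ x, ‖x - a‖ ^ (2 * (p + 1)) * ‖packetSum A B r h a η n c x‖ ^ 2 =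
        ∑ i, ‖x - a‖ ^ (2 * p) * ‖packetSum A B r h a η (n + 1) (coordCoef A h i c) x‖ ^ 2 := by
      intro x
      have h1 : ‖x - a‖ ^ 2 = ∑ i, ‖((x i - a i : ℝ) : ℂ)‖ ^ 2 := by
        rw [EuclideanSpace.norm_sq_eq]
        refine Finset.sum_congr rfl fun i _ => ?_
        rw [norm_real]
        rfl
      simp only [← coord_mul_packetSum hAB r hh a η _ hc, norm_mul, mul_pow, ← mul_assoc,
        ← Finset.sum_mul, ← Finset.mul_sum]
      rw [← h1]
      ring
    simp only [e1]
    rw [integral_finsetSum _ fun i _ => integrable_moment (continuous_packetSum hAB r hh a η _ _)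
      (gaussDecay_packetSum hAB r hh a η _ _) a p]
    calc _ ≤ ∑ i, κ ^ p * (n + 1 + 1).ascFactorial p *
          ∑ k ∈ indicesUpTo d (n + 1), ‖coordCoef A h i c k‖ ^ 2 :=
          Finset.sum_le_sum fun i _ => ih (n + 1) (coordCoef_eq_zero A h i hc)
      _ = κ ^ p * (n + 1 + 1).ascFactorial p *
          ∑ i, ∑ k ∈ indicesUpTo d (n + 1), ‖coordCoef A h i c k‖ ^ 2 := by
          rw [Finset.mul_sum]
      _ ≤ κ ^ p * (n + 1 + 1).ascFactorial p * (κ * (n + 1) * ∑ j ∈ indicesUpTo d n, ‖c j‖ ^ 2) := by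
          gcongr
          exact sum_norm_coordCoef_sq_le A hh hc
      _ = _ := by
          have : ((n + 1).ascFactorial (p + 1) : ℝ) = (n + 1) * (n + 1 + 1).ascFactorial p := by
            have h2 : (n + 1).ascFactorial (p + 1) = (n + 1) * (n + 1 + 1).ascFactorial p := by
              rw [Nat.ascFactorial_succ]
              exact (Nat.succ_ascFactorial (n + 1) p).symm
            exact_mod_cast h2
          rw [this]
          ring

/-- Exponential moments of a sum of wave packets of order at most `n`. -/
theorem integral_exp_moment_le (hr : r ^ 2 = A.det) (τ : ℝ) (p n : ℕ) {c : (Fin d → ℕ) → ℂ}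
    (hc : ∀ j, n < order j → c j = 0) :
    ∫ x, Real.exp (2 * τ * ‖x - a‖) * (‖x - a‖ ^ (2 * p) * ‖packetSum A B r h a η n c x‖ ^ 2) ≤
      2 * ((d * (d + 2) * h * opNorm A ^ 2) * (n + p)) ^ p * 2 ^ (n + p) *
        Real.exp (8 * τ ^ 2 * (d * (d + 2) * h * opNorm A ^ 2)) *
          ∑ j ∈ indicesUpTo d n, ‖c j‖ ^ 2 := by
  set κ := d * (d + 2) * h * opNorm A ^ 2
  have hκ : 0 ≤ κ := by positivity
  set s := ∑ j ∈ indicesUpTo d n, ‖c j‖ ^ 2 with hs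
  have hs0 : 0 ≤ s := Finset.sum_nonneg fun _ _ => by positivity
  set ψ := packetSum A B r h a η n c
  set F : ℕ → RSpace d → ℝ := fun q x =>
    (2 * τ) ^ (2 * q) / (2 * q).factorial * (‖x - a‖ ^ (2 * (p + q)) * ‖ψ x‖ ^ 2) with hF
  have hint : ∀ q, Integrable (F q) := fun q =>
    (integrable_moment (continuous_packetSum hAB r hh a η _ _)
      (gaussDecay_packetSum hAB r hh a η _ _) a (p + q)).const_mul _
  have hF0 : ∀ q x, 0 ≤ F q x := fun q x => by
    have : 0 ≤ (2 * τ) ^ (2 * q) := by rw [pow_mul]; positivity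
    positivity
  set b : ℕ → ℝ := fun q => κ ^ p * (n + p) ^ p * 2 ^ (n + p) * s *
    ((8 * τ ^ 2 * κ) ^ q / q.factorial) with hb
  have hFb : ∀ q, ∫ x, F q x ≤ b q := by
    intro q
    have h0 : 0 ≤ (2 * τ) ^ (2 * q) := by rw [pow_mul]; positivity
    -- The factor `q!` from the moments is compensated by `1 / (2q)!`.
    have hfac : ((q.factorial : ℝ) * q.factorial) ≤ (2 * q).factorial := by
      have := Nat.le_of_dvd (Nat.factorial_pos _) (Nat.factorial_mul_factorial_dvd_factorial_add q q)
      rw [two_mul]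
      exact_mod_cast this
    have hfq : (0 : ℝ) < q.factorial := by positivity
    rw [hF, integral_const_mul]
    calc _ ≤ (2 * τ) ^ (2 * q) / (q.factorial * q.factorial) *
          (κ ^ (p + q) * ((n + p) ^ p * (2 ^ (n + p) * 2 ^ q * q.factorial)) * s) := by
          gcongr
          refine (integral_moment_le hAB r hh a η hr (p + q) n hc).trans ?_
          gcongr
          exact ascFactorial_bound n p q
      _ = b q := by
          have e : (8 * τ ^ 2 * κ) ^ q = (2 * τ) ^ (2 * q) * 2 ^ q * κ ^ q := by
            rw [pow_mul, ← mul_pow, ← mul_pow]; ring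
          simp only [hb]
          rw [e, pow_add κ]
          field_simp
  have hexp : HasSum (fun q : ℕ => (8 * τ ^ 2 * κ) ^ q / q.factorial)
      (Real.exp (8 * τ ^ 2 * κ)) := by
    rw [Real.exp_eq_exp_ℝ]
    exact NormedSpace.expSeries_div_hasSum_exp _
  have hbs : HasSum b (κ ^ p * (n + p) ^ p * 2 ^ (n + p) * s * Real.exp (8 * τ ^ 2 * κ)) :=
    hexp.mul_left _
  have hnorm : ∀ q, ∫ x, ‖F q x‖ = ∫ x, F q x := fun q => by
    simp only [Real.norm_of_nonneg (hF0 q _)]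
  have hsum : Summable fun q => ∫ x, ‖F q x‖ := by
    refine Summable.of_nonneg_of_le (fun q => integral_nonneg fun x => norm_nonneg _)
      (fun q => ?_) hbs.summable
    rw [hnorm]
    exact hFb q
  have hI := hasSum_integral_of_summable_integral_norm hint hsum
  have hle : ∑' q, ∫ x, F q x ≤ _ := hI.summable.tsum_le_tsum hFb hbs.summable
  rw [hI.tsum_eq, hbs.tsum_eq] at hle
  have hcosh : ∀ x, ∑' q, F q x = Real.cosh (2 * τ * ‖x - a‖) * (‖x - a‖ ^ (2 * p) * ‖ψ x‖ ^ 2) := by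
    intro x
    rw [← ((Real.hasSum_cosh (2 * τ * ‖x - a‖)).mul_right _).tsum_eq]
    refine tsum_congr fun q => ?_
    simp only [hF]
    rw [mul_pow _ ‖x - a‖, mul_add, pow_add]
    ring
  simp only [hcosh] at hle
  have hmom := fun τ => integrable_exp_moment (continuous_packetSum hAB r hh a η n c)
    (gaussDecay_packetSum hAB r hh a η n c) a τ p
  have hcint : Integrable fun x =>
      2 * (Real.cosh (2 * τ * ‖x - a‖) * (‖x - a‖ ^ (2 * p) * ‖ψ x‖ ^ 2)) := by
    refine ((hmom τ).add (hmom (-τ))).congr (Eventually.of_forall fun x => ?_)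
    simp only [Pi.add_apply, Real.cosh_eq, mul_neg, neg_mul]
    ring
  -- The series of `cosh` contains only the even moments.
  calc _ ≤ ∫ x, 2 * (Real.cosh (2 * τ * ‖x - a‖) * (‖x - a‖ ^ (2 * p) * ‖ψ x‖ ^ 2)) := by
        refine integral_mono (hmom τ) hcint fun x => ?_
        have h1 : Real.exp (2 * τ * ‖x - a‖) ≤ 2 * Real.cosh (2 * τ * ‖x - a‖) := by
          rw [Real.cosh_eq]
          linarith [Real.exp_pos (-(2 * τ * ‖x - a‖))]
        have h2 : 0 ≤ ‖x - a‖ ^ (2 * p) * ‖ψ x‖ ^ 2 := by positivity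
        change _ * (‖x - a‖ ^ (2 * p) * ‖ψ x‖ ^ 2) ≤ _
        nlinarith
    _ ≤ _ := by
        rw [integral_const_mul, mul_pow]
        linarith

end

end Moments


/-! ### Taylor expansion of the potential -/

section Taylor

variable {d : ℕ} {V : RSpace d → ℝ}

/-- The homogeneous part of degree `p` of the Taylor expansion of `V` at `a`, in the direction
`v`. -/
noncomputable def taylorTerm (V : RSpace d → ℝ) (p : ℕ) (a v : RSpace d) : ℝ :=
  ∑ m ∈ (indicesUpTo d p).filter (fun m => order m = p),
    multiD m V a / (multiFactorial m : ℝ) * ∏ i, v i ^ m i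

/-- Iterated partial derivatives of a smooth function are smooth and may be taken in any order. The
induction runs in the subtype of smooth functions, where the operators `partialD i` commute. -/
theorem multiD_contDiff_and_add_single (hV : ContDiff ℝ ∞ V) (m : Fin d → ℕ) :
    ContDiff ℝ ∞ (multiD m V) ∧
      ∀ i, multiD (m + Pi.single i 1) V = partialD i (multiD m V) := by
  let g : Fin d → {f : RSpace d → ℝ // ContDiff ℝ ∞ f} → {f : RSpace d → ℝ // ContDiff ℝ ∞ f} :=
    fun i f => ⟨partialD i f.1, partialD_contDiff f.2 i⟩
  have hg : ∀ i k f, g i (g k f) = g k (g i f) := fun i k f =>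
    Subtype.ext (partialD_comm f.2 i k)
  have hit : ∀ i n f, ((g i)^[n] f).1 = (partialD i)^[n] f.1 := by
    intro i n f
    induction n with
    | zero => rfl
    | succ n ih => rw [Function.iterate_succ_apply', Function.iterate_succ_apply', ← ih]
  have hfold : ∀ (j : Fin d → ℕ) (l : List (Fin d)),
      (l.foldr (fun i f => (g i)^[j i] f) ⟨V, hV⟩).1 =
        l.foldr (fun i f => (partialD i)^[j i] f) V := by
    intro j l
    induction l with
    | nil => rfl
    | cons i l ih => rw [List.foldr_cons, List.foldr_cons, hit, ih]
  refine ⟨?_, fun i => ?_⟩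
  · unfold multiD
    rw [← hfold]
    exact Subtype.property _
  · have := congrArg Subtype.val (foldr_iterate_add_single g hg m i ⟨V, hV⟩)
    unfold multiD
    rw [← hfold, ← hfold, this]

theorem hasDerivAt_line {g : RSpace d → ℝ} (hg : ContDiff ℝ ∞ g) (a v : RSpace d) (s : ℝ) :
    HasDerivAt (fun s : ℝ => g (a + s • v)) (∑ i, v i * partialD i g (a + s • v)) s := by
  have h1 : HasDerivAt (fun s : ℝ => a + s • v) v s := by
    simpa using ((hasDerivAt_id s).smul_const v).const_add a
  have h2 := ((hg.differentiable (by simp) (a + s • v)).hasFDerivAt).comp_hasDerivAt s h1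
  refine h2.congr_deriv ?_
  have hv : v = ∑ i, v i • EuclideanSpace.single i (1 : ℝ) := by
    ext k
    simp [Pi.single_apply]
  conv_lhs => rw [hv]
  rw [map_sum]
  refine Finset.sum_congr rfl fun i _ => ?_
  rw [map_smul, ← hv]
  rfl

theorem sum_order_eq_succ (p : ℕ) (i : Fin d) (F : (Fin d → ℕ) → ℝ) :
    ∑ m ∈ (indicesUpTo d (p + 1)).filter (fun m => order m = p + 1), (m i : ℝ) * F m =
      ∑ m ∈ (indicesUpTo d p).filter (fun m => order m = p),
        ((m i : ℝ) + 1) * F (m + Pi.single i 1) := by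
  rw [Finset.sum_filter, Finset.sum_filter, sum_indicesUpTo_succ i p fun j hj => by simp [hj]]
  refine Finset.sum_congr rfl fun m _ => ?_
  simp only [order_add, order_single, Nat.add_right_cancel_iff, Pi.add_apply, Pi.single_eq_same]
  push_cast
  rfl

theorem prod_pow_add_single (v : RSpace d) (m : Fin d → ℕ) (i : Fin d) :
    ∏ k, v k ^ (m + Pi.single i 1 : Fin d → ℕ) k = v i * ∏ k, v k ^ m k := by
  simp only [Pi.add_apply, pow_add, Finset.prod_mul_distrib]
  rw [mul_comm]
  congr 1
  rw [Finset.prod_eq_single i (fun k _ hk => by simp [hk]) (by simp)]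
  simp

/-- Along a line, the derivative of the homogeneous Taylor part of degree `p` is `p + 1` times
that of degree `p + 1`. -/
theorem hasDerivAt_taylorTerm (hV : ContDiff ℝ ∞ V) (p : ℕ) (a v : RSpace d) (s : ℝ) :
    HasDerivAt (fun s : ℝ => taylorTerm V p (a + s • v) v)
      ((p + 1) * taylorTerm V (p + 1) (a + s • v) v) s := by
  have h1 := fun m => hasDerivAt_line (multiD_contDiff_and_add_single hV m).1 a v s
  have h2 := HasDerivAt.fun_sum (u := (indicesUpTo d p).filter (fun m => order m = p)) fun m _ =>
    ((h1 m).div_const (multiFactorial m : ℝ)).mul_const (∏ i, v i ^ m i)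
  refine h2.congr_deriv ?_
  set F : (Fin d → ℕ) → ℝ := fun m =>
    multiD m V (a + s • v) / (multiFactorial m : ℝ) * ∏ i, v i ^ m i with hF
  have e1 : ((p : ℝ) + 1) * taylorTerm V (p + 1) (a + s • v) v =
      ∑ i, ∑ m ∈ (indicesUpTo d (p + 1)).filter (fun m => order m = p + 1), (m i : ℝ) * F m := by
    rw [Finset.sum_comm, taylorTerm, Finset.mul_sum]
    refine Finset.sum_congr rfl fun m hm => ?_
    rw [← Finset.sum_mul]
    congr 1
    have h3 : ∑ i, m i = p + 1 := (Finset.mem_filter.1 hm).2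
    exact_mod_cast h3.symm
  rw [e1]
  simp only [sum_order_eq_succ]
  rw [Finset.sum_comm]
  refine Finset.sum_congr rfl fun m _ => ?_
  rw [Finset.sum_div, Finset.sum_mul]
  refine Finset.sum_congr rfl fun i _ => ?_
  simp only [hF]
  rw [(multiD_contDiff_and_add_single hV m).2, multiFactorial_add_single]
  rw [prod_pow_add_single]
  have h3 : (multiFactorial m : ℝ) ≠ 0 := by exact_mod_cast (multiFactorial_pos m).ne'
  have h4 : (m i : ℝ) + 1 ≠ 0 := by positivity
  push_cast
  field_simp

theorem taylorTerm_zero (a v : RSpace d) : taylorTerm V 0 a v = V a := by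
  have : (indicesUpTo d 0).filter (fun m => order m = 0) = {0} := by
    ext m
    simp only [Finset.mem_filter, mem_indicesUpTo, Finset.mem_singleton, order_eq_zero]
    constructor
    · exact fun h => h.2
    · rintro rfl; simp [order]
  rw [taylorTerm, this, Finset.sum_singleton]
  have h1 : multiD (0 : Fin d → ℕ) V = V := by
    unfold multiD
    have : ∀ l : List (Fin d), l.foldr (fun i f => (partialD i)^[(0 : Fin d → ℕ) i] f) V = V := by
      intro l
      induction l with
      | nil => rfl
      | cons i l ih => rw [List.foldr_cons, ih]; rfl
    exact this _
  rw [h1]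
  simp [multiFactorial]

theorem taylorTerm_one (hV : ContDiff ℝ ∞ V) (a v : RSpace d) :
    taylorTerm V 1 a v = ∑ i, v i * partialD i V a := by
  have h1 := hasDerivAt_taylorTerm hV 0 a v 0
  simp only [taylorTerm_zero] at h1
  have := h1.unique (hasDerivAt_line hV a v 0)
  simpa using this

theorem taylorTerm_two (hV : ContDiff ℝ ∞ V) (a v : RSpace d) :
    taylorTerm V 2 a v = (∑ i, ∑ j, v i * hessian V a i j * v j) / 2 := by
  have h1 := hasDerivAt_taylorTerm hV 1 a v 0
  simp only [taylorTerm_one hV] at h1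
  have h2 := HasDerivAt.fun_sum (u := Finset.univ) fun j (_ : j ∈ Finset.univ) =>
    (hasDerivAt_line (partialD_contDiff hV j) a v 0).const_mul (v j)
  have h3 := h1.unique h2
  simp only [zero_smul, add_zero] at h3
  have h4 : ∑ j, v j * ∑ i, v i * partialD i (partialD j V) a =
      ∑ i, ∑ j, v i * hessian V a i j * v j := by
    rw [Finset.sum_comm]
    refine Finset.sum_congr rfl fun j _ => ?_
    rw [Finset.mul_sum]
    refine Finset.sum_congr rfl fun i _ => ?_
    simp only [hessian, Matrix.of_apply]
    ring
  rw [← h4, ← h3]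
  norm_num

theorem quadTaylor_eq (hV : ContDiff ℝ ∞ V) (a x : RSpace d) :
    quadTaylor V a x = ∑ p ∈ Finset.range 3, taylorTerm V p a (x - a) := by
  rw [Finset.sum_range_succ, Finset.sum_range_succ, Finset.sum_range_one, taylorTerm_zero,
    taylorTerm_one hV, taylorTerm_two hV, quadTaylor]
  congr 2
  exact Finset.sum_congr rfl fun i _ => by rw [PiLp.sub_apply, mul_comm]

theorem taylorZ_eq (l : ℕ) (a x : RSpace d) :
    taylorZ V l a x = ∑ p ∈ Finset.Icc 3 (l + 1), taylorTerm V p a (x - a) := by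
  unfold taylorZ
  rw [← Finset.sum_fiberwise_of_maps_to (g := order) (t := Finset.Icc 3 (l + 1))]
  · refine Finset.sum_congr rfl fun p hp => Finset.sum_congr ?_ fun m _ => rfl
    ext m
    rw [Finset.mem_Icc] at hp
    simp only [Finset.mem_filter, mem_indicesUpTo]
    omega
  · intro m hm
    simp only [Finset.mem_filter, mem_indicesUpTo] at hm
    rw [Finset.mem_Icc]
    omega

theorem quadTaylor_add_taylorZ (hV : ContDiff ℝ ∞ V) {l : ℕ} (hl : 1 ≤ l) (a x : RSpace d) :
    quadTaylor V a x + taylorZ V l a x =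
      ∑ p ∈ Finset.range (l + 2), taylorTerm V p a (x - a) := by
  rw [quadTaylor_eq hV, taylorZ_eq, ← Finset.sum_range_add_sum_Ico _ (by omega : 3 ≤ l + 2)]
  rfl

end Taylor

section Cauchy

variable {d : ℕ} {V : RSpace d → ℝ} {Vc : CSpace d → ℂ} {δ M τ : ℝ}

theorem norm_complexify (x : RSpace d) : ‖complexify x‖ = ‖x‖ := by
  rw [EuclideanSpace.norm_eq, EuclideanSpace.norm_eq]
  simp [complexify, norm_real]

/-- The restriction to `ℝ^d` of an analytic function is smooth. -/
theorem contDiff_of_analytic (hδ : 0 < δ) (hVa : AnalyticOnNhd ℂ Vc (strip d δ))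
    (hVext : ∀ x : RSpace d, Vc (complexify x) = ((V x : ℝ) : ℂ)) : ContDiff ℝ ∞ V := by
  have hc : ContDiff ℝ ∞ (complexify (d := d)) := by
    refine PiLp.contDiff_toLp.comp (contDiff_pi.2 fun i => ?_)
    exact ofRealCLM.contDiff.comp (EuclideanSpace.proj (𝕜 := ℝ) i).contDiff
  have h1 : V = fun x => (Vc (complexify x)).re := by
    ext x; rw [hVext, ofReal_re]
  rw [h1, contDiff_iff_contDiffAt]
  intro x
  have hx : complexify x ∈ strip d δ := fun i => by simpa [complexify] using hδ
  have h2 : ContDiffAt ℝ ∞ Vc (complexify x) := ((hVa _ hx).contDiffAt (n := ∞)).restrict_scalars ℝ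
  exact reCLM.contDiff.contDiffAt.comp x (h2.comp x hc.contDiffAt)

theorem line_mem_strip (a v : RSpace d) {s : ℂ} (hs : ‖s‖ * ‖v‖ < δ) :
    complexify a + s • complexify v ∈ strip d δ := by
  intro i
  have h1 : ((complexify a + s • complexify v) i).im = s.im * v i := by
    simp [complexify]
  rw [h1, abs_mul]
  refine lt_of_le_of_lt ?_ hs
  gcongr
  · exact abs_im_le_norm s
  · exact PiLp.norm_apply_le v i

theorem analyticAt_line (hVa : AnalyticOnNhd ℂ Vc (strip d δ)) (a v : RSpace d) {s : ℂ}
    (hs : ‖s‖ * ‖v‖ < δ) :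
    AnalyticAt ℂ (fun s : ℂ => Vc (complexify a + s • complexify v)) s := by
  have h1 : AnalyticAt ℂ (fun s : ℂ => complexify a + s • complexify v) s := by fun_prop
  exact AnalyticAt.comp (g := Vc) (f := fun s : ℂ => complexify a + s • complexify v)
    (hVa _ (line_mem_strip a v hs)) h1

/-- The complex derivatives of the continuation along a real line are the homogeneous Taylor terms of
the potential. -/
theorem iteratedDeriv_line (hδ : 0 < δ) (hVa : AnalyticOnNhd ℂ Vc (strip d δ))
    (hVext : ∀ x : RSpace d, Vc (complexify x) = ((V x : ℝ) : ℂ)) (a v : RSpace d) (p : ℕ) :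
    ∀ s : ℝ, |s| * ‖v‖ < δ →
      iteratedDeriv p (fun s : ℂ => Vc (complexify a + s • complexify v)) (s : ℂ) =
        ((p.factorial * taylorTerm V p (a + s • v) v : ℝ) : ℂ) := by
  have hV := contDiff_of_analytic hδ hVa hVext
  induction p with
  | zero =>
    intro s hs
    rw [iteratedDeriv_zero, taylorTerm_zero]
    have : complexify a + (s : ℂ) • complexify v = complexify (a + s • v) := by
      ext i; simp [complexify]
    rw [this, hVext]
    simp
  | succ p ih =>
    intro s hs
    set f := fun s : ℂ => Vc (complexify a + s • complexify v) with hf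
    have h1 : AnalyticAt ℂ (iteratedDeriv p f) (s : ℂ) := by
      rw [iteratedDeriv_eq_iterate]
      exact (analyticAt_line hVa a v (by simpa using hs)).iterated_deriv p
    have h2 := h1.differentiableAt.hasDerivAt.comp_ofReal
    rw [← iteratedDeriv_succ] at h2
    have h3 := ((hasDerivAt_taylorTerm hV p a v s).const_mul (p.factorial : ℝ)).ofReal_comp
    have hnhds : ∀ᶠ y : ℝ in 𝓝 s, |y| * ‖v‖ < δ :=
      (by fun_prop : Continuous fun y : ℝ => |y| * ‖v‖).tendsto s |>.eventually (gt_mem_nhds hs)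
    have h4 := h3.congr_of_eventuallyEq (f₁ := fun y : ℝ => iteratedDeriv p f (y : ℂ))
      (hnhds.mono fun y hy => ih y hy)
    rw [h2.unique h4, Nat.factorial_succ]
    congr 1
    push_cast
    ring

variable (hδ : 0 < δ) (hM : 0 < M) (hτ : 0 < τ) (hVa : AnalyticOnNhd ℂ Vc (strip d δ))
  (hVext : ∀ x : RSpace d, Vc (complexify x) = ((V x : ℝ) : ℂ))
  (hVg : ∀ z ∈ strip d δ, ‖Vc z‖ ≤ M * Real.exp (τ * ‖z‖))
include hδ hM hτ hVa hVext hVg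

omit hM hτ hVa in
theorem abs_potential_le (x : RSpace d) : |V x| ≤ M * Real.exp (τ * ‖x‖) := by
  have hx : complexify x ∈ strip d δ := fun i => by simpa [complexify] using hδ
  have := hVg _ hx
  rwa [hVext, norm_real, norm_complexify] at this

/-- Cauchy's estimate for the homogeneous Taylor parts. -/
theorem abs_taylorTerm_le (a v : RSpace d) (p : ℕ) :
    |taylorTerm V p a v| ≤ M * Real.exp (τ * (‖a‖ + δ / 2)) * (‖v‖ / (δ / 2)) ^ p := by
  set f := fun s : ℂ => Vc (complexify a + s • complexify v) with hf
  have h0 := iteratedDeriv_line hδ hVa hVext a v p 0 (by simpa using hδ)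
  simp only [zero_smul, add_zero, ofReal_zero] at h0
  have hfp : (0 : ℝ) < p.factorial := by positivity
  -- For `v = 0` every radius is allowed, and the estimate follows in the limit.
  have key : ∀ R : ℝ, 0 < R → R * ‖v‖ ≤ δ / 2 →
      |taylorTerm V p a v| ≤ M * Real.exp (τ * (‖a‖ + δ / 2)) / R ^ p := by
    intro R hR hRv
    have hd : DiffContOnCl ℂ f (Metric.ball 0 R) := by
      refine DifferentiableOn.diffContOnCl fun s hs => ?_
      rw [closure_ball _ hR.ne', mem_closedBall_zero_iff] at hs
      refine (analyticAt_line hVa a v ?_).differentiableAt.differentiableWithinAt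
      have := mul_le_mul_of_nonneg_right hs (norm_nonneg v)
      linarith
    have hb : ∀ s ∈ Metric.sphere (0 : ℂ) R, ‖f s‖ ≤ M * Real.exp (τ * (‖a‖ + δ / 2)) := by
      intro s hs
      rw [mem_sphere_zero_iff_norm] at hs
      refine (hVg _ (line_mem_strip a v (by rw [hs]; linarith))).trans ?_
      gcongr
      refine (norm_add_le _ _).trans ?_
      rw [norm_smul, norm_complexify, norm_complexify, hs]
      linarith
    have h1 := norm_iteratedDeriv_le_of_forall_mem_sphere_norm_le p hR hd hb
    rw [h0, norm_real, Real.norm_eq_abs, abs_mul, abs_of_pos hfp, mul_div_assoc] at h1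
    exact le_of_mul_le_mul_left h1 hfp
  by_cases hv : ‖v‖ = 0
  · by_cases hp : p = 0
    · subst hp
      simpa using key 1 one_pos (by rw [hv]; linarith)
    · have h2 : v = 0 := norm_eq_zero.1 hv
      have h3 : taylorTerm V p a v = 0 := by
        unfold taylorTerm
        refine Finset.sum_eq_zero fun m hm => ?_
        obtain ⟨i, hi⟩ : ∃ i, m i ≠ 0 := by
          by_contra! hc
          have := (Finset.mem_filter.1 hm).2
          rw [order_eq_zero.2 (funext hc)] at this
          exact hp this.symm
        rw [Finset.prod_eq_zero (Finset.mem_univ i) (by rw [h2]; simp [hi]), mul_zero]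
      rw [h3, abs_zero]
      positivity
  · have hvpos : 0 < ‖v‖ := lt_of_le_of_ne (norm_nonneg v) (Ne.symm hv)
    have := key (δ / 2 / ‖v‖) (by positivity) (by field_simp; exact le_rfl)
    refine this.trans (le_of_eq ?_)
    rw [div_eq_mul_inv, ← inv_pow, inv_div]

/-- The Taylor remainder for every real increment `v`, not only inside the radius of convergence:
where `‖v‖` is large, the factor `(‖v‖ / (δ / 4)) ^ n` dominates each term separately. -/
theorem abs_taylor_remainder_le (a v : RSpace d) (n : ℕ) :
    |V (a + v) - ∑ p ∈ Finset.range n, taylorTerm V p a v| ≤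
      3 * (M * Real.exp (τ * (‖a‖ + δ / 2))) * Real.exp (τ * ‖v‖) * (‖v‖ / (δ / 4)) ^ n := by
  set M' := M * Real.exp (τ * (‖a‖ + δ / 2)) with hM'
  have hM'0 : 0 ≤ M' := by positivity
  have hT := abs_taylorTerm_le hδ hM hτ hVa hVext hVg a v
  set q := ‖v‖ / (δ / 4) with hq
  have hq0 : 0 ≤ q := by positivity
  have hq2 : ‖v‖ / (δ / 2) = q * (1 / 2) := by rw [hq]; field_simp; norm_num
  have he1 : 1 ≤ Real.exp (τ * ‖v‖) := Real.one_le_exp (by positivity)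
  have hgeom : ∀ p, (M' * (‖v‖ / (δ / 2)) ^ p : ℝ) = M' * q ^ p * (1 / 2) ^ p := fun p => by
    rw [hq2, mul_pow]; ring
  by_cases hv : q ≤ 1
  · -- Inside the ball of convergence the remainder is the tail of the Taylor series.
    have hv' : ‖v‖ ≤ δ / 4 := by rwa [hq, div_le_one (by positivity)] at hv
    set f := fun s : ℂ => Vc (complexify a + s • complexify v) with hf
    have hd : DifferentiableOn ℂ f (Metric.ball 0 2) := fun s hs => by
      rw [mem_ball_zero_iff] at hs
      refine (analyticAt_line hVa a v ?_).differentiableAt.differentiableWithinAt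
      have := mul_le_mul hs.le hv' (norm_nonneg v) (by norm_num)
      linarith
    have h1 := hasSum_taylorSeries_on_ball (z := 1) (c := 0) (r := 2) hd (by simp)
    have h2 : HasSum (fun p => taylorTerm V p a v) (V (a + v)) := by
      rw [← hasSum_ofReal]
      have e1 : f 1 = ((V (a + v) : ℝ) : ℂ) := by
        rw [← hVext]
        simp only [hf]
        congr 1
        ext i
        simp [complexify]
      rw [← e1]
      refine h1.congr_fun fun p => ?_
      have h0 := iteratedDeriv_line hδ hVa hVext a v p 0 (by simpa using hδ)
      simp only [zero_smul, add_zero, ofReal_zero] at h0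
      have hfp : (p.factorial : ℂ) ≠ 0 := by exact_mod_cast p.factorial_ne_zero
      rw [h0]
      push_cast
      simp [hfp]
    have h3 := (hasSum_nat_add_iff' n).2 h2
    have h4 : HasSum (fun p : ℕ => M' * q ^ n * (1 / 2) ^ p) (M' * q ^ n * 2) :=
      hasSum_geometric_two.mul_left _
    have h5 : ‖V (a + v) - ∑ p ∈ Finset.range n, taylorTerm V p a v‖ ≤ M' * q ^ n * 2 := by
      refine HasSum.norm_le_of_bounded h3 h4 fun p => ?_
      refine (hT _).trans ?_
      rw [hgeom, pow_add, pow_add]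
      have e1 : q ^ p ≤ 1 := pow_le_one₀ hq0 hv
      have e2 : (1 / 2 : ℝ) ^ n ≤ 1 := pow_le_one₀ (by norm_num) (by norm_num)
      have e3 : 0 ≤ M' * q ^ n * (1 / 2) ^ p := by positivity
      calc M' * (q ^ p * q ^ n) * ((1 / 2) ^ p * (1 / 2) ^ n) =
          M' * q ^ n * (1 / 2) ^ p * (q ^ p * (1 / 2) ^ n) := by ring
        _ ≤ M' * q ^ n * (1 / 2) ^ p * 1 := by
            gcongr
            exact mul_le_one₀ e1 (by positivity) e2
        _ = _ := mul_one _
    rw [Real.norm_eq_abs] at h5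
    refine h5.trans ?_
    have : 0 ≤ M' * q ^ n := by positivity
    nlinarith
  · -- Outside, each term is bounded by the right-hand side.
    push Not at hv
    have h1 : |V (a + v)| ≤ M' * Real.exp (τ * ‖v‖) * q ^ n := by
      refine (abs_potential_le hδ hVext hVg (a + v)).trans ?_
      have e1 : 1 ≤ q ^ n := one_le_pow₀ hv.le
      calc M * Real.exp (τ * ‖a + v‖) ≤ M * Real.exp (τ * (‖a‖ + δ / 2) + τ * ‖v‖) := by
            gcongr
            have := norm_add_le a v
            nlinarith
        _ = M' * Real.exp (τ * ‖v‖) * 1 := by rw [Real.exp_add, hM']; ring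
        _ ≤ _ := by gcongr
    have h2 : |∑ p ∈ Finset.range n, taylorTerm V p a v| ≤ M' * q ^ n * 2 := by
      refine (Finset.abs_sum_le_sum_abs _ _).trans ?_
      calc _ ≤ ∑ p ∈ Finset.range n, M' * q ^ n * (1 / 2) ^ p := by
            refine Finset.sum_le_sum fun p hp => (hT p).trans ?_
            rw [hgeom]
            gcongr
            · exact hv.le
            · exact (Finset.mem_range.1 hp).le
        _ ≤ M' * q ^ n * 2 := by
            rw [← Finset.mul_sum]
            gcongr
            exact sum_geometric_two_le n
    have h3 := abs_sub (V (a + v)) (∑ p ∈ Finset.range n, taylorTerm V p a v)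
    have : 0 ≤ M' * q ^ n := by positivity
    nlinarith

end Cauchy


/-! ### Banded quadratic forms with exponential weights -/

section Band

/-- A quadratic form of norm at most `ε` that connects only indices whose orders differ by at
most `p` stays bounded with respect to an exponential weight in the order. -/
theorem norm_weighted_form_le {ι : Type*} (s : Finset ι) (o : ι → ℕ) (K : ι → ι → ℂ) (p : ℕ)
    {ε : ℝ} (hε : 0 ≤ ε)
    (hK : ∀ u v : ι → ℂ, ‖∑ k ∈ s, ∑ j ∈ s, starRingEnd ℂ (u k) * K k j * v j‖ ≤
      ε * Real.sqrt (∑ k ∈ s, ‖u k‖ ^ 2) * Real.sqrt (∑ j ∈ s, ‖v j‖ ^ 2))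
    (hband : ∀ k ∈ s, ∀ j ∈ s, o j + p < o k ∨ o k + p < o j → K k j = 0) (c : ι → ℂ) :
    ‖∑ k ∈ s, ∑ j ∈ s, (Real.exp (2 * o k) : ℂ) * (starRingEnd ℂ (c k) * K k j * c j)‖ ≤
      (2 * p + 1) * Real.exp p * ε * ∑ k ∈ s, Real.exp (2 * o k) * ‖c k‖ ^ 2 := by
  classical
  set N := s.image o with hN
  set S : ℕ → ℝ := fun n => ∑ k ∈ s.filter (fun k => o k = n), ‖c k‖ ^ 2 with hS
  have hS0 : ∀ n, 0 ≤ S n := fun n => Finset.sum_nonneg fun _ _ => by positivity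
  set β : ℕ → ℝ := fun n => Real.exp (2 * n) * S n with hβ
  have hβ0 : ∀ n, 0 ≤ β n := fun n => mul_nonneg (Real.exp_nonneg _) (hS0 n)
  have hmaps : ∀ k ∈ s, o k ∈ N := fun k hk => Finset.mem_image_of_mem o hk
  set T : ℕ → ℕ → ℂ := fun n' n => ∑ k ∈ s.filter (fun k => o k = n'),
    ∑ j ∈ s.filter (fun j => o j = n),
      (Real.exp (2 * o k) : ℂ) * (starRingEnd ℂ (c k) * K k j * c j) with hT
  -- Decompose the form into blocks of fixed orders `n'` and `n`; only `|n' - n| ≤ p` contributes.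
  have hsplit : ∑ k ∈ s, ∑ j ∈ s, (Real.exp (2 * o k) : ℂ) * (starRingEnd ℂ (c k) * K k j * c j) =
      ∑ n' ∈ N, ∑ n ∈ N, T n' n := by
    rw [← Finset.sum_fiberwise_of_maps_to hmaps]
    refine Finset.sum_congr rfl fun n' _ => ?_
    simp only [hT]
    rw [Finset.sum_comm (s := N)]
    refine Finset.sum_congr rfl fun k _ => ?_
    rw [← Finset.sum_fiberwise_of_maps_to hmaps]
  have hβsum : ∑ n ∈ N, β n = ∑ k ∈ s, Real.exp (2 * o k) * ‖c k‖ ^ 2 := by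
    rw [← Finset.sum_fiberwise_of_maps_to hmaps]
    refine Finset.sum_congr rfl fun n _ => ?_
    simp only [hβ, hS, Finset.mul_sum]
    exact Finset.sum_congr rfl fun k hk => by rw [(Finset.mem_filter.1 hk).2]
  have hTle : ∀ n' n, ‖T n' n‖ ≤
      if n ≤ n' + p ∧ n' ≤ n + p then Real.exp p * ε * ((β n' + β n) / 2) else 0 := by
    intro n' n
    split_ifs with hnn
    · have h1 := hK (fun k => if o k = n' then c k else 0) (fun j => if o j = n then c j else 0)
      have e1 : ∀ m, ∑ k ∈ s, ‖if o k = m then c k else 0‖ ^ 2 = S m := by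
        intro m
        simp only [hS]
        rw [Finset.sum_filter]
        exact Finset.sum_congr rfl fun k _ => by split_ifs <;> simp
      rw [e1, e1] at h1
      have e2 : T n' n = (Real.exp (2 * n') : ℂ) * ∑ k ∈ s, ∑ j ∈ s,
          starRingEnd ℂ (if o k = n' then c k else 0) * K k j * (if o j = n then c j else 0) := by
        simp only [hT, Finset.mul_sum]
        rw [Finset.sum_filter]
        refine Finset.sum_congr rfl fun k _ => ?_
        rw [Finset.sum_filter]
        split_ifs with hk
        · refine Finset.sum_congr rfl fun j _ => ?_
          split_ifs
          · rw [hk]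
          · simp
        · simp
      rw [e2, norm_mul, norm_real, Real.norm_of_nonneg (Real.exp_nonneg _)]
      -- Within a block the weight is shared between both factors at the cost of `e^{n' - n} ≤ e^p`.
      have e3 : Real.exp (2 * n') = Real.exp ((n' : ℝ) - n) * (Real.exp n' * Real.exp n) := by
        rw [← Real.exp_add, ← Real.exp_add]; congr 1; ring
      have e4 : Real.exp ((n' : ℝ) - n) ≤ Real.exp p := by
        refine Real.exp_le_exp.2 ?_
        have : (n' : ℝ) ≤ n + p := by exact_mod_cast hnn.2
        linarith
      have e5 : ∀ m : ℕ, (Real.exp m * Real.sqrt (S m)) ^ 2 = β m := by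
        intro m
        rw [mul_pow, Real.sq_sqrt (hS0 m), ← Real.exp_nat_mul]
        push_cast
        rfl
      have e6 : (Real.exp n' * Real.sqrt (S n')) * (Real.exp n * Real.sqrt (S n)) ≤
          (β n' + β n) / 2 := by
        rw [← e5, ← e5]
        nlinarith [sq_nonneg (Real.exp n' * Real.sqrt (S n') - Real.exp n * Real.sqrt (S n))]
      calc _ ≤ Real.exp (2 * n') * (ε * Real.sqrt (S n') * Real.sqrt (S n)) := by gcongr
        _ = Real.exp ((n' : ℝ) - n) * ε *
            ((Real.exp n' * Real.sqrt (S n')) * (Real.exp n * Real.sqrt (S n))) := by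
            rw [e3]; ring
        _ ≤ _ := by gcongr
    · refine le_of_eq (norm_eq_zero.2 (Finset.sum_eq_zero fun k hk =>
        Finset.sum_eq_zero fun j hj => ?_))
      rw [Finset.mem_filter] at hk hj
      rw [hband k hk.1 j hj.1 (by omega)]
      simp
  rw [hsplit, ← hβsum]
  -- Schur test: each block has at most `2p + 1` neighbours.
  have hcard : ∀ n', ((N.filter (fun n => n ≤ n' + p ∧ n' ≤ n + p)).card : ℝ) ≤ 2 * p + 1 := by
    intro n'
    have h1 : N.filter (fun n => n ≤ n' + p ∧ n' ≤ n + p) ⊆ Finset.Icc (n' - p) (n' + p) := by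
      intro n hn
      rw [Finset.mem_filter] at hn
      rw [Finset.mem_Icc]
      omega
    have h2 := Finset.card_le_card h1
    rw [Nat.card_Icc] at h2
    have h3 : (N.filter (fun n => n ≤ n' + p ∧ n' ≤ n + p)).card ≤ 2 * p + 1 := by omega
    exact_mod_cast h3
  have hhalf : ∑ n' ∈ N, ∑ n ∈ N, (if n ≤ n' + p ∧ n' ≤ n + p then β n' else 0) ≤
      (2 * p + 1) * ∑ n ∈ N, β n := by
    rw [Finset.mul_sum]
    refine Finset.sum_le_sum fun n' _ => ?_
    rw [← Finset.sum_filter, Finset.sum_const, nsmul_eq_mul]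
    exact mul_le_mul_of_nonneg_right (hcard n') (hβ0 n')
  have hhalf' : ∑ n' ∈ N, ∑ n ∈ N, (if n ≤ n' + p ∧ n' ≤ n + p then β n else 0) ≤
      (2 * p + 1) * ∑ n ∈ N, β n := by
    rw [Finset.sum_comm]
    refine le_trans (le_of_eq ?_) hhalf
    exact Finset.sum_congr rfl fun n' _ => Finset.sum_congr rfl fun n _ => by
      simp only [and_comm]
  calc ‖∑ n' ∈ N, ∑ n ∈ N, T n' n‖ ≤ ∑ n' ∈ N, ∑ n ∈ N, ‖T n' n‖ :=
        (norm_sum_le _ _).trans (Finset.sum_le_sum fun n' _ => norm_sum_le _ _)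
    _ ≤ ∑ n' ∈ N, ∑ n ∈ N, (if n ≤ n' + p ∧ n' ≤ n + p then
          Real.exp p * ε * ((β n' + β n) / 2) else 0) :=
        Finset.sum_le_sum fun n' _ => Finset.sum_le_sum fun n _ => hTle n' n
    _ = Real.exp p * ε / 2 *
        (∑ n' ∈ N, ∑ n ∈ N, (if n ≤ n' + p ∧ n' ≤ n + p then β n' else 0) +
          ∑ n' ∈ N, ∑ n ∈ N, (if n ≤ n' + p ∧ n' ≤ n + p then β n else 0)) := by
        rw [← Finset.sum_add_distrib, Finset.mul_sum]
        refine Finset.sum_congr rfl fun n' _ => ?_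
        rw [← Finset.sum_add_distrib, Finset.mul_sum]
        refine Finset.sum_congr rfl fun n _ => ?_
        split_ifs <;> ring
    _ ≤ Real.exp p * ε / 2 * ((2 * p + 1) * ∑ n ∈ N, β n + (2 * p + 1) * ∑ n ∈ N, β n) := by
        gcongr
    _ = _ := by ring

/-- A form of Gronwall's inequality on a symmetric time interval. -/
theorem le_exp_mul_of_abs_deriv_le {Y Y' : ℝ → ℝ} {K T : ℝ} (hY : ∀ t, HasDerivAt Y (Y' t) t)
    (hle : ∀ t, |t| ≤ T → |Y' t| ≤ K * Y t) {t : ℝ} (ht : |t| ≤ T) :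
    Y t ≤ Y 0 * Real.exp (K * |t|) := by
  have key : ∀ {Z Z' : ℝ → ℝ}, (∀ t, HasDerivAt Z (Z' t) t) →
      (∀ t, |t| ≤ T → |Z' t| ≤ K * Z t) → ∀ t, 0 ≤ t → t ≤ T → Z t ≤ Z 0 * Real.exp (K * t) := by
    intro Z Z' hZ hZle t ht0 htT
    have hd : ∀ s, HasDerivAt (fun s => Z s * Real.exp (-(K * s)))
        (Z' s * Real.exp (-(K * s)) + Z s * (Real.exp (-(K * s)) * -(K * 1))) s := fun s =>
      (hZ s).mul ((((hasDerivAt_id s).const_mul K).neg).exp)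
    have hanti : AntitoneOn (fun s => Z s * Real.exp (-(K * s))) (Set.Icc 0 T) := by
      refine antitoneOn_of_deriv_nonpos (convex_Icc 0 T)
        (fun s _ => (hd s).continuousAt.continuousWithinAt)
        (fun s _ => (hd s).differentiableAt.differentiableWithinAt) fun s hs => ?_
      rw [interior_Icc] at hs
      rw [(hd s).deriv]
      have h1 := (le_abs_self _).trans (hZle s (by rw [abs_of_pos hs.1]; exact hs.2.le))
      have h2 := Real.exp_pos (-(K * s))
      nlinarith
    have h1 := hanti ⟨le_rfl, ht0.trans htT⟩ ⟨ht0, htT⟩ ht0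
    simp only [mul_zero, neg_zero, Real.exp_zero, mul_one] at h1
    rw [Real.exp_neg, ← div_eq_mul_inv, div_le_iff₀ (Real.exp_pos _)] at h1
    exact h1
  rcases le_total 0 t with h | h
  · rw [abs_of_nonneg h] at ht ⊢
    exact key hY hle t h ht
  · rw [abs_of_nonpos h] at ht ⊢
    have h1 : ∀ t, HasDerivAt (fun s => Y (-s)) (-Y' (-t)) t := fun t => by
      simpa [Function.comp_def] using HasDerivAt.scomp t (hY (-t)) (hasDerivAt_neg' t)
    simpa using key h1 (fun s hs => by simpa using hle (-s) (by simpa using hs)) (-t) (by linarith) ht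

end Band

/-! ### Multiplication by the Taylor polynomials of the potential -/

section TaylorMul

variable {d : ℕ} {A B : Matrix (Fin d) (Fin d) ℂ} (hAB : IsSymplecticPair A B) (r : ℂ) {h : ℝ}
  (hh : 0 < h) (a η : RSpace d)

include hAB hh in
theorem monomial_mul_packetSum (m : Fin d → ℕ) {n : ℕ} {c : (Fin d → ℕ) → ℂ}
    (hc : ∀ j, n < order j → c j = 0) : ∃ c', (∀ j, n + order m < order j → c' j = 0) ∧
      ∀ x, ((∏ i, (x - a) i ^ m i : ℝ) : ℂ) * packetSum A B r h a η n c x =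
        packetSum A B r h a η (n + order m) c' x := by
  induction m using multiIndex_induction with
  | zero => exact ⟨c, by simpa [order] using hc, fun x => by simp [order]⟩
  | add m i ih =>
    obtain ⟨c', hc', he⟩ := ih
    refine ⟨coordCoef A h i c', ?_, fun x => ?_⟩
    · rw [order_add, order_single, ← add_assoc]
      exact coordCoef_eq_zero A h i hc'
    · rw [order_add, order_single, ← add_assoc, ← coord_mul_packetSum hAB r hh a η i hc', ← he,
        prod_pow_add_single]
      push_cast
      rw [PiLp.sub_apply]
      push_cast
      ring

include hAB hh in
/-- Multiplication by the homogeneous Taylor part of degree `p` increases the order of a sum of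
wave packets at most by `p`. -/
theorem taylorTerm_mul_packetSum (V : RSpace d → ℝ) (p : ℕ) {n : ℕ} {c : (Fin d → ℕ) → ℂ}
    (hc : ∀ j, n < order j → c j = 0) : ∃ c', (∀ j, n + p < order j → c' j = 0) ∧
      ∀ x, (taylorTerm V p a (x - a) : ℂ) * packetSum A B r h a η n c x =
        packetSum A B r h a η (n + p) c' x := by
  choose c' hc' he using fun m => monomial_mul_packetSum hAB r hh a η m hc
  refine ⟨fun k => ∑ m ∈ (indicesUpTo d p).filter (fun m => order m = p),
    ((multiD m V a / (multiFactorial m : ℝ) : ℝ) : ℂ) * c' m k, fun j hj => ?_, fun x => ?_⟩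
  · refine Finset.sum_eq_zero fun m hm => ?_
    rw [hc' m j (by rw [(Finset.mem_filter.1 hm).2]; exact hj), mul_zero]
  · unfold taylorTerm
    rw [ofReal_sum, Finset.sum_mul]
    have e1 : ∀ m ∈ (indicesUpTo d p).filter (fun m => order m = p),
        ((multiD m V a / (multiFactorial m : ℝ) * ∏ i, (x - a) i ^ m i : ℝ) : ℂ) *
          packetSum A B r h a η n c x =
        ((multiD m V a / (multiFactorial m : ℝ) : ℝ) : ℂ) *
          packetSum A B r h a η (n + p) (c' m) x := by
      intro m hm
      have h1 := he m x
      rw [(Finset.mem_filter.1 hm).2] at h1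
      rw [← h1, ofReal_mul, mul_assoc]
    rw [Finset.sum_congr rfl e1]
    unfold packetSum
    simp only [Finset.mul_sum, Finset.sum_mul]
    rw [Finset.sum_comm]
    exact Finset.sum_congr rfl fun k _ => Finset.sum_congr rfl fun m _ => by ring

variable {V : RSpace d → ℝ} {Vc : CSpace d → ℂ} {δ M τ : ℝ}
  (hδ : 0 < δ) (hM : 0 < M) (hτ : 0 < τ) (hVa : AnalyticOnNhd ℂ Vc (strip d δ))
  (hVext : ∀ x : RSpace d, Vc (complexify x) = ((V x : ℝ) : ℂ))
  (hVg : ∀ z ∈ strip d δ, ‖Vc z‖ ≤ M * Real.exp (τ * ‖z‖))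

include hAB hh hδ hM in
/-- A function of the size of a Taylor remainder, applied to a combination of wave packets. The number
`q` measures the spread of packets of order at most `n + p` relative to the width of the strip. -/
theorem norm_remainder_mul_packetSum_le (hr : r ^ 2 = A.det) (p n : ℕ) {q : ℝ}
    (hq : (d * (d + 2) * h * opNorm A ^ 2) * (n + p) ≤ (δ / 4 * q) ^ 2) {c : (Fin d → ℕ) → ℂ}
    (hc : ∀ j, n < order j → c j = 0) {F : RSpace d → ℝ} (hF : Continuous F)
    (hFle : ∀ x, |F x| ≤ 3 * (M * Real.exp (τ * (‖a‖ + δ / 2))) * Real.exp (τ * ‖x - a‖) *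
      (‖x - a‖ / (δ / 4)) ^ p) :
    MemLp (fun x => (F x : ℂ) * packetSum A B r h a η n c x) 2 volume ∧
    ‖toL2 (fun x => (F x : ℂ) * packetSum A B r h a η n c x)‖ ^ 2 ≤
      18 * (M * Real.exp (τ * (‖a‖ + δ / 2))) ^ 2 * q ^ (2 * p) * 2 ^ (n + p) *
        Real.exp (8 * τ ^ 2 * (d * (d + 2) * h * opNorm A ^ 2)) *
          ∑ j ∈ indicesUpTo d n, ‖c j‖ ^ 2 := by
  set M' := M * Real.exp (τ * (‖a‖ + δ / 2)) with hM'
  have hM'0 : 0 ≤ M' := by positivity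
  set s := ∑ j ∈ indicesUpTo d n, ‖c j‖ ^ 2 with hs
  have hs0 : 0 ≤ s := Finset.sum_nonneg fun _ _ => by positivity
  have hmom := integrable_exp_moment (continuous_packetSum hAB r hh a η n c)
    (gaussDecay_packetSum hAB r hh a η n c) a τ p
  have hpt : ∀ x, ‖(F x : ℂ) * packetSum A B r h a η n c x‖ ^ 2 ≤
      (9 * M' ^ 2 * ((δ / 4) ^ (2 * p))⁻¹) * (Real.exp (2 * τ * ‖x - a‖) *
          (‖x - a‖ ^ (2 * p) * ‖packetSum A B r h a η n c x‖ ^ 2)) := by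
    intro x
    have h2 := pow_le_pow_left₀ (abs_nonneg _) (hFle x) 2
    rw [norm_mul, norm_real, Real.norm_eq_abs, mul_pow]
    refine (mul_le_mul_of_nonneg_right h2 (by positivity)).trans (le_of_eq ?_)
    rw [mul_pow, mul_pow, mul_pow, ← pow_mul, mul_comm p 2, div_pow, ← Real.exp_nat_mul,
      show ((2 : ℕ) : ℝ) * (τ * ‖x - a‖) = 2 * τ * ‖x - a‖ by push_cast; ring]
    ring
  have hcont : Continuous fun x => (F x : ℂ) * packetSum A B r h a η n c x :=
    (continuous_ofReal.comp hF).mul (continuous_packetSum hAB r hh a η n c)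
  have hint : Integrable (fun x => ‖(F x : ℂ) * packetSum A B r h a η n c x‖ ^ 2) :=
    (hmom.const_mul (9 * M' ^ 2 * ((δ / 4) ^ (2 * p))⁻¹)).mono'
      (hcont.norm.pow 2).aestronglyMeasurable (Eventually.of_forall fun x => by
        rw [Real.norm_of_nonneg (by positivity)]; exact hpt x)
  have hmem : MemLp (fun x => (F x : ℂ) * packetSum A B r h a η n c x) 2 volume :=
    (memLp_two_iff_integrable_sq_norm hcont.aestronglyMeasurable).2 hint
  refine ⟨hmem, ?_⟩
  rw [norm_toL2_sq hmem]
  calc _ ≤ ∫ x, (9 * M' ^ 2 * ((δ / 4) ^ (2 * p))⁻¹) * (Real.exp (2 * τ * ‖x - a‖) *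
          (‖x - a‖ ^ (2 * p) * ‖packetSum A B r h a η n c x‖ ^ 2)) :=
        integral_mono hint (hmom.const_mul _) hpt
    _ = (9 * M' ^ 2 * ((δ / 4) ^ (2 * p))⁻¹) * ∫ x, (Real.exp (2 * τ * ‖x - a‖) *
          (‖x - a‖ ^ (2 * p) * ‖packetSum A B r h a η n c x‖ ^ 2)) := integral_const_mul _ _
    _ ≤ (9 * M' ^ 2 * ((δ / 4) ^ (2 * p))⁻¹) * (2 * (δ / 4 * q) ^ (2 * p) * 2 ^ (n + p) *
        Real.exp (8 * τ ^ 2 * (d * (d + 2) * h * opNorm A ^ 2)) * s) := by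
        gcongr
        refine (integral_exp_moment_le hAB r hh a η hr τ p n hc).trans ?_
        gcongr
        rw [pow_mul]
        exact pow_le_pow_left₀ (by positivity) hq p
    _ = _ := by
        rw [mul_pow (δ / 4)]
        field_simp
        ring

include hAB hh hδ hM hτ hVa hVext hVg

/-- On combinations of wave packets of order at most `n`, the homogeneous Taylor part of degree `p` has
operator norm at most a multiple of `q ^ p`. -/
theorem norm_taylorTerm_mul_packetSum_le (hr : r ^ 2 = A.det) (p n : ℕ) {q : ℝ} (hq0 : 0 ≤ q)
    (hq : (d * (d + 2) * h * opNorm A ^ 2) * (n + p) ≤ (δ / 2 * q) ^ 2) {c : (Fin d → ℕ) → ℂ}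
    (hc : ∀ j, n < order j → c j = 0) :
    ‖toL2 (fun x => (taylorTerm V p a (x - a) : ℂ) * packetSum A B r h a η n c x)‖ ≤
      M * Real.exp (τ * (‖a‖ + δ / 2)) * q ^ p *
        Real.sqrt (∑ j ∈ indicesUpTo d n, ‖c j‖ ^ 2) := by
  set M' := M * Real.exp (τ * (‖a‖ + δ / 2)) with hM'
  have hM'0 : 0 ≤ M' := by positivity
  set s := ∑ j ∈ indicesUpTo d n, ‖c j‖ ^ 2 with hs
  have hs0 : 0 ≤ s := Finset.sum_nonneg fun _ _ => by positivity
  obtain ⟨c', -, he⟩ := taylorTerm_mul_packetSum hAB r hh a η V p hc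
  have hfun : (fun x => (taylorTerm V p a (x - a) : ℂ) * packetSum A B r h a η n c x) =
      packetSum A B r h a η (n + p) c' := funext he
  have hmem : MemLp (fun x => (taylorTerm V p a (x - a) : ℂ) * packetSum A B r h a η n c x) 2
      volume := by rw [hfun]; exact memLp_packetSum hAB r hh a η _ _
  refine le_of_sq_le_sq ?_ (by positivity)
  rw [norm_toL2_sq hmem, mul_pow, Real.sq_sqrt hs0]
  have hint := (memLp_two_iff_integrable_sq_norm hmem.1).1 hmem
  have hmom := integrable_moment (continuous_packetSum hAB r hh a η n c)
    (gaussDecay_packetSum hAB r hh a η n c) a p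
  calc _ ≤ ∫ x, (M' ^ 2 * ((δ / 2) ^ (2 * p))⁻¹) *
          (‖x - a‖ ^ (2 * p) * ‖packetSum A B r h a η n c x‖ ^ 2) := by
        refine integral_mono hint (hmom.const_mul _) fun x => ?_
        have h1 := abs_taylorTerm_le hδ hM hτ hVa hVext hVg a (x - a) p
        have h2 := pow_le_pow_left₀ (abs_nonneg _) h1 2
        simp only [norm_mul, norm_real, Real.norm_eq_abs]
        rw [mul_pow]
        refine (mul_le_mul_of_nonneg_right h2 (by positivity)).trans (le_of_eq ?_)
        rw [mul_pow, ← pow_mul, mul_comm p 2, div_pow, ← hM']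
        ring
    _ = (M' ^ 2 * ((δ / 2) ^ (2 * p))⁻¹) *
          ∫ x, ‖x - a‖ ^ (2 * p) * ‖packetSum A B r h a η n c x‖ ^ 2 := integral_const_mul _ _
    _ ≤ (M' ^ 2 * ((δ / 2) ^ (2 * p))⁻¹) * ((δ / 2 * q) ^ (2 * p) * s) := by
        gcongr
        refine (integral_moment_le hAB r hh a η hr p n hc).trans ?_
        gcongr
        rw [pow_mul]
        refine le_trans ?_ (pow_le_pow_left₀ (by positivity) hq p)
        rw [mul_pow (d * (d + 2) * h * opNorm A ^ 2 : ℝ)]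
        gcongr
        exact_mod_cast Nat.ascFactorial_le_pow_add n p
    _ = (M' * q ^ p) ^ 2 * s := by
        rw [mul_pow (δ / 2), mul_pow M', ← pow_mul, mul_comm p 2]
        field_simp

end TaylorMul


/-! ### The matrix elements of the Taylor polynomials -/

section MatrixElements

variable {d : ℕ} {A B : Matrix (Fin d) (Fin d) ℂ} (hAB : IsSymplecticPair A B) (r : ℂ) {h : ℝ}
  (hh : 0 < h) (a η : RSpace d)

/-- The matrix element of the homogeneous Taylor part of degree `p` between two wave packets. -/
noncomputable def termK (V : RSpace d → ℝ) (p : ℕ) (A B : Matrix (Fin d) (Fin d) ℂ) (r : ℂ) (h : ℝ)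
    (a η : RSpace d) (k j : Fin d → ℕ) : ℂ :=
  ∫ x, starRingEnd ℂ (packet A B r h a η k x) * (taylorTerm V p a (x - a) : ℂ) *
    packet A B r h a η j x

theorem packet_eq_packetSum (j : Fin d → ℕ) :
    packet A B r h a η j = packetSum A B r h a η (order j) (fun k => if k = j then 1 else 0) := by
  ext x
  unfold packetSum
  rw [Finset.sum_eq_single j (fun k _ hk => by simp [hk])
    (fun hj => absurd ((mem_indicesUpTo j).2 le_rfl) hj)]
  simp

include hAB hh

theorem taylorTerm_mul_packet (V : RSpace d → ℝ) (p : ℕ) (j : Fin d → ℕ) :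
    ∃ c, (fun x => (taylorTerm V p a (x - a) : ℂ) * packet A B r h a η j x) =
      packetSum A B r h a η (order j + p) c := by
  obtain ⟨c, -, hc⟩ := taylorTerm_mul_packetSum hAB r hh a η V p (n := order j)
    (c := fun k => if k = j then 1 else 0) (fun k hk => by
      rw [if_neg]; rintro rfl; exact lt_irrefl _ hk)
  refine ⟨c, ?_⟩
  rw [packet_eq_packetSum]
  exact funext hc

theorem memLp_taylorTerm_mul_packet (V : RSpace d → ℝ) (p : ℕ) (j : Fin d → ℕ) :
    MemLp (fun x => (taylorTerm V p a (x - a) : ℂ) * packet A B r h a η j x) 2 volume := by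
  obtain ⟨c, hc⟩ := taylorTerm_mul_packet hAB r hh a η V p j
  rw [hc]
  exact memLp_packetSum hAB r hh a η _ _

theorem termK_eq_inner (V : RSpace d → ℝ) (p : ℕ) (k j : Fin d → ℕ) :
    termK V p A B r h a η k j = inner ℂ (toL2 (packet A B r h a η k))
      (toL2 (fun x => (taylorTerm V p a (x - a) : ℂ) * packet A B r h a η j x)) := by
  rw [inner_toL2 (memLp_packet_static hAB r hh a η k) (memLp_taylorTerm_mul_packet hAB r hh a η V p j)]
  unfold termK
  simp only [mul_assoc]

omit hAB hh in
theorem star_termK (V : RSpace d → ℝ) (p : ℕ) (k j : Fin d → ℕ) :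
    starRingEnd ℂ (termK V p A B r h a η k j) = termK V p A B r h a η j k := by
  unfold termK
  rw [← integral_conj]
  refine integral_congr_ae (Eventually.of_forall fun x => ?_)
  simp only [map_mul, conj_conj, conj_ofReal]
  ring

/-- The matrix of the homogeneous Taylor part of degree `p` is banded: such a polynomial changes the
order of a wave packet by at most `p`. -/
theorem termK_eq_zero (hr : r ^ 2 = A.det) (V : RSpace d → ℝ) (p : ℕ) (k j : Fin d → ℕ)
    (hkj : order j + p < order k ∨ order k + p < order j) : termK V p A B r h a η k j = 0 := by
  have key : ∀ k j : Fin d → ℕ, order j + p < order k → termK V p A B r h a η k j = 0 := by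
    intro k j hkj
    obtain ⟨c, hc⟩ := taylorTerm_mul_packet hAB r hh a η V p j
    rw [termK_eq_inner hAB r hh, hc, toL2_packetSum hAB r hh, inner_sum]
    refine Finset.sum_eq_zero fun i hi => ?_
    rw [mem_indicesUpTo] at hi
    have hik : k ≠ i := by rintro rfl; omega
    rw [inner_smul_right, (orthonormal_packet hAB r hh a η hr).2 hik, mul_zero]
  rcases hkj with hkj | hkj
  · exact key k j hkj
  · rw [← star_termK, key j k hkj, map_zero]

theorem taylorTerm_mul_packetSum_eq_sum (V : RSpace d → ℝ) (p n : ℕ) (v : (Fin d → ℕ) → ℂ) :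
    toL2 (fun x => (taylorTerm V p a (x - a) : ℂ) * packetSum A B r h a η n v x) =
      ∑ j ∈ indicesUpTo d n, v j •
        toL2 (fun x => (taylorTerm V p a (x - a) : ℂ) * packet A B r h a η j x) := by
  have hm := memLp_taylorTerm_mul_packet hAB r hh a η V p
  have e : (fun x => (taylorTerm V p a (x - a) : ℂ) * packetSum A B r h a η n v x) =
      fun x => ∑ j ∈ indicesUpTo d n,
        v j * ((taylorTerm V p a (x - a) : ℂ) * packet A B r h a η j x) := by
    ext x
    unfold packetSum
    rw [Finset.mul_sum]
    exact Finset.sum_congr rfl fun j _ => mul_left_comm _ _ _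
  rw [e, toL2_sum _ fun j _ => (hm j).const_mul _]
  exact Finset.sum_congr rfl fun j _ => toL2_const_mul _ (hm j)

variable {V : RSpace d → ℝ} {Vc : CSpace d → ℂ} {δ M τ : ℝ}
  (hδ : 0 < δ) (hM : 0 < M) (hτ : 0 < τ) (hVa : AnalyticOnNhd ℂ Vc (strip d δ))
  (hVext : ∀ x : RSpace d, Vc (complexify x) = ((V x : ℝ) : ℂ))
  (hVg : ∀ z ∈ strip d δ, ‖Vc z‖ ≤ M * Real.exp (τ * ‖z‖))
include hδ hM hτ hVa hVext hVg

/-- The matrix of the homogeneous Taylor part of degree `p` is bounded by the norm of that part on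
combinations of wave packets. -/
theorem norm_termK_form_le (hr : r ^ 2 = A.det) (p n : ℕ) {q : ℝ} (hq0 : 0 ≤ q)
    (hq : (d * (d + 2) * h * opNorm A ^ 2) * (n + p) ≤ (δ / 2 * q) ^ 2)
    (u v : (Fin d → ℕ) → ℂ) :
    ‖∑ k ∈ indicesUpTo d n, ∑ j ∈ indicesUpTo d n,
        starRingEnd ℂ (u k) * termK V p A B r h a η k j * v j‖ ≤
      (M * Real.exp (τ * (‖a‖ + δ / 2)) * q ^ p) *
        Real.sqrt (∑ k ∈ indicesUpTo d n, ‖u k‖ ^ 2) *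
          Real.sqrt (∑ j ∈ indicesUpTo d n, ‖v j‖ ^ 2) := by
  set v' : (Fin d → ℕ) → ℂ := fun j => if order j ≤ n then v j else 0 with hv'
  have hvv : ∀ j ∈ indicesUpTo d n, v' j = v j := fun j hj =>
    if_pos ((mem_indicesUpTo j).1 hj)
  have e1 : ∑ k ∈ indicesUpTo d n, ∑ j ∈ indicesUpTo d n,
      starRingEnd ℂ (u k) * termK V p A B r h a η k j * v j =
      inner ℂ (toL2 (packetSum A B r h a η n u))
        (toL2 (fun x => (taylorTerm V p a (x - a) : ℂ) * packetSum A B r h a η n v' x)) := by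
    rw [toL2_packetSum hAB r hh, taylorTerm_mul_packetSum_eq_sum hAB r hh, sum_inner]
    refine Finset.sum_congr rfl fun k _ => ?_
    rw [inner_sum]
    refine Finset.sum_congr rfl fun j hj => ?_
    rw [inner_smul_left, inner_smul_right, ← termK_eq_inner hAB r hh, hvv j hj]
    ring
  have h1 := norm_taylorTerm_mul_packetSum_le hAB r hh a η hδ hM hτ hVa hVext hVg hr p n hq0 hq
    (c := v') (fun j hj => if_neg (not_le.2 hj))
  have e2 : ∑ j ∈ indicesUpTo d n, ‖v' j‖ ^ 2 = ∑ j ∈ indicesUpTo d n, ‖v j‖ ^ 2 :=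
    Finset.sum_congr rfl fun j hj => by rw [hvv j hj]
  have h2 : ‖toL2 (packetSum A B r h a η n u)‖ = Real.sqrt (∑ k ∈ indicesUpTo d n, ‖u k‖ ^ 2) := by
    rw [← norm_toL2_packetSum_sq hAB r hh a η hr, Real.sqrt_sq (norm_nonneg _)]
  rw [e1]
  rw [e2] at h1
  refine (norm_inner_le_norm _ _).trans ?_
  rw [h2]
  refine (mul_le_mul_of_nonneg_left h1 (Real.sqrt_nonneg _)).trans (le_of_eq ?_)
  ring

/-- With the weight `e^{2|k|}`, the quadratic form of the homogeneous Taylor part of degree `p`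
is still bounded. -/
theorem norm_weighted_termK_form_le (hr : r ^ 2 = A.det) (p n : ℕ) {q : ℝ} (hq0 : 0 ≤ q)
    (hq : (d * (d + 2) * h * opNorm A ^ 2) * (n + p) ≤ (δ / 2 * q) ^ 2)
    (c : (Fin d → ℕ) → ℂ) :
    ‖∑ k ∈ indicesUpTo d n, ∑ j ∈ indicesUpTo d n, (Real.exp (2 * order k) : ℂ) *
        (starRingEnd ℂ (c k) * termK V p A B r h a η k j * c j)‖ ≤
      (2 * p + 1) * Real.exp p * (M * Real.exp (τ * (‖a‖ + δ / 2)) * q ^ p) *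
        ∑ k ∈ indicesUpTo d n, Real.exp (2 * order k) * ‖c k‖ ^ 2 :=
  norm_weighted_form_le _ order _ p (by positivity)
    (norm_termK_form_le hAB r hh a η hδ hM hτ hVa hVext hVg hr p n hq0 hq)
    (fun k _ j _ hkj => termK_eq_zero hAB r hh a η hr V p k j hkj) c

end MatrixElements

/-! ### The system for the coefficients -/

theorem sum_Icc_three_pow_le {x : ℝ} (hx0 : 0 ≤ x) (hx : x ≤ 1 / 2) (n : ℕ) :
    ∑ p ∈ Finset.Icc 3 n, x ^ p ≤ 2 * x ^ 3 := by
  have e : Finset.Icc 3 n = Finset.Ico 3 (n + 1) := rfl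
  rw [e, Finset.sum_Ico_eq_sum_range]
  simp only [pow_add]
  rw [← Finset.mul_sum, mul_comm]
  refine mul_le_mul_of_nonneg_right ?_ (by positivity)
  calc _ ≤ ∑ i ∈ Finset.range (n + 1 - 3), (1 / 2 : ℝ) ^ i :=
        Finset.sum_le_sum fun i _ => pow_le_pow_left₀ hx0 hx i
    _ ≤ 2 := sum_geometric_two_le _

section Coefficients

variable {d : ℕ} {V : RSpace d → ℝ} {γ : Trajectory d} {J l : ℕ} {c0 : (Fin d → ℕ) → ℂ} {h : ℝ}
  {c : ℝ → (Fin d → ℕ) → ℂ}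

theorem hasDerivAt_weighted_norm (hc : IsCoefficients V γ J c0 l h c) (w : (Fin d → ℕ) → ℝ)
    (t : ℝ) : HasDerivAt (fun s => ∑ k ∈ indicesUpTo d (cutoff J l), w k * ‖c s k‖ ^ 2)
      (2 * ((I * (h : ℂ))⁻¹ * ∑ k ∈ indicesUpTo d (cutoff J l), ∑ j ∈ indicesUpTo d (cutoff J l),
        (w k : ℂ) * (starRingEnd ℂ (c t k) * kernelK V γ l h t k j * c t j)).re) t := by
  have h1 := HasDerivAt.fun_sum (u := indicesUpTo d (cutoff J l)) fun k hk =>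
    ((hc.deriv t k hk).norm_sq).const_mul (w k)
  refine h1.congr_deriv ?_
  rw [Finset.mul_sum, re_sum, Finset.mul_sum]
  refine Finset.sum_congr rfl fun k _ => ?_
  rw [Complex.inner]
  have e : (I * (h : ℂ))⁻¹ * ∑ j ∈ indicesUpTo d (cutoff J l),
      (w k : ℂ) * (starRingEnd ℂ (c t k) * kernelK V γ l h t k j * c t j) =
      (w k : ℂ) * (starRingEnd ℂ (c t k) * ((I * (h : ℂ))⁻¹ *
        ∑ j ∈ indicesUpTo d (cutoff J l), kernelK V γ l h t k j * c t j)) := by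
    simp only [Finset.mul_sum]
    exact Finset.sum_congr rfl fun j _ => by ring
  rw [e, re_ofReal_mul, mul_comm (starRingEnd ℂ (c t k))]
  ring

theorem star_kernelK (t : ℝ) (k j : Fin d → ℕ) :
    starRingEnd ℂ (kernelK V γ l h t k j) = kernelK V γ l h t j k := by
  unfold kernelK
  rw [← integral_conj]
  refine integral_congr_ae (Eventually.of_forall fun x => ?_)
  simp only [map_mul, conj_conj, conj_ofReal]
  ring

/-- The matrix of the system is Hermitian, so the norm of the coefficients is conserved. -/
theorem sum_norm_sq_coefficients (hc : IsCoefficients V γ J c0 l h c)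
    (hc0 : ∑ j ∈ indicesUpTo d J, ‖c0 j‖ ^ 2 = 1) (t : ℝ) :
    ∑ k ∈ indicesUpTo d (cutoff J l), ‖c t k‖ ^ 2 = 1 := by
  have hd : ∀ t, HasDerivAt (fun s => ∑ k ∈ indicesUpTo d (cutoff J l), ‖c s k‖ ^ 2) 0 t := by
    intro t
    have h1 := hasDerivAt_weighted_norm hc (fun _ => 1) t
    simp only [one_mul, ofReal_one] at h1
    refine h1.congr_deriv ?_
    set Q := ∑ k ∈ indicesUpTo d (cutoff J l), ∑ j ∈ indicesUpTo d (cutoff J l),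
      starRingEnd ℂ (c t k) * kernelK V γ l h t k j * c t j with hQ
    have hQc : starRingEnd ℂ Q = Q := by
      rw [hQ]
      simp only [map_sum, map_mul, conj_conj, star_kernelK]
      rw [Finset.sum_comm]
      exact Finset.sum_congr rfl fun k _ => Finset.sum_congr rfl fun j _ => by ring
    obtain ⟨y, hy⟩ := conj_eq_iff_real.1 hQc
    rw [hy, mul_inv, inv_I, ← ofReal_inv, neg_mul, neg_mul, mul_assoc, ← ofReal_mul]
    simp
  have h1 := is_const_of_deriv_eq_zero (fun t => (hd t).differentiableAt) (fun t => (hd t).deriv) t 0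
  rw [h1, ← hc0]
  have hJ : J ≤ cutoff J l := by unfold cutoff; omega
  have h2 : ∀ k ∈ indicesUpTo d (cutoff J l),
      ‖c 0 k‖ ^ 2 = if order k ≤ J then ‖c0 k‖ ^ 2 else 0 := fun k hk => by
    rw [hc.initial k hk]
    split_ifs <;> simp
  rw [Finset.sum_congr rfl h2, ← sum_indicesUpTo_of_le hJ
    (F := fun k => if order k ≤ J then ‖c0 k‖ ^ 2 else 0)
    fun j hj => if_neg (not_le.2 hj)]
  exact Finset.sum_congr rfl fun j hj => if_pos ((mem_indicesUpTo j).1 hj)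

theorem sum_exp_initial_le (hc : IsCoefficients V γ J c0 l h c)
    (hc0 : ∑ j ∈ indicesUpTo d J, ‖c0 j‖ ^ 2 = 1) :
    ∑ k ∈ indicesUpTo d (cutoff J l), Real.exp (2 * order k) * ‖c 0 k‖ ^ 2 ≤ Real.exp (2 * J) := by
  rw [← mul_one (Real.exp (2 * J)), ← sum_norm_sq_coefficients hc hc0 0, Finset.mul_sum]
  refine Finset.sum_le_sum fun k hk => ?_
  rw [hc.initial k hk]
  split_ifs with hkJ
  · gcongr
  · simp

variable {Vc : CSpace d → ℂ} {δ M τ : ℝ} (hγ : γ.IsClassical V)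
  (hδ : 0 < δ) (hM : 0 < M) (hτ : 0 < τ) (hVa : AnalyticOnNhd ℂ Vc (strip d δ))
  (hVext : ∀ x : RSpace d, Vc (complexify x) = ((V x : ℝ) : ℂ))
  (hVg : ∀ z ∈ strip d δ, ‖Vc z‖ ≤ M * Real.exp (τ * ‖z‖)) (hh : 0 < h)
include hγ hδ hVa hVext hh

theorem kernelK_eq_sum (t : ℝ) (k j : Fin d → ℕ) :
    kernelK V γ l h t k j = ∑ p ∈ Finset.Icc 3 (l + 1),
      termK V p (γ.A t) (γ.B t) (γ.r t) h (γ.a t) (γ.η t) k j := by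
  have hp := hγ.pair (contDiff_of_analytic hδ hVa hVext) t
  unfold kernelK termK
  rw [← integral_finsetSum]
  · refine integral_congr_ae (Eventually.of_forall fun x => ?_)
    simp only [taylorZ_eq, Trajectory.packet]
    rw [ofReal_sum, Finset.mul_sum, Finset.sum_mul]
  · intro p _
    have h1 := (memLp_packet_static hp (γ.r t) hh (γ.a t) (γ.η t) k).star.integrable_mul
      (memLp_taylorTerm_mul_packet hp (γ.r t) hh (γ.a t) (γ.η t) V p j)
    refine h1.congr (Eventually.of_forall fun x => ?_)
    simp only [Pi.mul_apply, Pi.star_apply, RCLike.star_def]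
    ring

include hM hτ hVg

/-- The coefficients of the semiclassical approximation decay exponentially in the order: their
weighted norm grows at most at the rate `4 M₁ (2eq)³ / ℏ`, where `q` measures the size of the wave
packets in comparison to the width of the domain of analyticity. -/
theorem weighted_norm_coefficients_le (hc : IsCoefficients V γ J c0 l h c)
    (hc0 : ∑ j ∈ indicesUpTo d J, ‖c0 j‖ ^ 2 = 1) {T q M₁ : ℝ} (hq0 : 0 ≤ q)
    (hq2 : 2 * Real.exp 1 * q ≤ 1 / 2)
    (hq : ∀ t, |t| ≤ T → (d * (d + 2) * h * opNorm (γ.A t) ^ 2) * (cutoff J l + (l + 1 : ℕ)) ≤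
      (δ / 2 * q) ^ 2)
    (hM₁ : ∀ t, |t| ≤ T → M * Real.exp (τ * (‖γ.a t‖ + δ / 2)) ≤ M₁) {t : ℝ} (ht : |t| ≤ T) :
    ∑ k ∈ indicesUpTo d (cutoff J l), Real.exp (2 * order k) * ‖c t k‖ ^ 2 ≤
      Real.exp (2 * J) * Real.exp (4 * M₁ * (2 * Real.exp 1 * q) ^ 3 / h * |t|) := by
  have hV := contDiff_of_analytic hδ hVa hVext
  refine (le_exp_mul_of_abs_deriv_le (hasDerivAt_weighted_norm hc fun k => Real.exp (2 * order k))
    (fun t ht => ?_) ht).trans (mul_le_mul_of_nonneg_right (sum_exp_initial_le hc hc0)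
      (Real.exp_nonneg _))
  set Y := ∑ k ∈ indicesUpTo d (cutoff J l), Real.exp (2 * order k) * ‖c t k‖ ^ 2 with hY
  have hY0 : 0 ≤ Y := Finset.sum_nonneg fun _ _ => by positivity
  have hM₁0 : 0 ≤ M₁ := le_trans (by positivity) (hM₁ t ht)
  have hp := hγ.pair hV t
  set Q := ∑ k ∈ indicesUpTo d (cutoff J l), ∑ j ∈ indicesUpTo d (cutoff J l),
      (Real.exp (2 * order k) : ℂ) * (starRingEnd ℂ (c t k) * kernelK V γ l h t k j * c t j) with hQ
  have hQle : ‖Q‖ ≤ 2 * M₁ * (2 * Real.exp 1 * q) ^ 3 * Y := by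
    have e1 : Q = ∑ p ∈ Finset.Icc 3 (l + 1), ∑ k ∈ indicesUpTo d (cutoff J l),
        ∑ j ∈ indicesUpTo d (cutoff J l), (Real.exp (2 * order k) : ℂ) * (starRingEnd ℂ (c t k) *
          termK V p (γ.A t) (γ.B t) (γ.r t) h (γ.a t) (γ.η t) k j * c t j) := by
      rw [hQ, Finset.sum_comm (s := Finset.Icc 3 (l + 1))]
      refine Finset.sum_congr rfl fun k _ => ?_
      rw [Finset.sum_comm (s := Finset.Icc 3 (l + 1))]
      refine Finset.sum_congr rfl fun j _ => ?_
      rw [kernelK_eq_sum hγ hδ hVa hVext hh, Finset.mul_sum, Finset.sum_mul, Finset.mul_sum]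
    rw [e1]
    refine (norm_sum_le _ _).trans ?_
    calc _ ≤ ∑ p ∈ Finset.Icc 3 (l + 1), M₁ * Y * (2 * Real.exp 1 * q) ^ p := by
          refine Finset.sum_le_sum fun p hpm => ?_
          rw [Finset.mem_Icc] at hpm
          refine (norm_weighted_termK_form_le hp (γ.r t) hh (γ.a t) (γ.η t) hδ hM hτ hVa hVext hVg
            (hγ.r_sq t) p (cutoff J l) hq0 ?_ (c t)).trans ?_
          · refine le_trans ?_ (hq t ht)
            have : (p : ℝ) ≤ (l + 1 : ℕ) := by exact_mod_cast hpm.2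
            gcongr
          -- For `p ≥ 3` the polynomial factor `2p + 1` is absorbed by `2 ^ p`.
          · have e2 : ((2 * p + 1 : ℕ) : ℝ) ≤ (2 ^ p : ℕ) := by
              have : ∀ p, 3 ≤ p → 2 * p + 1 ≤ 2 ^ p := by
                intro p hp
                induction p, hp using Nat.le_induction with
                | base => norm_num
                | succ p hp ih => rw [pow_succ]; omega
              exact_mod_cast this p hpm.1
            push_cast at e2
            have e3 : Real.exp p = Real.exp 1 ^ p := by rw [← Real.exp_nat_mul, mul_one]
            rw [mul_pow, mul_pow, ← e3]
            calc _ ≤ 2 ^ p * Real.exp p * (M₁ * q ^ p) * Y := by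
                  gcongr
                  exact hM₁ t ht
              _ = _ := by ring
      _ = M₁ * Y * ∑ p ∈ Finset.Icc 3 (l + 1), (2 * Real.exp 1 * q) ^ p :=
          (Finset.mul_sum _ _ _).symm
      _ ≤ M₁ * Y * (2 * (2 * Real.exp 1 * q) ^ 3) := by
          gcongr
          exact sum_Icc_three_pow_le (by positivity) hq2 _
      _ = _ := by ring
  rw [abs_mul, abs_two]
  have h1 : |((I * (h : ℂ))⁻¹ * Q).re| ≤ h⁻¹ * ‖Q‖ := by
    refine (abs_re_le_norm _).trans (le_of_eq ?_)
    rw [norm_mul, norm_inv, norm_mul, norm_I, one_mul, norm_real, Real.norm_of_nonneg hh.le]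
  calc _ ≤ 2 * (h⁻¹ * (2 * M₁ * (2 * Real.exp 1 * q) ^ 3 * Y)) := by
        gcongr
        exact h1.trans (by gcongr)
    _ = _ := by field_simp; ring

end Coefficients


/-! ### The residual of the approximation -/

/-- The projection onto the complement of finitely many orthonormal vectors is a contraction. -/
theorem norm_sub_sum_inner_le {ι E : Type*} [NormedAddCommGroup E] [InnerProductSpace ℂ E]
    {v : ι → E} (hv : Orthonormal ℂ v) (s : Finset ι) (f : E) :
    ‖f - ∑ k ∈ s, inner ℂ (v k) f • v k‖ ≤ ‖f‖ := by
  set P := ∑ k ∈ s, inner ℂ (v k) f • v k with hP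
  have h1 : inner ℂ (f - P) P = 0 := by
    rw [hP, inner_sum]
    refine Finset.sum_eq_zero fun k hk => ?_
    rw [inner_smul_right, inner_sub_left, ← inner_conj_symm (∑ i ∈ s, _) (v k),
      hv.inner_right_sum _ hk, inner_conj_symm, sub_self, mul_zero]
  have h2 := norm_add_sq_eq_norm_sq_add_norm_sq_of_inner_eq_zero (f - P) P h1
  rw [sub_add_cancel] at h2
  nlinarith [norm_nonneg (f - P), norm_nonneg P, norm_nonneg f]

section Residual

variable {d : ℕ} {A B : Matrix (Fin d) (Fin d) ℂ} (hAB : IsSymplecticPair A B) (r : ℂ) {h : ℝ}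
  (hh : 0 < h) (a η : RSpace d) {V : RSpace d → ℝ} {Vc : CSpace d → ℂ} {δ M τ : ℝ}
  (hδ : 0 < δ) (hM : 0 < M) (hτ : 0 < τ) (hVa : AnalyticOnNhd ℂ Vc (strip d δ))
  (hVext : ∀ x : RSpace d, Vc (complexify x) = ((V x : ℝ) : ℂ))
  (hVg : ∀ z ∈ strip d δ, ‖Vc z‖ ≤ M * Real.exp (τ * ‖z‖))

include hAB hh in
/-- The projection onto the wave packets of order at most `n` fixes combinations of these packets. -/
theorem toL2_packetSum_sub_sum_inner (hr : r ^ 2 = A.det) {m n : ℕ} (hmn : m ≤ n)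
    (c : (Fin d → ℕ) → ℂ) :
    toL2 (packetSum A B r h a η m c) - ∑ k ∈ indicesUpTo d n,
      inner ℂ (toL2 (packet A B r h a η k)) (toL2 (packetSum A B r h a η m c)) •
        toL2 (packet A B r h a η k) = 0 := by
  have ho := orthonormal_packet hAB r hh a η hr
  rw [sub_eq_zero, toL2_packetSum hAB r hh]
  have hz : ∀ k ∈ indicesUpTo d n, k ∉ indicesUpTo d m →
      inner ℂ (toL2 (packet A B r h a η k))
        (∑ j ∈ indicesUpTo d m, c j • toL2 (packet A B r h a η j)) •
        toL2 (packet A B r h a η k) = 0 := by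
    intro k _ hk
    rw [inner_sum, Finset.sum_eq_zero, zero_smul]
    intro j hj
    have hkj : k ≠ j := by rintro rfl; exact hk hj
    rw [inner_smul_right, ho.2 hkj, mul_zero]
  rw [← Finset.sum_subset (fun j hj => (mem_indicesUpTo j).2
    (((mem_indicesUpTo j).1 hj).trans hmn)) hz]
  refine Finset.sum_congr rfl fun k hk => ?_
  rw [ho.inner_right_sum _ hk]

include hAB hh hδ hM hτ hVa hVext hVg

/-- Multiplication with the Taylor part of degree `p` raises the order by at most `p`, so only
the wave packets whose order exceeds `n - p` contribute beyond the order `n`, and their weight is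
exponentially small. -/
theorem norm_taylorTerm_sub_sum_inner_le (hr : r ^ 2 = A.det) (p n : ℕ) {q : ℝ} (hq0 : 0 ≤ q)
    (hq : (d * (d + 2) * h * opNorm A ^ 2) * (n + p) ≤ (δ / 2 * q) ^ 2) {v : (Fin d → ℕ) → ℂ}
    (hv : ∀ j, n < order j → v j = 0) :
    ‖toL2 (fun x => (taylorTerm V p a (x - a) : ℂ) * packetSum A B r h a η n v x) -
      ∑ k ∈ indicesUpTo d n, inner ℂ (toL2 (packet A B r h a η k))
        (toL2 (fun x => (taylorTerm V p a (x - a) : ℂ) * packetSum A B r h a η n v x)) •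
          toL2 (packet A B r h a η k)‖ ≤
      M * Real.exp (τ * (‖a‖ + δ / 2)) * (Real.exp 1 * q) ^ p * (Real.exp (-n) *
        Real.sqrt (∑ k ∈ indicesUpTo d n, Real.exp (2 * order k) * ‖v k‖ ^ 2)) := by
  have ho := orthonormal_packet hAB r hh a η hr
  -- The part `u` of order at most `n - p` stays in the span, so only the part `w` of order above
  -- `n - p` contributes, and it is small by the weight.
  set u : (Fin d → ℕ) → ℂ := fun j => if order j + p ≤ n then v j else 0 with hu
  set w : (Fin d → ℕ) → ℂ := fun j => if order j + p ≤ n then 0 else v j with hw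
  have hw0 : ∀ j, n < order j → w j = 0 := fun j hj => by
    simp only [hw]; split_ifs <;> simp [hv j hj]
  set R : L2Space d → L2Space d := fun f => f - ∑ k ∈ indicesUpTo d n,
    inner ℂ (toL2 (packet A B r h a η k)) f • toL2 (packet A B r h a η k) with hR
  have hRadd : ∀ f g, R (f + g) = R f + R g := by
    intro f g
    simp only [hR, inner_add_right, add_smul, Finset.sum_add_distrib]
    abel
  have huw : toL2 (fun x => (taylorTerm V p a (x - a) : ℂ) * packetSum A B r h a η n v x) =
      toL2 (fun x => (taylorTerm V p a (x - a) : ℂ) * packetSum A B r h a η n u x) +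
      toL2 (fun x => (taylorTerm V p a (x - a) : ℂ) * packetSum A B r h a η n w x) := by
    rw [taylorTerm_mul_packetSum_eq_sum hAB r hh, taylorTerm_mul_packetSum_eq_sum hAB r hh,
      taylorTerm_mul_packetSum_eq_sum hAB r hh, ← Finset.sum_add_distrib]
    refine Finset.sum_congr rfl fun j _ => ?_
    rw [← add_smul]
    congr 1
    simp only [hu, hw]
    split_ifs <;> simp
  have hRu : R (toL2 (fun x => (taylorTerm V p a (x - a) : ℂ) * packetSum A B r h a η n u x)) =
      0 := by
    by_cases hpn : p ≤ n
    · obtain ⟨c', -, he⟩ := taylorTerm_mul_packetSum hAB r hh a η V p (n := n - p) (c := u)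
        (fun j hj => if_neg (by omega))
      have e1 : packetSum A B r h a η n u = packetSum A B r h a η (n - p) u := by
        ext x
        unfold packetSum
        symm
        refine sum_indicesUpTo_of_le (Nat.sub_le n p) fun j hj => ?_
        simp only [hu]
        rw [if_neg (by omega), zero_mul]
      rw [e1, funext he]
      exact toL2_packetSum_sub_sum_inner hAB r hh a η hr (by omega) c'
    · have e1 : u = 0 := by
        ext j
        simp only [hu]
        rw [if_neg (by omega), Pi.zero_apply]
      rw [taylorTerm_mul_packetSum_eq_sum hAB r hh, e1]
      simp [hR]
  have hwn : ∑ j ∈ indicesUpTo d n, ‖w j‖ ^ 2 ≤ (Real.exp p * Real.exp (-n)) ^ 2 *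
      ∑ k ∈ indicesUpTo d n, Real.exp (2 * order k) * ‖v k‖ ^ 2 := by
    rw [Finset.mul_sum]
    refine Finset.sum_le_sum fun j _ => ?_
    simp only [hw]
    split_ifs with hj
    · rw [norm_zero, zero_pow two_ne_zero]; positivity
    · rw [← mul_assoc, ← Real.exp_add, ← Real.exp_nat_mul, ← Real.exp_add]
      refine le_mul_of_one_le_left (by positivity) (Real.one_le_exp ?_)
      have : (n : ℝ) ≤ order j + p := by exact_mod_cast (not_le.1 hj).le
      push_cast
      linarith
  rw [huw]
  change ‖R _‖ ≤ _
  rw [hRadd, hRu, zero_add]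
  refine (norm_sub_sum_inner_le ho _ _).trans ?_
  refine (norm_taylorTerm_mul_packetSum_le hAB r hh a η hδ hM hτ hVa hVext hVg hr p n hq0 hq
    hw0).trans ?_
  have h1 := Real.sqrt_le_sqrt hwn
  rw [Real.sqrt_mul (sq_nonneg _), Real.sqrt_sq (by positivity)] at h1
  refine (mul_le_mul_of_nonneg_left h1 (by positivity)).trans (le_of_eq ?_)
  rw [mul_pow, ← Real.exp_nat_mul, mul_one]
  ring

/-- The residual of the approximation: the difference between the projection of the anharmonic
Taylor polynomial and the full anharmonic part of the potential, applied to the approximation. -/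
theorem norm_residual_le (hr : r ^ 2 = A.det) (n : ℕ) {l : ℕ} (hl : 1 ≤ l) {q : ℝ} (hq0 : 0 ≤ q)
    (hq2 : Real.exp 1 * q ≤ 1 / 2)
    (hq : (d * (d + 2) * h * opNorm A ^ 2) * (n + (l + 2 : ℕ)) ≤ (δ / 4 * q) ^ 2)
    {v : (Fin d → ℕ) → ℂ} (hv : ∀ j, n < order j → v j = 0)
    (hv1 : ∑ j ∈ indicesUpTo d n, ‖v j‖ ^ 2 = 1) :
    MemLp (fun x => ((V x - quadTaylor V a x : ℝ) : ℂ) * packetSum A B r h a η n v x) 2 volume ∧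
    ‖(∑ k ∈ indicesUpTo d n, (∑ j ∈ indicesUpTo d n,
          (∑ p ∈ Finset.Icc 3 (l + 1), termK V p A B r h a η k j) * v j) •
        toL2 (packet A B r h a η k)) -
      toL2 (fun x => ((V x - quadTaylor V a x : ℝ) : ℂ) * packetSum A B r h a η n v x)‖ ≤
      M * Real.exp (τ * (‖a‖ + δ / 2)) * (Real.exp (-n) *
        Real.sqrt (∑ k ∈ indicesUpTo d n, Real.exp (2 * order k) * ‖v k‖ ^ 2)) +
      Real.sqrt (18 * (M * Real.exp (τ * (‖a‖ + δ / 2))) ^ 2 * q ^ (2 * (l + 2)) *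
        2 ^ (n + (l + 2)) * Real.exp (8 * τ ^ 2 * (d * (d + 2) * h * opNorm A ^ 2))) := by
  have hV := contDiff_of_analytic hδ hVa hVext
  -- `F` is the Taylor remainder of degree `l + 2`; the anharmonic part is `F` plus the homogeneous
  -- terms of degrees `3, …, l + 1`, of which only the parts leaving the span contribute.
  set F : RSpace d → ℝ := fun x => V x - ∑ p ∈ Finset.range (l + 2), taylorTerm V p a (x - a)
    with hF
  have hTc : ∀ p, Continuous fun x => taylorTerm V p a (x - a) := by
    intro p
    unfold taylorTerm
    fun_prop
  have hFc : Continuous F := hV.continuous.sub (continuous_finsetSum _ fun p _ => hTc p)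
  obtain ⟨hm, hFn⟩ := norm_remainder_mul_packetSum_le hAB r hh a η hδ hM hr (l + 2) n hq hv hFc
    (fun x => by
      have := abs_taylor_remainder_le hδ hM hτ hVa hVext hVg a (x - a) (l + 2)
      rwa [add_sub_cancel] at this)
  rw [hv1, mul_one] at hFn
  set ψ := packetSum A B r h a η n v with hψ
  have hmT : ∀ p, MemLp (fun x => (taylorTerm V p a (x - a) : ℂ) * ψ x) 2 volume := by
    intro p
    obtain ⟨c', -, he⟩ := taylorTerm_mul_packetSum hAB r hh a η V p hv
    rw [funext he]
    exact memLp_packetSum hAB r hh a η _ _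
  have hsplit : (fun x => ((V x - quadTaylor V a x : ℝ) : ℂ) * ψ x) =
      fun x => (∑ p ∈ Finset.Icc 3 (l + 1), (taylorTerm V p a (x - a) : ℂ) * ψ x) +
        (F x : ℂ) * ψ x := by
    ext x
    rw [← Finset.sum_mul, ← add_mul, ← ofReal_sum, ← ofReal_add]
    congr 2
    simp only [hF]
    rw [← quadTaylor_add_taylorZ hV hl, taylorZ_eq]
    ring
  have hmS := memLp_sum (Finset.Icc 3 (l + 1)) fun p _ => hmT p
  refine ⟨hsplit ▸ hmS.add hm, ?_⟩
  rw [hsplit, toL2_add hmS hm, toL2_sum _ fun p _ => hmT p, ← sub_sub]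
  refine (norm_sub_le _ _).trans (add_le_add ?_ (Real.le_sqrt_of_sq_le hFn))
  have e1 : ∑ k ∈ indicesUpTo d n, (∑ j ∈ indicesUpTo d n,
        (∑ p ∈ Finset.Icc 3 (l + 1), termK V p A B r h a η k j) * v j) •
          toL2 (packet A B r h a η k) =
      ∑ p ∈ Finset.Icc 3 (l + 1), ∑ k ∈ indicesUpTo d n,
        inner ℂ (toL2 (packet A B r h a η k))
          (toL2 (fun x => (taylorTerm V p a (x - a) : ℂ) * ψ x)) •
            toL2 (packet A B r h a η k) := by
    rw [Finset.sum_comm]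
    refine Finset.sum_congr rfl fun k _ => ?_
    rw [← Finset.sum_smul]
    congr 1
    simp only [Finset.sum_mul]
    rw [Finset.sum_comm]
    refine Finset.sum_congr rfl fun p _ => ?_
    rw [taylorTerm_mul_packetSum_eq_sum hAB r hh, inner_sum]
    refine Finset.sum_congr rfl fun j _ => ?_
    rw [inner_smul_right, ← termK_eq_inner hAB r hh, mul_comm]
  rw [e1, ← Finset.sum_sub_distrib]
  refine (norm_sum_le _ _).trans ?_
  set W := Real.exp (-n) *
    Real.sqrt (∑ k ∈ indicesUpTo d n, Real.exp (2 * order k) * ‖v k‖ ^ 2) with hW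
  have hW0 : 0 ≤ W := by positivity
  have hκ : 0 ≤ d * (d + 2) * h * opNorm A ^ 2 := by positivity
  calc _ ≤ ∑ p ∈ Finset.Icc 3 (l + 1), M * Real.exp (τ * (‖a‖ + δ / 2)) * W *
        (Real.exp 1 * q) ^ p := by
        refine Finset.sum_le_sum fun p hpm => ?_
        rw [norm_sub_rev]
        refine (norm_taylorTerm_sub_sum_inner_le hAB r hh a η hδ hM hτ hVa hVext hVg hr p n hq0 ?_
          hv).trans (le_of_eq (by rw [hW]; ring))
        have : (p : ℝ) ≤ (l + 2 : ℕ) := by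
          exact_mod_cast (Finset.mem_Icc.1 hpm).2.trans (Nat.le_succ _)
        calc _ ≤ (d * (d + 2) * h * opNorm A ^ 2) * (n + (l + 2 : ℕ)) := by gcongr
          _ ≤ (δ / 4 * q) ^ 2 := hq
          _ ≤ (δ / 2 * q) ^ 2 := by gcongr; linarith
    _ = M * Real.exp (τ * (‖a‖ + δ / 2)) * W * ∑ p ∈ Finset.Icc 3 (l + 1), (Real.exp 1 * q) ^ p :=
        (Finset.mul_sum _ _ _).symm
    _ ≤ M * Real.exp (τ * (‖a‖ + δ / 2)) * W * (2 * (Real.exp 1 * q) ^ 3) := by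
        gcongr
        exact sum_Icc_three_pow_le (by positivity) hq2 _
    _ ≤ M * Real.exp (τ * (‖a‖ + δ / 2)) * W * 1 := by
        gcongr
        have : (Real.exp 1 * q) ^ 3 ≤ (1 / 2) ^ 3 := by gcongr
        norm_num at this
        linarith
    _ = _ := mul_one _

end Residual


/-! ### The exact solution -/

section Exact

variable {d : ℕ}

theorem laplacian_eq_sum_partialD {f : RSpace d → ℂ} (hf : ContDiff ℝ ∞ f) (x : RSpace d) :
    Laplacian.laplacian f x = ∑ k, partialD k (partialD k f) x := by
  rw [InnerProductSpace.laplacian_eq_iteratedFDeriv_orthonormalBasis f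
    (EuclideanSpace.basisFun (Fin d) ℝ)]
  refine Finset.sum_congr rfl fun k _ => ?_
  rw [iteratedFDeriv_two_apply]
  have hd : DifferentiableAt ℝ (fderiv ℝ f) x :=
    (hf.fderiv_right (m := ∞) (by simp)).differentiable (by simp) x
  unfold partialD
  rw [fderiv_clm_apply hd (differentiableAt_const _)]
  simp

/-- The differential expression `-(ℏ²/2) Δ + V`, applied to a function. -/
noncomputable def hamiltonianExpr (V : RSpace d → ℝ) (h : ℝ) (u : RSpace d → ℂ) : RSpace d → ℂ :=
  fun x => -((h : ℂ) ^ 2 / 2) * ∑ k, partialD k (partialD k u) x + ((V x : ℝ) : ℂ) * u x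

theorem contDiff_star {f : RSpace d → ℂ} (hf : ContDiff ℝ ∞ f) :
    ContDiff ℝ ∞ (fun x => starRingEnd ℂ (f x)) :=
  conjCLE.contDiff.comp hf

theorem hasCompactSupport_partialD {f : RSpace d → ℂ} (hf : HasCompactSupport f) (k : Fin d) :
    HasCompactSupport (partialD k f) :=
  hf.fderiv_apply (𝕜 := ℝ) _

theorem integral_mul_partialD {f u : RSpace d → ℂ} (hf : ContDiff ℝ ∞ f)
    (hfs : HasCompactSupport f) (hu : ContDiff ℝ ∞ u) (k : Fin d) :
    ∫ x, f x * partialD k u x = -∫ x, partialD k f x * u x := by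
  refine integral_mul_fderiv_eq_neg_fderiv_mul_of_integrable ?_ ?_ ?_
    (fun x _ => hf.differentiable (by simp) x) (fun x _ => hu.differentiable (by simp) x)
  · exact ((partialD_contDiff hf k).continuous.mul hu.continuous).integrable_of_hasCompactSupport
      (hasCompactSupport_partialD hfs k).mul_right
  · exact (hf.continuous.mul (partialD_contDiff hu k).continuous).integrable_of_hasCompactSupport
      hfs.mul_right
  · exact (hf.continuous.mul hu.continuous).integrable_of_hasCompactSupport hfs.mul_right

/-- Green's identity for a test function and a smooth function. -/
theorem integral_star_hamiltonianExpr_mul {V : RSpace d → ℝ} (hV : Continuous V) (h : ℝ)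
    {f u : RSpace d → ℂ} (hf : ContDiff ℝ ∞ f) (hfs : HasCompactSupport f) (hu : ContDiff ℝ ∞ u) :
    ∫ x, starRingEnd ℂ (hamiltonianExpr V h f x) * u x =
      ∫ x, starRingEnd ℂ (f x) * hamiltonianExpr V h u x := by
  set g : RSpace d → ℂ := fun x => starRingEnd ℂ (f x) with hg
  have hgc : ContDiff ℝ ∞ g := contDiff_star hf
  have hgs : HasCompactSupport g := hfs.comp_left (map_zero _)
  have hd1 : ∀ k, partialD k g = fun x => starRingEnd ℂ (partialD k f x) := fun k =>
    funext fun x => partialD_star (hf.differentiable (by simp)) k x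
  have hd2 : ∀ k x, starRingEnd ℂ (partialD k (partialD k f) x) = partialD k (partialD k g) x := by
    intro k x
    rw [hd1 k, partialD_star ((partialD_contDiff hf k).differentiable (by simp)) k x]
  have key : ∀ k, ∫ x, partialD k (partialD k g) x * u x =
      ∫ x, g x * partialD k (partialD k u) x := by
    intro k
    have h1 := integral_mul_partialD hgc hgs (partialD_contDiff hu k) k
    have h2 := integral_mul_partialD (partialD_contDiff hgc k) (hasCompactSupport_partialD hgs k) hu k
    rw [h1, h2, neg_neg]
  have i1 : ∀ k, Integrable (fun x => partialD k (partialD k g) x * u x) volume := fun k =>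
    ((partialD_contDiff (partialD_contDiff hgc k) k).continuous.mul
      hu.continuous).integrable_of_hasCompactSupport
      (hasCompactSupport_partialD (hasCompactSupport_partialD hgs k) k).mul_right
  have i2 : ∀ k, Integrable (fun x => g x * partialD k (partialD k u) x) volume := fun k =>
    (hgc.continuous.mul
      (partialD_contDiff (partialD_contDiff hu k) k).continuous).integrable_of_hasCompactSupport
      hgs.mul_right
  have i3 : Integrable (fun x => ((V x : ℝ) : ℂ) * (g x * u x)) volume :=
    ((continuous_ofReal.comp hV).mul (hgc.continuous.mul
      hu.continuous)).integrable_of_hasCompactSupport hgs.mul_right.mul_left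
  have e1 : (fun x => starRingEnd ℂ (hamiltonianExpr V h f x) * u x) = fun x =>
      -((h : ℂ) ^ 2 / 2) * (∑ k, partialD k (partialD k g) x * u x) +
        ((V x : ℝ) : ℂ) * (g x * u x) := by
    ext x
    unfold hamiltonianExpr
    rw [map_add, map_mul, map_mul, map_sum, conj_ofReal, Finset.sum_congr rfl fun k _ => hd2 k x,
      ← Finset.sum_mul]
    have : starRingEnd ℂ (-((h : ℂ) ^ 2 / 2)) = -((h : ℂ) ^ 2 / 2) := by
      simp [map_ofNat]
    rw [this]
    ring
  have e2 : (fun x => starRingEnd ℂ (f x) * hamiltonianExpr V h u x) = fun x =>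
      -((h : ℂ) ^ 2 / 2) * (∑ k, g x * partialD k (partialD k u) x) +
        ((V x : ℝ) : ℂ) * (g x * u x) := by
    ext x
    unfold hamiltonianExpr
    rw [← Finset.mul_sum]
    ring
  rw [e1, e2, integral_add ((integrable_finsetSum _ fun k _ => i1 k).const_mul _) i3,
    integral_add ((integrable_finsetSum _ fun k _ => i2 k).const_mul _) i3,
    integral_const_mul, integral_const_mul, integral_finsetSum _ fun k _ => i1 k,
    integral_finsetSum _ fun k _ => i2 k, Finset.sum_congr rfl fun k _ => key k]

variable {V : RSpace d → ℝ} {h : ℝ}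

theorem exists_of_mem_hamiltonianCore {p : L2Space d × L2Space d} (hp : p ∈ hamiltonianCore V h) :
    ∃ φ : RSpace d → ℂ, ContDiff ℝ ∞ φ ∧ HasCompactSupport φ ∧
      (p.1 : RSpace d → ℂ) =ᵐ[volume] φ ∧
      (p.2 : RSpace d → ℂ) =ᵐ[volume] hamiltonianExpr V h φ := by
  obtain ⟨φ, h1, h2, h3, h4⟩ := hp
  refine ⟨φ, h1, h2, h3, h4.trans (Eventually.of_forall fun x => ?_)⟩
  unfold hamiltonianExpr
  simp only [laplacian_eq_sum_partialD h1]

/-- The Hamiltonian acts on smooth functions in the weak sense. -/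
theorem inner_of_mem_hamiltonianGraph (hV : Continuous V) {p : L2Space d × L2Space d}
    (hp : p ∈ hamiltonianGraph V h) {u : RSpace d → ℂ} (hu : ContDiff ℝ ∞ u)
    (hm : MemLp u 2 volume) (hHm : MemLp (hamiltonianExpr V h u) 2 volume) :
    inner ℂ p.2 (toL2 u) = inner ℂ p.1 (toL2 (hamiltonianExpr V h u)) := by
  have hcl : IsClosed {p : L2Space d × L2Space d |
      inner ℂ p.2 (toL2 u) = inner ℂ p.1 (toL2 (hamiltonianExpr V h u))} :=
    isClosed_eq (continuous_snd.inner continuous_const) (continuous_fst.inner continuous_const)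
  refine closure_minimal ?_ hcl hp
  intro p hp
  obtain ⟨φ, h1, h2, h3, h4⟩ := exists_of_mem_hamiltonianCore hp
  change inner ℂ p.2 (toL2 u) = inner ℂ p.1 (toL2 (hamiltonianExpr V h u))
  rw [inner_toL2_right _ hm, inner_toL2_right _ hHm]
  calc _ = ∫ x, starRingEnd ℂ (hamiltonianExpr V h φ x) * u x := by
        refine integral_congr_ae ?_
        filter_upwards [h4] with x hx
        rw [hx]
    _ = ∫ x, starRingEnd ℂ (φ x) * hamiltonianExpr V h u x :=
        integral_star_hamiltonianExpr_mul hV h h1 h2 hu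
    _ = _ := by
        refine integral_congr_ae ?_
        filter_upwards [h3] with x hx
        rw [hx]

/-- The Hamiltonian is symmetric. -/
theorem star_inner_of_mem_hamiltonianGraph (hV : Continuous V) {p : L2Space d × L2Space d}
    (hp : p ∈ hamiltonianGraph V h) : inner ℂ p.2 p.1 = inner ℂ p.1 p.2 := by
  have hcl : IsClosed {p : L2Space d × L2Space d | inner ℂ p.2 p.1 = inner ℂ p.1 p.2} :=
    isClosed_eq (continuous_snd.inner continuous_fst) (continuous_fst.inner continuous_snd)
  refine closure_minimal ?_ hcl hp
  intro p hp
  obtain ⟨φ, h1, h2, h3, h4⟩ := exists_of_mem_hamiltonianCore hp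
  have hm : MemLp φ 2 volume := (memLp_congr_ae h3).1 (Lp.memLp p.1)
  have hHm : MemLp (hamiltonianExpr V h φ) 2 volume := (memLp_congr_ae h4).1 (Lp.memLp p.2)
  have e1 : p.1 = toL2 φ := Lp.ext (h3.trans (coeFn_toL2 hm).symm)
  have e2 : p.2 = toL2 (hamiltonianExpr V h φ) := Lp.ext (h4.trans (coeFn_toL2 hHm).symm)
  have := inner_of_mem_hamiltonianGraph hV (subset_closure hp) h1 hm hHm
  rwa [← e1, ← e2] at this

variable {Ψ : ℝ → L2Space d}

/-- The norm is conserved, because the Hamiltonian is symmetric. -/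
theorem norm_exactSolution (hV : Continuous V) (hh : 0 < h) (hΨ : IsExactSolution V h Ψ) (t : ℝ) :
    ‖Ψ t‖ = ‖Ψ 0‖ := by
  have hd : ∀ t, HasDerivAt (fun t => inner ℂ (Ψ t) (Ψ t)) 0 t := by
    intro t
    obtain ⟨Ψ', h1, h2⟩ := hΨ t
    have h3 := star_inner_of_mem_hamiltonianGraph hV h2
    simp only [inner_smul_left, inner_smul_right, map_mul, conj_I, conj_ofReal] at h3
    refine (h1.inner ℂ h1).congr_deriv ?_
    have hne : I * (h : ℂ) ≠ 0 := mul_ne_zero I_ne_zero (ofReal_ne_zero.2 hh.ne')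
    refine (mul_eq_zero.1 (?_ : (I * (h : ℂ)) * _ = 0)).resolve_left hne
    linear_combination -h3
  have h1 := is_const_of_deriv_eq_zero (fun t => (hd t).differentiableAt) (fun t => (hd t).deriv) t 0
  simp only [inner_self_eq_norm_sq_to_K] at h1
  have h2 : ‖Ψ t‖ ^ 2 = ‖Ψ 0‖ ^ 2 := by exact_mod_cast h1
  exact (pow_left_inj₀ (norm_nonneg _) (norm_nonneg _) two_ne_zero).1 h2

/-- A normalized approximate solution with a small residual stays close to the exact solution. -/
theorem norm_sub_sq_le_of_residual (hV : Continuous V) (hh : 0 < h) (hΨ : IsExactSolution V h Ψ)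
    {u : ℝ → RSpace d → ℂ} (hu : ∀ t, ContDiff ℝ ∞ (u t)) (hm : ∀ t, MemLp (u t) 2 volume)
    {T ε : ℝ}
    (hd : ∀ t, |t| ≤ T → ∃ Φ' ξ : L2Space d, HasDerivAt (fun s => toL2 (u s)) Φ' t ∧
      MemLp (hamiltonianExpr V h (u t)) 2 volume ∧
      (I * (h : ℂ)) • Φ' = toL2 (hamiltonianExpr V h (u t)) + ξ ∧ ‖ξ‖ ≤ ε)
    (hn : ∀ t, ‖toL2 (u t)‖ = 1) (h0 : Ψ 0 = toL2 (u 0)) {t : ℝ} (ht : |t| ≤ T) :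
    ‖toL2 (u t) - Ψ t‖ ^ 2 ≤ 2 * (ε / h * |t|) := by
  have hT : 0 ≤ T := (abs_nonneg t).trans ht
  have hΨn : ∀ t, ‖Ψ t‖ = 1 := fun t => by rw [norm_exactSolution hV hh hΨ, h0, hn]
  have hne : I * (h : ℂ) ≠ 0 := mul_ne_zero I_ne_zero (ofReal_ne_zero.2 hh.ne')
  -- Differentiating `⟨Ψ, u⟩`, the Hamiltonian cancels by symmetry and only the residual remains.
  have key : ∀ s, |s| ≤ T → ∃ D : ℂ,
      HasDerivAt (fun s => inner ℂ (Ψ s) (toL2 (u s))) D s ∧ ‖D‖ ≤ ε / h := by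
    intro s hs
    obtain ⟨Φ', ξ, h1, h2, h3, h4⟩ := hd s hs
    obtain ⟨Ψ', h5, h6⟩ := hΨ s
    refine ⟨(I * (h : ℂ))⁻¹ * inner ℂ (Ψ s) ξ, (h5.inner ℂ h1).congr_deriv ?_, ?_⟩
    · have h7 := inner_of_mem_hamiltonianGraph hV h6 (hu s) (hm s) h2
      simp only [inner_smul_left, map_mul, conj_I, conj_ofReal] at h7
      have h8 := congrArg (inner ℂ (Ψ s)) h3
      rw [inner_smul_right, inner_add_right] at h8
      rw [eq_comm, inv_mul_eq_iff_eq_mul₀ hne]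
      linear_combination h7 - h8
    · rw [norm_mul, norm_inv, norm_mul, norm_I, one_mul, norm_real, Real.norm_of_nonneg hh.le,
        inv_mul_eq_div]
      refine div_le_div_of_nonneg_right ((norm_inner_le_norm _ _).trans ?_) hh.le
      rw [hΨn, one_mul]
      exact h4
  choose! D hD hDn using key
  have h1 := (convex_Icc (-T) T).norm_image_sub_le_of_norm_hasDerivWithin_le
    (f := fun s => inner ℂ (Ψ s) (toL2 (u s))) (f' := D) (C := ε / h)
    (fun s hs => (hD s (abs_le.2 hs)).hasDerivWithinAt) (fun s hs => hDn s (abs_le.2 hs))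
    (x := 0) (y := t) ⟨by linarith, hT⟩ (abs_le.1 ht)
  rw [sub_zero, Real.norm_eq_abs, ← h0, inner_self_eq_norm_sq_to_K, hΨn] at h1
  have h2 : 1 - (inner ℂ (Ψ t) (toL2 (u t))).re ≤ ε / h * |t| := by
    refine le_trans ?_ h1
    rw [norm_sub_rev]
    refine le_trans (le_of_eq ?_) ((le_abs_self _).trans (abs_re_le_norm _))
    simp
  -- Both vectors are normalized, hence `‖Ψ - u‖² = 2 (1 - Re ⟨Ψ, u⟩)`.
  rw [norm_sub_rev, @norm_sub_sq ℂ, hΨn, hn]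
  simp only [RCLike.re_to_complex]
  linarith

end Exact

/-! ### The approximation as an approximate solution -/

section Approx

variable {d : ℕ} {V : RSpace d → ℝ} {γ : Trajectory d} {J l : ℕ} {c0 : (Fin d → ℕ) → ℂ} {h : ℝ}
  {c : ℝ → (Fin d → ℕ) → ℂ}

theorem partialD_const_mul_sum {ι : Type*} (s : Finset ι) (E : ℂ) (α : ι → ℂ) {F : ι → RSpace d → ℂ}
    (hF : ∀ j, Differentiable ℝ (F j)) (k : Fin d) :
    partialD k (fun x => E * ∑ j ∈ s, α j * F j x) =
      fun x => E * ∑ j ∈ s, α j * partialD k (F j) x := by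
  ext x
  have h1 : HasFDerivAt (fun x => E * ∑ j ∈ s, α j * F j x)
      (E • ∑ j ∈ s, α j • fderiv ℝ (F j) x) x :=
    (HasFDerivAt.fun_sum fun j _ => ((hF j x).hasFDerivAt.const_mul (α j))).const_mul E
  unfold partialD
  rw [h1.fderiv]
  simp

theorem approx_eq (t : ℝ) : approx γ J l h c t = fun x => cexp (I * (γ.S t : ℂ) / (h : ℂ)) *
    packetSum (γ.A t) (γ.B t) (γ.r t) h (γ.a t) (γ.η t) (cutoff J l) (c t) x := rfl

theorem norm_exp_action (t : ℝ) : ‖cexp (I * (γ.S t : ℂ) / (h : ℂ))‖ = 1 := by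
  rw [show I * (γ.S t : ℂ) / h = ((γ.S t / h : ℝ) : ℂ) * I by push_cast; ring,
    norm_exp_ofReal_mul_I]

variable {N lam : ℝ} (hγ : γ.IsClassical V) (hV : ContDiff ℝ ∞ V)
  (hA : ∀ t, opNorm (γ.A t) ≤ N * Real.exp (lam * |t|)) (hh : 0 < h)
include hγ hV hh

theorem contDiff_approx (t : ℝ) : ContDiff ℝ ∞ (approx γ J l h c t) := by
  rw [approx_eq]
  exact contDiff_const.mul (contDiff_packetSum (hγ.pair hV t) _ hh _ _ _ _)

theorem memLp_approx (t : ℝ) : MemLp (approx γ J l h c t) 2 volume := by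
  rw [approx_eq]
  exact (memLp_packetSum (hγ.pair hV t) _ hh _ _ _ _).const_mul _

theorem norm_toL2_approx (hc : IsCoefficients V γ J c0 l h c)
    (hc0 : ∑ j ∈ indicesUpTo d J, ‖c0 j‖ ^ 2 = 1) (t : ℝ) : ‖toL2 (approx γ J l h c t)‖ = 1 := by
  rw [approx_eq, toL2_const_mul _ (memLp_packetSum (hγ.pair hV t) _ hh _ _ _ _), norm_smul,
    norm_exp_action, one_mul]
  have := norm_toL2_packetSum_sq (hγ.pair hV t) (γ.r t) hh (γ.a t) (γ.η t) (hγ.r_sq t)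
    (cutoff J l) (c t)
  rw [sum_norm_sq_coefficients hc hc0] at this
  exact (pow_left_inj₀ (norm_nonneg _) zero_le_one two_ne_zero).1 (by rw [this, one_pow])

include hA

/-- The approximation solves the Schrödinger equation up to a residual: the projection of the
anharmonic Taylor polynomial minus the anharmonic part of the potential. -/
theorem hasDerivAt_toL2_approx (hc : IsCoefficients V γ J c0 l h c) (t : ℝ)
    (hW : MemLp (fun x => ((V x - quadTaylor V (γ.a t) x : ℝ) : ℂ) *
      packetSum (γ.A t) (γ.B t) (γ.r t) h (γ.a t) (γ.η t) (cutoff J l) (c t) x) 2 volume) :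
    ∃ Φ' : L2Space d, HasDerivAt (fun s => toL2 (approx γ J l h c s)) Φ' t ∧
      MemLp (hamiltonianExpr V h (approx γ J l h c t)) 2 volume ∧
      (I * (h : ℂ)) • Φ' = toL2 (hamiltonianExpr V h (approx γ J l h c t)) +
        cexp (I * (γ.S t : ℂ) / (h : ℂ)) • ((∑ k ∈ indicesUpTo d (cutoff J l),
          (∑ j ∈ indicesUpTo d (cutoff J l), kernelK V γ l h t k j * c t j) •
            toL2 (γ.packet h t k)) -
          toL2 (fun x => ((V x - quadTaylor V (γ.a t) x : ℝ) : ℂ) *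
            packetSum (γ.A t) (γ.B t) (γ.r t) h (γ.a t) (γ.η t) (cutoff J l) (c t) x)) := by
  have hne : I * (h : ℂ) ≠ 0 := mul_ne_zero I_ne_zero (ofReal_ne_zero.2 hh.ne')
  set s := indicesUpTo d (cutoff J l) with hs
  set E := cexp (I * (γ.S t : ℂ) / (h : ℂ)) with hE
  have hmp := memLp_packet hγ hV hA hh
  have hcd := fun j => contDiff_packet hγ hV hh t j (n := ∞)
  have hmD : ∀ j k, MemLp (partialD k (partialD k (γ.packet h t j))) 2 volume := by
    intro j k
    obtain ⟨C, c, hc, hb⟩ := (gaussDecay_partialD_partialD_packet hγ hV hA hh t j k).self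
    exact memLp_of_gaussDecay
      (partialD_contDiff (partialD_contDiff (hcd j) k) k).continuous.aestronglyMeasurable hc hb
  have hmQ : ∀ j, MemLp (fun x => (quadTaylor V (γ.a t) x : ℂ) * γ.packet h t j x) 2 volume := by
    intro j
    obtain ⟨C, c, hc, hb⟩ :=
      (gaussDecay_quadTaylor_mul hγ hV (gaussDecay_packet hγ hV hA hh t j)).self
    refine memLp_of_gaussDecay (Continuous.aestronglyMeasurable ?_) hc hb
    have h1 : Continuous fun x => (quadTaylor V (γ.a t) x : ℂ) := by
      unfold quadTaylor
      fun_prop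
    exact h1.mul (hcd j).continuous
  set G : (Fin d → ℕ) → RSpace d → ℂ := fun j x =>
    -((h : ℂ) ^ 2 / 2) * ∑ k, partialD k (partialD k (γ.packet h t j)) x +
      (quadTaylor V (γ.a t) x : ℂ) * γ.packet h t j x with hG
  have hmG : ∀ j, MemLp (G j) 2 volume := fun j =>
    ((memLp_sum _ fun k _ => hmD j k).const_mul _).add (hmQ j)
  have hmGs : MemLp (fun x => ∑ j ∈ s, c t j * G j x) 2 volume :=
    memLp_sum s fun j _ => (hmG j).const_mul _
  have hHu : hamiltonianExpr V h (approx γ J l h c t) = fun x =>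
      E * ((∑ j ∈ s, c t j * G j x) + ((V x - quadTaylor V (γ.a t) x : ℝ) : ℂ) *
        packetSum (γ.A t) (γ.B t) (γ.r t) h (γ.a t) (γ.η t) (cutoff J l) (c t) x) := by
    have e1 : ∀ k, partialD k (partialD k (approx γ J l h c t)) = fun x =>
        E * ∑ j ∈ s, c t j * partialD k (partialD k (γ.packet h t j)) x := by
      intro k
      unfold approx
      rw [partialD_const_mul_sum _ _ _ fun j => (hcd j).differentiable (by simp),
        partialD_const_mul_sum _ _ _ fun j =>
          (partialD_contDiff (hcd j) k).differentiable (by simp)]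
    ext x
    unfold hamiltonianExpr
    simp only [e1, approx, packetSum, hG, ← hE, ← hs]
    rw [← Finset.mul_sum, Finset.sum_comm]
    simp only [← Finset.mul_sum, mul_add, Finset.sum_add_distrib]
    have e2 : ∑ j ∈ s, c t j * (-((h : ℂ) ^ 2 / 2) *
        ∑ k, partialD k (partialD k (γ.packet h t j)) x) = -((h : ℂ) ^ 2 / 2) *
        ∑ j ∈ s, c t j * ∑ k, partialD k (partialD k (γ.packet h t j)) x := by
      rw [Finset.mul_sum]
      exact Finset.sum_congr rfl fun j _ => by ring
    have e3 : ∑ j ∈ s, c t j * ((quadTaylor V (γ.a t) x : ℂ) * γ.packet h t j x) =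
        (quadTaylor V (γ.a t) x : ℂ) * ∑ j ∈ s, c t j * γ.packet h t j x := by
      rw [Finset.mul_sum]
      exact Finset.sum_congr rfl fun j _ => by ring
    rw [e2, e3]
    simp only [Trajectory.packet]
    push_cast
    ring
  have hHm : MemLp (hamiltonianExpr V h (approx γ J l h c t)) 2 volume := by
    rw [hHu]
    exact (hmGs.add hW).const_mul _
  have hsum : (fun s' => toL2 (approx γ J l h c s')) = fun s' =>
      ∑ j ∈ s, c s' j • toL2 (fun x => cexp (I * (γ.S s' : ℂ) / h) * γ.packet h s' j x) := by
    ext1 s'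
    rw [Finset.sum_congr rfl fun j _ => (toL2_const_mul (c s' j) ((hmp s' j).const_mul _)).symm,
      ← toL2_sum _ fun j _ => ((hmp s' j).const_mul _).const_mul _]
    congr 1
    ext x
    unfold approx
    rw [Finset.mul_sum]
    exact Finset.sum_congr rfl fun j _ => mul_left_comm _ _ _
  have hder := HasDerivAt.fun_sum (u := s) fun j hj =>
    (hc.deriv t j hj).smul (hasDerivAt_toL2_packet hγ hV hA hh t j)
  refine ⟨_, hsum ▸ hder, hHm, ?_⟩
  have hGj : ∀ j, (I * (h : ℂ)) • toL2 (fun x => cexp (I * (γ.S t : ℂ) / h) *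
      (I * h / 2 * ∑ k, partialD k (partialD k (γ.packet h t j)) x -
        I / h * (quadTaylor V (γ.a t) x : ℂ) * γ.packet h t j x)) = E • toL2 (G j) := by
    intro j
    rw [← toL2_const_mul _ (hmG j)]
    have e : (fun x => cexp (I * (γ.S t : ℂ) / h) *
        (I * h / 2 * ∑ k, partialD k (partialD k (γ.packet h t j)) x -
          I / h * (quadTaylor V (γ.a t) x : ℂ) * γ.packet h t j x)) =
        fun x => (I * (h : ℂ))⁻¹ * (E * G j x) := by
      ext x
      simp only [hG, ← hE]
      have hh' : (h : ℂ) ≠ 0 := ofReal_ne_zero.2 hh.ne'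
      field_simp
      rw [I_sq]
      ring
    rw [e, toL2_const_mul _ ((hmG j).const_mul _), smul_smul, mul_inv_cancel₀ hne, one_smul]
  have hmGW : MemLp (fun x => (∑ j ∈ s, c t j * G j x) +
      ((V x - quadTaylor V (γ.a t) x : ℝ) : ℂ) *
        packetSum (γ.A t) (γ.B t) (γ.r t) h (γ.a t) (γ.η t) (cutoff J l) (c t) x) 2 volume :=
    hmGs.add hW
  rw [hHu, toL2_const_mul _ hmGW, toL2_add hmGs hW,
    toL2_sum _ fun j _ => (hmG j).const_mul _, Finset.sum_congr rfl fun j _ =>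
      toL2_const_mul (c t j) (hmG j), ← smul_add, add_add_sub_cancel, Finset.smul_sum,
    ← Finset.sum_add_distrib, Finset.smul_sum]
  refine Finset.sum_congr rfl fun j _ => ?_
  rw [smul_add, smul_comm _ (c t j), hGj, toL2_const_mul _ (hmp t j), smul_smul, smul_add,
    smul_comm E, smul_smul, mul_inv_cancel_left₀ hne, smul_comm _ E, mul_smul]

end Approx


/-! ### The error estimate -/

section Error

variable {d : ℕ} {V : RSpace d → ℝ} {γ : Trajectory d}

/-- Conservation of energy bounds the momentum, so the position grows at most linearly. -/
theorem exists_norm_position_le (hγ : γ.IsClassical V) (hV : ContDiff ℝ ∞ V)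
    (hVb : ∃ b : ℝ, ∀ x, b ≤ V x) :
    ∃ α₀ α₁ : ℝ, 0 ≤ α₁ ∧ ∀ t, ‖γ.a t‖ ≤ α₀ + α₁ * |t| := by
  obtain ⟨b, hb⟩ := hVb
  have hd : ∀ t, HasDerivAt (fun t => ‖γ.η t‖ ^ 2 + 2 * V (γ.a t)) 0 t := by
    intro t
    have h1 := (hγ.deriv_η t).norm_sq
    have h2 : HasFDerivAt V (fderiv ℝ V (γ.a t)) (γ.a t) :=
      (hV.differentiable (by simp) _).hasFDerivAt
    have h3 := (h2.comp_hasDerivAt t (hγ.deriv_a t)).const_mul 2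
    refine (h1.add h3).congr_deriv ?_
    have h4 : inner ℝ (gradient V (γ.a t)) (γ.η t) = fderiv ℝ V (γ.a t) (γ.η t) :=
      InnerProductSpace.toDual_symm_apply
    rw [inner_neg_right, real_inner_comm, h4]
    ring
  have hE : ∀ t, ‖γ.η t‖ ^ 2 + 2 * V (γ.a t) = ‖γ.η 0‖ ^ 2 + 2 * V (γ.a 0) := fun t =>
    is_const_of_deriv_eq_zero (fun t => (hd t).differentiableAt) (fun t => (hd t).deriv) t 0
  set K := Real.sqrt (‖γ.η 0‖ ^ 2 + 2 * V (γ.a 0) - 2 * b) with hK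
  have hη : ∀ t, ‖γ.η t‖ ≤ K := fun t => Real.le_sqrt_of_sq_le (by
    linarith [hE t, hb (γ.a t)])
  refine ⟨‖γ.a 0‖, K, Real.sqrt_nonneg _, fun t => ?_⟩
  have h1 := convex_univ.norm_image_sub_le_of_norm_hasDerivWithin_le (f := γ.a) (f' := γ.η) (C := K)
    (fun s _ => (hγ.deriv_a s).hasDerivWithinAt) (fun s _ => hη s) (Set.mem_univ 0) (Set.mem_univ t)
  rw [sub_zero, Real.norm_eq_abs] at h1
  have h2 := norm_le_norm_add_norm_sub' (γ.a t) (γ.a 0)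
  linarith

variable {J l : ℕ} {c0 : (Fin d → ℕ) → ℂ} {h : ℝ} {c : ℝ → (Fin d → ℕ) → ℂ} {Ψ : ℝ → L2Space d}

theorem exactSolution_zero_eq (hγ : γ.IsClassical V) (hV : ContDiff ℝ ∞ V) (hh : 0 < h)
    (hc : IsCoefficients V γ J c0 l h c)
    (h0 : (Ψ 0 : RSpace d → ℂ) =ᵐ[volume]
      fun x => ∑ j ∈ indicesUpTo d J, c0 j * γ.packet h 0 j x) :
    Ψ 0 = toL2 (approx γ J l h c 0) := by
  have e : approx γ J l h c 0 = fun x => ∑ j ∈ indicesUpTo d J, c0 j * γ.packet h 0 j x := by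
    ext x
    have hJ : J ≤ cutoff J l := by unfold cutoff; omega
    have h1 : ∀ j ∈ indicesUpTo d (cutoff J l), c 0 j * γ.packet h 0 j x =
        if order j ≤ J then c0 j * γ.packet h 0 j x else 0 := fun j hj => by
      rw [hc.initial j hj]
      split_ifs <;> simp
    unfold approx
    rw [hγ.S_zero, Finset.sum_congr rfl h1, ← sum_indicesUpTo_of_le hJ
      (F := fun j => if order j ≤ J then c0 j * γ.packet h 0 j x else 0)
      fun j hj => if_neg (not_le.2 hj)]
    simp only [ofReal_zero, mul_zero, zero_div, Complex.exp_zero, one_mul]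
    exact Finset.sum_congr rfl fun j hj => if_pos ((mem_indicesUpTo j).1 hj)
  exact Lp.ext ((e ▸ h0).trans (coeFn_toL2 (memLp_approx hγ hV hh 0)).symm)

/-- Both functions have norm one; this settles the values of `ℏ` that are not small. -/
theorem norm_approx_sub_le_two (hγ : γ.IsClassical V) (hV : ContDiff ℝ ∞ V) (hh : 0 < h)
    (hc : IsCoefficients V γ J c0 l h c) (hc0 : ∑ j ∈ indicesUpTo d J, ‖c0 j‖ ^ 2 = 1)
    (hΨ : IsExactSolution V h Ψ)
    (h0 : (Ψ 0 : RSpace d → ℂ) =ᵐ[volume]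
      fun x => ∑ j ∈ indicesUpTo d J, c0 j * γ.packet h 0 j x) (t : ℝ) :
    ‖toL2 (approx γ J l h c t) - Ψ t‖ ≤ 2 := by
  refine (norm_sub_le _ _).trans ?_
  rw [norm_exactSolution hV.continuous hh hΨ, exactSolution_zero_eq hγ hV hh hc h0,
    norm_toL2_approx hγ hV hh hc hc0, norm_toL2_approx hγ hV hh hc hc0]
  norm_num

variable {Vc : CSpace d → ℂ} {δ M τ N lam : ℝ}
  (hδ : 0 < δ) (hM : 0 < M) (hτ : 0 < τ) (hVa : AnalyticOnNhd ℂ Vc (strip d δ))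
  (hVext : ∀ x : RSpace d, Vc (complexify x) = ((V x : ℝ) : ℂ))
  (hVg : ∀ z ∈ strip d δ, ‖Vc z‖ ≤ M * Real.exp (τ * ‖z‖))
  (hγ : γ.IsClassical V) (hA : ∀ t, opNorm (γ.A t) ≤ N * Real.exp (lam * |t|)) (hh : 0 < h)
include hδ hM hτ hVa hVext hVg hγ hA hh

/-- The error estimate for a fixed order of truncation, in terms of bounds `q` for the size of the
wave packets and `M₁` for the size of the potential near the trajectory. -/
theorem norm_approx_sub_sq_le (hc : IsCoefficients V γ J c0 l h c)
    (hc0 : ∑ j ∈ indicesUpTo d J, ‖c0 j‖ ^ 2 = 1) (hΨ : IsExactSolution V h Ψ)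
    (h0 : (Ψ 0 : RSpace d → ℂ) =ᵐ[volume]
      fun x => ∑ j ∈ indicesUpTo d J, c0 j * γ.packet h 0 j x)
    (hl : 1 ≤ l) {T q M₁ K₁ : ℝ} (hq0 : 0 ≤ q) (hq2 : 2 * Real.exp 1 * q ≤ 1 / 2)
    (hM₁0 : 0 ≤ M₁)
    (hq : ∀ t, |t| ≤ T → (d * (d + 2) * h * opNorm (γ.A t) ^ 2) * (cutoff J l + (l + 2 : ℕ)) ≤
      (δ / 4 * q) ^ 2)
    (hM₁ : ∀ t, |t| ≤ T → M * Real.exp (τ * (‖γ.a t‖ + δ / 2)) ≤ M₁)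
    (hK₁ : ∀ t, |t| ≤ T → d * (d + 2) * h * opNorm (γ.A t) ^ 2 ≤ K₁) {t : ℝ} (ht : |t| ≤ T) :
    ‖toL2 (approx γ J l h c t) - Ψ t‖ ^ 2 ≤
      2 * ((M₁ * (Real.exp (-cutoff J l) *
          Real.sqrt (Real.exp (2 * J) * Real.exp (4 * M₁ * (2 * Real.exp 1 * q) ^ 3 / h * T))) +
        Real.sqrt (18 * M₁ ^ 2 * q ^ (2 * (l + 2)) * 2 ^ (cutoff J l + (l + 2)) *
          Real.exp (8 * τ ^ 2 * K₁))) / h * |t|) := by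
  have hV := contDiff_of_analytic hδ hVa hVext
  refine norm_sub_sq_le_of_residual hV.continuous hh hΨ (contDiff_approx hγ hV hh)
    (memLp_approx hγ hV hh) (fun s hs => ?_) (norm_toL2_approx hγ hV hh hc hc0)
    (exactSolution_zero_eq hγ hV hh hc h0) ht
  have hp := hγ.pair hV s
  set n := cutoff J l with hn
  set v : (Fin d → ℕ) → ℂ := fun j => if order j ≤ n then c s j else 0 with hv
  have hvc : ∀ j ∈ indicesUpTo d n, v j = c s j := fun j hj => if_pos ((mem_indicesUpTo j).1 hj)
  have hve : packetSum (γ.A s) (γ.B s) (γ.r s) h (γ.a s) (γ.η s) n v =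
      packetSum (γ.A s) (γ.B s) (γ.r s) h (γ.a s) (γ.η s) n (c s) := by
    ext x
    exact Finset.sum_congr rfl fun j hj => by rw [hvc j hj]
  have hnorm := sum_norm_sq_coefficients hc hc0 s
  obtain ⟨hW, hres⟩ := norm_residual_le hp (γ.r s) hh (γ.a s) (γ.η s) hδ hM hτ hVa hVext hVg
    (hγ.r_sq s) n hl hq0 (by nlinarith [mul_nonneg (Real.exp_nonneg 1) hq0]) (hq s hs) (v := v)
    (fun j hj => if_neg (not_le.2 hj))
    (by rw [← hnorm]; exact Finset.sum_congr rfl fun j hj => by rw [hvc j hj])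
  have hY := weighted_norm_coefficients_le hγ hδ hM hτ hVa hVext hVg hh hc hc0 hq0 hq2
    (fun t ht => by
      have hκ : 0 ≤ d * (d + 2) * h * opNorm (γ.A t) ^ 2 := by positivity
      have : ((l + 1 : ℕ) : ℝ) ≤ (l + 2 : ℕ) := by exact_mod_cast Nat.le_succ _
      calc _ ≤ (d * (d + 2) * h * opNorm (γ.A t) ^ 2) * (cutoff J l + (l + 2 : ℕ)) := by gcongr
        _ ≤ (δ / 4 * q) ^ 2 := hq t ht
        _ ≤ (δ / 2 * q) ^ 2 := by gcongr; linarith) hM₁ hs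
  rw [hve] at hres
  rw [hve] at hW
  obtain ⟨Φ', h1, h2, h3⟩ := hasDerivAt_toL2_approx hγ hV hA hh hc s hW
  refine ⟨Φ', _, h1, h2, h3, ?_⟩
  rw [norm_smul, norm_exp_action, one_mul]
  have e1 : ∑ k ∈ indicesUpTo d n, (∑ j ∈ indicesUpTo d n, kernelK V γ l h s k j * c s j) •
      toL2 (γ.packet h s k) = ∑ k ∈ indicesUpTo d n, (∑ j ∈ indicesUpTo d n,
        (∑ p ∈ Finset.Icc 3 (l + 1), termK V p (γ.A s) (γ.B s) (γ.r s) h (γ.a s) (γ.η s) k j) *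
          v j) • toL2 (packet (γ.A s) (γ.B s) (γ.r s) h (γ.a s) (γ.η s) k) := by
    refine Finset.sum_congr rfl fun k _ => ?_
    congr 1
    refine Finset.sum_congr rfl fun j hj => ?_
    rw [kernelK_eq_sum hγ hδ hVa hVext hh, hvc j hj]
  rw [e1]
  refine hres.trans (add_le_add ?_ (Real.sqrt_le_sqrt ?_))
  · gcongr
    · exact hM₁ s hs
    · refine (le_of_eq (Finset.sum_congr rfl fun k hk => by rw [hvc k hk])).trans (hY.trans ?_)
      gcongr
  · gcongr
    · exact hM₁ s hs
    · exact hK₁ s hs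

set_option maxHeartbeats 1000000 in
/-- The error estimate for the order of truncation `l = ⌊g/ℏ⌋` with `g = s² e^{-νT}`. -/
theorem norm_approx_sub_sq_le_of_truncation (hN : 0 < N) (hlam : 0 < lam)
    (hc : IsCoefficients V γ J c0 l h c)
    (hc0 : ∑ j ∈ indicesUpTo d J, ‖c0 j‖ ^ 2 = 1) (hΨ : IsExactSolution V h Ψ)
    (h0 : (Ψ 0 : RSpace d → ℂ) =ᵐ[volume]
      fun x => ∑ j ∈ indicesUpTo d J, c0 j * γ.packet h 0 j x)
    {α₀ α₁ : ℝ} (hα₁ : 0 ≤ α₁) (ha : ∀ t, ‖γ.a t‖ ≤ α₀ + α₁ * |t|)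
    {C₃ s ν T : ℝ} (hC₃ : 0 ≤ C₃) (hs : 0 < s)
    (hC₃q : d * (d + 2) * N ^ 2 * (J + 4) = (δ / 4 * C₃) ^ 2)
    (hsC : C₃ * s ≤ Real.exp (-2) / 4)
    (hsK : 16 * Real.exp 1 ^ 3 * (M * Real.exp (τ * (α₀ + δ / 2))) * C₃ ^ 3 * s ≤ 1)
    (hν : 2 * (τ * α₁ + 3 * lam + 1) ≤ ν) (hl : 1 ≤ l)
    (hlg : l * h ≤ s ^ 2 * Real.exp (-ν * T)) (hgl : s ^ 2 * Real.exp (-ν * T) ≤ (l + 1) * h)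
    {t : ℝ} (ht : |t| ≤ T) :
    ‖toL2 (approx γ J l h c t) - Ψ t‖ ^ 2 ≤
      2 * (M * Real.exp (τ * (α₀ + δ / 2)) * (Real.exp 6 +
        Real.sqrt (18 * 2 ^ J * Real.exp (8 * τ ^ 2 * (d * (d + 2) * N ^ 2 * s ^ 2))))) *
        (Real.exp ((τ * α₁ + 1) * T) / h * Real.exp (-2 * (s ^ 2 * Real.exp (-ν * T) / h))) := by
  have hT : 0 ≤ T := (abs_nonneg t).trans ht
  set g := s ^ 2 * Real.exp (-ν * T) with hg
  set M₀ := M * Real.exp (τ * (α₀ + δ / 2)) with hM₀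
  have hM₀0 : 0 ≤ M₀ := by positivity
  set M₁ := M₀ * Real.exp (τ * α₁ * T) with hM₁
  have hM₁0 : 0 ≤ M₁ := by positivity
  set q := C₃ * s * Real.exp ((lam - ν / 2) * T) with hq
  have hq0 : 0 ≤ q := by positivity
  have hl' : (1 : ℝ) ≤ l := by exact_mod_cast hl
  have hτα : 0 ≤ τ * α₁ := by positivity
  have hqs : q ≤ C₃ * s := by
    refine mul_le_of_le_one_right (by positivity) (Real.exp_le_one_iff.2 ?_)
    exact mul_nonpos_of_nonpos_of_nonneg (by linarith) hT
  have hq4 : 4 * q ≤ Real.exp (-2) := by linarith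
  have hq2 : 2 * Real.exp 1 * q ≤ 1 / 2 := by
    have h1 : Real.exp 1 * Real.exp (-2) ≤ 1 := by
      rw [← Real.exp_add]; exact Real.exp_le_one_iff.2 (by norm_num)
    nlinarith [Real.exp_pos 1]
  have hop : ∀ t, |t| ≤ T → opNorm (γ.A t) ^ 2 ≤ N ^ 2 * Real.exp (2 * lam * T) := by
    intro t ht
    have h1 : opNorm (γ.A t) ≤ N * Real.exp (lam * T) := (hA t).trans (by gcongr)
    have h2 : 0 ≤ opNorm (γ.A t) := norm_nonneg _
    calc _ ≤ (N * Real.exp (lam * T)) ^ 2 := by gcongr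
      _ = _ := by rw [mul_pow, ← Real.exp_nat_mul]; congr 2; push_cast; ring
  -- The largest order plus the degree is at most `(J + 4) l`; by `l ℏ ≤ g`, the spread is at most `q`.
  have hκq : ∀ t, |t| ≤ T →
      (d * (d + 2) * h * opNorm (γ.A t) ^ 2) * (cutoff J l + (l + 2 : ℕ)) ≤ (δ / 4 * q) ^ 2 := by
    intro t ht
    have h1 : (cutoff J l + (l + 2 : ℕ) : ℝ) ≤ (J + 4) * l := by
      have e : cutoff J l + (l + 2) + 1 = J + 4 * l := by unfold cutoff; omega
      have e' : (cutoff J l + (l + 2 : ℕ) : ℝ) + 1 = J + 4 * l := by exact_mod_cast e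
      nlinarith [Nat.cast_nonneg (α := ℝ) J]
    calc _ ≤ (d * (d + 2) * h * (N ^ 2 * Real.exp (2 * lam * T))) * ((J + 4) * l) := by
          gcongr
          exact hop t ht
      _ = (d * (d + 2) * N ^ 2 * (J + 4)) * Real.exp (2 * lam * T) * (l * h) := by ring
      _ ≤ (d * (d + 2) * N ^ 2 * (J + 4)) * Real.exp (2 * lam * T) * g := by gcongr
      _ = (δ / 4 * q) ^ 2 := by
          rw [hC₃q, hg, hq]
          have : Real.exp ((lam - ν / 2) * T) ^ 2 = Real.exp (2 * lam * T) * Real.exp (-ν * T) := by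
            rw [← Real.exp_nat_mul, ← Real.exp_add]
            congr 1
            push_cast
            ring
          rw [show (δ / 4 * (C₃ * s * Real.exp ((lam - ν / 2) * T))) ^ 2 = (δ / 4 * C₃) ^ 2 * s ^ 2 *
            Real.exp ((lam - ν / 2) * T) ^ 2 by ring, this]
          ring
  have hκ : ∀ t, |t| ≤ T →
      d * (d + 2) * h * opNorm (γ.A t) ^ 2 ≤ d * (d + 2) * N ^ 2 * s ^ 2 := by
    intro t ht
    have h1 : h ≤ g := le_trans (by nlinarith) hlg
    calc _ ≤ d * (d + 2) * g * (N ^ 2 * Real.exp (2 * lam * T)) := by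
          gcongr
          exact hop t ht
      _ = d * (d + 2) * N ^ 2 * s ^ 2 * Real.exp ((2 * lam - ν) * T) := by
          rw [hg, show (2 * lam - ν) * T = -ν * T + 2 * lam * T by ring, Real.exp_add]
          ring
      _ ≤ _ := by
          refine mul_le_of_le_one_right (by positivity) (Real.exp_le_one_iff.2 ?_)
          exact mul_nonpos_of_nonpos_of_nonneg (by linarith) hT
  have hMle : ∀ t, |t| ≤ T → M * Real.exp (τ * (‖γ.a t‖ + δ / 2)) ≤ M₁ := by
    intro t ht
    rw [hM₁, hM₀, mul_assoc, ← Real.exp_add]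
    gcongr
    have h1 : ‖γ.a t‖ ≤ α₀ + α₁ * T := (ha t).trans (by gcongr)
    have h2 := mul_le_mul_of_nonneg_left h1 hτ.le
    linarith
  refine (norm_approx_sub_sq_le hδ hM hτ hVa hVext hVg hγ hA hh hc hc0 hΨ h0 hl hq0 hq2 hM₁0 hκq hMle
    hκ ht).trans ?_
  have hgh : g / h ≤ l + 1 := (div_le_iff₀ hh).2 hgl
  -- The weighted norm of the coefficients grows at most by the factor `e^{2g/ℏ}`.
  have hgrow : 4 * M₁ * (2 * Real.exp 1 * q) ^ 3 / h * T ≤ 2 * (g / h) := by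
    have h1 : T ≤ Real.exp T := by linarith [Real.add_one_le_exp T]
    have h2 : 2 * M₁ * (2 * Real.exp 1 * q) ^ 3 * T ≤ g := by
      calc _ ≤ 2 * M₁ * (2 * Real.exp 1 * q) ^ 3 * Real.exp T := by gcongr
        _ = (16 * Real.exp 1 ^ 3 * M₀ * C₃ ^ 3 * s) * (s ^ 2 * (Real.exp (τ * α₁ * T) *
              Real.exp ((lam - ν / 2) * T) ^ 3 * Real.exp T)) := by rw [hM₁, hq]; ring
        _ ≤ 1 * (s ^ 2 * (Real.exp (τ * α₁ * T) * Real.exp ((lam - ν / 2) * T) ^ 3 *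
              Real.exp T)) := by gcongr
        _ ≤ g := by
            rw [hg, one_mul, ← Real.exp_nat_mul, ← Real.exp_add, ← Real.exp_add]
            gcongr
            have h3 := mul_le_mul_of_nonneg_right hν hT
            push_cast
            linarith
    calc _ = 2 * ((2 * M₁ * (2 * Real.exp 1 * q) ^ 3 * T) / h) := by ring
      _ ≤ _ := by gcongr
  -- The cutoff is at `J + 3l - 3`, and `3 (l + 1) ≥ 3 g/ℏ` beats the growth `e^{g/ℏ}`.
  have hterm1 : Real.exp (-cutoff J l) * Real.sqrt (Real.exp (2 * J) *
      Real.exp (4 * M₁ * (2 * Real.exp 1 * q) ^ 3 / h * T)) ≤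
      Real.exp 6 * Real.exp (-2 * (g / h)) := by
    have e1 : Real.sqrt (Real.exp (2 * J) * Real.exp (4 * M₁ * (2 * Real.exp 1 * q) ^ 3 / h * T)) ≤
        Real.exp (J + g / h) := by
      refine Real.sqrt_le_iff.2 ⟨(Real.exp_pos _).le, ?_⟩
      rw [← Real.exp_add, ← Real.exp_nat_mul]
      refine Real.exp_le_exp.2 ?_
      push_cast
      linarith
    refine (mul_le_mul_of_nonneg_left e1 (Real.exp_pos _).le).trans ?_
    rw [← Real.exp_add, ← Real.exp_add]
    refine Real.exp_le_exp.2 ?_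
    have e2 : cutoff J l + 3 = J + 3 * l := by unfold cutoff; omega
    have e3 : (cutoff J l : ℝ) + 3 = J + 3 * l := by exact_mod_cast e2
    linarith
  -- The Taylor remainder: `4q ≤ e^{-2}` and `l + 2 ≥ g/ℏ` give `(4q)^{l+2} ≤ e^{-2g/ℏ}`.
  have hterm2 : Real.sqrt (18 * M₁ ^ 2 * q ^ (2 * (l + 2)) * 2 ^ (cutoff J l + (l + 2)) *
      Real.exp (8 * τ ^ 2 * (d * (d + 2) * N ^ 2 * s ^ 2))) ≤
      M₁ * Real.sqrt (18 * 2 ^ J * Real.exp (8 * τ ^ 2 * (d * (d + 2) * N ^ 2 * s ^ 2))) *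
        Real.exp (-2 * (g / h)) := by
    refine Real.sqrt_le_iff.2 ⟨by positivity, ?_⟩
    rw [mul_pow (M₁ * _) (Real.exp _), mul_pow M₁ (Real.sqrt _), Real.sq_sqrt (by positivity)]
    have e1 : cutoff J l + (l + 2) ≤ J + 4 * (l + 2) := by unfold cutoff; omega
    have e2 : q ^ (2 * (l + 2)) * 2 ^ (cutoff J l + (l + 2)) ≤
        2 ^ J * Real.exp (-2 * (g / h)) ^ 2 := by
      calc _ ≤ q ^ (2 * (l + 2)) * 2 ^ (J + 4 * (l + 2)) := by
            gcongr
            norm_num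
        _ = 2 ^ J * ((4 * q) ^ (l + 2)) ^ 2 := by
            rw [pow_add, pow_mul, pow_mul, mul_left_comm, ← mul_pow, ← pow_mul, mul_comm (l + 2) 2,
              pow_mul (4 * q)]
            congr 2
            ring
        _ ≤ 2 ^ J * (Real.exp (-2) ^ (l + 2)) ^ 2 := by gcongr
        _ ≤ 2 ^ J * Real.exp (-2 * (g / h)) ^ 2 := by
            rw [← Real.exp_nat_mul]
            gcongr 2 ^ J * Real.exp ?_ ^ 2
            push_cast
            linarith
    calc _ = 18 * M₁ ^ 2 * Real.exp (8 * τ ^ 2 * (d * (d + 2) * N ^ 2 * s ^ 2)) *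
          (q ^ (2 * (l + 2)) * 2 ^ (cutoff J l + (l + 2))) := by ring
      _ ≤ 18 * M₁ ^ 2 * Real.exp (8 * τ ^ 2 * (d * (d + 2) * N ^ 2 * s ^ 2)) *
          (2 ^ J * Real.exp (-2 * (g / h)) ^ 2) := by gcongr
      _ = _ := by ring
  have hTe : |t| ≤ Real.exp T := ht.trans (by linarith [Real.add_one_le_exp T])
  set R := Real.sqrt (18 * 2 ^ J * Real.exp (8 * τ ^ 2 * (d * (d + 2) * N ^ 2 * s ^ 2))) with hR
  calc _ ≤ 2 * ((M₁ * (Real.exp 6 * Real.exp (-2 * (g / h))) +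
        M₁ * R * Real.exp (-2 * (g / h))) / h * Real.exp T) := by gcongr
    _ = _ := by
        rw [hM₁, add_mul (τ * α₁), one_mul, Real.exp_add]
        ring

end Error

/-! ### The choice of the order of truncation -/

/-- The ratio `g(T)/ℏ` is a negative power of `ℏ`. -/
theorem mul_exp_div_eq_rpow {g₀ ν T' h : ℝ} (hh : 0 < h) (hh1 : h < 1) :
    g₀ * Real.exp (-ν * (T' * |Real.log h|)) / h = g₀ * h ^ (-(1 - ν * T')) := by
  rw [abs_of_neg (Real.log_neg hh hh1), Real.rpow_def_of_pos hh, mul_div_assoc]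
  congr 1
  conv_lhs => rw [← Real.exp_log hh, Real.log_exp, ← Real.exp_sub]
  congr 1
  ring

/-- Powers of `1/ℏ` are absorbed by the exponential. -/
theorem inv_sq_mul_exp_le {g₀ h σ : ℝ} (hg₀ : 0 < g₀) (hh : 0 < h) (hh1 : h ≤ 1) (hσ : 1 / 2 ≤ σ) :
    h⁻¹ ^ 2 * Real.exp (-2 * (g₀ * h ^ (-σ))) ≤ 24 / g₀ ^ 4 * Real.exp (-(g₀ * h ^ (-σ))) := by
  set x := h ^ (-σ) with hx
  have hx0 : 0 < x := Real.rpow_pos_of_pos hh _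
  have h1 : h⁻¹ ^ 2 ≤ x ^ 4 := by
    rw [hx, ← Real.rpow_natCast (h ^ (-σ)), ← Real.rpow_mul hh.le, ← Real.rpow_neg_one,
      ← Real.rpow_natCast, ← Real.rpow_mul hh.le]
    refine Real.rpow_le_rpow_of_exponent_ge hh hh1 ?_
    push_cast
    linarith
  have h2 : (g₀ * x) ^ 4 / 24 ≤ Real.exp (g₀ * x) := by
    have := Real.pow_div_factorial_le_exp (g₀ * x) (by positivity) 4
    norm_num [Nat.factorial] at this
    exact this
  have h3 : x ^ 4 ≤ 24 / g₀ ^ 4 * Real.exp (g₀ * x) := by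
    rw [div_mul_eq_mul_div, le_div_iff₀ (by positivity)]
    nlinarith [h2]
  calc _ ≤ (24 / g₀ ^ 4 * Real.exp (g₀ * x)) * Real.exp (-2 * (g₀ * x)) := by
        gcongr
        exact h1.trans h3
    _ = _ := by
        rw [mul_assoc, ← Real.exp_add]
        congr 2
        ring

end Semiclassical

open Semiclassical in
theorem theorem1p2 (d : ℕ) (V : RSpace d → ℝ) (Vc : CSpace d → ℂ) (δ M τ : ℝ)
    (hδ : 0 < δ) (hM : 0 < M) (hτ : 0 < τ)
    (hVbelow : ∃ b : ℝ, ∀ x, b ≤ V x)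
    (hVanalytic : AnalyticOnNhd ℂ Vc (strip d δ))
    (hVext : ∀ x : RSpace d, Vc (complexify x) = ((V x : ℝ) : ℂ))
    (hVgrowth : ∀ z ∈ strip d δ, ‖Vc z‖ ≤ M * Real.exp (τ * ‖z‖))
    (γ : Trajectory d) (hγ : γ.IsClassical V)
    (J : ℕ) (c0 : (Fin d → ℕ) → ℂ) (hc0 : ∑ j ∈ indicesUpTo d J, ‖c0 j‖ ^ 2 = 1)
    (N lam : ℝ) (hN : 0 < N) (hlam : 0 < lam)
    (hA : ∀ t, opNorm (γ.A t) ≤ N * Real.exp (lam * |t|)) :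
    ∃ g₀ > (0 : ℝ), ∃ ν > (0 : ℝ), ∃ T₀ > (0 : ℝ), ∀ T' : ℝ, 0 < T' → T' ≤ T₀ →
      ∃ C' > (0 : ℝ), ∃ γ' > (0 : ℝ), ∃ σ > (0 : ℝ),
        ∀ h : ℝ, 0 < h →
        ∀ c : ℝ → (Fin d → ℕ) → ℂ, IsCoefficients V γ J c0 (truncation g₀ ν T' h) h c →
        ∀ Ψ : ℝ → L2Space d, IsExactSolution V h Ψ →
          ((Ψ 0 : RSpace d → ℂ) =ᵐ[volume]
            fun x => ∑ j ∈ indicesUpTo d J, c0 j * γ.packet h 0 j x) →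
          ∀ t : ℝ, |t| ≤ T' * |Real.log h| →
            eLpNorm (fun x => approx γ J (truncation g₀ ν T' h) h c t x - Ψ t x) 2 volume ≤
              ENNReal.ofReal (C' * Real.exp (-γ' / h ^ σ)) := by
  have hV := contDiff_of_analytic hδ hVanalytic hVext
  obtain ⟨α₀, α₁, hα₁, ha⟩ := exists_norm_position_le hγ hV hVbelow
  -- `q = C₃ s e^{(λ-ν/2)T}` is the size of the wave packets relative to the width `δ`; the number
  -- `s = g₀^{1/2}` is so small that `4q ≤ e^{-2}` and that the coefficients grow slowly.
  set C₃ : ℝ := 4 / δ * (N * Real.sqrt (d * (d + 2) * (J + 4))) with hC₃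
  have hC₃0 : 0 ≤ C₃ := by positivity
  set K : ℝ := 16 * Real.exp 1 ^ 3 * (M * Real.exp (τ * (α₀ + δ / 2))) * C₃ ^ 3 with hK
  have hK0 : 0 ≤ K := by positivity
  set s : ℝ := (2 + 4 * Real.exp 2 * C₃ + K)⁻¹ with hs
  have hden : 0 < 2 + 4 * Real.exp 2 * C₃ + K := by positivity
  have hs0 : 0 < s := inv_pos.2 hden
  have hs1 : s < 1 := inv_lt_one_of_one_lt₀ (by
    have : 0 ≤ 4 * Real.exp 2 * C₃ := by positivity
    linarith)
  have hsC : C₃ * s ≤ Real.exp (-2) / 4 := by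
    rw [hs, ← div_eq_mul_inv, div_le_iff₀ hden]
    have h1 : Real.exp (-2) * Real.exp 2 = 1 := by rw [← Real.exp_add]; norm_num
    have h2 : 0 ≤ Real.exp (-2) * (2 + K) := by positivity
    linear_combination h2 / 4 - C₃ * h1
  have hsK : K * s ≤ 1 := by
    rw [hs, ← div_eq_mul_inv, div_le_one hden]
    have : 0 ≤ 4 * Real.exp 2 * C₃ := by positivity
    linarith
  have hC₃q : d * (d + 2) * N ^ 2 * (J + 4) = (δ / 4 * C₃) ^ 2 := by
    have h1 : δ / 4 * C₃ = N * Real.sqrt (d * (d + 2) * (J + 4)) := by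
      rw [hC₃]
      field_simp
    rw [h1, mul_pow, Real.sq_sqrt (by positivity)]
    ring
  set ν : ℝ := 2 * (τ * α₁ + 3 * lam + 1) with hν
  have hτα : 0 ≤ τ * α₁ := by positivity
  have hν0 : 0 < ν := by positivity
  set C₅ : ℝ := 2 * (M * Real.exp (τ * (α₀ + δ / 2)) * (Real.exp 6 +
    Real.sqrt (18 * 2 ^ J * Real.exp (8 * τ ^ 2 * (d * (d + 2) * N ^ 2 * s ^ 2))))) with hC₅
  have hC₅0 : 0 ≤ C₅ := by positivity
  have hg₀ : 0 < s ^ 2 := by positivity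
  have hg₁ : s ^ 2 < 1 := pow_lt_one₀ hs0.le hs1 two_ne_zero
  refine ⟨s ^ 2, hg₀, ν, hν0, 1 / (2 * ν), by positivity, fun T' hT' hT₀ => ?_⟩
  have hνT : ν * T' ≤ 1 / 2 := by
    rw [le_div_iff₀ (by positivity)] at hT₀
    linarith
  refine ⟨Real.sqrt (C₅ * (24 / (s ^ 2) ^ 4)) + 2 * Real.exp 1, by positivity, s ^ 2 / 2,
    by positivity, 1 - ν * T', by linarith, fun h hh c hc Ψ hΨ h0 t ht => ?_⟩
  set l := truncation (s ^ 2) ν T' h with hl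
  have hnorm : eLpNorm (fun x => approx γ J l h c t x - Ψ t x) 2 volume =
      ENNReal.ofReal ‖toL2 (approx γ J l h c t) - Ψ t‖ := by
    rw [Lp.norm_def, ENNReal.ofReal_toReal (Lp.eLpNorm_ne_top _)]
    refine eLpNorm_congr_ae ?_
    filter_upwards [Lp.coeFn_sub (toL2 (approx γ J l h c t)) (Ψ t),
      coeFn_toL2 (memLp_approx (c := c) (J := J) (l := l) hγ hV hh t)] with x h1 h2
    rw [h1, Pi.sub_apply, h2]
  rw [hnorm]
  refine ENNReal.ofReal_le_ofReal ?_
  have hexp : -(s ^ 2 / 2) / h ^ (1 - ν * T') = -(s ^ 2 / 2) * h ^ (-(1 - ν * T')) := by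
    rw [Real.rpow_neg hh.le, div_eq_mul_inv]
  rw [hexp]
  set x := h ^ (-(1 - ν * T')) with hx
  have hx0 : 0 < x := Real.rpow_pos_of_pos hh _
  set T := T' * |Real.log h| with hT
  have hT0 : 0 ≤ T := by positivity
  by_cases hgh : s ^ 2 * Real.exp (-ν * T) < h
  · -- No order of the expansion is available, and the bound by `2` is good enough.
    refine (norm_approx_sub_le_two hγ hV hh hc hc0 hΨ h0 t).trans ?_
    have h1 : s ^ 2 / 2 * x ≤ 1 := by
      rcases lt_or_ge h 1 with hh1 | hh1
      · have h2 := mul_exp_div_eq_rpow (g₀ := s ^ 2) (ν := ν) (T' := T') hh hh1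
        rw [← hx, ← hT] at h2
        have h3 : s ^ 2 * Real.exp (-ν * T) / h < 1 := (div_lt_one hh).2 hgh
        linarith
      · have h2 : x ≤ 1 := Real.rpow_le_one_of_one_le_of_nonpos hh1 (by linarith)
        have h3 := mul_le_mul hg₁.le h2 hx0.le zero_le_one
        linarith
    have h2 : 1 ≤ Real.exp 1 * Real.exp (-(s ^ 2 / 2) * x) := by
      rw [← Real.exp_add]
      exact Real.one_le_exp (by linarith)
    have h3 : 0 ≤ Real.sqrt (C₅ * (24 / (s ^ 2) ^ 4)) * Real.exp (-(s ^ 2 / 2) * x) := by positivity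
    linear_combination 2 * h2 + h3
  · have hgh' := not_lt.1 hgh
    have hgs : Real.exp (-ν * T) ≤ 1 := Real.exp_le_one_iff.2 (by
      rw [neg_mul, neg_nonpos]; positivity)
    have hh1 : h < 1 := (hgh'.trans (mul_le_of_le_one_right hg₀.le hgs)).trans_lt hg₁
    have hl1 : 1 ≤ l := by
      rw [hl, truncation, Nat.one_le_floor_iff, one_le_div hh]
      exact hgh'
    have hlg : l * h ≤ s ^ 2 * Real.exp (-ν * T) := by
      rw [← le_div_iff₀ hh]
      exact Nat.floor_le (by positivity)
    have hgl : s ^ 2 * Real.exp (-ν * T) ≤ (l + 1) * h := by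
      rw [← div_le_iff₀ hh]
      exact (Nat.lt_floor_add_one _).le
    have h1 := norm_approx_sub_sq_le_of_truncation hδ hM hτ hVanalytic hVext hVgrowth hγ hA hh hN hlam
      hc hc0 hΨ h0 hα₁ ha hC₃0 hs0 hC₃q hsC hsK le_rfl hl1 hlg hgl ht
    rw [← hC₅, mul_exp_div_eq_rpow hh hh1, ← hx] at h1
    -- The polynomial prefactor is absorbed by half of the exponential.
    have h2 : Real.exp ((τ * α₁ + 1) * T) ≤ h⁻¹ := by
      rw [← Real.exp_log (inv_pos.2 hh), Real.log_inv, Real.exp_le_exp, hT,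
        abs_of_neg (Real.log_neg hh hh1)]
      have h3 : (τ * α₁ + 1) * T' ≤ 1 := by
        have h4 : τ * α₁ + 1 ≤ ν := by linarith
        have h5 := mul_le_mul_of_nonneg_right h4 hT'.le
        linarith
      have h4 := mul_le_mul_of_nonneg_right h3 (neg_nonneg.2 (Real.log_neg hh hh1).le)
      linarith
    have h3 : ‖toL2 (approx γ J l h c t) - Ψ t‖ ^ 2 ≤
        C₅ * (24 / (s ^ 2) ^ 4) * Real.exp (-(s ^ 2 * x)) := by
      calc _ ≤ C₅ * (h⁻¹ / h * Real.exp (-2 * (s ^ 2 * x))) := h1.trans (by gcongr)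
        _ = C₅ * (h⁻¹ ^ 2 * Real.exp (-2 * (s ^ 2 * x))) := by rw [div_eq_mul_inv, ← sq]
        _ ≤ C₅ * (24 / (s ^ 2) ^ 4 * Real.exp (-(s ^ 2 * x))) :=
            mul_le_mul_of_nonneg_left
              (inv_sq_mul_exp_le (σ := 1 - ν * T') hg₀ hh hh1.le (by linarith)) hC₅0
        _ = _ := by ring
    have h4 := Real.le_sqrt_of_sq_le h3
    have h5 : Real.sqrt (Real.exp (-(s ^ 2 * x))) = Real.exp (-(s ^ 2 / 2) * x) := by
      rw [Real.sqrt_eq_iff_mul_self_eq (by positivity) (by positivity), ← Real.exp_add]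
      congr 1
      ring
    rw [Real.sqrt_mul (by positivity), h5] at h4
    refine h4.trans (mul_le_mul_of_nonneg_right ?_ (Real.exp_nonneg _))
    linarith [Real.exp_pos 1]
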